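/- Let $k\ge 1$ and $2-2g-k<0$, and equip the $k$-punctured genus $g$ surface $S=S_{g,k}$ with a complete hyperbolic metric of finite area, so that $S=\mathbb{H}^2/\Pi$ with $\Pi<\mathrm{PSL}_2(\mathbb{R})$ discrete and torsion-free. Let $F_\infty\subset\partial\mathbb{H}^2$ be the set of lifts of the punctures (the fixed points of parabolic elements of $\Pi$), let $T$ be an ideal triangulation of $S$ with geodesic edges and $\widetilde T$ its lift to $\mathbb{H}^2$. Let $\rho:\Pi\to\mathrm{PSL}_2(\mathbb{C})$ be a representation and $\beta:F_\infty\to\mathbb{C}\mathrm{P}^1$ a $\rho$-equivariant map (a framing). For an edge $\tilde e=p_1p_3$ of $\widetilde T$ whose two adjacent triangles have vertices $p_1,p_2,p_3,p_4$ in counter-clockwise order, put $$c(\tilde e)=\frac{(z_1-z_2)(z_3-z_4)}{(z_2-z_3)(z_1-z_4)},\qquad z_i=\beta(p_i),$$ and assume that these Fock–Goncharov coordinates are well-defined and non-zero for all edges. A pleated plane with framing $\beta$ is a continuous map $\Psi:\mathbb{H}^2\to\mathbb{H}^3$ which maps each triangle of $\widetilde T$ with vertices $p,q,r$ homeomorphically,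 edges to edges, onto the totally geodesic ideal triangle with ideal vertices $\beta(p),\beta(q),\beta(r)$; the edges of $\widetilde T$ are its pleating lines. A straightened framing is a map $\bar\beta:F_\infty\to\mathbb{R}\mathrm{P}^1$ which preserves the cyclic order of the vertices of each triangle and for which the cross-ratio at each edge $\tilde e$ equals $|c(\tilde e)|$. A straightened plane is a pleated plane $\overline\Psi:\mathbb{H}^2\to\mathbb{H}^2\subset\mathbb{H}^3$ in the equatorial plane with framing $\bar\beta$. Then there are a $\rho$-equivariant pleated plane $\Psi$ with framing $\beta$ and a straightened framing $\bar\beta$. For every such $\Psi$ and $\bar\beta$ the following holds. (1) There is a homomorphism $\bar\rho:\Pi\to\mathrm{PSL}_2(\mathbb{R})$ for which $\bar\beta$ is equivariant, and a $\bar\rho$-equivariant straightened plane with framing $\bar\beta$. For every such $\overline\Psi$, $\bar\rho$ is injective with discrete image $\Gamma$ acting freely on $\mathbb{H}^2$, $\overline\Psi$ is a homeomorphism onto an open set $\Omega\subset\mathbb{H}^2$, and it induces a homeomorphism from $S$ to $\Omega/\Gamma$. That is, $\overline\Psi$ is the developing map of a hyperbolic surface homeomorphic to $S_{g,k}$; let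 $\widehat S=\overline\Omega/\Gamma$ be this surface together with its boundary, where $\overline\Omega$ is the closure of $\Omega$ in $\mathbb{H}^2$. (2) Each puncture of $S$ corresponds either to a cusp of $\widehat S$ (the holonomy around it is parabolic and $\overline\Psi$ matches neighbourhoods of the puncture with neighbourhoods of the cusp) or to a geodesic boundary component of $\widehat S$ (the holonomy around it is a hyperbolic translation along a geodesic in $\partial\Omega$, which covers a simple closed geodesic, and $\overline\Psi$ matches neighbourhoods of the puncture with one-sided collars of this geodesic). The frontier of $\Omega$ in $\mathbb{H}^2$ is the union of the lifts of these boundary components. (3) Let $\alpha(\tilde e)\in[0,2\pi)$ be the bending angle of $\Psi$ at the edge $\tilde e$. The geodesics $\overline\Psi(\tilde e)$ with $\alpha(\tilde e)>0$, each with weight $\alpha(\tilde e)$, together with the lifts of the geodesic boundary components, each with infinite weight, are the leaves of (the lift of) a measured lamination $\lambda$ on $\widehat S$. For each geodesic boundary component at least one pleating line ends at the corresponding puncture, and every pleating line ending there spirals onto this boundary component in $\widehat S$ (it is a finite-weight leaf of $\lambda$ if its bending angle is positive). -/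

import Mathlib

open Set Topology MeasureTheory
open scoped MatrixGroups UpperHalfPlane LinearAlgebra.Projectivization ENNReal ComplexOrder

noncomputable section

namespace Straightening

/-! ### The hyperbolic plane and its ideal boundary

`ℍ` is Mathlib's upper half-plane with its hyperbolic metric. The projective line over a field `K`
is `ℙ K (Fin 2 → K)`, on which Mathlib lets `PSL(2, K)` act; for `K = ℝ` it is the ideal boundary of
the hyperbolic plane, for `K = ℂ` it is the Riemann sphere. -/

/-- The real projective line, the ideal boundary of the hyperbolic plane. -/
abbrev RP1 : Type := ℙ ℝ (Fin 2 → ℝ)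

/-- The complex projective line, the ideal boundary of hyperbolic 3-space. -/
abbrev CP1 : Type := ℙ ℂ (Fin 2 → ℂ)

/-- `PSL(2, ℝ)` acts on the upper half-plane by Möbius transformations. -/
instance pslAction : MulAction PSL(2, ℝ) ℍ :=
  MulAction.compHom ℍ (Matrix.ProjectiveSpecialLinearGroup.toPGL (n := Fin 2) (R := ℝ))

/-- The point `0 = [0 : 1]` of the projective line. -/
def zeroPt (K : Type*) [Field K] : ℙ K (Fin 2 → K) := Projectivization.mk K ![0, 1] (by simp)

/-- The point `1 = [1 : 1]` of the projective line. -/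
def onePt (K : Type*) [Field K] : ℙ K (Fin 2 → K) := Projectivization.mk K ![1, 1] (by simp)

/-- The point `∞ = [1 : 0]` of the projective line. -/
def inftyPt (K : Type*) [Field K] : ℙ K (Fin 2 → K) := Projectivization.mk K ![1, 0] (by simp)

/-- The inclusion of the real projective line (the equator) into the complex one. -/
def toCP1 (p : RP1) : CP1 :=
  Projectivization.mk ℂ (fun i => ((p.rep i : ℝ) : ℂ)) (by
    intro h
    refine p.rep_nonzero (funext fun i => ?_)
    have := congrFun h i
    simpa using this)

/-- Three points of the ideal boundary are distinct and in counter-clockwise order: they are the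
image of `0, 1, ∞` under an orientation preserving isometry. -/
def CCW (a b c : RP1) : Prop :=
  ∃ g : SL(2, ℝ), g • zeroPt ℝ = a ∧ g • onePt ℝ = b ∧ g • inftyPt ℝ = c

/-- The determinant of two homogeneous vectors; for `(z, 1)` and `(w, 1)` it is `z - w`. -/
def det2 {K : Type*} [Field K] (v w : Fin 2 → K) : K := v 0 * w 1 - v 1 * w 0

/-- The cross-ratio `(z₁ - z₂)(z₃ - z₄) / ((z₂ - z₃)(z₁ - z₄))` of four points of the projective
line, computed in homogeneous coordinates (it does not depend on the chosen representatives). -/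
def crossRatio {K : Type*} [Field K] (p₁ p₂ p₃ p₄ : ℙ K (Fin 2 → K)) : K :=
  (det2 p₁.rep p₂.rep * det2 p₃.rep p₄.rep) / (det2 p₂.rep p₃.rep * det2 p₁.rep p₄.rep)

/-! ### Hyperbolic 3-space -/

/-- Hyperbolic 3-space in the Hermitian form of the hyperboloid model: positive definite Hermitian
`2 × 2` matrices of determinant one. The point `(z, t)` of the upper half-space is the matrix
`!![t + |z|² / t, z / t; conj z / t, 1 / t]`. -/
def H3 : Type := {X : Matrix (Fin 2) (Fin 2) ℂ // X.PosDef ∧ X.det = 1}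

instance : TopologicalSpace H3 :=
  inferInstanceAs (TopologicalSpace {X : Matrix (Fin 2) (Fin 2) ℂ // X.PosDef ∧ X.det = 1})

lemma posDef_conj (g : SL(2, ℂ)) {X : Matrix (Fin 2) (Fin 2) ℂ} (hX : X.PosDef ∧ X.det = 1) :
    ((g : Matrix (Fin 2) (Fin 2) ℂ) * X * (g : Matrix (Fin 2) (Fin 2) ℂ).conjTranspose).PosDef ∧
      ((g : Matrix (Fin 2) (Fin 2) ℂ) * X *
        (g : Matrix (Fin 2) (Fin 2) ℂ).conjTranspose).det = 1 := by
  refine ⟨hX.1.mul_mul_conjTranspose_same ?_, by simp [Matrix.det_conjTranspose, hX.2]⟩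
  refine Matrix.vecMul_injective_of_isUnit ?_
  rw [Matrix.isUnit_iff_isUnit_det]
  simp

/-- `SL(2, ℂ)` acts on hyperbolic 3-space by `X ↦ g X gᴴ`. -/
instance : MulAction SL(2, ℂ) H3 where
  smul g X := ⟨_, posDef_conj g X.2⟩
  one_smul X := Subtype.ext (by
    change ((1 : SL(2, ℂ)) : Matrix (Fin 2) (Fin 2) ℂ) * X.1 *
      ((1 : SL(2, ℂ)) : Matrix (Fin 2) (Fin 2) ℂ).conjTranspose = X.1
    simp)
  mul_smul g h X := Subtype.ext (by
    change ((g * h : SL(2, ℂ)) : Matrix (Fin 2) (Fin 2) ℂ) * X.1 *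
      ((g * h : SL(2, ℂ)) : Matrix (Fin 2) (Fin 2) ℂ).conjTranspose =
      (g : Matrix (Fin 2) (Fin 2) ℂ) * ((h : Matrix (Fin 2) (Fin 2) ℂ) * X.1 *
      (h : Matrix (Fin 2) (Fin 2) ℂ).conjTranspose) *
      (g : Matrix (Fin 2) (Fin 2) ℂ).conjTranspose
    simp [Matrix.conjTranspose_mul, Matrix.mul_assoc])

lemma center_le_ker :
    Subgroup.center SL(2, ℂ) ≤ (MulAction.toPermHom SL(2, ℂ) H3).ker := by
  intro g hg
  obtain ⟨r, hr, hg⟩ := Matrix.SpecialLinearGroup.mem_center_iff.1 hg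
  have hn : r * (starRingEnd ℂ) r = 1 := by
    have h1 : ‖r‖ ^ 2 = 1 := by
      have := congrArg norm hr
      simpa using this
    rw [Complex.mul_conj, Complex.normSq_eq_norm_sq, h1]
    simp
  rw [MonoidHom.mem_ker]
  refine Equiv.ext fun X => Subtype.ext ?_
  change (g : Matrix (Fin 2) (Fin 2) ℂ) * X.1 *
    (g : Matrix (Fin 2) (Fin 2) ℂ).conjTranspose = X.1
  rw [← hg]
  ext i j
  simp only [Matrix.scalar_apply, Matrix.diagonal_conjTranspose, Matrix.mul_diagonal,
    Matrix.diagonal_mul]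
  have : r * X.1 i j * (starRingEnd ℂ) r = X.1 i j := by
    calc r * X.1 i j * (starRingEnd ℂ) r = (r * (starRingEnd ℂ) r) * X.1 i j := by ring
      _ = X.1 i j := by rw [hn, one_mul]
  simpa using this

/-- `PSL(2, ℂ)` acts on hyperbolic 3-space (by orientation preserving isometries). -/
instance pslActionH3 : MulAction PSL(2, ℂ) H3 :=
  MulAction.compHom H3 (QuotientGroup.lift _ (MulAction.toPermHom SL(2, ℂ) H3) center_le_ker)

/-- The rank one Hermitian matrix `v vᴴ` spanning the light ray of an ideal point `[v]`. -/
def ray (p : CP1) : Matrix (Fin 2) (Fin 2) ℂ := Matrix.vecMulVec p.rep (star p.rep)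

/-- The complete geodesic of hyperbolic 3-space with ideal endpoints `a`, `b`. -/
def geodesic3 (a b : CP1) : Set H3 :=
  {X | ∃ r s : ℝ, 0 ≤ r ∧ 0 ≤ s ∧ X.1 = (r : ℂ) • ray a + (s : ℂ) • ray b}

/-- The (closed) totally geodesic ideal triangle with ideal vertices `a`, `b`, `c`. -/
def idealTriangle3 (a b c : CP1) : Set H3 :=
  {X | ∃ r s t : ℝ, 0 ≤ r ∧ 0 ≤ s ∧ 0 ≤ t ∧
    X.1 = (r : ℂ) • ray a + (s : ℂ) • ray b + (t : ℂ) • ray c}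

/-- The matrix of the point `(x, y)` of the equatorial plane. -/
def planeMatrix (z : ℍ) : Matrix (Fin 2) (Fin 2) ℂ :=
  !![((z.im + z.re ^ 2 / z.im : ℝ) : ℂ), ((z.re / z.im : ℝ) : ℂ);
     ((z.re / z.im : ℝ) : ℂ), ((1 / z.im : ℝ) : ℂ)]

lemma planeMatrix_mem (z : ℍ) : (planeMatrix z).PosDef ∧ (planeMatrix z).det = 1 := by
  have hy : 0 < z.im := z.im_pos
  set s : ℝ := Real.sqrt z.im with hs
  have hs0 : 0 < s := Real.sqrt_pos.2 hy
  have hss : s * s = z.im := Real.mul_self_sqrt hy.le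
  have hsC : (s : ℂ) ≠ 0 := by exact_mod_cast hs0.ne'
  have key : planeMatrix z = !![(s : ℂ), ((z.re / s : ℝ) : ℂ); 0, ((1 / s : ℝ) : ℂ)] *
      (!![(s : ℂ), ((z.re / s : ℝ) : ℂ); 0, ((1 / s : ℝ) : ℂ)]).conjTranspose := by
    rw [planeMatrix, ← hss]
    ext i j
    fin_cases i <;> fin_cases j <;>
      simp [Matrix.mul_apply, Fin.sum_univ_two, Matrix.conjTranspose_apply] <;> field_simp
  refine ⟨?_, ?_⟩
  · rw [key]
    refine Matrix.PosDef.mul_conjTranspose_self _ ?_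
    refine Matrix.vecMul_injective_of_isUnit ?_
    rw [Matrix.isUnit_iff_isUnit_det]
    simp [Matrix.det_fin_two, hsC]
  · rw [key, Matrix.det_mul, Matrix.det_conjTranspose]
    simp [Matrix.det_fin_two, hsC]

/-- The inclusion of the hyperbolic plane as the equatorial plane of hyperbolic 3-space. -/
def toH3 (z : ℍ) : H3 := ⟨planeMatrix z, planeMatrix_mem z⟩

/-- The complete geodesic of the hyperbolic plane with ideal endpoints `a`, `b`. -/
def geodesic (a b : RP1) : Set ℍ := toH3 ⁻¹' geodesic3 (toCP1 a) (toCP1 b)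

/-- The closed ideal triangle of the hyperbolic plane with ideal vertices `a`, `b`, `c`. -/
def idealTriangle (a b c : RP1) : Set ℍ :=
  toH3 ⁻¹' idealTriangle3 (toCP1 a) (toCP1 b) (toCP1 c)

/-- `B` is an open horoball of the hyperbolic plane centred at the ideal point `c`. -/
def IsHoroball (c : RP1) (B : Set ℍ) : Prop :=
  ∃ g : SL(2, ℝ), g • inftyPt ℝ = c ∧ B = {z | 1 < (g⁻¹ • z).im}

/-- The complex coordinate `z` of a point `(z, t)` of hyperbolic 3-space in the upper half-space
model. -/
def H3.foot (X : H3) : ℂ := X.1 0 1 / X.1 1 1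

/-! ### Fuchsian groups, the Farey set, ideal triangulations -/

/-- `G` is a Fuchsian group: it acts properly discontinuously on the hyperbolic plane. -/
def IsFuchsian (G : Subgroup PSL(2, ℝ)) : Prop :=
  ∀ K : Set ℍ, IsCompact K → {g : PSL(2, ℝ) | g ∈ G ∧ (((g • ·) '' K) ∩ K).Nonempty}.Finite

/-- `G` acts freely on the hyperbolic plane. -/
def ActsFreely (G : Subgroup PSL(2, ℝ)) : Prop :=
  ∀ g ∈ G, ∀ z : ℍ, g • z = z → g = 1

/-- A parabolic element of `PSL(2, ℝ)` with fixed point `c`: a non-trivial element whose only fixed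
point on the ideal boundary is `c`. -/
def IsParabolicAt (g : PSL(2, ℝ)) (c : RP1) : Prop :=
  g ≠ 1 ∧ ∀ x : RP1, g • x = x ↔ x = c

/-- The Farey set of `Γ`: the ideal points that are lifts of the punctures of `ℍ / Γ`, that is, the
fixed points of the parabolic elements of `Γ`. -/
def Farey (Γ : Subgroup PSL(2, ℝ)) : Type := {c : RP1 // ∃ g ∈ Γ, IsParabolicAt g c}

/-- The ideal point underlying an element of the Farey set. -/
def Farey.pt {Γ : Subgroup PSL(2, ℝ)} (p : Farey Γ) : RP1 := p.1

lemma farey_smul {Γ : Subgroup PSL(2, ℝ)} (γ : Γ) {c : RP1} (hc : ∃ g ∈ Γ, IsParabolicAt g c) :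
    ∃ g ∈ Γ, IsParabolicAt g ((γ : PSL(2, ℝ)) • c) := by
  obtain ⟨g, hg, h1, h2⟩ := hc
  refine ⟨γ * g * (γ : PSL(2, ℝ))⁻¹, Γ.mul_mem (Γ.mul_mem γ.2 hg) (Γ.inv_mem γ.2), ?_, ?_⟩
  · intro h
    exact h1 (conj_eq_one_iff.1 h)
  · intro x
    rw [mul_smul, mul_smul, smul_eq_iff_eq_inv_smul, h2, inv_smul_eq_iff]

instance (Γ : Subgroup PSL(2, ℝ)) : MulAction Γ (Farey Γ) where
  smul γ p := ⟨(γ : PSL(2, ℝ)) • p.1, farey_smul γ p.2⟩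
  one_smul p := Subtype.ext (one_smul PSL(2, ℝ) p.1)
  mul_smul γ δ p := Subtype.ext (mul_smul (γ : PSL(2, ℝ)) (δ : PSL(2, ℝ)) p.1)

/-- The lift to `ℍ` of an ideal triangulation of the punctured surface `ℍ / Γ`: a collection of
pairwise disjoint geodesics with ideal endpoints at lifts of punctures, invariant under `Γ`, locally
finite and descending to finitely many arcs, which divides `ℍ` into ideal triangles. Edges are
recorded through the graph that they form on the Farey set. -/
structure IdealTriangulation (Γ : Subgroup PSL(2, ℝ)) where
  /-- `graph.Adj p q` says that the geodesic from `p` to `q` is an edge. -/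
  graph : SimpleGraph (Farey Γ)
  smul_adj : ∀ (γ : Γ) (p q : Farey Γ), graph.Adj p q → graph.Adj (γ • p) (γ • q)
  disjoint : ∀ p q p' q' : Farey Γ, graph.Adj p q → graph.Adj p' q' → s(p, q) ≠ s(p', q') →
    Disjoint (geodesic p.pt q.pt) (geodesic p'.pt q'.pt)
  cover : ∀ z : ℍ, ∃ p q r : Farey Γ, graph.Adj p q ∧ graph.Adj q r ∧ graph.Adj r p ∧
    z ∈ idealTriangle p.pt q.pt r.pt
  finite_orbits : ∃ F : Set (Farey Γ × Farey Γ), F.Finite ∧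
    ∀ p q : Farey Γ, graph.Adj p q → ∃ γ : Γ, (γ • p, γ • q) ∈ F
  locally_finite : ∀ K : Set ℍ, IsCompact K →
    {e : Farey Γ × Farey Γ | graph.Adj e.1 e.2 ∧ (geodesic e.1.pt e.2.pt ∩ K).Nonempty}.Finite

namespace IdealTriangulation

variable {Γ : Subgroup PSL(2, ℝ)} (T : IdealTriangulation Γ)

/-- `p, q, r` are the vertices of a triangle of the triangulation. -/
def IsTriangle (p q r : Farey Γ) : Prop := T.graph.Adj p q ∧ T.graph.Adj q r ∧ T.graph.Adj r p

/-- `p₁, p₂, p₃, p₄`, in counter-clockwise order, are the vertices of the two triangles adjacent to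
the edge from `p₁` to `p₃`. -/
def IsQuad (p₁ p₂ p₃ p₄ : Farey Γ) : Prop :=
  T.IsTriangle p₁ p₂ p₃ ∧ T.IsTriangle p₁ p₃ p₄ ∧
    CCW p₁.pt p₂.pt p₃.pt ∧ CCW p₁.pt p₃.pt p₄.pt

/-- The Fock-Goncharov coordinates (cross-ratios) of a framing are well-defined and non-zero at all
edges of the triangulation. -/
def HasNonzeroCoordinates (β : Farey Γ → CP1) : Prop :=
  ∀ p₁ p₂ p₃ p₄ : Farey Γ, T.IsQuad p₁ p₂ p₃ p₄ →
    det2 (β p₂).rep (β p₃).rep * det2 (β p₁).rep (β p₄).rep ≠ 0 ∧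
      crossRatio (β p₁) (β p₂) (β p₃) (β p₄) ≠ 0

/-- `Ψ` is a pleated plane with framing `β`: it is continuous, and maps each triangle of the
triangulation homeomorphically, edges to edges, onto the totally geodesic ideal triangle whose ideal
vertices are given by `β`. -/
structure IsPleatedPlane (β : Farey Γ → CP1) (Ψ : ℍ → H3) : Prop where
  continuous : Continuous Ψ
  isEmbedding : ∀ p q r : Farey Γ, T.IsTriangle p q r →
    IsEmbedding ((idealTriangle p.pt q.pt r.pt).domRestrict Ψ)
  image_triangle : ∀ p q r : Farey Γ, T.IsTriangle p q r →
    Ψ '' idealTriangle p.pt q.pt r.pt = idealTriangle3 (β p) (β q) (β r)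
  image_edge : ∀ p q : Farey Γ, T.graph.Adj p q →
    Ψ '' geodesic p.pt q.pt = geodesic3 (β p) (β q)

/-- `β'` is the real framing obtained from `β` by replacing the complex cross-ratios of the edges by
their moduli, the ideal boundary having its standard orientation. -/
structure IsStraightening (β : Farey Γ → CP1) (β' : Farey Γ → RP1) : Prop where
  ccw : ∀ p q r : Farey Γ, T.IsTriangle p q r → CCW p.pt q.pt r.pt → CCW (β' p) (β' q) (β' r)
  crossRatio_eq : ∀ p₁ p₂ p₃ p₄ : Farey Γ, T.IsQuad p₁ p₂ p₃ p₄ →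
    crossRatio (β' p₁) (β' p₂) (β' p₃) (β' p₄) = ‖crossRatio (β p₁) (β p₂) (β p₃) (β p₄)‖

/-- `Ψ'` is a straightened plane with real framing `β'`: a pleated plane in the equatorial plane. -/
def IsStraightenedPlane (β' : Farey Γ → RP1) (Ψ' : ℍ → ℍ) : Prop :=
  T.IsPleatedPlane (fun p => toCP1 (β' p)) (fun z => toH3 (Ψ' z))

end IdealTriangulation

/-- `f` is equivariant for the homomorphism `ρ`. -/
def IsEquivariant {Γ : Subgroup PSL(2, ℝ)} {G X Y : Type*} [Group G] [MulAction Γ X]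
    [MulAction G Y] (ρ : Γ →* G) (f : X → Y) : Prop :=
  ∀ (γ : Γ) (x : X), f (γ • x) = ρ γ • f x

/-- `θ ∈ [0, 2π)` is the bending angle along the oriented geodesic from `a` to `b` between two pieces
`L`, `R` of half-planes bounded by this geodesic: in upper half-space coordinates in which the
geodesic runs from `0` to `∞`, the half-plane containing `L` is obtained from the continuation
beyond the geodesic of the half-plane containing `R` by a rotation of angle `θ`. -/
def IsBendingAngle (a b : CP1) (L R : Set H3) (θ : ℝ) : Prop :=
  θ ∈ Ico 0 (2 * Real.pi) ∧
    ∀ g : SL(2, ℂ), g • zeroPt ℂ = a → g • inftyPt ℂ = b →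
      ∀ x ∈ L \ geodesic3 a b, ∀ y ∈ R \ geodesic3 a b, ∃ r : ℝ, 0 < r ∧
        (g⁻¹ • x).foot = Complex.exp (θ * Complex.I) * (-(r * (g⁻¹ • y).foot))

/-! ### Hyperbolic surfaces and their ends -/

/-- `Ψ'` is the developing map, with holonomy `ρ'`, of a hyperbolic surface `range Ψ' / range ρ'`,
and the induced map from `ℍ / Γ` to it is a homeomorphism. -/
structure IsDevelopingMap {Γ : Subgroup PSL(2, ℝ)} (ρ' : Γ →* PSL(2, ℝ)) (Ψ' : ℍ → ℍ) : Prop where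
  injective : Function.Injective ρ'
  fuchsian : IsFuchsian ρ'.range
  free : ActsFreely ρ'.range
  equivariant : IsEquivariant ρ' Ψ'
  isOpenEmbedding : IsOpenEmbedding Ψ'
  homeo : ∃ h : Quotient (MulAction.orbitRel Γ ℍ) ≃ₜ
      Quotient ((MulAction.orbitRel ρ'.range ℍ).comap (Subtype.val : range Ψ' → ℍ)),
    ∀ z : ℍ, h (Quotient.mk _ z) = Quotient.mk _ ⟨Ψ' z, mem_range_self z⟩

section Ends

variable {Γ : Subgroup PSL(2, ℝ)} (ρ' : Γ →* PSL(2, ℝ)) (β' : Farey Γ → RP1) (Ψ' : ℍ → ℍ)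

/-- The puncture `p` becomes a cusp of the surface developed by `Ψ'`: its holonomy is parabolic with
fixed point `β' p`, and `Ψ'` matches the neighbourhoods of the puncture (horoballs at `p`) with those
of the cusp (horoballs at `β' p`). -/
structure IsCuspEnd (p : Farey Γ) : Prop where
  parabolic : ∀ γ : Γ, γ • p = p → γ ≠ 1 → IsParabolicAt (ρ' γ) (β' p)
  horoball_subset_image : ∀ B : Set ℍ, IsHoroball p.pt B →
    ∃ B' : Set ℍ, IsHoroball (β' p) B' ∧ B' ⊆ Ψ' '' B
  image_subset_horoball : ∀ B' : Set ℍ, IsHoroball (β' p) B' →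
    ∃ B : Set ℍ, IsHoroball p.pt B ∧ Ψ' '' B ⊆ B'

/-- The puncture `p` becomes a geodesic boundary component, with lift `ℓ`, of the surface developed by
`Ψ'`: `ℓ` is a geodesic in the frontier of the developed image with `β' p` as one endpoint; it is the
axis of the holonomy around the puncture, all other translates of it being disjoint from it (so that
it covers a simple closed geodesic); and `Ψ'` matches the neighbourhoods of the puncture (horoballs
at `p`) with the one-sided collars of `ℓ`. -/
structure IsBoundaryEnd (p : Farey Γ) (ℓ : Set ℍ) : Prop where
  axis : ∃ q : RP1, q ≠ β' p ∧ ℓ = geodesic (β' p) q ∧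
    ∀ γ : Γ, γ • p = p → ρ' γ • β' p = β' p ∧ ρ' γ • q = q
  subset_frontier : ℓ ⊆ frontier (range Ψ')
  disjoint : ∀ γ : Γ, γ • p ≠ p → Disjoint ((ρ' γ • ·) '' ℓ) ℓ
  collar_subset_image : ∀ B : Set ℍ, IsHoroball p.pt B →
    ∃ ε : ℝ, 0 < ε ∧ {y ∈ range Ψ' | Metric.infDist y ℓ < ε} ⊆ Ψ' '' B
  image_subset_collar : ∀ ε : ℝ, 0 < ε →
    ∃ B : Set ℍ, IsHoroball p.pt B ∧ Ψ' '' B ⊆ {y ∈ range Ψ' | Metric.infDist y ℓ < ε}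

end Ends

/-- The geodesic `m` has the ideal endpoint `a` in common with the different geodesic `ℓ`; modulo a
group containing a translation along `ℓ`, such a geodesic `m` spirals onto the image of `ℓ`. -/
def IsAsymptoticAt (a : RP1) (m ℓ : Set ℍ) : Prop :=
  ∃ b c : RP1, a ≠ b ∧ a ≠ c ∧ b ≠ c ∧ m = geodesic a b ∧ ℓ = geodesic a c

/-! ### Measured laminations -/

/-- The geodesic segment between two points of the hyperbolic plane. -/
def geodesicSegment (x y : ℍ) : Set ℍ := {z | dist x z + dist z y = dist x y}

/-- The segment from `x` to `y` is a non-degenerate arc in `X` transverse to the geodesics of the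
family `leaves`, that is, not contained in one of them. -/
def IsTransverse (X : Set ℍ) (leaves : Set (Set ℍ)) (x y : ℍ) : Prop :=
  x ≠ y ∧ geodesicSegment x y ⊆ X ∧ ∀ ℓ ∈ leaves, ¬ (x ∈ ℓ ∧ y ∈ ℓ)

/-- A measured lamination on the hyperbolic surface with geodesic boundary `X / G`, given by its lift
to `X ⊆ ℍ`: a `G`-invariant family of pairwise disjoint complete geodesics with closed union, and a
`G`-invariant transverse measure of full support which is invariant under homotopies along leaves.
It is finite on compact arcs in the interior of the surface; boundary leaves may have infinite
weight. -/
structure MeasuredLamination (G : Subgroup PSL(2, ℝ)) (X : Set ℍ) where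
  /-- The leaves. -/
  leaves : Set (Set ℍ)
  /-- The transverse measure on the segment from `x` to `y`. -/
  measure : ℍ → ℍ → Measure ℍ
  isGeodesic : ∀ ℓ ∈ leaves, ∃ a b : RP1, a ≠ b ∧ ℓ = geodesic a b
  subset : ∀ ℓ ∈ leaves, ℓ ⊆ X
  disjoint : leaves.PairwiseDisjoint id
  isClosed : IsClosed (⋃₀ leaves)
  smul_leaves : ∀ g ∈ G, ∀ ℓ ∈ leaves, (g • ·) '' ℓ ∈ leaves
  concentrated : ∀ x y, IsTransverse X leaves x y →
    measure x y (geodesicSegment x y ∩ ⋃₀ leaves)ᶜ = 0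
  full_support : ∀ x y, IsTransverse X leaves x y → ∀ z ∈ geodesicSegment x y ∩ ⋃₀ leaves,
    (z ≠ x ∧ z ≠ y) ∨ z ∈ frontier X → z ∈ (measure x y).support
  restrict : ∀ x y x' y', IsTransverse X leaves x y → IsTransverse X leaves x' y' →
    geodesicSegment x' y' ⊆ geodesicSegment x y →
    measure x' y' = (measure x y).restrict (geodesicSegment x' y')
  holonomy : ∀ x y x' y', IsTransverse X leaves x y → IsTransverse X leaves x' y' →
    ∀ f : ℍ → ℍ, ContinuousOn f (geodesicSegment x y) →
      BijOn f (geodesicSegment x y) (geodesicSegment x' y') →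
      (∀ ℓ ∈ leaves, ∀ z ∈ geodesicSegment x y, z ∈ ℓ ↔ f z ∈ ℓ) →
      ∀ A : Set ℍ, MeasurableSet A →
        measure x' y' A = measure x y (geodesicSegment x y ∩ f ⁻¹' A)
  smul_measure : ∀ g ∈ G, ∀ x y, IsTransverse X leaves x y →
    measure (g • x) (g • y) = (measure x y).map (g • ·)
  finite : ∀ x y, IsTransverse X leaves x y → geodesicSegment x y ⊆ interior X →
    measure x y univ < ⊤

namespace MeasuredLamination

variable {G : Subgroup PSL(2, ℝ)} {X : Set ℍ}

/-- The leaf `ℓ` carries the weight `w`: every transverse arc has an atom of mass `w` at its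
intersection with `ℓ`. -/
def HasWeight (lam : MeasuredLamination G X) (ℓ : Set ℍ) (w : ℝ≥0∞) : Prop :=
  ∀ x y, IsTransverse X lam.leaves x y → ∀ z ∈ geodesicSegment x y ∩ ℓ, lam.measure x y {z} = w

end MeasuredLamination

end Straightening

end

/-! Everything is reduced to real algebra through the side functions `lam a b` of oriented geodesics:
the hyperbolic sine of the signed distance to the geodesic from `a` to `b`. The three side functions
of an ideal triangle are coordinates on the hyperbolic plane, which becomes a sheet of a quadric
(`lam_quadric`), and the triangle is where all three are non-negative.

*Framing and planes.* Local finiteness implies that from any edge every ideal vertex is reached by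
crossing finitely many edges (`desc_of_ccw`). Hence a straightened framing can be developed one vertex
at a time (`exists_straightening`); it preserves the sides of all edges and is determined by its values
on one triangle, which yields the holonomy (`IsStraightening.exists_holonomy`). A pleated plane is
written down triangle by triangle (`exists_pleatedPlane`): each triangle is mapped by
identifying the coordinates, after its sides have been slid by amounts that compensate for the
difference of the moduli of the cross-ratios, so that the maps agree on common sides and the result is
equivariant. Its bending angles are the arguments of the cross-ratios (`isBendingAngle_bendAngle`). The
straightened plane is the special case of a real framing.

*The developed image.* A straightened plane preserves the sides of edges, so it is injective, and it is
an open embedding (`IsStraightening.isOpenEmbedding`). The key step is the description of the complement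
of its image. A point outside is separated from a base triangle by an infinite sequence of edges. If
the common vertex of consecutive edges changed infinitely often, then the arcs cut off by them would
shrink by a definite factor each time, as the cross-ratios are bounded away from zero modulo the group,
and the point could not lie beyond all of them. So the point lies beyond all edges that end at a single
vertex `p` (`IsStraightening.exists_mem_beyond`). The sets `Beyond p` of such points are disjoint and
permuted by the holonomy, which gives freeness of the action (`IsStraightening.actsFreely_range`).

*Punctures.* In a chart with `p` and its image at infinity (`EndChart`), a parabolic element at `p` is a
translation, and its holonomy is an affine map `x ↦ l x + t`. If `l = 1`, the edges at `p` are unbounded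
in both directions and `Beyond p` is empty: a cusp, whose stabilizer is parabolic since the holonomy is
Fuchsian. If `l ≠ 1`, the edges accumulate at the fixed point `b = t / (1 - l)`, and `Beyond p` is the
half-plane bounded by the vertical line at `b`, the boundary geodesic (`EndChart.IsBoundary`). This
determines the frontier (`IsStraightening.frontier_eq`). Neighbourhoods of the ends are matched on each
triangle by a connectedness argument (`exists_vertex_nhds`), and there are finitely many triangles at `p`
modulo the parabolic element.

*Lamination.* The transverse measure is a sum of point masses (`weightedLamination`); it is finite on
compact arcs in the interior because finitely many edges meet a compact set.
-/

noncomputable section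

namespace Straightening

/-! ### Side functions of geodesics -/

lemma det2_smul {K : Type*} [Field K] (c d : K) (v w : Fin 2 → K) :
    det2 (c • v) (d • w) = c * d * det2 v w := by
  simp [det2]; ring

lemma det2_swap {K : Type*} [Field K] (v w : Fin 2 → K) : det2 w v = -det2 v w := by
  simp [det2]; ring

lemma det2_mulVec {K : Type*} [Field K] (g : SL(2, K)) (v w : Fin 2 → K) :
    det2 ((g : Matrix (Fin 2) (Fin 2) K).mulVec v) ((g : Matrix (Fin 2) (Fin 2) K).mulVec w) =
      det2 v w := by
  have h := g.2
  rw [Matrix.det_fin_two] at h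
  simp only [det2, Matrix.mulVec, dotProduct, Fin.sum_univ_two]
  linear_combination (v 0 * w 1 - v 1 * w 0) * h

lemma smul_mk_eq {K : Type*} [Field K] (g : SL(2, K)) (v : Fin 2 → K) (hv : v ≠ 0) :
    ∃ h, g • Projectivization.mk K v hv =
      Projectivization.mk K ((g : Matrix (Fin 2) (Fin 2) K).mulVec v) h :=
  ⟨_, rfl⟩

lemma exists_mk {K : Type*} [Field K] (p : ℙ K (Fin 2 → K)) :
    ∃ v, ∃ hv : v ≠ 0, p = Projectivization.mk K v hv :=
  ⟨p.rep, p.rep_nonzero, p.mk_rep.symm⟩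

lemma exists_rep_mk {K : Type*} [Field K] (v : Fin 2 → K) (hv : v ≠ 0) :
    ∃ c : K, c ≠ 0 ∧ (Projectivization.mk K v hv).rep = c • v := by
  obtain ⟨a, ha⟩ := Projectivization.exists_smul_eq_mk_rep K v hv
  exact ⟨a, a.ne_zero, ha.symm⟩

lemma det2_eq_zero_iff {K : Type*} [Field K] {v w : Fin 2 → K} (hv : v ≠ 0) (hw : w ≠ 0) :
    det2 v w = 0 ↔ Projectivization.mk K v hv = Projectivization.mk K w hw := by
  rw [Projectivization.mk_eq_mk_iff']
  constructor
  · intro h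
    have h' : v 0 * w 1 = v 1 * w 0 := sub_eq_zero.1 h
    by_cases h0 : w 0 = 0
    · have h1 : w 1 ≠ 0 := fun h1 => hw (by ext i; fin_cases i <;> simp [h0, h1])
      refine ⟨v 1 / w 1, ?_⟩
      have : v 0 = 0 := by simpa [h0, h1] using h'
      ext i; fin_cases i <;> simp [h0, h1, this]
    · refine ⟨v 0 / w 0, ?_⟩
      ext i; fin_cases i
      · simp [h0]
      · simp; field_simp; linear_combination h'
  · rintro ⟨a, rfl⟩
    simp [det2]; ring

lemma det2_rep_ne_zero {K : Type*} [Field K] {p q : ℙ K (Fin 2 → K)} :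
    det2 p.rep q.rep ≠ 0 ↔ p ≠ q := by
  rw [ne_eq, det2_eq_zero_iff p.rep_nonzero q.rep_nonzero]
  simp

lemma crossRatio_mk {K : Type*} [Field K] (v₁ v₂ v₃ v₄ : Fin 2 → K) (h₁ h₂ h₃ h₄) :
    crossRatio (Projectivization.mk K v₁ h₁) (Projectivization.mk K v₂ h₂)
      (Projectivization.mk K v₃ h₃) (Projectivization.mk K v₄ h₄) =
      (det2 v₁ v₂ * det2 v₃ v₄) / (det2 v₂ v₃ * det2 v₁ v₄) := by
  obtain ⟨c₁, hc₁, e₁⟩ := exists_rep_mk v₁ h₁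
  obtain ⟨c₂, hc₂, e₂⟩ := exists_rep_mk v₂ h₂
  obtain ⟨c₃, hc₃, e₃⟩ := exists_rep_mk v₃ h₃
  obtain ⟨c₄, hc₄, e₄⟩ := exists_rep_mk v₄ h₄
  simp only [crossRatio, e₁, e₂, e₃, e₄, det2_smul]
  rw [show c₁ * c₂ * det2 v₁ v₂ * (c₃ * c₄ * det2 v₃ v₄) =
      (c₁ * c₂ * c₃ * c₄) * (det2 v₁ v₂ * det2 v₃ v₄) by ring,
    show c₂ * c₃ * det2 v₂ v₃ * (c₁ * c₄ * det2 v₁ v₄) =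
      (c₁ * c₂ * c₃ * c₄) * (det2 v₂ v₃ * det2 v₁ v₄) by ring, mul_div_mul_left]
  simp [hc₁, hc₂, hc₃, hc₄]

lemma crossRatio_smul {K : Type*} [Field K] (g : SL(2, K)) (p₁ p₂ p₃ p₄ : ℙ K (Fin 2 → K)) :
    crossRatio (g • p₁) (g • p₂) (g • p₃) (g • p₄) = crossRatio p₁ p₂ p₃ p₄ := by
  obtain ⟨v₁, h₁, rfl⟩ := exists_mk p₁
  obtain ⟨v₂, h₂, rfl⟩ := exists_mk p₂
  obtain ⟨v₃, h₃, rfl⟩ := exists_mk p₃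
  obtain ⟨v₄, h₄, rfl⟩ := exists_mk p₄
  obtain ⟨_, e₁⟩ := smul_mk_eq g v₁ h₁
  obtain ⟨_, e₂⟩ := smul_mk_eq g v₂ h₂
  obtain ⟨_, e₃⟩ := smul_mk_eq g v₃ h₃
  obtain ⟨_, e₄⟩ := smul_mk_eq g v₄ h₄
  simp only [e₁, e₂, e₃, e₄, crossRatio_mk, det2_mulVec]

lemma crossRatio_psl_smul {K : Type*} [Field K] (g : PSL(2, K)) (p₁ p₂ p₃ p₄ : ℙ K (Fin 2 → K)) :
    crossRatio (g • p₁) (g • p₂) (g • p₃) (g • p₄) = crossRatio p₁ p₂ p₃ p₄ := by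
  induction g using QuotientGroup.induction_on with
  | H g => exact crossRatio_smul g p₁ p₂ p₃ p₄

/-- The cross-ratio at an edge does not depend on the orientation of the edge. -/
lemma crossRatio_rotate {K : Type*} [Field K] (p₁ p₂ p₃ p₄ : ℙ K (Fin 2 → K)) :
    crossRatio p₃ p₄ p₁ p₂ = crossRatio p₁ p₂ p₃ p₄ := by
  simp only [crossRatio]
  rw [det2_swap p₁.rep p₄.rep, det2_swap p₂.rep p₃.rep]
  ring

/-- The pairing of the quadratic form of the point `z` with two vectors; for `v = w` it is a Busemann
function of `z` at the ideal point `[v]`. -/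
def pairing (v w : Fin 2 → ℝ) (z : ℍ) : ℝ :=
  ((v 0 - z.re * v 1) * (w 0 - z.re * w 1) + z.im ^ 2 * (v 1 * w 1)) / z.im

lemma pairing_smul (c d : ℝ) (v w : Fin 2 → ℝ) (z : ℍ) :
    pairing (c • v) (d • w) z = c * d * pairing v w z := by
  simp [pairing]; ring

lemma pairing_comm (v w : Fin 2 → ℝ) (z : ℍ) : pairing w v z = pairing v w z := by
  simp [pairing]; ring

lemma pairing_self_pos {v : Fin 2 → ℝ} (hv : v ≠ 0) (z : ℍ) : 0 < pairing v v z := by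
  have hy := z.im_pos
  refine div_pos ?_ hy
  by_cases h1 : v 1 = 0
  · have h0 : v 0 ≠ 0 := fun h0 => hv (by ext i; fin_cases i <;> simp [h0, h1])
    simp only [h1]
    have : 0 < v 0 * v 0 := mul_self_pos.2 h0
    simpa using this
  · have : 0 < v 1 * v 1 := mul_self_pos.2 h1
    have h2 : 0 < z.im ^ 2 := by positivity
    nlinarith [mul_self_nonneg (v 0 - z.re * v 1), mul_pos h2 this]

lemma smul_re_im (g : SL(2, ℝ)) (z : ℍ) :
    let a := g 0 0; let b := g 0 1; let c := g 1 0; let d := g 1 1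
    0 < (c * z.re + d) ^ 2 + (c * z.im) ^ 2 ∧
    (g • z).re = ((a * z.re + b) * (c * z.re + d) + a * c * z.im ^ 2) /
      ((c * z.re + d) ^ 2 + (c * z.im) ^ 2) ∧
    (g • z).im = z.im / ((c * z.re + d) ^ 2 + (c * z.im) ^ 2) := by
  intro a b c d
  have hdet : a * d - b * c = 1 := by
    have := g.2; rw [Matrix.det_fin_two] at this; exact this
  have hy := z.im_pos
  have hpos : 0 < (c * z.re + d) ^ 2 + (c * z.im) ^ 2 := by
    by_cases hc : c = 0
    · have : d ≠ 0 := by rintro hd; simp [hc, hd] at hdet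
      have : 0 < d ^ 2 := by positivity
      simpa [hc] using this
    · have : c * z.im ≠ 0 := mul_ne_zero hc hy.ne'
      positivity
  have hcoe : ((g • z : ℍ) : ℂ) = (a * z + b) / (c * z + d) := by
    rw [UpperHalfPlane.specialLinearGroup_apply]; rfl
  have hz : (z : ℂ) = ⟨z.re, z.im⟩ := rfl
  have h1 : ((a : ℂ) * z + b) = ⟨a * z.re + b, a * z.im⟩ := by
    rw [hz]; apply Complex.ext <;> simp
  have h2 : ((c : ℂ) * z + d) = ⟨c * z.re + d, c * z.im⟩ := by
    rw [hz]; apply Complex.ext <;> simp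
  have hn : Complex.normSq (⟨c * z.re + d, c * z.im⟩ : ℂ) =
      (c * z.re + d) ^ 2 + (c * z.im) ^ 2 := by
    simp [Complex.normSq_apply]; ring
  refine ⟨hpos, ?_, ?_⟩
  · have : (g • z).re = ((g • z : ℍ) : ℂ).re := rfl
    rw [this, hcoe, h1, h2, Complex.div_re, hn]
    simp only
    rw [← add_div]; congr 1; ring
  · have : (g • z).im = ((g • z : ℍ) : ℂ).im := rfl
    rw [this, hcoe, h1, h2, Complex.div_im, hn]
    simp only
    rw [← sub_div]; congr 1
    linear_combination z.im * hdet

lemma pairing_mulVec (g : SL(2, ℝ)) (v w : Fin 2 → ℝ) (z : ℍ) :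
    pairing ((g : Matrix (Fin 2) (Fin 2) ℝ).mulVec v) ((g : Matrix (Fin 2) (Fin 2) ℝ).mulVec w)
      (g • z) = pairing v w z := by
  obtain ⟨hpos, hre, him⟩ := smul_re_im g z
  have hdet : g 0 0 * g 1 1 - g 0 1 * g 1 0 = 1 := by
    have := g.2; rw [Matrix.det_fin_two] at this; exact this
  have hy := z.im_pos
  simp only [pairing, hre, him, Matrix.mulVec, dotProduct, Fin.sum_univ_two]
  generalize g 0 0 = a at *
  generalize g 0 1 = b at *
  generalize g 1 0 = c at *
  generalize g 1 1 = d at *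
  set x := z.re
  set y := z.im
  set N := (c * x + d) ^ 2 + (c * y) ^ 2 with hN
  have key : ∀ p q : ℝ, N * (a * p + b * q) - ((a * x + b) * (c * x + d) + a * c * y ^ 2) *
      (c * p + d * q) = (c * x + d) * (p - x * q) - c * y ^ 2 * q := by
    intro p q
    rw [hN]
    linear_combination ((c * x + d) * (p - x * q) - c * y ^ 2 * q) * hdet
  have e : ∀ p q : ℝ, a * p + b * q - ((a * x + b) * (c * x + d) + a * c * y ^ 2) / N *
      (c * p + d * q) = ((c * x + d) * (p - x * q) - c * y ^ 2 * q) / N := by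
    intro p q
    rw [← key]; field_simp
  rw [e, e]
  field_simp
  rw [hN]
  ring

/-- The side function of the oriented geodesic from `a` to `b`: the hyperbolic sine of the signed
distance to it. It is positive on the left side, where the ideal points `c` satisfy `CCW a b c`. -/
def lam (a b : RP1) (z : ℍ) : ℝ := -(pairing a.rep b.rep z / det2 a.rep b.rep)

lemma lam_mk (v w : Fin 2 → ℝ) (hv hw) (z : ℍ) :
    lam (Projectivization.mk ℝ v hv) (Projectivization.mk ℝ w hw) z =
      -(pairing v w z / det2 v w) := by
  obtain ⟨c, hc, e⟩ := exists_rep_mk v hv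
  obtain ⟨d, hd, e'⟩ := exists_rep_mk w hw
  simp only [lam, e, e', det2_smul, pairing_smul]
  rw [mul_div_mul_left _ _ (mul_ne_zero hc hd)]

lemma lam_swap (a b : RP1) (z : ℍ) : lam b a z = -lam a b z := by
  simp only [lam]
  rw [det2_swap a.rep, pairing_comm a.rep, div_neg]

lemma lam_smul (g : SL(2, ℝ)) (a b : RP1) (z : ℍ) : lam (g • a) (g • b) (g • z) = lam a b z := by
  obtain ⟨v, hv, rfl⟩ := exists_mk a
  obtain ⟨w, hw, rfl⟩ := exists_mk b
  obtain ⟨_, e₁⟩ := smul_mk_eq g v hv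
  obtain ⟨_, e₂⟩ := smul_mk_eq g w hw
  rw [e₁, e₂, lam_mk, lam_mk, pairing_mulVec, det2_mulVec]

lemma lam_psl_smul (g : PSL(2, ℝ)) (a b : RP1) (z : ℍ) :
    lam (g • a) (g • b) (g • z) = lam a b z := by
  induction g using QuotientGroup.induction_on with
  | H g => exact lam_smul g a b z

lemma continuous_lam (a b : RP1) : Continuous (lam a b) := by
  unfold lam pairing
  have h1 : Continuous fun z : ℍ => z.re := UpperHalfPlane.continuous_re
  have h2 : Continuous fun z : ℍ => z.im := UpperHalfPlane.continuous_im
  refine ((Continuous.div ?_ h2 fun z => z.im_pos.ne').div_const _).neg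
  fun_prop

/-! ### Orientation of triples of ideal points -/

lemma ccw_mk {u v w : Fin 2 → ℝ} (hu : u ≠ 0) (hv : v ≠ 0) (hw : w ≠ 0) :
    CCW (Projectivization.mk ℝ u hu) (Projectivization.mk ℝ v hv) (Projectivization.mk ℝ w hw) ↔
      0 < det2 u v * det2 v w * det2 w u := by
  constructor
  · rintro ⟨g, h0, h1, h2⟩
    simp only [zeroPt, onePt, inftyPt] at h0 h1 h2
    obtain ⟨_, e0⟩ := smul_mk_eq g ![0, 1] (by simp)
    obtain ⟨_, e1⟩ := smul_mk_eq g ![1, 1] (by simp)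
    obtain ⟨_, e2⟩ := smul_mk_eq g ![1, 0] (by simp)
    rw [e0, eq_comm, Projectivization.mk_eq_mk_iff'] at h0
    rw [e1, eq_comm, Projectivization.mk_eq_mk_iff'] at h1
    rw [e2, eq_comm, Projectivization.mk_eq_mk_iff'] at h2
    obtain ⟨a, rfl⟩ := h0
    obtain ⟨b, rfl⟩ := h1
    obtain ⟨c, rfl⟩ := h2
    have ha : a ≠ 0 := by rintro rfl; simp at hu
    have hb : b ≠ 0 := by rintro rfl; simp at hv
    have hc : c ≠ 0 := by rintro rfl; simp at hw
    simp only [det2_smul, det2_mulVec]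
    have : a * b * det2 ![0, 1] ![1, 1] * (b * c * det2 ![1, 1] ![1, 0]) *
        (c * a * det2 ![1, 0] ![0, 1]) = (a * b * c) ^ 2 := by
      simp [det2]; ring
    rw [this]
    positivity
  · intro h
    set D := det2 u v * det2 v w * det2 w u with hD
    have huv : det2 u v ≠ 0 := by rintro h'; simp [hD, h'] at h
    have hvw : det2 v w ≠ 0 := by rintro h'; simp [hD, h'] at h
    have hwu : det2 w u ≠ 0 := by rintro h'; simp [hD, h'] at h
    set s := Real.sqrt D with hs
    have hs0 : 0 < s := Real.sqrt_pos.2 h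
    have hss : s * s = D := Real.mul_self_sqrt h.le
    let M : Matrix (Fin 2) (Fin 2) ℝ :=
      !![w 0 * det2 u v / s, u 0 * det2 v w / s; w 1 * det2 u v / s, u 1 * det2 v w / s]
    have hM : M.det = 1 := by
      have : M.det = det2 u v * det2 v w * det2 w u / (s * s) := by
        rw [Matrix.det_fin_two]; simp only [M, Matrix.of_apply, Matrix.cons_val', Matrix.cons_val_zero, Matrix.cons_val_one, Matrix.cons_val_fin_one]
        field_simp
        simp only [det2]; ring
      rw [this, hss, hD, div_self h.ne']
    refine ⟨⟨M, hM⟩, ?_, ?_, ?_⟩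
    · obtain ⟨_, e0⟩ := smul_mk_eq (⟨M, hM⟩ : SL(2, ℝ)) ![0, 1] (by simp)
      rw [zeroPt, e0, Projectivization.mk_eq_mk_iff']
      refine ⟨det2 v w / s, ?_⟩
      ext i; fin_cases i <;> simp [M, Matrix.mulVec, dotProduct, Fin.sum_univ_two] <;> ring
    · obtain ⟨_, e0⟩ := smul_mk_eq (⟨M, hM⟩ : SL(2, ℝ)) ![1, 1] (by simp)
      rw [onePt, e0, Projectivization.mk_eq_mk_iff']
      refine ⟨det2 u w / s, ?_⟩
      ext i; fin_cases i <;> simp [M, Matrix.mulVec, dotProduct, Fin.sum_univ_two] <;>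
        field_simp <;> simp only [det2] <;> ring
    · obtain ⟨_, e0⟩ := smul_mk_eq (⟨M, hM⟩ : SL(2, ℝ)) ![1, 0] (by simp)
      rw [inftyPt, e0, Projectivization.mk_eq_mk_iff']
      refine ⟨det2 u v / s, ?_⟩
      ext i; fin_cases i <;> simp [M, Matrix.mulVec, dotProduct, Fin.sum_univ_two] <;> ring

lemma ccw_iff {a b c : RP1} :
    CCW a b c ↔ 0 < det2 a.rep b.rep * det2 b.rep c.rep * det2 c.rep a.rep := by
  rw [← ccw_mk a.rep_nonzero b.rep_nonzero c.rep_nonzero]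
  simp only [Projectivization.mk_rep]

lemma ccw_smul_iff (g : SL(2, ℝ)) {a b c : RP1} : CCW (g • a) (g • b) (g • c) ↔ CCW a b c := by
  constructor
  · rintro ⟨h, h0, h1, h2⟩
    refine ⟨g⁻¹ * h, ?_, ?_, ?_⟩ <;> simp [mul_smul, h0, h1, h2]
  · rintro ⟨h, h0, h1, h2⟩
    refine ⟨g * h, ?_, ?_, ?_⟩ <;> simp [mul_smul, h0, h1, h2]

lemma ccw_psl_smul_iff (g : PSL(2, ℝ)) {a b c : RP1} :
    CCW (g • a) (g • b) (g • c) ↔ CCW a b c := by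
  induction g using QuotientGroup.induction_on with
  | H g => exact ccw_smul_iff g

/-- The finite point `x` of the real projective line. -/
def realPt (x : ℝ) : RP1 := Projectivization.mk ℝ ![x, 1] (by simp)

lemma eq_realPt {a : RP1} (ha : a ≠ inftyPt ℝ) : ∃ x, a = realPt x := by
  obtain ⟨v, hv, rfl⟩ := exists_mk a
  have h1 : v 1 ≠ 0 := by
    intro h1
    refine ha ((det2_eq_zero_iff hv _).1 ?_)
    simp [det2, h1]
  refine ⟨v 0 / v 1, (det2_eq_zero_iff hv _).1 ?_⟩
  simp [det2]; field_simp; simp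

lemma realPt_ne_infty (x : ℝ) : realPt x ≠ inftyPt ℝ := by
  intro h
  have := (det2_eq_zero_iff _ _).2 h
  simp [det2] at this

lemma realPt_injective : Function.Injective realPt := by
  intro x y h
  have := (det2_eq_zero_iff _ _).2 h
  simp [det2] at this
  linarith

lemma ccw_realPt {x y z : ℝ} :
    CCW (realPt x) (realPt y) (realPt z) ↔ 0 < (x - y) * (y - z) * (z - x) := by
  rw [realPt, realPt, realPt, ccw_mk]
  simp [det2]

lemma ccw_rotate {a b c : RP1} : CCW a b c ↔ CCW b c a := by
  rw [ccw_iff, ccw_iff]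
  constructor <;> intro h <;> linarith

lemma ccw_infty {x y : ℝ} : CCW (realPt x) (realPt y) (inftyPt ℝ) ↔ x < y := by
  rw [realPt, realPt, inftyPt, ccw_mk]
  simp [det2]

/-- An angular coordinate on the real projective line. -/
def theta (a : RP1) : ℝ := if a.rep 1 = 0 then Real.pi / 2 else Real.arctan (a.rep 0 / a.rep 1)

lemma theta_realPt (x : ℝ) : theta (realPt x) = Real.arctan x := by
  obtain ⟨c, hc, e⟩ := exists_rep_mk (K := ℝ) ![x, 1] (by simp)
  have e' : (realPt x).rep = c • ![x, 1] := e
  rw [theta, e']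
  simp [hc]

lemma theta_infty : theta (inftyPt ℝ) = Real.pi / 2 := by
  obtain ⟨c, hc, e⟩ := exists_rep_mk (K := ℝ) ![1, 0] (by simp)
  have e' : (inftyPt ℝ).rep = c • ![1, 0] := e
  rw [theta, e']
  simp

lemma theta_injective : Function.Injective theta := by
  intro a b h
  by_cases ha : a = inftyPt ℝ <;> by_cases hb : b = inftyPt ℝ
  · rw [ha, hb]
  · obtain ⟨x, rfl⟩ := eq_realPt hb
    rw [ha, theta_infty, theta_realPt] at h
    exact absurd h (Real.arctan_lt_pi_div_two x).ne'
  · obtain ⟨x, rfl⟩ := eq_realPt ha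
    rw [hb, theta_infty, theta_realPt] at h
    exact absurd h (Real.arctan_lt_pi_div_two x).ne
  · obtain ⟨x, rfl⟩ := eq_realPt ha
    obtain ⟨y, rfl⟩ := eq_realPt hb
    rw [theta_realPt, theta_realPt] at h
    rw [Real.arctan_injective h]

lemma cyclic_iff_mul_pos {x y z : ℝ} : 0 < (x - y) * (y - z) * (z - x) ↔
    (x < y ∧ y < z) ∨ (y < z ∧ z < x) ∨ (z < x ∧ x < y) := by
  constructor
  · intro h
    rcases lt_trichotomy x y with h1 | h1 | h1
    · rcases lt_trichotomy y z with h2 | h2 | h2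
      · exact Or.inl ⟨h1, h2⟩
      · simp [h2] at h
      · refine Or.inr (Or.inr ⟨?_, h1⟩)
        by_contra h3
        nlinarith [mul_nonneg (mul_nonneg (sub_nonneg.2 h1.le) (sub_nonneg.2 h2.le)) (sub_nonneg.2 (not_lt.1 h3))]
    · simp [h1] at h
    · refine Or.inr (Or.inl ?_)
      rcases lt_trichotomy y z with h2 | h2 | h2
      · refine ⟨h2, ?_⟩
        by_contra h3
        nlinarith [mul_nonneg (mul_nonneg (sub_nonneg.2 h1.le) (sub_nonneg.2 h2.le)) (sub_nonneg.2 (not_lt.1 h3))]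
      · simp [h2] at h
      · nlinarith [mul_pos (mul_pos (sub_pos.2 h1) (sub_pos.2 h2)) (sub_pos.2 (h2.trans h1))]
  · rintro (⟨h1, h2⟩ | ⟨h1, h2⟩ | ⟨h1, h2⟩)
    · nlinarith [mul_pos (mul_pos (sub_pos.2 h1) (sub_pos.2 h2)) (sub_pos.2 (h1.trans h2))]
    · nlinarith [mul_pos (mul_pos (sub_pos.2 h1) (sub_pos.2 h2)) (sub_pos.2 (h1.trans h2))]
    · nlinarith [mul_pos (mul_pos (sub_pos.2 h1) (sub_pos.2 h2)) (sub_pos.2 (h1.trans h2))]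

/-- The counter-clockwise order is the cyclic order of the angular coordinates. -/
lemma ccw_iff_theta {a b c : RP1} : CCW a b c ↔
    (theta a < theta b ∧ theta b < theta c) ∨ (theta b < theta c ∧ theta c < theta a) ∨
      (theta c < theta a ∧ theta a < theta b) := by
  have irr : ∀ a b : RP1, ¬ CCW a a b := fun a b h => by
    rw [ccw_iff] at h; simp [det2, mul_comm] at h
  have key : ∀ x : ℝ, theta (realPt x) < theta (inftyPt ℝ) := fun x => by
    rw [theta_realPt, theta_infty]; exact Real.arctan_lt_pi_div_two x
  have mono : ∀ x y : ℝ, theta (realPt x) < theta (realPt y) ↔ x < y := fun x y => by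
    rw [theta_realPt, theta_realPt]; exact Real.arctan_strictMono.lt_iff_lt
  by_cases ha : a = inftyPt ℝ
  · subst ha
    by_cases hb : b = inftyPt ℝ
    · subst hb
      simp only [irr, false_iff]
      grind
    · obtain ⟨y, rfl⟩ := eq_realPt hb
      by_cases hc : c = inftyPt ℝ
      · subst hc
        rw [← ccw_rotate]
        simp only [irr, false_iff]
        grind
      · obtain ⟨z, rfl⟩ := eq_realPt hc
        rw [ccw_rotate, ccw_infty]
        have := key y
        have := key z
        rw [← mono]
        grind
  · obtain ⟨x, rfl⟩ := eq_realPt ha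
    by_cases hb : b = inftyPt ℝ
    · subst hb
      by_cases hc : c = inftyPt ℝ
      · subst hc
        rw [ccw_rotate]
        simp only [irr, false_iff]
        grind
      · obtain ⟨z, rfl⟩ := eq_realPt hc
        rw [← ccw_rotate, ccw_infty]
        have := key x
        have := key z
        rw [← mono]
        grind
    · obtain ⟨y, rfl⟩ := eq_realPt hb
      by_cases hc : c = inftyPt ℝ
      · subst hc
        rw [ccw_infty]
        have := key x
        have := key y
        rw [← mono]
        grind
      · obtain ⟨z, rfl⟩ := eq_realPt hc
        rw [ccw_realPt, cyclic_iff_mul_pos]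
        simp only [mono]

lemma CCW.ne12 {a b c : RP1} (h : CCW a b c) : a ≠ b := by
  rintro rfl
  rw [ccw_iff_theta] at h
  grind

lemma CCW.ne23 {a b c : RP1} (h : CCW a b c) : b ≠ c := (ccw_rotate.1 h).ne12

lemma CCW.ne31 {a b c : RP1} (h : CCW a b c) : c ≠ a := (ccw_rotate.1 (ccw_rotate.1 h)).ne12

lemma ccw_or_ccw {a b c : RP1} (h1 : a ≠ b) (h2 : b ≠ c) (h3 : c ≠ a) :
    CCW a b c ∨ CCW a c b := by
  rw [ccw_iff_theta, ccw_iff_theta]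
  have h1' := theta_injective.ne h1
  have h2' := theta_injective.ne h2
  have h3' := theta_injective.ne h3
  grind

/-! ### Geodesics and ideal triangles in terms of side functions -/

lemma ray_mk (v : Fin 2 → ℂ) (hv : v ≠ 0) : ∃ c : ℝ, 0 < c ∧
    ray (Projectivization.mk ℂ v hv) = (c : ℂ) • Matrix.vecMulVec v (star v) := by
  obtain ⟨u, hu, e⟩ := exists_rep_mk v hv
  refine ⟨‖u‖ ^ 2, by positivity, ?_⟩
  have : ((‖u‖ ^ 2 : ℝ) : ℂ) = u * star u := by
    rw [Complex.star_def, Complex.mul_conj, Complex.normSq_eq_norm_sq]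
  rw [ray, e, this]
  ext i j
  simp [Matrix.vecMulVec_apply]
  ring

lemma ofReal_comp_ne_zero {v : Fin 2 → ℝ} (hv : v ≠ 0) : (fun i => (v i : ℂ)) ≠ 0 := by
  intro h
  refine hv (funext fun i => ?_)
  have := congrFun h i
  simpa using this

lemma toCP1_mk (v : Fin 2 → ℝ) (hv : v ≠ 0) : toCP1 (Projectivization.mk ℝ v hv) =
    Projectivization.mk ℂ (fun i => (v i : ℂ)) (ofReal_comp_ne_zero hv) := by
  obtain ⟨u, hu, e⟩ := exists_rep_mk v hv
  rw [toCP1, Projectivization.mk_eq_mk_iff']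
  refine ⟨u, ?_⟩
  ext i
  simp [e]

lemma ray_toCP1 (v : Fin 2 → ℝ) (hv : v ≠ 0) : ∃ c : ℝ, 0 < c ∧
    ∀ i j, ray (toCP1 (Projectivization.mk ℝ v hv)) i j = ((c * (v i * v j) : ℝ) : ℂ) := by
  obtain ⟨c, hc, e⟩ := ray_mk _ (ofReal_comp_ne_zero hv)
  refine ⟨c, hc, fun i j => ?_⟩
  rw [toCP1_mk, e]
  simp [Matrix.vecMulVec_apply]

lemma toH3_val_eq_iff (z : ℍ) (M : Matrix (Fin 2) (Fin 2) ℝ) :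
    (toH3 z).1 = M.map (fun x : ℝ => (x : ℂ)) ↔ z.im + z.re ^ 2 / z.im = M 0 0 ∧
      z.re / z.im = M 0 1 ∧ z.re / z.im = M 1 0 ∧ 1 / z.im = M 1 1 := by
  simp only [toH3, planeMatrix]
  rw [← Matrix.ext_iff]
  simp only [Fin.forall_fin_two, Matrix.map_apply, Matrix.of_apply, Matrix.cons_val', Matrix.cons_val_zero,
    Matrix.cons_val_one, Matrix.cons_val_fin_one, Complex.ofReal_inj]
  tauto

lemma mem_geodesic_mk {v w : Fin 2 → ℝ} (hv : v ≠ 0) (hw : w ≠ 0) (z : ℍ) :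
    z ∈ geodesic (Projectivization.mk ℝ v hv) (Projectivization.mk ℝ w hw) ↔
      ∃ r s : ℝ, 0 ≤ r ∧ 0 ≤ s ∧ z.im + z.re ^ 2 / z.im = r * v 0 ^ 2 + s * w 0 ^ 2 ∧
        z.re / z.im = r * (v 0 * v 1) + s * (w 0 * w 1) ∧
        1 / z.im = r * v 1 ^ 2 + s * w 1 ^ 2 := by
  obtain ⟨c, hc, e⟩ := ray_toCP1 v hv
  obtain ⟨d, hd, e'⟩ := ray_toCP1 w hw
  have key : ∀ r s : ℝ, ((toH3 z).1 = (r : ℂ) • ray (toCP1 (Projectivization.mk ℝ v hv)) +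
      (s : ℂ) • ray (toCP1 (Projectivization.mk ℝ w hw)) ↔
      z.im + z.re ^ 2 / z.im = r * c * v 0 ^ 2 + s * d * w 0 ^ 2 ∧
        z.re / z.im = r * c * (v 0 * v 1) + s * d * (w 0 * w 1) ∧
        1 / z.im = r * c * v 1 ^ 2 + s * d * w 1 ^ 2) := by
    intro r s
    have : (r : ℂ) • ray (toCP1 (Projectivization.mk ℝ v hv)) +
      (s : ℂ) • ray (toCP1 (Projectivization.mk ℝ w hw)) =
      (Matrix.of fun i j => r * (c * (v i * v j)) + s * (d * (w i * w j))).map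
        (fun x : ℝ => (x : ℂ)) := by
      ext i j; simp [e, e']
    rw [this, toH3_val_eq_iff]
    simp only [Matrix.of_apply]
    constructor
    · rintro ⟨h1, h2, h3, h4⟩; exact ⟨by rw [h1]; ring, by rw [h2]; ring, by rw [h4]; ring⟩
    · rintro ⟨h1, h2, h4⟩; exact ⟨by rw [h1]; ring, by rw [h2]; ring, by rw [h2]; ring, by rw [h4]; ring⟩
  constructor
  · rintro ⟨r, s, hr, hs, h⟩
    exact ⟨r * c, s * d, by positivity, by positivity, (key r s).1 h⟩
  · rintro ⟨r, s, hr, hs, h⟩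
    refine ⟨r / c, s / d, by positivity, by positivity, (key _ _).2 ?_⟩
    rw [div_mul_cancel₀ _ hc.ne', div_mul_cancel₀ _ hd.ne']
    exact h

lemma mem_idealTriangle_mk {u v w : Fin 2 → ℝ} (hu : u ≠ 0) (hv : v ≠ 0) (hw : w ≠ 0) (z : ℍ) :
    z ∈ idealTriangle (Projectivization.mk ℝ u hu) (Projectivization.mk ℝ v hv)
      (Projectivization.mk ℝ w hw) ↔
      ∃ r s t : ℝ, 0 ≤ r ∧ 0 ≤ s ∧ 0 ≤ t ∧
        z.im + z.re ^ 2 / z.im = r * u 0 ^ 2 + s * v 0 ^ 2 + t * w 0 ^ 2 ∧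
        z.re / z.im = r * (u 0 * u 1) + s * (v 0 * v 1) + t * (w 0 * w 1) ∧
        1 / z.im = r * u 1 ^ 2 + s * v 1 ^ 2 + t * w 1 ^ 2 := by
  obtain ⟨b, hb, e''⟩ := ray_toCP1 u hu
  obtain ⟨c, hc, e⟩ := ray_toCP1 v hv
  obtain ⟨d, hd, e'⟩ := ray_toCP1 w hw
  have key : ∀ r s t : ℝ, ((toH3 z).1 = (r : ℂ) • ray (toCP1 (Projectivization.mk ℝ u hu)) +
      (s : ℂ) • ray (toCP1 (Projectivization.mk ℝ v hv)) +
      (t : ℂ) • ray (toCP1 (Projectivization.mk ℝ w hw)) ↔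
      z.im + z.re ^ 2 / z.im = r * b * u 0 ^ 2 + s * c * v 0 ^ 2 + t * d * w 0 ^ 2 ∧
        z.re / z.im = r * b * (u 0 * u 1) + s * c * (v 0 * v 1) + t * d * (w 0 * w 1) ∧
        1 / z.im = r * b * u 1 ^ 2 + s * c * v 1 ^ 2 + t * d * w 1 ^ 2) := by
    intro r s t
    have : (r : ℂ) • ray (toCP1 (Projectivization.mk ℝ u hu)) +
      (s : ℂ) • ray (toCP1 (Projectivization.mk ℝ v hv)) +
      (t : ℂ) • ray (toCP1 (Projectivization.mk ℝ w hw)) =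
      (Matrix.of fun i j => r * (b * (u i * u j)) + s * (c * (v i * v j)) +
        t * (d * (w i * w j))).map (fun x : ℝ => (x : ℂ)) := by
      ext i j; simp [e, e', e'']
    rw [this, toH3_val_eq_iff]
    simp only [Matrix.of_apply]
    constructor
    · rintro ⟨h1, h2, h3, h4⟩; exact ⟨by rw [h1]; ring, by rw [h2]; ring, by rw [h4]; ring⟩
    · rintro ⟨h1, h2, h4⟩; exact ⟨by rw [h1]; ring, by rw [h2]; ring, by rw [h2]; ring, by rw [h4]; ring⟩
  constructor
  · rintro ⟨r, s, t, hr, hs, ht, h⟩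
    exact ⟨r * b, s * c, t * d, by positivity, by positivity, by positivity, (key r s t).1 h⟩
  · rintro ⟨r, s, t, hr, hs, ht, h⟩
    refine ⟨r / b, s / c, t / d, by positivity, by positivity, by positivity, (key _ _ _).2 ?_⟩
    rw [div_mul_cancel₀ _ hb.ne', div_mul_cancel₀ _ hc.ne', div_mul_cancel₀ _ hd.ne']
    exact h

lemma pairing_eq (v w : Fin 2 → ℝ) (z : ℍ) : pairing v w z =
    (z.im + z.re ^ 2 / z.im) * (v 1 * w 1) - z.re / z.im * (v 0 * w 1 + v 1 * w 0) +
      1 / z.im * (v 0 * w 0) := by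
  have := z.im_pos.ne'
  simp only [pairing]
  field_simp
  ring

lemma mem_geodesic_iff {a b : RP1} (hab : a ≠ b) (z : ℍ) : z ∈ geodesic a b ↔ lam a b z = 0 := by
  obtain ⟨v, hv, rfl⟩ := exists_mk a
  obtain ⟨w, hw, rfl⟩ := exists_mk b
  have hd : det2 v w ≠ 0 := fun h => hab ((det2_eq_zero_iff hv hw).1 h)
  rw [mem_geodesic_mk, lam_mk, neg_eq_zero, div_eq_zero_iff, or_iff_left hd]
  constructor
  · rintro ⟨r, s, -, -, h1, h2, h3⟩
    rw [pairing_eq, h1, h2, h3]; ring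
  · intro h
    have h1 := (pairing_self_pos hv z).le
    have h2 := (pairing_self_pos hw z).le
    refine ⟨pairing w w z / det2 v w ^ 2, pairing v v z / det2 v w ^ 2, by positivity,
      by positivity, ?_⟩
    rw [pairing_eq] at h
    rw [pairing_eq, pairing_eq]
    set A := z.im + z.re ^ 2 / z.im
    set B := z.re / z.im
    set C := 1 / z.im
    refine ⟨?_, ?_, ?_⟩ <;> field_simp <;> simp only [det2]
    · linear_combination (-2 * v 0 * w 0) * h
    · linear_combination (-(v 0 * w 1 + v 1 * w 0)) * h
    · linear_combination (-2 * v 1 * w 1) * h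

lemma mem_idealTriangle_iff {a b c : RP1} (h : CCW a b c) (z : ℍ) :
    z ∈ idealTriangle a b c ↔ 0 ≤ lam a b z ∧ 0 ≤ lam b c z ∧ 0 ≤ lam c a z := by
  obtain ⟨u, hu, rfl⟩ := exists_mk a
  obtain ⟨v, hv, rfl⟩ := exists_mk b
  obtain ⟨w, hw, rfl⟩ := exists_mk c
  rw [ccw_mk] at h
  rw [mem_idealTriangle_mk, lam_mk, lam_mk, lam_mk]
  set D := det2 u v * det2 v w * det2 w u with hD
  have huv : det2 u v ≠ 0 := by rintro h'; simp [hD, h'] at h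
  have hvw : det2 v w ≠ 0 := by rintro h'; simp [hD, h'] at h
  have hwu : det2 w u ≠ 0 := by rintro h'; simp [hD, h'] at h
  constructor
  · rintro ⟨r, s, t, hr, hs, ht, h1, h2, h3⟩
    have e1 : -(pairing u v z / det2 u v) = t * D / det2 u v ^ 2 := by
      rw [pairing_eq, h1, h2, h3, hD]; field_simp; simp only [det2]; ring
    have e2 : -(pairing v w z / det2 v w) = r * D / det2 v w ^ 2 := by
      rw [pairing_eq, h1, h2, h3, hD]; field_simp; simp only [det2]; ring
    have e3 : -(pairing w u z / det2 w u) = s * D / det2 w u ^ 2 := by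
      rw [pairing_eq, h1, h2, h3, hD]; field_simp; simp only [det2]; ring
    rw [e1, e2, e3]
    exact ⟨by positivity, by positivity, by positivity⟩
  · rintro ⟨h1, h2, h3⟩
    refine ⟨-(pairing v w z / det2 v w) * det2 v w ^ 2 / D,
      -(pairing w u z / det2 w u) * det2 w u ^ 2 / D,
      -(pairing u v z / det2 u v) * det2 u v ^ 2 / D, by positivity, by positivity, by positivity,
      ?_⟩
    rw [pairing_eq, pairing_eq, pairing_eq, hD]
    set A := z.im + z.re ^ 2 / z.im
    set B := z.re / z.im
    set C := 1 / z.im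
    refine ⟨?_, ?_, ?_⟩ <;> field_simp <;> simp only [det2] <;> ring

lemma idealTriangle3_rotate (a b c : CP1) : idealTriangle3 a b c = idealTriangle3 b c a := by
  ext X
  constructor
  · rintro ⟨r, s, t, hr, hs, ht, h⟩
    exact ⟨s, t, r, hs, ht, hr, by rw [h]; abel⟩
  · rintro ⟨r, s, t, hr, hs, ht, h⟩
    exact ⟨t, r, s, ht, hr, hs, by rw [h]; abel⟩

lemma idealTriangle3_swap (a b c : CP1) : idealTriangle3 a b c = idealTriangle3 b a c := by
  ext X
  constructor <;>
  · rintro ⟨r, s, t, hr, hs, ht, h⟩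
    exact ⟨s, r, t, hs, hr, ht, by rw [h]; abel⟩

lemma geodesic3_comm (a b : CP1) : geodesic3 a b = geodesic3 b a := by
  ext X
  constructor <;>
  · rintro ⟨r, s, hr, hs, h⟩
    exact ⟨s, r, hs, hr, by rw [h]; abel⟩

lemma geodesic_comm (a b : RP1) : geodesic a b = geodesic b a := by
  rw [geodesic, geodesic3_comm]; rfl

lemma idealTriangle_rotate (a b c : RP1) : idealTriangle a b c = idealTriangle b c a := by
  rw [idealTriangle, idealTriangle3_rotate]; rfl

lemma idealTriangle_swap (a b c : RP1) : idealTriangle a b c = idealTriangle b a c := by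
  rw [idealTriangle, idealTriangle3_swap]; rfl

lemma lam_infty_realPt (x : ℝ) (z : ℍ) : lam (inftyPt ℝ) (realPt x) z = (z.re - x) / z.im := by
  rw [inftyPt, realPt, lam_mk]
  simp [pairing, det2]
  ring

lemma lam_realPt (x y : ℝ) (z : ℍ) : lam (realPt x) (realPt y) z =
    ((z.re - x) * (z.re - y) + z.im ^ 2) / (z.im * (y - x)) := by
  rw [realPt, realPt, lam_mk]
  simp only [pairing, det2, Matrix.cons_val_zero, Matrix.cons_val_one]
  rw [div_div, ← div_neg]
  congr 1 <;> ring

lemma zeroPt_eq : zeroPt ℝ = realPt 0 := rfl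
lemma onePt_eq : onePt ℝ = realPt 1 := rfl

/-- The side functions of the edges of an ideal triangle are coordinates in which the hyperbolic
plane is a sheet of a quadric. -/
lemma lam_quadric {p q r : RP1} (h : CCW p q r) (z : ℍ) :
    lam q r z * lam r p z + lam r p z * lam p q z + lam p q z * lam q r z = 1 := by
  obtain ⟨g, rfl, rfl, rfl⟩ := h
  obtain ⟨w, rfl⟩ : ∃ w, z = g • w := ⟨g⁻¹ • z, by simp⟩
  simp only [lam_smul, zeroPt_eq, onePt_eq]
  rw [lam_swap (inftyPt ℝ) (realPt 1), lam_infty_realPt, lam_infty_realPt, lam_realPt]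
  have := w.im_pos.ne'
  field_simp
  ring

lemma exists_lam_eq {p q r : RP1} (h : CCW p q r) {R S T : ℝ} (hR : 0 ≤ R) (hS : 0 ≤ S)
    (hRST : R * S + S * T + T * R = 1) :
    ∃ z, lam q r z = R ∧ lam r p z = S ∧ lam p q z = T := by
  obtain ⟨g, rfl, rfl, rfl⟩ := h
  have hpos : 0 < R + S := by
    rcases hR.lt_or_eq with h | h
    · linarith
    · rcases hS.lt_or_eq with h' | h'
      · linarith
      · simp [← h, ← h'] at hRST
  let w : ℍ := ⟨⟨S / (R + S), 1 / (R + S)⟩, by simpa using hpos⟩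
  have hre : w.re = S / (R + S) := rfl
  have him : w.im = 1 / (R + S) := rfl
  refine ⟨g • w, ?_⟩
  simp only [lam_smul, zeroPt_eq, onePt_eq]
  rw [lam_swap (inftyPt ℝ) (realPt 1), lam_infty_realPt, lam_infty_realPt, lam_realPt, hre, him]
  refine ⟨?_, ?_, ?_⟩ <;> field_simp
  · ring
  · ring
  · linear_combination -hRST

/-- Every side function is a linear combination of the side functions of the edges of an ideal
triangle; the signs of the coefficients tell on which sides the vertices are. -/
lemma lam_eq_sum {p q r : RP1} (h : CCW p q r) {a b : RP1} (hab : a ≠ b) :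
    ∃ α β γ : ℝ, (∀ z, lam a b z = α * lam q r z + β * lam r p z + γ * lam p q z) ∧
      ((0 < α ↔ CCW a b p) ∧ (0 < β ↔ CCW a b q) ∧ (0 < γ ↔ CCW a b r)) ∧
      ((α < 0 ↔ CCW b a p) ∧ (β < 0 ↔ CCW b a q) ∧ (γ < 0 ↔ CCW b a r)) := by
  obtain ⟨g, rfl, rfl, rfl⟩ := h
  obtain ⟨a, rfl⟩ : ∃ a', a = g • a' := ⟨g⁻¹ • a, by simp⟩
  obtain ⟨b, rfl⟩ : ∃ a', b = g • a' := ⟨g⁻¹ • b, by simp⟩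
  simp only [ccw_smul_iff]
  have hab : a ≠ b := fun h => hab (by rw [h])
  obtain ⟨v, hv, rfl⟩ := exists_mk a
  obtain ⟨w, hw, rfl⟩ := exists_mk b
  have hd : det2 v w ≠ 0 := fun h => hab ((det2_eq_zero_iff hv hw).1 h)
  have hd2 : 0 < det2 v w ^ 2 := by positivity
  have sgn1 : ∀ x y : ℝ, x * det2 v w ^ 2 = y → (0 < x ↔ 0 < y) := by
    rintro x y rfl; exact (mul_pos_iff_of_pos_right hd2).symm
  have sgn2 : ∀ x y : ℝ, x * det2 v w ^ 2 = -y → (x < 0 ↔ 0 < y) := by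
    intro x y hy
    have : y = (-x) * det2 v w ^ 2 := by linarith
    rw [this, mul_pos_iff_of_pos_right hd2, neg_pos]
  refine ⟨-(v 0 * w 0 / det2 v w), -((v 0 - v 1) * (w 0 - w 1) / det2 v w),
    -(v 1 * w 1 / det2 v w), ?_, ⟨?_, ?_, ?_⟩, ?_, ?_, ?_⟩
  · intro z
    obtain ⟨z, rfl⟩ : ∃ w, z = g • w := ⟨g⁻¹ • z, by simp⟩
    simp only [lam_smul, zeroPt_eq, onePt_eq]
    rw [lam_mk, lam_swap (inftyPt ℝ) (realPt 1), lam_infty_realPt, lam_infty_realPt, lam_realPt,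
      pairing]
    have := z.im_pos.ne'
    field_simp
    ring
  all_goals
    simp only [zeroPt, onePt, inftyPt]
    rw [ccw_mk]
    first | apply sgn1 | apply sgn2
    field_simp
    simp [det2]
    ring

lemma lam_nonneg_of_mem_idealTriangle {p q r : RP1} (h : CCW p q r) {a b : RP1} (hab : a ≠ b)
    {z : ℍ} (hz : z ∈ idealTriangle p q r) (hp : ¬ CCW b a p) (hq : ¬ CCW b a q)
    (hr : ¬ CCW b a r) : 0 ≤ lam a b z := by
  obtain ⟨α, β, γ, e, -, e1, e2, e3⟩ := lam_eq_sum h hab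
  rw [mem_idealTriangle_iff h] at hz
  rw [e]
  have h1 : 0 ≤ α := not_lt.1 fun h' => hp (e1.1 h')
  have h2 : 0 ≤ β := not_lt.1 fun h' => hq (e2.1 h')
  have h3 : 0 ≤ γ := not_lt.1 fun h' => hr (e3.1 h')
  have := mul_nonneg h1 hz.2.1
  have := mul_nonneg h2 hz.2.2
  have := mul_nonneg h3 hz.1
  linarith

lemma eq_or_eq_of_not_ccw {a b p : RP1} (hab : a ≠ b) (h1 : ¬ CCW a b p) (h2 : ¬ CCW b a p) :
    p = a ∨ p = b := by
  by_contra! h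
  rcases ccw_or_ccw hab h.2.symm h.1 with h' | h'
  · exact h1 h'
  · exact h2 (ccw_rotate.1 (ccw_rotate.1 h'))

/-- An ideal triangle on one closed side of a geodesic meets this geodesic only if it is a side. -/
lemma mem_vertices_of_lam_eq_zero {p q r : RP1} (h : CCW p q r) {a b : RP1} (hab : a ≠ b)
    {z : ℍ} (hz : z ∈ idealTriangle p q r) (hp : ¬ CCW b a p) (hq : ¬ CCW b a q)
    (hr : ¬ CCW b a r) (h0 : lam a b z = 0) :
    (a = p ∧ b = q) ∨ (a = q ∧ b = r) ∨ (a = r ∧ b = p) := by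
  obtain ⟨α, β, γ, e, ⟨f1, f2, f3⟩, e1, e2, e3⟩ := lam_eq_sum h hab
  rw [mem_idealTriangle_iff h] at hz
  obtain ⟨hT, hR, hS⟩ := hz
  have hQ := lam_quadric h z
  rw [e] at h0
  have h1 : 0 ≤ α := not_lt.1 fun h' => hp (e1.1 h')
  have h2 : 0 ≤ β := not_lt.1 fun h' => hq (e2.1 h')
  have h3 : 0 ≤ γ := not_lt.1 fun h' => hr (e3.1 h')
  have k1 := mul_nonneg h1 hR
  have k2 := mul_nonneg h2 hS
  have k3 := mul_nonneg h3 hT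
  have z1 : α * lam q r z = 0 := by linarith
  have z2 : β * lam r p z = 0 := by linarith
  have z3 : γ * lam p q z = 0 := by linarith
  have n1 : α = 0 → p = a ∨ p = b := fun h' =>
    eq_or_eq_of_not_ccw hab (fun h'' => by have := f1.2 h''; linarith) hp
  have n2 : β = 0 → q = a ∨ q = b := fun h' =>
    eq_or_eq_of_not_ccw hab (fun h'' => by have := f2.2 h''; linarith) hq
  have n3 : γ = 0 → r = a ∨ r = b := fun h' =>
    eq_or_eq_of_not_ccw hab (fun h'' => by have := f3.2 h''; linarith) hr
  have g1 := h.ne12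
  have g2 := h.ne23
  have g3 := h.ne31
  have orient : ∀ x y : RP1, CCW a b x → CCW b a x → False := by
    intro x y h h'
    rw [ccw_iff_theta] at h h'
    grind
  rcases mul_eq_zero.1 z1 with hα | hR0
  · have m1 := n1 hα
    rcases mul_eq_zero.1 z2 with hβ | hS0
    · have m2 := n2 hβ
      rcases m1 with rfl | rfl <;> rcases m2 with rfl | rfl
      · exact absurd rfl g1
      · exact Or.inl ⟨rfl, rfl⟩
      · exact absurd h hr
      · exact absurd rfl g1
    · have hTR : lam p q z ≠ 0 := fun h' => by simp [hS0, h'] at hQ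
      have m3 := n3 ((mul_eq_zero.1 z3).resolve_right hTR)
      rcases m1 with rfl | rfl <;> rcases m3 with rfl | rfl
      · exact absurd rfl g3
      · exact absurd (ccw_rotate.2 h) hq
      · exact Or.inr (Or.inr ⟨rfl, rfl⟩)
      · exact absurd rfl g3
  · have hS : lam r p z ≠ 0 := fun h' => by simp [hR0, h'] at hQ
    have hT : lam p q z ≠ 0 := fun h' => by simp [hR0, h'] at hQ
    have m2 := n2 ((mul_eq_zero.1 z2).resolve_right hS)
    have m3 := n3 ((mul_eq_zero.1 z3).resolve_right hT)
    rcases m2 with rfl | rfl <;> rcases m3 with rfl | rfl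
    · exact absurd rfl g2
    · exact Or.inr (Or.inl ⟨rfl, rfl⟩)
    · exact absurd (ccw_rotate.1 h) hp
    · exact absurd rfl g2

lemma exists_ccw {a b : RP1} (hab : a ≠ b) : ∃ c, CCW a c b := by
  obtain ⟨u, hu, rfl⟩ := exists_mk a
  obtain ⟨w, hw, rfl⟩ := exists_mk b
  have hd : det2 u w ≠ 0 := fun h => hab ((det2_eq_zero_iff hu hw).1 h)
  have e : det2 u (u - det2 u w • w) = -(det2 u w) ^ 2 := by
    simp [det2]; ring
  have hne : u - det2 u w • w ≠ 0 := by
    intro h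
    rw [h] at e
    have : (det2 u w) ^ 2 ≠ 0 := by positivity
    simp [det2] at e this
    exact this (by linarith)
  refine ⟨Projectivization.mk ℝ _ hne, ?_⟩
  rw [ccw_mk hu hne hw, e]
  have : -det2 u w ^ 2 * det2 (u - det2 u w • w) w * det2 w u = (det2 u w ^ 2) ^ 2 := by
    simp [det2]; ring
  rw [this]
  positivity

lemma exists_mem_geodesic_inter {a b c d : RP1} (h : CCW a c b) (h' : CCW b d a) :
    ∃ z, lam a b z = 0 ∧ lam c d z = 0 := by
  have hcd : c ≠ d := by
    rintro rfl
    rw [ccw_iff_theta] at h h'; grind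
  obtain ⟨α, β, γ, e, ⟨f1, f2, f3⟩, e1, e2, e3⟩ := lam_eq_sum h hcd
  have hα : 0 < α := f1.2 (by rw [ccw_iff_theta] at *; grind)
  have hγ : γ < 0 := e3.2 (by rw [ccw_iff_theta] at *; grind)
  have hpos : 0 < -γ / α := div_pos (by linarith) hα
  set R := Real.sqrt (-γ / α) with hR
  have hR0 : 0 < R := Real.sqrt_pos.2 hpos
  have hRR : R * R = -γ / α := Real.mul_self_sqrt hpos.le
  obtain ⟨z, h1, h2, h3⟩ := exists_lam_eq h (R := R) (S := 0) (T := 1 / R) hR0.le le_rfl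
    (by field_simp; ring)
  refine ⟨z, by rw [lam_swap, h2, neg_zero], ?_⟩
  rw [e, h1, h2, h3]
  have : α * R + β * 0 + γ * (1 / R) = (α * (R * R) + γ) / R := by field_simp; ring
  rw [this, hRR]
  field_simp
  ring

lemma isClosed_geodesic {a b : RP1} (hab : a ≠ b) : IsClosed (geodesic a b) := by
  have : geodesic a b = lam a b ⁻¹' {0} := by
    ext z; simp [mem_geodesic_iff hab]
  rw [this]
  exact isClosed_singleton.preimage (continuous_lam a b)

lemma exists_smul_infty (p : RP1) : ∃ A : SL(2, ℝ), A • inftyPt ℝ = p := by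
  by_cases hp : p = inftyPt ℝ
  · exact ⟨1, by simp [hp]⟩
  · obtain ⟨c, g, h1, h2, h3⟩ := exists_ccw (Ne.symm hp)
    exact ⟨g, h3⟩

/-- An orientation preserving isometry fixing `∞` acts affinely. -/
lemma exists_affine (M : SL(2, ℝ)) (h : M • inftyPt ℝ = inftyPt ℝ) : ∃ l t : ℝ, 0 < l ∧
    (∀ x, M • realPt x = realPt (l * x + t)) ∧
    ∀ z : ℍ, (M • z).re = l * z.re + t ∧ (M • z).im = l * z.im := by
  have hdet : M 0 0 * M 1 1 - M 0 1 * M 1 0 = 1 := by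
    have := M.2; rw [Matrix.det_fin_two] at this; exact this
  have hc : M 1 0 = 0 := by
    obtain ⟨_, e⟩ := smul_mk_eq M ![(1 : ℝ), 0] (by simp)
    rw [inftyPt, e, ← det2_eq_zero_iff] at h
    simpa [det2, Matrix.mulVec, dotProduct, Fin.sum_univ_two] using h
  rw [hc] at hdet
  have ha : M 0 0 ≠ 0 := by intro h; simp [h] at hdet
  have hd : M 1 1 = 1 / M 0 0 := by field_simp; linarith
  refine ⟨M 0 0 ^ 2, M 0 0 * M 0 1, by positivity, ?_, ?_⟩
  · intro x
    obtain ⟨_, e⟩ := smul_mk_eq M ![x, 1] (by simp)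
    rw [realPt, realPt, e, ← det2_eq_zero_iff]
    simp [det2, Matrix.mulVec, dotProduct, Fin.sum_univ_two, hc, hd]
    field_simp
    ring
  · intro z
    obtain ⟨-, h1, h2⟩ := smul_re_im M z
    rw [h1, h2, hc, hd]
    constructor <;> field_simp <;> ring

/-- An element of `PSL(2, ℝ)` fixing the ideal point `A • ∞` acts affinely in the coordinate given
by `A`. -/
lemma exists_affine_chart (A : SL(2, ℝ)) (g : PSL(2, ℝ))
    (h : g • (A • inftyPt ℝ) = A • inftyPt ℝ) : ∃ l t : ℝ, 0 < l ∧
    (∀ x, g • (A • realPt x) = A • realPt (l * x + t)) ∧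
    ∀ z : ℍ, (A⁻¹ • (g • z)).re = l * (A⁻¹ • z).re + t ∧ (A⁻¹ • (g • z)).im = l * (A⁻¹ • z).im := by
  induction g using QuotientGroup.induction_on with
  | H B =>
    obtain ⟨l, t, hl, h1, h2⟩ := exists_affine (A⁻¹ * B * A) (by
      rw [mul_smul, mul_smul]
      have : B • A • inftyPt ℝ = A • inftyPt ℝ := h
      rw [this, inv_smul_smul])
    refine ⟨l, t, hl, fun x => ?_, fun z => ?_⟩
    · change B • A • realPt x = _
      rw [← h1, mul_smul, mul_smul, smul_inv_smul]
    · change (A⁻¹ • (B • z)).re = _ ∧ (A⁻¹ • (B • z)).im = _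
      have := h2 (A⁻¹ • z)
      rw [mul_smul, mul_smul, smul_inv_smul] at this
      exact this

lemma isParabolicAt_affine {A : SL(2, ℝ)} {g : PSL(2, ℝ)} {l t : ℝ}
    (h : ∀ x, g • (A • realPt x) = A • realPt (l * x + t))
    (hinf : g • (A • inftyPt ℝ) = A • inftyPt ℝ) :
    IsParabolicAt g (A • inftyPt ℝ) ↔ l = 1 ∧ t ≠ 0 := by
  have inj : ∀ x y : RP1, A • x = A • y → x = y := fun x y h => MulAction.injective A h
  constructor
  · rintro ⟨-, h2⟩
    have key : ∀ x : ℝ, l * x + t ≠ x := by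
      intro x hx
      have := (h2 (A • realPt x)).1 (by rw [h, hx])
      exact realPt_ne_infty x (inj _ _ this)
    have hl : l = 1 := by
      by_contra hl
      refine key (t / (1 - l)) ?_
      have : 1 - l ≠ 0 := fun h => hl (by linarith)
      field_simp
      ring
    refine ⟨hl, fun ht => key 0 (by simp [ht])⟩
  · rintro ⟨rfl, ht⟩
    refine ⟨?_, fun x => ⟨fun hx => ?_, fun hx => by rw [hx, hinf]⟩⟩
    · rintro rfl
      have := h 0
      rw [one_smul] at this
      have := realPt_injective (inj _ _ this)
      simp at this
      exact ht this.symm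
    · by_contra hne
      obtain ⟨y, hy⟩ : ∃ y, x = A • realPt y := by
        obtain ⟨y, hy⟩ := eq_realPt (a := A⁻¹ • x) (by
          intro h'; exact hne (by rw [← h', smul_inv_smul]))
        exact ⟨y, by rw [← hy, smul_inv_smul]⟩
      rw [hy, h] at hx
      have := realPt_injective (inj _ _ hx)
      exact ht (by linarith)

lemma chart_cases (A : SL(2, ℝ)) {q : RP1} (h : q ≠ A • inftyPt ℝ) : ∃ x, q = A • realPt x := by
  obtain ⟨y, hy⟩ := eq_realPt (a := A⁻¹ • q) (by
    intro h'; exact h (by rw [← h', smul_inv_smul]))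
  exact ⟨y, by rw [← hy, smul_inv_smul]⟩

/-! ### Combinatorics of ideal triangulations -/

lemma Farey.pt_injective {Γ : Subgroup PSL(2, ℝ)} : Function.Injective (Farey.pt (Γ := Γ)) :=
  Subtype.val_injective

lemma Farey.pt_smul {Γ : Subgroup PSL(2, ℝ)} (γ : Γ) (p : Farey Γ) :
    (γ • p).pt = (γ : PSL(2, ℝ)) • p.pt := rfl

namespace IdealTriangulation

variable {Γ : Subgroup PSL(2, ℝ)} (T : IdealTriangulation Γ)

lemma pt_ne {p q : Farey Γ} (h : T.graph.Adj p q) : p.pt ≠ q.pt :=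
  fun h' => h.ne (Farey.pt_injective h')

lemma smul_adj_iff (γ : Γ) {p q : Farey Γ} : T.graph.Adj (γ • p) (γ • q) ↔ T.graph.Adj p q :=
  ⟨fun h => by simpa using T.smul_adj γ⁻¹ _ _ h, T.smul_adj γ p q⟩

/-- Edges of the triangulation do not cross. -/
lemma not_cross {a b c d : Farey Γ} (hab : T.graph.Adj a b) (hcd : T.graph.Adj c d)
    (h : CCW a.pt c.pt b.pt) (h' : CCW b.pt d.pt a.pt) : False := by
  have hne : s(a, b) ≠ s(c, d) := by
    intro he
    rw [Sym2.eq_iff] at he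
    rcases he with ⟨rfl, rfl⟩ | ⟨rfl, rfl⟩
    · exact h.ne12 rfl
    · exact h.ne23 rfl
  obtain ⟨z, h1, h2⟩ := exists_mem_geodesic_inter h h'
  exact Set.disjoint_left.1 (T.disjoint a b c d hab hcd hne)
    ((mem_geodesic_iff (T.pt_ne hab) z).2 h1) ((mem_geodesic_iff (T.pt_ne hcd) z).2 h2)

variable {T} in
lemma IsTriangle.rotate {p q r : Farey Γ} (h : T.IsTriangle p q r) : T.IsTriangle q r p :=
  ⟨h.2.1, h.2.2, h.1⟩

variable {T} in
lemma IsTriangle.swap {p q r : Farey Γ} (h : T.IsTriangle p q r) : T.IsTriangle q p r :=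
  ⟨h.1.symm, h.2.2.symm, h.2.1.symm⟩

variable {T} in
lemma IsTriangle.ccw_or {p q r : Farey Γ} (h : T.IsTriangle p q r) :
    CCW p.pt q.pt r.pt ∨ CCW q.pt p.pt r.pt := by
  rcases ccw_or_ccw (T.pt_ne h.1) (T.pt_ne h.2.1) (T.pt_ne h.2.2) with h | h
  · exact Or.inl h
  · exact Or.inr (ccw_rotate.1 (ccw_rotate.1 h))

/-- Every point lies in a positively oriented triangle. -/
lemma exists_triangle (z : ℍ) : ∃ p q r : Farey Γ, T.IsTriangle p q r ∧ CCW p.pt q.pt r.pt ∧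
    z ∈ idealTriangle p.pt q.pt r.pt := by
  obtain ⟨p, q, r, h1, h2, h3, hz⟩ := T.cover z
  have ht : T.IsTriangle p q r := ⟨h1, h2, h3⟩
  rcases ht.ccw_or with h | h
  · exact ⟨p, q, r, ht, h, hz⟩
  · exact ⟨q, p, r, ht.swap, h, by rwa [idealTriangle_swap]⟩

/-- A triangle of the triangulation lies on one side of each edge. -/
lemma triangle_side {a b p q r : Farey Γ} (hab : T.graph.Adj a b) (ht : T.IsTriangle p q r) :
    (¬ CCW a.pt p.pt b.pt ∧ ¬ CCW a.pt q.pt b.pt ∧ ¬ CCW a.pt r.pt b.pt) ∨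
    (¬ CCW b.pt p.pt a.pt ∧ ¬ CCW b.pt q.pt a.pt ∧ ¬ CCW b.pt r.pt a.pt) := by
  have key : ∀ {x y : Farey Γ}, T.graph.Adj x y → CCW a.pt x.pt b.pt → ¬ CCW b.pt y.pt a.pt :=
    fun h h1 h2 => T.not_cross hab h h1 h2
  have irr : ∀ x : Farey Γ, CCW a.pt x.pt b.pt → ¬ CCW b.pt x.pt a.pt := fun x h h' => by
    rw [ccw_iff_theta] at h h'; grind
  have h1 := @key _ _ ht.1
  have h2 := @key _ _ ht.2.1
  have h3 := @key _ _ ht.2.2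
  have h4 := @key _ _ ht.1.symm
  have h5 := @key _ _ ht.2.1.symm
  have h6 := @key _ _ ht.2.2.symm
  have i1 := irr p
  have i2 := irr q
  have i3 := irr r
  by_cases hex : CCW a.pt p.pt b.pt ∨ CCW a.pt q.pt b.pt ∨ CCW a.pt r.pt b.pt
  · right
    rcases hex with h | h | h
    · exact ⟨i1 h, h1 h, h6 h⟩
    · exact ⟨h4 h, i2 h, h2 h⟩
    · exact ⟨h3 h, h5 h, i3 h⟩
  · push Not at hex
    exact Or.inl hex

lemma ccw_swap_iff {a b x : RP1} : CCW b a x ↔ CCW a x b := by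
  rw [ccw_rotate]

/-- The vertices of a triangle that contains a point on the side of `b, a` opposite to the arc from
`b` to `a` are not on this arc. -/
lemma not_ccw_of_lam_pos {a b p q r : Farey Γ} (hab : T.graph.Adj a b) (ht : T.IsTriangle p q r)
    (hc : CCW p.pt q.pt r.pt) {z : ℍ} (hz : z ∈ idealTriangle p.pt q.pt r.pt)
    (hpos : 0 < lam b.pt a.pt z) :
    ¬ CCW b.pt p.pt a.pt ∧ ¬ CCW b.pt q.pt a.pt ∧ ¬ CCW b.pt r.pt a.pt := by
  rcases T.triangle_side hab ht with h | h
  · have := lam_nonneg_of_mem_idealTriangle hc (T.pt_ne hab) hz (by rw [ccw_swap_iff]; exact h.1)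
      (by rw [ccw_swap_iff]; exact h.2.1) (by rw [ccw_swap_iff]; exact h.2.2)
    rw [lam_swap] at hpos
    linarith
  · exact h

/-- Every edge has a triangle on each of its sides. -/
lemma exists_apex {a b : Farey Γ} (hab : T.graph.Adj a b) :
    ∃ c : Farey Γ, T.IsTriangle a c b ∧ CCW a.pt c.pt b.pt := by
  have hne := T.pt_ne hab
  obtain ⟨x, g, h0, h1, h2⟩ := exists_ccw hne
  let φ : ℝ → ℍ := fun t => g • (⟨⟨t, 1⟩, by simp⟩ : ℍ)
  have hφ : Continuous φ := by
    refine Continuous.const_smul ?_ g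
    rw [UpperHalfPlane.isEmbedding_coe.continuous_iff]
    change Continuous fun t : ℝ => (⟨t, 1⟩ : ℂ)
    have : (fun t : ℝ => (⟨t, 1⟩ : ℂ)) = fun t : ℝ => (t : ℂ) + Complex.I := by
      funext t; apply Complex.ext <;> simp
    rw [this]
    fun_prop
  have hlam : ∀ t, lam b.pt a.pt (φ t) = t := by
    intro t
    rw [← h0, ← h2, lam_smul, zeroPt_eq, lam_infty_realPt]
    change (t - 0) / 1 = t
    simp
  set E : Set (Farey Γ × Farey Γ) := {e | T.graph.Adj e.1 e.2 ∧
    (geodesic e.1.pt e.2.pt ∩ (φ '' Icc (0 : ℝ) 1)).Nonempty} with hE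
  have hfin : E.Finite := T.locally_finite _ (isCompact_Icc.image hφ)
  have hnhds : ∀ᶠ t in 𝓝 (0 : ℝ), ∀ e ∈ E, s(e.1, e.2) ≠ s(a, b) →
      φ t ∉ geodesic e.1.pt e.2.pt := by
    rw [hfin.eventually_all]
    intro e he
    by_cases hs : s(e.1, e.2) = s(a, b)
    · exact Filter.Eventually.of_forall fun t h => absurd hs h
    · have hz : φ 0 ∉ geodesic e.1.pt e.2.pt := by
        intro hmem
        refine Set.disjoint_left.1 (T.disjoint _ _ _ _ he.1 hab hs) hmem ?_
        rw [mem_geodesic_iff hne, lam_swap, hlam, neg_zero]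
      have : ∀ᶠ t in 𝓝 (0 : ℝ), φ t ∈ (geodesic e.1.pt e.2.pt)ᶜ :=
        hφ.continuousAt.eventually_mem ((isClosed_geodesic (T.pt_ne he.1)).isOpen_compl.mem_nhds hz)
      filter_upwards [this] with t ht _ using ht
  obtain ⟨ε, hε, hball⟩ := Metric.eventually_nhds_iff.1 hnhds
  obtain ⟨t, ht0, ht1, htε⟩ : ∃ t : ℝ, 0 < t ∧ t ≤ 1 ∧ t < ε :=
    ⟨min 1 (ε / 2), by positivity, min_le_left _ _, (min_le_right _ _).trans_lt (by linarith)⟩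
  obtain ⟨p, q, r, htri, hccw, hmem⟩ := T.exists_triangle (φ t)
  obtain ⟨n1, n2, n3⟩ := T.not_ccw_of_lam_pos hab htri hccw hmem (by rw [hlam]; exact ht0)
  have main : ∀ {x y : Farey Γ}, T.graph.Adj x y → ∀ s ∈ Icc 0 t, lam x.pt y.pt (φ s) = 0 →
      s(x, y) = s(a, b) := by
    intro x y hxy s hs h
    by_contra hne'
    have hg : φ s ∈ geodesic x.pt y.pt := (mem_geodesic_iff (T.pt_ne hxy) _).2 h
    refine hball (y := s) ?_ (x, y) ⟨hxy, φ s, hg, s, ⟨hs.1, hs.2.trans ht1⟩, rfl⟩ hne' hg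
    rw [Real.dist_eq, sub_zero, abs_of_nonneg hs.1]
    exact hs.2.trans_lt htε
  have key : s(p, q) = s(a, b) ∨ s(q, r) = s(a, b) ∨ s(r, p) = s(a, b) := by
    by_cases hmem0 : φ 0 ∈ idealTriangle p.pt q.pt r.pt
    · have := mem_vertices_of_lam_eq_zero hccw hne.symm hmem0
        (by rwa [ccw_swap_iff]) (by rwa [ccw_swap_iff]) (by rwa [ccw_swap_iff]) (hlam 0)
      rcases this with ⟨h, h'⟩ | ⟨h, h'⟩ | ⟨h, h'⟩ <;>
        have := Farey.pt_injective h <;> have := Farey.pt_injective h' <;> subst_vars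
      · exact Or.inl Sym2.eq_swap
      · exact Or.inr (Or.inl Sym2.eq_swap)
      · exact Or.inr (Or.inr Sym2.eq_swap)
    · rw [mem_idealTriangle_iff hccw] at hmem hmem0
      have hcont : Continuous fun s => min (lam p.pt q.pt (φ s))
          (min (lam q.pt r.pt (φ s)) (lam r.pt p.pt (φ s))) :=
        ((continuous_lam _ _).comp hφ).min
          (((continuous_lam _ _).comp hφ).min ((continuous_lam _ _).comp hφ))
      have hneg : min (lam p.pt q.pt (φ 0)) (min (lam q.pt r.pt (φ 0)) (lam r.pt p.pt (φ 0))) ≤ 0 := by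
        by_contra! h
        rw [lt_min_iff, lt_min_iff] at h
        exact hmem0 ⟨h.1.le, h.2.1.le, h.2.2.le⟩
      have hpos : 0 ≤ min (lam p.pt q.pt (φ t)) (min (lam q.pt r.pt (φ t)) (lam r.pt p.pt (φ t))) :=
        le_min hmem.1 (le_min hmem.2.1 hmem.2.2)
      obtain ⟨s, hs, hs0⟩ := intermediate_value_Icc ht0.le hcont.continuousOn ⟨hneg, hpos⟩
      simp only at hs0
      rcases min_choice (lam p.pt q.pt (φ s)) (min (lam q.pt r.pt (φ s)) (lam r.pt p.pt (φ s)))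
        with h | h
      · exact Or.inl (main htri.1 s hs (by rw [← h]; exact hs0))
      · rw [h] at hs0
        rcases min_choice (lam q.pt r.pt (φ s)) (lam r.pt p.pt (φ s)) with h | h
        · exact Or.inr (Or.inl (main htri.2.1 s hs (by rw [← h]; exact hs0)))
        · exact Or.inr (Or.inr (main htri.2.2 s hs (by rw [← h]; exact hs0)))
  have fin : ∀ c : Farey Γ, T.IsTriangle a c b → ¬ CCW b.pt c.pt a.pt →
      ∃ c : Farey Γ, T.IsTriangle a c b ∧ CCW a.pt c.pt b.pt := by
    intro c hc hn
    refine ⟨c, hc, ?_⟩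
    rcases ccw_or_ccw (T.pt_ne hc.1) (T.pt_ne hc.2.1) (T.pt_ne hc.2.2) with h | h
    · exact h
    · exact absurd (ccw_rotate.1 h) hn
  simp only [Sym2.eq_iff] at key
  rcases key with (⟨rfl, rfl⟩ | ⟨rfl, rfl⟩) | (⟨rfl, rfl⟩ | ⟨rfl, rfl⟩) | (⟨rfl, rfl⟩ | ⟨rfl, rfl⟩)
  · exact fin r ⟨htri.2.2.symm, htri.2.1.symm, htri.1.symm⟩ n3
  · exact fin r ⟨htri.2.1, htri.2.2, htri.1⟩ n3
  · exact fin p ⟨htri.1.symm, htri.2.2.symm, htri.2.1.symm⟩ n1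
  · exact fin p ⟨htri.2.2, htri.1, htri.2.1⟩ n1
  · exact fin q ⟨htri.2.1.symm, htri.1.symm, htri.2.2.symm⟩ n2
  · exact fin q ⟨htri.1, htri.2.1, htri.2.2⟩ n2

/-- Every point of the Farey set is a vertex of the triangulation: otherwise a long edge would cross
its image under a parabolic element. -/
lemma exists_adj (p : Farey Γ) : ∃ q, T.graph.Adj p q := by
  obtain ⟨g, hg, hpar⟩ := p.2
  obtain ⟨A, hA⟩ := exists_smul_infty p.pt
  have hA' : A • inftyPt ℝ = p.1 := hA
  rw [← hA'] at hpar
  have hinf := (hpar.2 _).2 rfl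
  obtain ⟨l, t, hl, hx, hz⟩ := exists_affine_chart A g hinf
  obtain ⟨rfl, ht⟩ := (isParabolicAt_affine hx hinf).1 hpar
  by_contra! hno
  have hh : 0 < |t| := abs_pos.2 ht
  let w : ℍ := ⟨⟨0, |t|⟩, hh⟩
  have main : ∀ {a b c : Farey Γ} {xa xb xc : ℝ}, T.IsTriangle a b c → a.pt = A • realPt xa →
      b.pt = A • realPt xb → c.pt = A • realPt xc →
      A • w ∈ idealTriangle a.pt b.pt c.pt → xa < xb → xb < xc → False := by
    intro a b c xa xb xc htri ha hb hc hmem hab hbc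
    have hccw : CCW a.pt b.pt c.pt := by
      rw [ha, hb, hc, ccw_smul_iff, ccw_realPt, cyclic_iff_mul_pos]
      exact Or.inl ⟨hab, hbc⟩
    have hac := hab.trans hbc
    have h3 := ((mem_idealTriangle_iff hccw _).1 hmem).2.2
    rw [ha, hc, lam_smul, lam_realPt] at h3
    have hre : w.re = 0 := rfl
    have him : w.im = |t| := rfl
    rw [hre, him, sq_abs] at h3
    have hden : |t| * (xa - xc) < 0 := mul_neg_of_pos_of_neg hh (by linarith)
    have hnum : (0 - xc) * (0 - xa) + t ^ 2 ≤ 0 := by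
      by_contra! h
      have := div_neg_of_pos_of_neg h hden
      linarith
    have hlen : |t| < xc - xa := by
      refine abs_lt_of_sq_lt_sq ?_ (by linarith)
      nlinarith [sq_nonneg (xc + xa), sq_pos_of_ne_zero ht]
    have hadj : T.graph.Adj a c := htri.2.2.symm
    have hadj' := T.smul_adj ⟨g, hg⟩ _ _ hadj
    have ga : ((⟨g, hg⟩ : Γ) • a).pt = A • realPt (xa + t) := by
      rw [Farey.pt_smul, ha, hx, one_mul]
    have gc : ((⟨g, hg⟩ : Γ) • c).pt = A • realPt (xc + t) := by
      rw [Farey.pt_smul, hc, hx, one_mul]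
    rw [abs_lt] at hlen
    rcases lt_or_gt_of_ne ht with h | h
    · refine T.not_cross hadj' hadj ?_ ?_
      · rw [ga, gc, ha, ccw_smul_iff, ccw_realPt, cyclic_iff_mul_pos]
        exact Or.inl ⟨by linarith, by linarith⟩
      · rw [ga, gc, hc, ccw_smul_iff, ccw_realPt, cyclic_iff_mul_pos]
        exact Or.inr (Or.inr ⟨by linarith, by linarith⟩)
    · refine T.not_cross hadj hadj' ?_ ?_
      · rw [ga, ha, hc, ccw_smul_iff, ccw_realPt, cyclic_iff_mul_pos]
        exact Or.inl ⟨by linarith, by linarith⟩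
      · rw [gc, ha, hc, ccw_smul_iff, ccw_realPt, cyclic_iff_mul_pos]
        exact Or.inr (Or.inr ⟨by linarith, by linarith⟩)
  obtain ⟨a, b, c, htri, hccw, hmem⟩ := T.exists_triangle (A • w)
  have hcoord : ∀ {x y : Farey Γ}, T.graph.Adj x y → ∃ u, x.pt = A • realPt u := by
    intro x y hxy
    refine chart_cases A fun h => ?_
    rw [hA] at h
    exact hno y (Farey.pt_injective h ▸ hxy)
  obtain ⟨xa, ha⟩ := hcoord htri.1
  obtain ⟨xb, hb⟩ := hcoord htri.2.1
  obtain ⟨xc, hc⟩ := hcoord htri.2.2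
  rw [ha, hb, hc, ccw_smul_iff, ccw_realPt, cyclic_iff_mul_pos] at hccw
  rcases hccw with h | h | h
  · exact main htri ha hb hc hmem h.1 h.2
  · rw [idealTriangle_rotate] at hmem
    exact main htri.rotate hb hc ha hmem h.1 h.2
  · rw [← idealTriangle_rotate] at hmem
    exact main htri.rotate.rotate hc ha hb hmem h.1 h.2

/-- `Desc a b p`: starting from the edge from `a` to `b`, the vertex `p` is reached by crossing
finitely many edges inside the arc from `a` to `b`. -/
inductive Desc : Farey Γ → Farey Γ → Farey Γ → Prop
  | apex {a b p : Farey Γ} : T.IsTriangle a p b → CCW a.pt p.pt b.pt → Desc a b p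
  | left {a b c p : Farey Γ} : T.IsTriangle a c b → CCW a.pt c.pt b.pt → Desc a c p → Desc a b p
  | right {a b c p : Farey Γ} : T.IsTriangle a c b → CCW a.pt c.pt b.pt → Desc c b p → Desc a b p

variable {T} in
lemma Desc.ccw {a b p : Farey Γ} (h : T.Desc a b p) : CCW a.pt p.pt b.pt := by
  induction h with
  | apex _ h => exact h
  | left _ h _ ih => rw [ccw_iff_theta] at *; grind
  | right _ h _ ih => rw [ccw_iff_theta] at *; grind

/-- Finitely many edges separate `p` from the edge `a, b`: they meet a compact path from this edge to an
edge at `p`. -/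
lemma finite_separating {a b p : Farey Γ} (hab : T.graph.Adj a b) :
    {e : Farey Γ × Farey Γ | T.graph.Adj e.1 e.2 ∧ CCW e.1.pt p.pt e.2.pt ∧
      ¬ CCW e.1.pt a.pt e.2.pt ∧ ¬ CCW e.1.pt b.pt e.2.pt}.Finite := by
  obtain ⟨q, hpq⟩ := T.exists_adj p
  have point : ∀ {a b : Farey Γ}, T.graph.Adj a b → ∃ z, lam a.pt b.pt z = 0 := by
    intro a b hab
    obtain ⟨c, hc⟩ := exists_ccw (T.pt_ne hab).symm
    obtain ⟨z, -, h, -⟩ := exists_lam_eq hc (R := 1) (S := 0) (T := 1) (by simp) le_rfl (by simp)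
    exact ⟨z, h⟩
  obtain ⟨z, hz⟩ := point hab
  obtain ⟨w, hw⟩ := point hpq
  have side : ∀ {a b u v : Farey Γ} {z : ℍ}, T.graph.Adj a b → T.graph.Adj u v →
      lam a.pt b.pt z = 0 → ¬ CCW v.pt a.pt u.pt → ¬ CCW v.pt b.pt u.pt →
      0 ≤ lam v.pt u.pt z := by
    intro a b u v z hab huv hz h1 h2
    obtain ⟨c, ht, hc⟩ := T.exists_apex hab
    obtain ⟨c', ht', hc'⟩ := T.exists_apex hab.symm
    have e : ∃ α γ : ℝ, 0 ≤ α ∧ 0 ≤ γ ∧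
        lam v.pt u.pt z = α * lam c.pt b.pt z + γ * lam a.pt c.pt z := by
      obtain ⟨α, β, γ, e, -, e1, e2, e3⟩ := lam_eq_sum hc (T.pt_ne huv).symm
      refine ⟨α, γ, not_lt.1 fun h => h1 ?_, not_lt.1 fun h => h2 ?_, ?_⟩
      · rw [← ccw_swap_iff]; exact e1.1 h
      · rw [← ccw_swap_iff]; exact e3.1 h
      · rw [e, lam_swap a.pt b.pt, hz]; ring
    obtain ⟨α, γ, hα, hγ, e⟩ := e
    have hmem : 0 ≤ lam c.pt b.pt z ∧ 0 ≤ lam a.pt c.pt z := by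
      have hg : z ∈ geodesic a.pt b.pt := (mem_geodesic_iff (T.pt_ne hab) z).2 hz
      obtain ⟨r, s, hr, hs, h⟩ := hg
      have : z ∈ idealTriangle a.pt c.pt b.pt := ⟨r, 0, s, hr, le_rfl, hs, by rw [h]; simp⟩
      rw [mem_idealTriangle_iff hc] at this
      exact ⟨this.2.1, this.1⟩
    rw [e]
    have := mul_nonneg hα hmem.1
    have := mul_nonneg hγ hmem.2
    linarith
  obtain ⟨f⟩ : Nonempty (Path z w) := PathConnectedSpace.joined z w
  refine (T.locally_finite (range f) (isCompact_range f.continuous)).subset ?_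
  rintro ⟨u, v⟩ ⟨huv, hp, ha, hb⟩
  simp only at huv hp ha hb
  refine ⟨huv, ?_⟩
  have hz' : 0 ≤ lam u.pt v.pt z := side hab huv.symm hz ha hb
  have hw' : 0 ≤ lam v.pt u.pt w := by
    refine side hpq huv hw (fun h => ?_) (fun h => T.not_cross huv hpq hp h)
    rw [ccw_iff_theta] at *; grind
  rw [lam_swap] at hw'
  have hcont : Continuous fun t => lam u.pt v.pt (f t) := (continuous_lam _ _).comp f.continuous
  have hmem : (0 : ℝ) ∈ range fun t => lam u.pt v.pt (f t) :=
    mem_range_of_exists_le_of_exists_ge hcont ⟨1, by simp; linarith⟩ ⟨0, by simp; linarith⟩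
  obtain ⟨t, ht⟩ := hmem
  exact ⟨f t, (mem_geodesic_iff (T.pt_ne huv) _).2 ht, t, rfl⟩

/-- Every vertex in the arc from `a` to `b` is reached from the edge from `a` to `b`, by induction on the
number of edges that separate them. -/
lemma desc_of_ccw {a b p : Farey Γ} (hab : T.graph.Adj a b) (h : CCW a.pt p.pt b.pt) :
    T.Desc a b p := by
  have main : ∀ n : ℕ, ∀ a b : Farey Γ, T.graph.Adj a b → CCW a.pt p.pt b.pt →
      {e : Farey Γ × Farey Γ | T.graph.Adj e.1 e.2 ∧ CCW e.1.pt p.pt e.2.pt ∧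
      ¬ CCW e.1.pt a.pt e.2.pt ∧ ¬ CCW e.1.pt b.pt e.2.pt}.ncard = n → T.Desc a b p := by
    intro n
    induction n using Nat.strong_induction_on with
    | _ n ih =>
      intro a b hab h hn
      obtain ⟨c, ht, hc⟩ := T.exists_apex hab
      by_cases hcp : c = p
      · subst hcp; exact Desc.apex ht hc
      have hcp' : c.pt ≠ p.pt := fun h => hcp (Farey.pt_injective h)
      have hlt : ∀ a' b' : Farey Γ, (a' = a ∧ b' = c ∨ a' = c ∧ b' = b) → T.graph.Adj a' b' →
          CCW a'.pt p.pt b'.pt →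
          {e : Farey Γ × Farey Γ | T.graph.Adj e.1 e.2 ∧ CCW e.1.pt p.pt e.2.pt ∧
          ¬ CCW e.1.pt a'.pt e.2.pt ∧ ¬ CCW e.1.pt b'.pt e.2.pt}.ncard < n := by
        intro a' b' hor hadj hpp
        rw [← hn]
        refine Set.ncard_lt_ncard ?_ (T.finite_separating hab)
        refine ⟨?_, fun hsub => ?_⟩
        · rintro ⟨u, v⟩ ⟨h1, h2, h3, h4⟩
          simp only at h1 h2 h3 h4
          have k1 := T.not_cross h1 hab
          have k2 := T.not_cross h1 hab.symm
          refine ⟨h1, h2, ?_⟩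
          clear ih hn hadj
          simp only [ccw_iff_theta] at *
          rcases hor with ⟨rfl, rfl⟩ | ⟨rfl, rfl⟩ <;> grind
        · have hin := @hsub (a, b) ⟨hab, h, fun h => h.ne12 rfl, fun h => h.ne23 rfl⟩
          rcases hor with ⟨rfl, rfl⟩ | ⟨rfl, rfl⟩
          · exact hin.2.2.2 hc
          · exact hin.2.2.1 hc
      have hor : CCW a.pt p.pt c.pt ∨ CCW c.pt p.pt b.pt := by
        have := theta_injective.ne hcp'
        rw [ccw_iff_theta] at *
        rw [ccw_iff_theta]
        grind
      rcases hor with h' | h'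
      · exact Desc.left ht hc (ih _ (hlt a c (Or.inl ⟨rfl, rfl⟩) ht.1 h') a c ht.1 h' rfl)
      · exact Desc.right ht hc (ih _ (hlt c b (Or.inr ⟨rfl, rfl⟩) ht.2.1 h') c b ht.2.1 h' rfl)
  exact main _ a b hab h rfl

end IdealTriangulation

/-! ### Cross-ratios of real points -/

lemma crossRatio_infty_zero_one (x : ℝ) :
    crossRatio (inftyPt ℝ) (realPt x) (zeroPt ℝ) (onePt ℝ) = -1 / x := by
  rw [inftyPt, realPt, zeroPt, onePt, crossRatio_mk]
  simp [det2]

lemma crossRatio_self_left {K : Type*} [Field K] (a b c : ℙ K (Fin 2 → K)) :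
    crossRatio a a b c = 0 := by
  simp [crossRatio, det2, mul_comm]

lemma exists_crossRatio_eq {a b o : RP1} (h : CCW b o a) {X : ℝ} (hX : 0 < X) :
    ∃ c, CCW a c b ∧ crossRatio a c b o = X := by
  obtain ⟨g, rfl, rfl, rfl⟩ := h
  refine ⟨g • realPt (-1 / X), ?_, ?_⟩
  · rw [ccw_smul_iff, ccw_rotate, zeroPt_eq, ccw_infty]
    exact div_neg_of_neg_of_pos (by norm_num) hX
  · rw [crossRatio_smul, crossRatio_infty_zero_one]
    field_simp

lemma eq_of_crossRatio_eq {a b o c c' : RP1} (h : CCW b o a) (hX : crossRatio a c b o ≠ 0)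
    (hc : crossRatio a c b o = crossRatio a c' b o) : c = c' := by
  obtain ⟨g, rfl, rfl, rfl⟩ := h
  obtain ⟨c, rfl⟩ : ∃ a', c = g • a' := ⟨g⁻¹ • c, by simp⟩
  obtain ⟨c', rfl⟩ : ∃ a', c' = g • a' := ⟨g⁻¹ • c', by simp⟩
  have hX' := hX
  rw [hc] at hX'
  simp only [crossRatio_smul] at hX hX' hc
  have h1 : c ≠ inftyPt ℝ := by rintro rfl; exact hX (crossRatio_self_left _ _ _)
  have h2 : c' ≠ inftyPt ℝ := by rintro rfl; exact hX' (crossRatio_self_left _ _ _)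
  obtain ⟨x, rfl⟩ := eq_realPt h1
  obtain ⟨y, rfl⟩ := eq_realPt h2
  simp only [crossRatio_infty_zero_one] at hc hX hX'
  have hx : x ≠ 0 := by rintro rfl; simp at hX
  have hy : y ≠ 0 := by rintro rfl; simp at hX'
  field_simp at hc
  rw [neg_inj.1 hc]

/-- An element of `PSL(2, ℝ)` is determined by the images of three ideal points. -/
lemma psl_eq_of_ccw {a b c : RP1} (h : CCW a b c) {g k : PSL(2, ℝ)} (ha : g • a = k • a)
    (hb : g • b = k • b) (hc : g • c = k • c) : g = k := by
  obtain ⟨A, rfl, rfl, rfl⟩ := h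
  have hinf : (k⁻¹ * g) • (A • inftyPt ℝ) = A • inftyPt ℝ := by
    rw [mul_smul, hc, inv_smul_smul]
  obtain ⟨l, t, hl, h1, -⟩ := exists_affine_chart A _ hinf
  have e0 := h1 0
  have e1 := h1 1
  rw [← zeroPt_eq, mul_smul, ha, inv_smul_smul] at e0
  rw [← onePt_eq, mul_smul, hb, inv_smul_smul] at e1
  have e0 := realPt_injective (MulAction.injective A e0)
  have e1 := realPt_injective (MulAction.injective A e1)
  have ht : t = 0 := by linarith
  have hl : l = 1 := by linarith
  subst ht hl
  have : k⁻¹ * g = 1 := by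
    refine FaithfulSMul.eq_of_smul_eq_smul (α := RP1) fun x => ?_
    rw [one_smul]
    by_cases hx : x = A • inftyPt ℝ
    · rw [hx, hinf]
    · obtain ⟨y, rfl⟩ := chart_cases A hx
      rw [h1, one_mul, add_zero]
  exact (inv_mul_eq_one.1 this).symm

namespace IdealTriangulation

variable {Γ : Subgroup PSL(2, ℝ)} {T : IdealTriangulation Γ}

/-! ### Quadrilaterals -/

lemma IsTriangle.apex_unique {a b c c' : Farey Γ} (h : T.IsTriangle a c b)
    (h' : T.IsTriangle a c' b) (hc : CCW a.pt c.pt b.pt) (hc' : CCW a.pt c'.pt b.pt) : c = c' := by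
  by_contra hne
  have hne' : c.pt ≠ c'.pt := fun e => hne (Farey.pt_injective e)
  have := theta_injective.ne hne'
  have k1 := T.not_cross h.1 h'.2.1
  have k2 := T.not_cross h'.1 h.2.1
  clear h h'
  simp only [ccw_iff_theta] at *
  grind

lemma IsQuad.rotate {p₁ p₂ p₃ p₄ : Farey Γ} (h : T.IsQuad p₁ p₂ p₃ p₄) : T.IsQuad p₃ p₄ p₁ p₂ :=
  ⟨h.2.1.rotate, h.1.rotate.rotate, ccw_rotate.1 h.2.2.2, ccw_rotate.1 (ccw_rotate.1 h.2.2.1)⟩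

lemma IsQuad.adj {p₁ p₂ p₃ p₄ : Farey Γ} (h : T.IsQuad p₁ p₂ p₃ p₄) : T.graph.Adj p₁ p₃ :=
  h.2.1.1

lemma IsQuad.unique {p₁ p₂ p₃ p₄ p₂' p₄' : Farey Γ} (h : T.IsQuad p₁ p₂ p₃ p₄)
    (h' : T.IsQuad p₁ p₂' p₃ p₄') : p₂ = p₂' ∧ p₄ = p₄' :=
  ⟨h.1.apex_unique h'.1 h.2.2.1 h'.2.2.1, h.2.1.rotate.apex_unique h'.2.1.rotate
    (ccw_rotate.1 h.2.2.2) (ccw_rotate.1 h'.2.2.2)⟩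

lemma isQuad_mk {a b p o : Farey Γ} (h : T.IsTriangle a p b) (hp : CCW a.pt p.pt b.pt)
    (h' : T.IsTriangle b o a) (ho : CCW b.pt o.pt a.pt) : T.IsQuad a p b o :=
  ⟨h, h'.rotate.rotate, hp, ccw_rotate.1 (ccw_rotate.1 ho)⟩

lemma exists_quad {a b : Farey Γ} (h : T.graph.Adj a b) : ∃ p o, T.IsQuad a p b o := by
  obtain ⟨p, hp, hp'⟩ := T.exists_apex h
  obtain ⟨o, ho, ho'⟩ := T.exists_apex h.symm
  exact ⟨p, o, isQuad_mk hp hp' ho ho'⟩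

lemma IsTriangle.smul (γ : Γ) {p q r : Farey Γ} (h : T.IsTriangle p q r) :
    T.IsTriangle (γ • p) (γ • q) (γ • r) :=
  ⟨T.smul_adj γ _ _ h.1, T.smul_adj γ _ _ h.2.1, T.smul_adj γ _ _ h.2.2⟩

lemma ccw_pt_smul_iff (γ : Γ) {p q r : Farey Γ} :
    CCW (γ • p).pt (γ • q).pt (γ • r).pt ↔ CCW p.pt q.pt r.pt :=
  ccw_psl_smul_iff (γ : PSL(2, ℝ))

lemma IsQuad.smul (γ : Γ) {p₁ p₂ p₃ p₄ : Farey Γ} (h : T.IsQuad p₁ p₂ p₃ p₄) :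
    T.IsQuad (γ • p₁) (γ • p₂) (γ • p₃) (γ • p₄) :=
  ⟨h.1.smul γ, h.2.1.smul γ, (ccw_pt_smul_iff γ).2 h.2.2.1, (ccw_pt_smul_iff γ).2 h.2.2.2⟩

lemma ccw_cases {p q r : RP1} (h : CCW p q r) (x : RP1) :
    x = p ∨ x = q ∨ x = r ∨ CCW p x q ∨ CCW q x r ∨ CCW r x p := by
  by_contra! hne
  obtain ⟨h1, h2, h3, h4, h5, h6⟩ := hne
  have := theta_injective.ne h1
  have := theta_injective.ne h2
  have := theta_injective.ne h3
  simp only [ccw_iff_theta] at *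
  grind

/-- Every vertex is reached from each triangle. -/
lemma desc_cases {p q r : Farey Γ} (h : T.IsTriangle p q r) (hc : CCW p.pt q.pt r.pt)
    (x : Farey Γ) : x = p ∨ x = q ∨ x = r ∨ T.Desc p q x ∨ T.Desc q r x ∨ T.Desc r p x := by
  rcases ccw_cases hc x.pt with e | e | e | e | e | e
  · exact Or.inl (Farey.pt_injective e)
  · exact Or.inr (Or.inl (Farey.pt_injective e))
  · exact Or.inr (Or.inr (Or.inl (Farey.pt_injective e)))
  · exact Or.inr (Or.inr (Or.inr (Or.inl (T.desc_of_ccw h.1 e))))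
  · exact Or.inr (Or.inr (Or.inr (Or.inr (Or.inl (T.desc_of_ccw h.2.1 e)))))
  · exact Or.inr (Or.inr (Or.inr (Or.inr (Or.inr (T.desc_of_ccw h.2.2 e)))))

/-! ### Straightened framings: order and uniqueness -/

variable {β : Farey Γ → CP1} {β' β'' : Farey Γ → RP1}

lemma IsStraightening.ccw_of_desc (hs : T.IsStraightening β β') {a b p : Farey Γ}
    (h : T.Desc a b p) : CCW (β' a) (β' p) (β' b) := by
  induction h with
  | apex h h' => exact hs.ccw _ _ _ h h'
  | left h h' _ ih =>
    have := hs.ccw _ _ _ h h'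
    simp only [ccw_iff_theta] at *; grind
  | right h h' _ ih =>
    have := hs.ccw _ _ _ h h'
    simp only [ccw_iff_theta] at *; grind

/-- A straightened framing maps the vertices on either side of an edge to the corresponding side of
the image of the edge. -/
lemma IsStraightening.ccw_of_ccw (hs : T.IsStraightening β β') {a b p : Farey Γ}
    (hab : T.graph.Adj a b) (h : CCW a.pt p.pt b.pt) : CCW (β' a) (β' p) (β' b) :=
  hs.ccw_of_desc (T.desc_of_ccw hab h)

lemma exists_triangle_of_vertex (p : Farey Γ) : ∃ q r, T.IsTriangle p q r ∧
    CCW p.pt q.pt r.pt := by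
  obtain ⟨r, hr⟩ := T.exists_adj p
  obtain ⟨q, h, h'⟩ := T.exists_apex hr
  exact ⟨q, r, h, h'⟩

lemma IsStraightening.injective (hs : T.IsStraightening β β') : Function.Injective β' := by
  intro x p hxp
  obtain ⟨q, r, h, hc⟩ := exists_triangle_of_vertex (T := T) p
  have hc' := hs.ccw _ _ _ h hc
  rcases desc_cases h hc x with rfl | rfl | rfl | e | e | e
  · rfl
  · exact absurd hxp.symm hc'.ne12
  · exact absurd hxp hc'.ne31
  · exact absurd hxp.symm (hs.ccw_of_desc e).ne12
  · have := hs.ccw_of_desc e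
    rw [hxp] at this
    rw [ccw_iff_theta] at this hc'
    grind
  · exact absurd hxp (hs.ccw_of_desc e).ne23

lemma IsStraightening.ccw_iff_of_adj (hs : T.IsStraightening β β') {a b p : Farey Γ}
    (hab : T.graph.Adj a b) : CCW (β' a) (β' p) (β' b) ↔ CCW a.pt p.pt b.pt := by
  refine ⟨fun h => ?_, hs.ccw_of_ccw hab⟩
  by_contra hn
  rcases ccw_or_ccw (a := a.pt) (b := p.pt) (c := b.pt)
    (fun e => h.ne12 (congrArg β' (Farey.pt_injective e)))
    (fun e => h.ne23 (congrArg β' (Farey.pt_injective e)))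
    (fun e => h.ne31 (congrArg β' (Farey.pt_injective e))) with h' | h'
  · exact hn h'
  · have := hs.ccw_of_ccw hab.symm (ccw_rotate.1 h')
    simp only [ccw_iff_theta] at *
    grind

lemma IsStraightening.eq_of_desc (hs : T.IsStraightening β β') (hs' : T.IsStraightening β β'')
    (hFG : T.HasNonzeroCoordinates β) {a b p : Farey Γ} (h : T.Desc a b p) :
    ∀ o, T.IsTriangle b o a → CCW b.pt o.pt a.pt → β' a = β'' a → β' b = β'' b → β' o = β'' o →
      β' p = β'' p := by
  induction h with
  | @apex a b p h h' =>
    intro o ho hco ea eb eo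
    have hq := isQuad_mk h h' ho hco
    have h1 := hs.crossRatio_eq _ _ _ _ hq
    have h2 := hs'.crossRatio_eq _ _ _ _ hq
    rw [← ea, ← eb, ← eo] at h2
    refine eq_of_crossRatio_eq (hs.ccw _ _ _ ho hco) ?_ (h1.trans h2.symm)
    rw [h1]
    exact norm_ne_zero_iff.2 (hFG _ _ _ _ hq).2
  | @left a b c p h h' hd ih =>
    intro o ho hco ea eb eo
    have ec : β' c = β'' c := by
      have hq := isQuad_mk h h' ho hco
      have h1 := hs.crossRatio_eq _ _ _ _ hq
      have h2 := hs'.crossRatio_eq _ _ _ _ hq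
      rw [← ea, ← eb, ← eo] at h2
      refine eq_of_crossRatio_eq (hs.ccw _ _ _ ho hco) ?_ (h1.trans h2.symm)
      rw [h1]
      exact norm_ne_zero_iff.2 (hFG _ _ _ _ hq).2
    exact ih b h.rotate (ccw_rotate.1 h') ea ec eb
  | @right a b c p h h' hd ih =>
    intro o ho hco ea eb eo
    have ec : β' c = β'' c := by
      have hq := isQuad_mk h h' ho hco
      have h1 := hs.crossRatio_eq _ _ _ _ hq
      have h2 := hs'.crossRatio_eq _ _ _ _ hq
      rw [← ea, ← eb, ← eo] at h2
      refine eq_of_crossRatio_eq (hs.ccw _ _ _ ho hco) ?_ (h1.trans h2.symm)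
      rw [h1]
      exact norm_ne_zero_iff.2 (hFG _ _ _ _ hq).2
    exact ih a h.rotate.rotate (ccw_rotate.1 (ccw_rotate.1 h')) ec eb ea

/-- A straightened framing is determined by its values on one triangle. -/
lemma IsStraightening.eq_of_triangle (hs : T.IsStraightening β β')
    (hs' : T.IsStraightening β β'') (hFG : T.HasNonzeroCoordinates β) {p q r : Farey Γ}
    (h : T.IsTriangle p q r) (hc : CCW p.pt q.pt r.pt) (ep : β' p = β'' p) (eq : β' q = β'' q)
    (er : β' r = β'' r) : β' = β'' := by
  funext x
  rcases desc_cases h hc x with rfl | rfl | rfl | e | e | e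
  · exact ep
  · exact eq
  · exact er
  · exact hs.eq_of_desc hs' hFG e r h.rotate (ccw_rotate.1 hc) ep eq er
  · exact hs.eq_of_desc hs' hFG e p h.rotate.rotate (ccw_rotate.1 (ccw_rotate.1 hc)) eq er ep
  · exact hs.eq_of_desc hs' hFG e q h hc er ep eq

/-! ### Existence of a straightened framing -/

/-- In the development of the triangulation from the base triangle `o 0, o 1, o 2`, the vertex `p`
is placed by crossing the edge from `a` to `b` from the triangle with third vertex `c`. -/
def Parent (T : IdealTriangulation Γ) (o : Fin 3 → Farey Γ) (a b c p : Farey Γ) : Prop :=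
  T.IsQuad a p b c ∧ ∀ i, ¬ CCW a.pt (o i).pt b.pt

lemma Parent.unique {o : Fin 3 → Farey Γ} (ho : o 0 ≠ o 1) {a b c a' b' c' p : Farey Γ}
    (h : T.Parent o a b c p) (h' : T.Parent o a' b' c' p) : a = a' ∧ b = b' ∧ c = c' := by
  suffices h : a = a' ∧ b = b' by
    obtain ⟨rfl, rfl⟩ := h
    exact ⟨rfl, rfl, (h.1.unique h'.1).2⟩
  obtain ⟨⟨t, -, hc, -⟩, hb⟩ := h
  obtain ⟨⟨t', -, hc', -⟩, hb'⟩ := h'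
  obtain ⟨A, hA⟩ := exists_smul_infty p.pt
  have chart : ∀ x : Farey Γ, x ≠ p → ∃ u, x.pt = A • realPt u := fun x hx =>
    chart_cases A fun e => hx (Farey.pt_injective (e.trans hA))
  have base : ∀ i, o i ≠ p := fun i e => hb i (by rw [e]; exact hc)
  obtain ⟨x0, e0⟩ := chart _ (base 0)
  obtain ⟨x1, e1⟩ := chart _ (base 1)
  obtain ⟨xa, ea⟩ := chart _ t.1.ne
  obtain ⟨xb, eb⟩ := chart _ t.2.1.ne'
  obtain ⟨xa', ea'⟩ := chart _ t'.1.ne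
  obtain ⟨xb', eb'⟩ := chart _ t'.2.1.ne'
  have hx01 : x0 ≠ x1 := by
    rintro rfl
    exact ho (Farey.pt_injective (e0.trans e1.symm))
  have c3 : ∀ {x y z : ℝ}, CCW (A • realPt x) (A • realPt y) (A • realPt z) ↔
      (x < y ∧ y < z) ∨ (y < z ∧ z < x) ∨ (z < x ∧ x < y) := by
    intro x y z
    rw [ccw_smul_iff, ccw_realPt, cyclic_iff_mul_pos]
  have ci : ∀ {x y : ℝ}, CCW (A • realPt x) (A • inftyPt ℝ) (A • realPt y) ↔ y < x := by
    intro x y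
    rw [ccw_smul_iff, ccw_rotate, ccw_rotate, ccw_infty]
  have ci' : ∀ {x y : ℝ}, CCW (A • realPt x) (A • realPt y) (A • inftyPt ℝ) ↔ x < y := by
    intro x y
    rw [ccw_smul_iff, ccw_infty]
  rw [ea, eb, ← hA, ci] at hc
  rw [ea', eb', ← hA, ci] at hc'
  have nc : ∀ {u v w : Farey Γ} {xu xv xw : ℝ}, T.graph.Adj p u → T.graph.Adj v w →
      u.pt = A • realPt xu → v.pt = A • realPt xv → w.pt = A • realPt xw → xv < xu → xw ≤ xu := by
    intro u v w xu xv xw h h' eu ev ew h1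
    by_contra! h2
    refine T.not_cross h h' ?_ ?_
    · rw [eu, ev, ← hA, ccw_rotate, ci']; exact h1
    · rw [eu, ew, ← hA, ci']; exact h2
  have inside : ∀ {x y z : ℝ}, y < x → ¬ CCW (A • realPt x) (A • realPt z) (A • realPt y) →
      y ≤ z ∧ z ≤ x := by
    intro x y z h hn
    rw [c3] at hn
    constructor <;> by_contra! h'
    · exact hn (Or.inr (Or.inl ⟨h', h⟩))
    · exact hn (Or.inr (Or.inr ⟨h, h'⟩))
  have b0 := hb 0
  have b1 := hb 1
  have b0' := hb' 0
  have b1' := hb' 1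
  rw [e0, ea, eb] at b0
  rw [e1, ea, eb] at b1
  rw [e0, ea', eb'] at b0'
  rw [e1, ea', eb'] at b1'
  have i0 := inside hc b0
  have i1 := inside hc b1
  have i0' := inside hc' b0'
  have i1' := inside hc' b1'
  have ov1 : xb' < xa := by
    by_contra! h
    exact hx01 (by linarith [i0.2, i1.2, i0'.1, i1'.1])
  have ov2 : xb < xa' := by
    by_contra! h
    exact hx01 (by linarith [i0.1, i1.1, i0'.2, i1'.2])
  have n1 := nc t.1.symm t'.2.2 ea eb' ea' ov1
  have n2 := nc t'.1.symm t.2.2 ea' eb ea ov2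
  have n3 : xb' ≤ xb := by
    by_contra! h
    exact absurd (nc t'.2.1 t.2.2 eb' eb ea h) (not_le.2 ov1)
  have n4 : xb ≤ xb' := by
    by_contra! h
    exact absurd (nc t.2.1 t'.2.2 eb eb' ea' h) (not_le.2 ov2)
  obtain rfl := le_antisymm n1 n2
  obtain rfl := le_antisymm n3 n4
  exact ⟨Farey.pt_injective (ea.trans ea'.symm), Farey.pt_injective (eb.trans eb'.symm)⟩

end IdealTriangulation

namespace IdealTriangulation

variable {Γ : Subgroup PSL(2, ℝ)} {T : IdealTriangulation Γ} {β : Farey Γ → CP1}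
  {β' β'' : Farey Γ → RP1}

/-- The vertices from which `p` is placed. -/
def ParentRel (T : IdealTriangulation Γ) (o : Fin 3 → Farey Γ) (q p : Farey Γ) : Prop :=
  ∃ a b c, T.Parent o a b c p ∧ (q = a ∨ q = b ∨ q = c)

lemma acc_of_desc {o : Fin 3 → Farey Γ} (ho : o 0 ≠ o 1) {a b p : Farey Γ} (h : T.Desc a b p) :
    (∀ i, ¬ CCW a.pt (o i).pt b.pt) → ∀ c, T.IsTriangle b c a → CCW b.pt c.pt a.pt →
      Acc (T.ParentRel o) a → Acc (T.ParentRel o) b → Acc (T.ParentRel o) c →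
      Acc (T.ParentRel o) p := by
  have step : ∀ {a b p c : Farey Γ}, T.Parent o a b c p → Acc (T.ParentRel o) a →
      Acc (T.ParentRel o) b → Acc (T.ParentRel o) c → Acc (T.ParentRel o) p := by
    intro a b p c hp ha hb hc
    refine Acc.intro _ ?_
    rintro q ⟨a', b', c', hp', hq⟩
    obtain ⟨rfl, rfl, rfl⟩ := hp.unique ho hp'
    rcases hq with rfl | rfl | rfl <;> assumption
  induction h with
  | @apex a b p h h' =>
    intro hb c hc hc'
    exact step ⟨isQuad_mk h h' hc hc', hb⟩
  | @left a b d p h h' _ ih =>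
    intro hb c hc hc' ha hb' hc''
    have hd := step ⟨isQuad_mk h h' hc hc', hb⟩ ha hb' hc''
    refine ih (fun i hi => hb i ?_) b h.rotate (ccw_rotate.1 h') ha hd hb'
    simp only [ccw_iff_theta] at *; grind
  | @right a b d p h h' _ ih =>
    intro hb c hc hc' ha hb' hc''
    have hd := step ⟨isQuad_mk h h' hc hc', hb⟩ ha hb' hc''
    refine ih (fun i hi => hb i ?_) a h.rotate.rotate (ccw_rotate.1 (ccw_rotate.1 h')) hd hb' ha
    simp only [ccw_iff_theta] at *; grind

open Classical in
/-- The point on the other side of the edge `a, b` of the triangle `a, b, c` that gives the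
cross-ratio `X` at this edge. -/
def place (a b c : RP1) (X : ℝ) : RP1 :=
  if h : ∃ x, CCW a x b ∧ crossRatio a x b c = X then h.choose else a

lemma place_spec {a b c : RP1} (h : CCW b c a) {X : ℝ} (hX : 0 < X) :
    CCW a (place a b c X) b ∧ crossRatio a (place a b c X) b c = X := by
  have h' := exists_crossRatio_eq h hX
  rw [place, dif_pos h']
  exact h'.choose_spec

open Classical in
/-- The points of the base triangle are placed at `0, 1, ∞`; all others by their parents. -/
lemma exists_development (β : Farey Γ → CP1) {o : Fin 3 → Farey Γ}
    (hwf : WellFounded (T.ParentRel o)) (h01 : o 0 ≠ o 1) (h12 : o 1 ≠ o 2) (h20 : o 2 ≠ o 0) :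
    ∃ β' : Farey Γ → RP1, CCW (β' (o 0)) (β' (o 1)) (β' (o 2)) ∧
      ∀ a b c p, T.Parent o a b c p →
        β' p = place (β' a) (β' b) (β' c) ‖crossRatio (β a) (β p) (β b) (β c)‖ := by
  let F : (p : Farey Γ) → ((q : Farey Γ) → T.ParentRel o q p → RP1) → RP1 := fun p f =>
    if h : ∃ a b c, T.Parent o a b c p then
      place (f h.choose ⟨_, _, _, h.choose_spec.choose_spec.choose_spec, Or.inl rfl⟩)
        (f h.choose_spec.choose ⟨_, _, _, h.choose_spec.choose_spec.choose_spec, Or.inr (Or.inl rfl)⟩)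
        (f h.choose_spec.choose_spec.choose
          ⟨_, _, _, h.choose_spec.choose_spec.choose_spec, Or.inr (Or.inr rfl)⟩)
        ‖crossRatio (β h.choose) (β p) (β h.choose_spec.choose)
          (β h.choose_spec.choose_spec.choose)‖
    else if p = o 0 then zeroPt ℝ else if p = o 1 then onePt ℝ else inftyPt ℝ
  have hbase : ∀ i, ¬ ∃ a b c, T.Parent o a b c (o i) := by
    rintro i ⟨a, b, c, h⟩
    exact h.2 i h.1.2.2.1
  refine ⟨hwf.fix F, ?_, ?_⟩
  · have e0 : hwf.fix F (o 0) = zeroPt ℝ := by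
      rw [hwf.fix_eq]; simp only [F]; rw [dif_neg (hbase 0)]; simp
    have e1 : hwf.fix F (o 1) = onePt ℝ := by
      rw [hwf.fix_eq]; simp only [F]; rw [dif_neg (hbase 1)]; simp [h01.symm]
    have e2 : hwf.fix F (o 2) = inftyPt ℝ := by
      rw [hwf.fix_eq]; simp only [F]; rw [dif_neg (hbase 2)]; simp [h20, h12.symm]
    rw [e0, e1, e2]
    exact ⟨1, by simp, by simp, by simp⟩
  · intro a b c p hp
    have h : ∃ a b c, T.Parent o a b c p := ⟨a, b, c, hp⟩
    rw [hwf.fix_eq]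
    simp only [F]
    rw [dif_pos h]
    obtain ⟨ea, eb, ec⟩ := hp.unique h01 h.choose_spec.choose_spec.choose_spec
    conv_rhs => rw [ea, eb, ec]

/-- A triangle is the base triangle, or one of its vertices is placed from the opposite edge. -/
lemma base_or_parent {o : Fin 3 → Farey Γ} (ho : T.IsTriangle (o 0) (o 1) (o 2))
    (hoc : CCW (o 0).pt (o 1).pt (o 2).pt) {u v w : Farey Γ} (h : T.IsTriangle u v w)
    (hc : CCW u.pt v.pt w.pt) :
    ((u = o 0 ∧ v = o 1 ∧ w = o 2) ∨ (u = o 1 ∧ v = o 2 ∧ w = o 0) ∨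
      (u = o 2 ∧ v = o 0 ∧ w = o 1)) ∨
      (∃ c, T.Parent o v u c w) ∨ (∃ c, T.Parent o w v c u) ∨ (∃ c, T.Parent o u w c v) := by
  have side : ∀ {u v w : Farey Γ}, T.IsTriangle u v w → CCW u.pt v.pt w.pt →
      (∃ i, CCW u.pt (o i).pt v.pt) → ∃ c, T.Parent o v u c w := by
    rintro u v w h hc ⟨i, hi⟩
    obtain ⟨c, hc1, hc2⟩ := T.exists_apex h.1
    refine ⟨c, isQuad_mk h.rotate (ccw_rotate.1 hc) hc1 hc2, ?_⟩
    rcases T.triangle_side h.1 ho with ⟨h0, h1, h2⟩ | ⟨h0, h1, h2⟩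
    · fin_cases i
      · exact absurd hi h0
      · exact absurd hi h1
      · exact absurd hi h2
    · intro j
      fin_cases j
      · exact h0
      · exact h1
      · exact h2
  by_cases h1 : ∃ i, CCW u.pt (o i).pt v.pt
  · exact Or.inr (Or.inl (side h hc h1))
  by_cases h2 : ∃ i, CCW v.pt (o i).pt w.pt
  · exact Or.inr (Or.inr (Or.inl (side h.rotate (ccw_rotate.1 hc) h2)))
  by_cases h3 : ∃ i, CCW w.pt (o i).pt u.pt
  · exact Or.inr (Or.inr (Or.inr (side h.rotate.rotate (ccw_rotate.1 (ccw_rotate.1 hc)) h3)))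
  left
  push Not at h1 h2 h3
  have key : ∀ i, o i = u ∨ o i = v ∨ o i = w := by
    intro i
    rcases ccw_cases hc (o i).pt with e | e | e | e | e | e
    · exact Or.inl (Farey.pt_injective e)
    · exact Or.inr (Or.inl (Farey.pt_injective e))
    · exact Or.inr (Or.inr (Farey.pt_injective e))
    · exact absurd e (h1 i)
    · exact absurd e (h2 i)
    · exact absurd e (h3 i)
  have n01 := ho.1.ne
  have n12 := ho.2.1.ne
  have n20 := ho.2.2.ne
  have irr : ∀ {x y z : Farey Γ}, CCW x.pt y.pt z.pt → CCW y.pt x.pt z.pt → False := by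
    intro x y z h h'
    simp only [ccw_iff_theta] at h h'; grind
  rcases key 0 with e0 | e0 | e0 <;> rcases key 1 with e1 | e1 | e1 <;>
    rcases key 2 with e2 | e2 | e2 <;> rw [e0, e1] at n01 <;> rw [e1, e2] at n12 <;>
    rw [e2, e0] at n20 <;>
    (first
      | exact absurd rfl n01
      | exact absurd rfl n12
      | exact absurd rfl n20
      | skip)
  · exact Or.inl ⟨e0.symm, e1.symm, e2.symm⟩
  · rw [e0, e1, e2] at hoc
    exact (irr hc (ccw_rotate.1 (ccw_rotate.1 hoc))).elim
  · rw [e0, e1, e2] at hoc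
    exact (irr hc hoc).elim
  · exact Or.inr (Or.inr ⟨e2.symm, e0.symm, e1.symm⟩)
  · exact Or.inr (Or.inl ⟨e1.symm, e2.symm, e0.symm⟩)
  · rw [e0, e1, e2] at hoc
    exact (irr hc (ccw_rotate.1 hoc)).elim

/-- A straightened framing exists: a base triangle is placed arbitrarily, and every other vertex is
determined by the cross-ratio at the edge through which it is first reached. -/
theorem exists_straightening (T : IdealTriangulation Γ) (hFG : T.HasNonzeroCoordinates β) :
    ∃ β' : Farey Γ → RP1, T.IsStraightening β β' := by
  obtain ⟨p, q, r, ht, hc, -⟩ := T.exists_triangle UpperHalfPlane.I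
  let o : Fin 3 → Farey Γ := ![p, q, r]
  have ho : T.IsTriangle (o 0) (o 1) (o 2) := ht
  have hoc : CCW (o 0).pt (o 1).pt (o 2).pt := hc
  have h01 : o 0 ≠ o 1 := ht.1.ne
  have hbase : ∀ i, Acc (T.ParentRel o) (o i) := by
    intro i
    refine Acc.intro _ ?_
    rintro q ⟨a, b, c, h, -⟩
    exact absurd h.1.2.2.1 (h.2 i)
  have sides : (∀ i, ¬ CCW p.pt (o i).pt q.pt) ∧ (∀ i, ¬ CCW q.pt (o i).pt r.pt) ∧
      (∀ i, ¬ CCW r.pt (o i).pt p.pt) := by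
    have irr : ∀ x y : RP1, ¬ CCW x x y := fun x y h => h.ne12 rfl
    have irr' : ∀ x y : RP1, ¬ CCW x y y := fun x y h => h.ne23 rfl
    have key : ∀ {x y z : RP1}, CCW x y z → ¬ CCW x z y := by
      intro x y z h h'
      simp only [ccw_iff_theta] at h h'; grind
    refine ⟨fun i => ?_, fun i => ?_, fun i => ?_⟩ <;> fin_cases i
    · exact irr _ _
    · exact irr' _ _
    · exact key hc
    · exact key (ccw_rotate.1 hc)
    · exact irr _ _
    · exact irr' _ _
    · exact irr' _ _
    · exact key (ccw_rotate.1 (ccw_rotate.1 hc))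
    · exact irr _ _
  have hwf : WellFounded (T.ParentRel o) := by
    refine ⟨fun x => ?_⟩
    rcases desc_cases ht hc x with rfl | rfl | rfl | e | e | e
    · exact hbase 0
    · exact hbase 1
    · exact hbase 2
    · exact acc_of_desc h01 e sides.1 r ht.rotate (ccw_rotate.1 hc) (hbase 0) (hbase 1) (hbase 2)
    · exact acc_of_desc h01 e sides.2.1 p ht.rotate.rotate (ccw_rotate.1 (ccw_rotate.1 hc))
        (hbase 1) (hbase 2) (hbase 0)
    · exact acc_of_desc h01 e sides.2.2 q ht hc (hbase 2) (hbase 0) (hbase 1)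
  obtain ⟨β', hb, hβ'⟩ := exists_development β hwf h01 ht.2.1.ne ht.2.2.ne
  have hX : ∀ {a b c p : Farey Γ}, T.Parent o a b c p →
      0 < ‖crossRatio (β a) (β p) (β b) (β c)‖ := fun h =>
    norm_pos_iff.2 (hFG _ _ _ _ h.1).2
  -- the edge through which a vertex is placed is placed with the correct orientation
  have hccw : ∀ x a b c, T.Parent o a b c x → CCW (β' b) (β' c) (β' a) := by
    intro x
    induction x using hwf.induction with
    | _ x ih =>
      intro a b c h
      have key : ∀ w, (w = a ∨ w = b ∨ w = c) → ∀ a' b' c', T.Parent o a' b' c' w →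
          CCW (β' a') (β' w) (β' b') := by
        intro w hw a' b' c' hw'
        rw [hβ' _ _ _ _ hw']
        exact (place_spec (ih w ⟨a, b, c, h, hw⟩ a' b' c' hw') (hX hw')).1
      have htri : T.IsTriangle b c a := h.1.2.1.rotate
      have htc : CCW b.pt c.pt a.pt := ccw_rotate.1 h.1.2.2.2
      rcases base_or_parent ho hoc htri htc with
        (⟨rfl, rfl, rfl⟩ | ⟨rfl, rfl, rfl⟩ | ⟨rfl, rfl, rfl⟩) | ⟨d, hd⟩ | ⟨d, hd⟩ | ⟨d, hd⟩
      · exact hb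
      · exact ccw_rotate.1 hb
      · exact ccw_rotate.1 (ccw_rotate.1 hb)
      · exact ccw_rotate.1 (ccw_rotate.1 (key a (Or.inl rfl) _ _ _ hd))
      · exact ccw_rotate.1 (key b (Or.inr (Or.inl rfl)) _ _ _ hd)
      · exact key c (Or.inr (Or.inr rfl)) _ _ _ hd
  have hplace : ∀ {a b c p : Farey Γ}, T.Parent o a b c p → CCW (β' a) (β' p) (β' b) ∧
      crossRatio (β' a) (β' p) (β' b) (β' c) = ‖crossRatio (β a) (β p) (β b) (β c)‖ := by
    intro a b c p h
    rw [hβ' _ _ _ _ h]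
    exact place_spec (hccw _ _ _ _ h) (hX h)
  refine ⟨β', ⟨?_, ?_⟩⟩
  · intro u v w h hc
    rcases base_or_parent ho hoc h hc with
        (⟨rfl, rfl, rfl⟩ | ⟨rfl, rfl, rfl⟩ | ⟨rfl, rfl, rfl⟩) | ⟨d, hd⟩ | ⟨d, hd⟩ | ⟨d, hd⟩
    · exact hb
    · exact ccw_rotate.1 hb
    · exact ccw_rotate.1 (ccw_rotate.1 hb)
    · exact ccw_rotate.1 (ccw_rotate.1 (hplace hd).1)
    · exact ccw_rotate.1 (hplace hd).1
    · exact (hplace hd).1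
  · intro p₁ p₂ p₃ p₄ h
    rcases T.triangle_side h.adj ho with ⟨h0, h1, h2⟩ | ⟨h0, h1, h2⟩
    · refine (hplace (a := p₁) (b := p₃) (c := p₄) (p := p₂) ⟨h, fun i => ?_⟩).2
      fin_cases i
      · exact h0
      · exact h1
      · exact h2
    · rw [← crossRatio_rotate, ← crossRatio_rotate (β p₁)]
      refine (hplace (a := p₃) (b := p₁) (c := p₂) (p := p₄) ⟨h.rotate, fun i => ?_⟩).2
      fin_cases i
      · exact h0
      · exact h1
      · exact h2

/-! ### The holonomy of a straightened framing -/

lemma IsStraightening.comp_smul {ρ : Γ →* PSL(2, ℂ)} (hβ : IsEquivariant ρ β)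
    (hs : T.IsStraightening β β') (γ : Γ) : T.IsStraightening β fun p => β' (γ • p) := by
  refine ⟨fun p q r h hc => hs.ccw _ _ _ (h.smul γ) ((ccw_pt_smul_iff γ).2 hc), ?_⟩
  intro p₁ p₂ p₃ p₄ h
  rw [hs.crossRatio_eq _ _ _ _ (h.smul γ), hβ, hβ, hβ, hβ, crossRatio_psl_smul]

lemma IsStraightening.smul (hs : T.IsStraightening β β') (g : PSL(2, ℝ)) :
    T.IsStraightening β fun p => g • β' p := by
  refine ⟨fun p q r h hc => (ccw_psl_smul_iff g).2 (hs.ccw _ _ _ h hc), ?_⟩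
  intro p₁ p₂ p₃ p₄ h
  rw [crossRatio_psl_smul, hs.crossRatio_eq _ _ _ _ h]

/-- A straightened framing is equivariant for some holonomy representation. -/
theorem IsStraightening.exists_holonomy {ρ : Γ →* PSL(2, ℂ)} (hβ : IsEquivariant ρ β)
    (hs : T.IsStraightening β β') (hFG : T.HasNonzeroCoordinates β) :
    ∃ ρ' : Γ →* PSL(2, ℝ), IsEquivariant ρ' β' := by
  obtain ⟨p, q, r, ht, hc, -⟩ := T.exists_triangle UpperHalfPlane.I
  have hc' := hs.ccw _ _ _ ht hc
  have ex : ∀ γ : Γ, ∃ g : PSL(2, ℝ), ∀ x, β' (γ • x) = g • β' x := by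
    intro γ
    have hsγ := hs.comp_smul hβ γ
    obtain ⟨A, a0, a1, a2⟩ := hc'
    obtain ⟨B, b0, b1, b2⟩ := hsγ.ccw _ _ _ ht hc
    refine ⟨((B * A⁻¹ : SL(2, ℝ)) : PSL(2, ℝ)), fun x => ?_⟩
    refine congrFun (hsγ.eq_of_triangle (hs.smul _) hFG ht hc ?_ ?_ ?_) x
    · rw [← b0, ← a0, Matrix.ProjectiveSpecialLinearGroup.smul_proj_mk, mul_smul, inv_smul_smul]
    · rw [← b1, ← a1, Matrix.ProjectiveSpecialLinearGroup.smul_proj_mk, mul_smul, inv_smul_smul]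
    · rw [← b2, ← a2, Matrix.ProjectiveSpecialLinearGroup.smul_proj_mk, mul_smul, inv_smul_smul]
  choose f hf using ex
  have f1 : f 1 = 1 := by
    refine psl_eq_of_ccw hc' ?_ ?_ ?_ <;> rw [← hf, one_smul, one_smul]
  refine ⟨⟨⟨f, f1⟩, ?_⟩, fun γ x => hf γ x⟩
  · intro γ δ
    change f (γ * δ) = f γ * f δ
    refine psl_eq_of_ccw hc' ?_ ?_ ?_ <;> rw [← hf, mul_smul, mul_smul, hf, hf]

end IdealTriangulation

/-! ### Sliding the sides of an ideal triangle -/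

/-- The change of `x` when `x : y` is replaced by `μ x : y` with `x + y` kept fixed. -/
def slide (μ x y : ℝ) : ℝ := (μ - 1) * x * y / (μ * x + y)

lemma slide_zero_left (μ y : ℝ) : slide μ 0 y = 0 := by simp [slide]

lemma slide_zero_right (μ x : ℝ) : slide μ x 0 = 0 := by simp [slide]

lemma slide_swap {μ : ℝ} (hμ : 0 < μ) (x y : ℝ) : slide μ⁻¹ y x = -slide μ x y := by
  have h : μ⁻¹ * y + x = (μ * x + y) * μ⁻¹ := by field_simp; ring
  rw [slide, slide, h, ← div_div, div_inv_eq_mul, ← neg_div, div_mul_eq_mul_div]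
  congr 1
  field_simp
  ring

lemma slide_mul {μ : ℝ} (c x y : ℝ) : slide μ (c * x) (c * y) = c * slide μ x y := by
  rcases eq_or_ne c 0 with rfl | hc
  · simp [slide]
  · rw [slide, slide, show μ * (c * x) + c * y = c * (μ * x + y) by ring,
      show (μ - 1) * (c * x) * (c * y) = c * (c * ((μ - 1) * x * y)) by ring, mul_div_mul_left _ _ hc]
    ring

lemma add_slide_nonneg {μ x y : ℝ} (hμ : 0 < μ) (hx : 0 ≤ x) (hy : 0 ≤ y) : 0 ≤ x + slide μ x y := by
  rcases eq_or_lt_of_le (show 0 ≤ μ * x + y by positivity) with h | h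
  · simp [slide, ← h, hx]
  · rw [slide, show x + (μ - 1) * x * y / (μ * x + y) = μ * x * (x + y) / (μ * x + y) by
      rw [eq_div_iff h.ne', add_mul, div_mul_cancel₀ _ h.ne']; ring]
    positivity

lemma sub_slide_nonneg {μ x y : ℝ} (hμ : 0 < μ) (hx : 0 ≤ x) (hy : 0 ≤ y) : 0 ≤ y - slide μ x y := by
  have := add_slide_nonneg (inv_pos.2 hμ) hy hx
  rwa [slide_swap hμ, ← sub_eq_add_neg] at this

lemma add_slide_eq {μ x y : ℝ} (hμ : 0 < μ) (hx : 0 ≤ x) (hy : 0 ≤ y) :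
    x + slide μ x y = (μ * x * (x + y)) / (μ * x + y) ∧ y - slide μ x y = y * (x + y) / (μ * x + y) := by
  rcases eq_or_lt_of_le (show 0 ≤ μ * x + y by positivity) with h | h
  · have hx0 : x = 0 := by
      have := mul_nonneg hμ.le hx
      have : μ * x = 0 := by linarith
      exact (mul_eq_zero.1 this).resolve_left hμ.ne'
    have hy0 : y = 0 := by simpa [hx0] using h.symm
    simp [slide, hx0, hy0]
  · rw [slide, eq_div_iff h.ne', eq_div_iff h.ne', add_mul, sub_mul y,
      div_mul_cancel₀ _ h.ne']
    constructor <;> ring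

lemma slide_slide {μ x y : ℝ} (hμ : 0 < μ) (hx : 0 ≤ x) (hy : 0 ≤ y) :
    slide μ⁻¹ (x + slide μ x y) (y - slide μ x y) = -slide μ x y := by
  rcases eq_or_lt_of_le (show 0 ≤ μ * x + y by positivity) with h | h
  · have hs : slide μ x y = 0 := by simp [slide, ← h]
    rw [hs]
    have hx0 : x = 0 := by
      have := mul_nonneg hμ.le hx
      have : μ * x = 0 := by linarith
      exact (mul_eq_zero.1 this).resolve_left hμ.ne'
    simp [slide, hx0]
  · obtain ⟨h1, h2⟩ := add_slide_eq hμ hx hy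
    rw [h1, h2]
    have hxy : 0 < x + y := by
      rcases hx.eq_or_lt with h0 | h0
      · rw [← h0] at h ⊢; simpa using h
      · linarith
    rw [slide, slide]
    have : μ⁻¹ * (μ * x * (x + y) / (μ * x + y)) + y * (x + y) / (μ * x + y) =
      (x + y) ^ 2 / (μ * x + y) := by field_simp
    rw [this]
    field_simp
    ring

lemma abs_slide_le {μ x y : ℝ} (hμ : 0 < μ) (hx : 0 ≤ x) (hy : 0 ≤ y) :
    |slide μ x y| ≤ |μ - 1| * x := by
  rw [slide, abs_div, abs_mul, abs_mul, abs_of_nonneg hx, abs_of_nonneg hy,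
    abs_of_nonneg (by positivity : 0 ≤ μ * x + y)]
  refine div_le_of_le_mul₀ (by positivity) (by positivity) ?_
  refine mul_le_mul_of_nonneg_left ?_ (by positivity)
  nlinarith [mul_nonneg hμ.le hx]

lemma continuous_slide {X : Type*} [TopologicalSpace X] {μ : ℝ} (hμ : 0 < μ) {f g : X → ℝ}
    (hf : Continuous f) (hg : Continuous g) (hf0 : ∀ x, 0 ≤ f x) (hg0 : ∀ x, 0 ≤ g x) :
    Continuous fun x => slide μ (f x) (g x) := by
  rw [continuous_iff_continuousAt]
  intro x
  by_cases h : μ * f x + g x = 0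
  · have hx0 : f x = 0 := by
      have := mul_nonneg hμ.le (hf0 x)
      have := hg0 x
      have : μ * f x = 0 := by linarith
      exact (mul_eq_zero.1 this).resolve_left hμ.ne'
    have e : slide μ (f x) (g x) = 0 := by simp [slide, hx0]
    rw [ContinuousAt, e]
    refine squeeze_zero_norm (a := fun y => |μ - 1| * f y) (fun y => abs_slide_le hμ (hf0 y) (hg0 y)) ?_
    have : Continuous fun y => |μ - 1| * f y := by fun_prop
    simpa [hx0] using this.tendsto x
  · unfold slide
    exact ContinuousAt.div (by fun_prop) (by fun_prop) h

/-- The homeomorphism of `ℝ³` that preserves the minimum and the sum of the coordinates and, after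
the minimum has been subtracted, multiplies the ratios `R : S`, `S : T`, `T : R` of the two
remaining coordinates by `μ.2.2`, `μ.1`, `μ.2.1`. In the coordinates of an ideal triangle it slides each
of the sides along itself. -/
def slideMap (μ c : ℝ × ℝ × ℝ) : ℝ × ℝ × ℝ :=
  let m := min c.1 (min c.2.1 c.2.2)
  (c.1 + slide μ.2.2 (c.1 - m) (c.2.1 - m) - slide μ.2.1 (c.2.2 - m) (c.1 - m),
    c.2.1 + slide μ.1 (c.2.1 - m) (c.2.2 - m) - slide μ.2.2 (c.1 - m) (c.2.1 - m),
    c.2.2 + slide μ.2.1 (c.2.2 - m) (c.1 - m) - slide μ.1 (c.2.1 - m) (c.2.2 - m))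

/-- Cyclic permutation of coordinates. -/
def rot (c : ℝ × ℝ × ℝ) : ℝ × ℝ × ℝ := (c.2.1, c.2.2, c.1)

lemma slideMap_rot (μ c : ℝ × ℝ × ℝ) : slideMap (rot μ) (rot c) = rot (slideMap μ c) := by
  have h : min c.2.1 (min c.2.2 c.1) = min c.1 (min c.2.1 c.2.2) := by
    rw [← min_assoc, min_comm]
  simp only [slideMap, rot, h]

/-- All three parameters are positive. -/
def Pos3 (μ : ℝ × ℝ × ℝ) : Prop := 0 < μ.1 ∧ 0 < μ.2.1 ∧ 0 < μ.2.2

lemma Pos3.rot {μ : ℝ × ℝ × ℝ} (h : Pos3 μ) : Pos3 (rot μ) := ⟨h.2.1, h.2.2, h.1⟩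

/-- The coordinatewise inverse. -/
def inv3 (μ : ℝ × ℝ × ℝ) : ℝ × ℝ × ℝ := (μ.1⁻¹, μ.2.1⁻¹, μ.2.2⁻¹)

lemma Pos3.inv3 {μ : ℝ × ℝ × ℝ} (h : Pos3 μ) : Pos3 (inv3 μ) :=
  ⟨inv_pos.2 h.1, inv_pos.2 h.2.1, inv_pos.2 h.2.2⟩

lemma slideMap_of_min {μ : ℝ × ℝ × ℝ} {R S T : ℝ} (hR : T ≤ R) (hS : T ≤ S) :
    slideMap μ (R, S, T) =
      (R + slide μ.2.2 (R - T) (S - T), S - slide μ.2.2 (R - T) (S - T), T) := by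
  have hm : min R (min S T) = T := by rw [min_eq_right hS, min_eq_right hR]
  simp only [slideMap, hm, sub_self, slide_zero_left, slide_zero_right]
  simp

/-- Up to a cyclic permutation the last coordinate is the smallest one. -/
lemma rot_induction {P : ℝ × ℝ × ℝ → Prop} (h : ∀ R S T, T ≤ R → T ≤ S → P (R, S, T))
    (hrot : ∀ c, P (rot c) → P c) (c : ℝ × ℝ × ℝ) : P c := by
  obtain ⟨R, S, T⟩ := c
  rcases le_total R S with h1 | h1 <;> rcases le_total S T with h2 | h2 <;>
    rcases le_total R T with h3 | h3
  · exact hrot _ (h S T R h1 h3)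
  · exact hrot _ (h S T R h1 (h1.trans h2))
  · exact hrot _ (h S T R h1 h3)
  · exact h R S T h3 h2
  · exact hrot _ (hrot _ (h T R S h2 h1))
  · exact hrot _ (hrot _ (h T R S h2 h1))
  · exact h R S T (h2.trans h1) h2
  · exact h R S T h3 h2

lemma slideMap_slideMap {μ : ℝ × ℝ × ℝ} (hμ : Pos3 μ) (c : ℝ × ℝ × ℝ) :
    slideMap (inv3 μ) (slideMap μ c) = c := by
  revert μ
  refine rot_induction (P := fun c => ∀ {μ : ℝ × ℝ × ℝ}, Pos3 μ →
    slideMap (inv3 μ) (slideMap μ c) = c) ?_ ?_ c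
  · intro R S T hR hS μ hμ
    have h1 := add_slide_nonneg hμ.2.2 (sub_nonneg.2 hR) (sub_nonneg.2 hS)
    have h2 := sub_slide_nonneg hμ.2.2 (sub_nonneg.2 hR) (sub_nonneg.2 hS)
    have h3 := slide_slide hμ.2.2 (sub_nonneg.2 hR) (sub_nonneg.2 hS)
    rw [slideMap_of_min hR hS, slideMap_of_min (by linarith) (by linarith)]
    set d := slide μ.2.2 (R - T) (S - T)
    rw [show R + d - T = R - T + d by ring, show S - d - T = S - T - d by ring]
    simp only [inv3]
    rw [h3]
    simp
  · intro c h μ hμ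
    have := h hμ.rot
    rw [slideMap_rot, show inv3 (rot μ) = rot (inv3 μ) from rfl, slideMap_rot] at this
    simp only [rot, Prod.mk.injEq] at this
    exact Prod.ext this.2.2 (Prod.ext this.1 this.2.1)

lemma slideMap_slideMap' {μ : ℝ × ℝ × ℝ} (hμ : Pos3 μ) (c : ℝ × ℝ × ℝ) :
    slideMap μ (slideMap (inv3 μ) c) = c := by
  have := slideMap_slideMap hμ.inv3 c
  rwa [show inv3 (inv3 μ) = μ by simp [inv3]] at this

lemma continuous_slideMap {μ : ℝ × ℝ × ℝ} (hμ : Pos3 μ) : Continuous (slideMap μ) := by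
  have h1 : ∀ c : ℝ × ℝ × ℝ, 0 ≤ c.1 - min c.1 (min c.2.1 c.2.2) := fun c => by simp
  have h2 : ∀ c : ℝ × ℝ × ℝ, 0 ≤ c.2.1 - min c.1 (min c.2.1 c.2.2) := fun c => by simp
  have h3 : ∀ c : ℝ × ℝ × ℝ, 0 ≤ c.2.2 - min c.1 (min c.2.1 c.2.2) := fun c => by simp
  have c1 := continuous_slide hμ.2.2 (f := fun c : ℝ × ℝ × ℝ => c.1 - min c.1 (min c.2.1 c.2.2))
    (by fun_prop) (by fun_prop) h1 h2
  have c2 := continuous_slide hμ.2.1 (f := fun c : ℝ × ℝ × ℝ => c.2.2 - min c.1 (min c.2.1 c.2.2))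
    (by fun_prop) (by fun_prop) h3 h1
  have c3 := continuous_slide hμ.1 (f := fun c : ℝ × ℝ × ℝ => c.2.1 - min c.1 (min c.2.1 c.2.2))
    (by fun_prop) (by fun_prop) h2 h3
  exact ((continuous_fst.add c1).sub c2).prodMk
    ((((continuous_fst.comp continuous_snd).add c3).sub c1).prodMk
      (((continuous_snd.comp continuous_snd).add c2).sub c3))

lemma slideMap_mul {k : ℝ} (hk : 0 ≤ k) (μ c : ℝ × ℝ × ℝ) :
    slideMap μ (k • c) = k • slideMap μ c := by
  obtain ⟨R, S, T⟩ := c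
  have hm : min (k * R) (min (k * S) (k * T)) = k * min R (min S T) := by
    rw [mul_min_of_nonneg _ _ hk, mul_min_of_nonneg _ _ hk]
  simp only [slideMap, Prod.smul_mk, smul_eq_mul, hm, ← mul_sub, slide_mul, Prod.mk.injEq]
  refine ⟨by ring, by ring, by ring⟩

/-- The coordinates of points of an ideal triangle, up to scale: two coordinates are positive. -/
def Cone (c : ℝ × ℝ × ℝ) : Prop :=
  0 ≤ c.1 ∧ 0 ≤ c.2.1 ∧ 0 ≤ c.2.2 ∧ 0 < c.1 * c.2.1 + c.2.1 * c.2.2 + c.2.2 * c.1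

lemma cone_rot {c : ℝ × ℝ × ℝ} : Cone (rot c) ↔ Cone c := by
  simp only [Cone, rot]
  constructor <;> rintro ⟨h1, h2, h3, h4⟩ <;> refine ⟨?_, ?_, ?_, ?_⟩ <;> linarith

lemma Cone.slideMap {μ c : ℝ × ℝ × ℝ} (hμ : Pos3 μ) (hc : Cone c) : Cone (slideMap μ c) := by
  revert μ hc
  refine rot_induction (P := fun c => ∀ {μ : ℝ × ℝ × ℝ}, Pos3 μ → Cone c →
    Cone (Straightening.slideMap μ c)) ?_ ?_ c
  · intro R S T hR hS μ hμ hc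
    have h1 := add_slide_nonneg hμ.2.2 (sub_nonneg.2 hR) (sub_nonneg.2 hS)
    have h2 := sub_slide_nonneg hμ.2.2 (sub_nonneg.2 hR) (sub_nonneg.2 hS)
    obtain ⟨h3, h4⟩ := add_slide_eq hμ.2.2 (sub_nonneg.2 hR) (sub_nonneg.2 hS)
    have hcR : 0 ≤ R := hc.1
    have hcS : 0 ≤ S := hc.2.1
    have hT : 0 ≤ T := hc.2.2.1
    have hpos : 0 < R * S + S * T + T * R := hc.2.2.2
    rw [slideMap_of_min hR hS]
    refine ⟨by dsimp only; linarith, by dsimp only; linarith, hT, ?_⟩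
    dsimp only
    set d := slide μ.2.2 (R - T) (S - T)
    rcases hT.eq_or_lt with h0 | h0
    · rw [← h0] at h3 h4 hpos ⊢
      simp only [sub_zero, mul_zero, add_zero, zero_mul] at *
      have hR0 : 0 < R := lt_of_le_of_ne hcR (by rintro rfl; simp at hpos)
      have hS0 : 0 < S := lt_of_le_of_ne hcS (by rintro rfl; simp at hpos)
      have := hμ.2.2
      rw [h3, h4]
      positivity
    · have : 0 < R + S := by nlinarith
      nlinarith [mul_nonneg (show 0 ≤ R + d by linarith) (show 0 ≤ S - d by linarith), mul_pos h0 this]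
  · intro c h μ hμ hc
    have := h hμ.rot (cone_rot.2 hc)
    rwa [slideMap_rot, cone_rot] at this

lemma slideMap_side {μ : ℝ × ℝ × ℝ} {R S : ℝ} (hμ : Pos3 μ) (hR : 0 ≤ R) (hS : 0 ≤ S) :
    slideMap μ (R, S, 0) =
      (μ.2.2 * R * (R + S) / (μ.2.2 * R + S), S * (R + S) / (μ.2.2 * R + S), 0) := by
  obtain ⟨h1, h2⟩ := add_slide_eq hμ.2.2 hR hS
  rw [slideMap_of_min hR hS, sub_zero, sub_zero, h1, h2]

/-! ### Ideal triangles in hyperbolic 3-space -/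

/-- The coefficient that makes `wt a b c • ray a` independent of representatives and equivariant. -/
def wt (a b c : CP1) : ℝ := ‖det2 b.rep c.rep‖ / (‖det2 a.rep b.rep‖ * ‖det2 a.rep c.rep‖)

/-- The light-like vector at the vertex `a` of the ideal triangle `a, b, c`, normalised so that the
three of them have pairwise product `1` for the quadratic form `det`. -/
def vertexMat (a b c : CP1) : Matrix (Fin 2) (Fin 2) ℂ := (wt a b c : ℂ) • ray a

/-- The combination of the vertices `a, b, c` with coefficients `x`. -/
def combMat (a b c : CP1) (x : ℝ × ℝ × ℝ) : Matrix (Fin 2) (Fin 2) ℂ :=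
  (x.1 : ℂ) • vertexMat a b c + (x.2.1 : ℂ) • vertexMat b c a + (x.2.2 : ℂ) • vertexMat c a b

/-- The second elementary symmetric function. -/
def e2 (x : ℝ × ℝ × ℝ) : ℝ := x.1 * x.2.1 + x.2.1 * x.2.2 + x.2.2 * x.1

lemma norm_det2_swap (v w : Fin 2 → ℂ) : ‖det2 v w‖ = ‖det2 w v‖ := by
  rw [det2_swap w v, norm_neg]

lemma wt_swap (a b c : CP1) : wt a b c = wt a c b := by
  rw [wt, wt, norm_det2_swap b.rep, mul_comm]

lemma wt_pos {a b c : CP1} (hab : a ≠ b) (hbc : b ≠ c) (hca : c ≠ a) : 0 < wt a b c := by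
  have h1 := norm_pos_iff.2 (det2_rep_ne_zero.2 hab)
  have h2 := norm_pos_iff.2 (det2_rep_ne_zero.2 hbc)
  have h3 := norm_pos_iff.2 (det2_rep_ne_zero.2 hca.symm)
  rw [wt]; positivity

lemma vertexMat_mk (u v w : Fin 2 → ℂ) (hu : u ≠ 0) (hv : v ≠ 0) (hw : w ≠ 0) :
    vertexMat (Projectivization.mk ℂ u hu) (Projectivization.mk ℂ v hv) (Projectivization.mk ℂ w hw) =
      ((‖det2 v w‖ / (‖det2 u v‖ * ‖det2 u w‖) : ℝ) : ℂ) • Matrix.vecMulVec u (star u) := by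
  obtain ⟨x, hx, ex⟩ := exists_rep_mk u hu
  obtain ⟨y, hy, ey⟩ := exists_rep_mk v hv
  obtain ⟨z, hz, ez⟩ := exists_rep_mk w hw
  have hx' : (‖x‖ : ℂ) ≠ 0 := by simpa using hx
  have hy' : (‖y‖ : ℂ) ≠ 0 := by simpa using hy
  have hz' : (‖z‖ : ℂ) ≠ 0 := by simpa using hz
  have hn : x * (starRingEnd ℂ) x = (‖x‖ : ℂ) ^ 2 := by
    rw [Complex.mul_conj, Complex.normSq_eq_norm_sq]; simp
  rw [vertexMat, wt, ray, ex, ey, ez, det2_smul, det2_smul, det2_smul]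
  ext i j
  simp only [Matrix.smul_apply, Matrix.vecMulVec_apply, Pi.smul_apply, Pi.star_apply, smul_eq_mul,
    norm_mul, Complex.ofReal_div, Complex.ofReal_mul, star_mul', Complex.star_def]
  rw [show x * u i * ((starRingEnd ℂ) x * (starRingEnd ℂ) (u j)) =
    (x * (starRingEnd ℂ) x) * (u i * (starRingEnd ℂ) (u j)) by ring, hn,
    show (‖y‖ : ℂ) * ‖z‖ * ‖det2 v w‖ / (‖x‖ * ‖y‖ * ‖det2 u v‖ * (‖x‖ * ‖z‖ * ‖det2 u w‖)) =
      (‖y‖ * ‖z‖) * ‖det2 v w‖ / ((‖y‖ * ‖z‖) * (‖x‖ ^ 2 * (‖det2 u v‖ * ‖det2 u w‖))) by ring_nf,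
    mul_div_mul_left _ _ (mul_ne_zero hy' hz'), ← mul_assoc, mul_comm ((‖x‖ : ℂ) ^ 2), ← div_div,
    div_mul_cancel₀ _ (pow_ne_zero 2 hx')]

lemma vertexMat_smul (g : SL(2, ℂ)) (a b c : CP1) :
    (g : Matrix (Fin 2) (Fin 2) ℂ) * vertexMat a b c * (g : Matrix (Fin 2) (Fin 2) ℂ).conjTranspose =
      vertexMat (g • a) (g • b) (g • c) := by
  obtain ⟨u, hu, rfl⟩ := exists_mk a
  obtain ⟨v, hv, rfl⟩ := exists_mk b
  obtain ⟨w, hw, rfl⟩ := exists_mk c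
  obtain ⟨_, e₁⟩ := smul_mk_eq g u hu
  obtain ⟨_, e₂⟩ := smul_mk_eq g v hv
  obtain ⟨_, e₃⟩ := smul_mk_eq g w hw
  rw [e₁, e₂, e₃, vertexMat_mk, vertexMat_mk, det2_mulVec, det2_mulVec, det2_mulVec,
    Matrix.mul_smul, Matrix.smul_mul, Matrix.mul_vecMulVec, Matrix.vecMulVec_mul, Matrix.star_mulVec]

lemma combMat_smul (g : SL(2, ℂ)) (a b c : CP1) (x : ℝ × ℝ × ℝ) :
    (g : Matrix (Fin 2) (Fin 2) ℂ) * combMat a b c x *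
      (g : Matrix (Fin 2) (Fin 2) ℂ).conjTranspose = combMat (g • a) (g • b) (g • c) x := by
  simp only [combMat, Matrix.mul_add, Matrix.add_mul, Matrix.mul_smul, Matrix.smul_mul,
    vertexMat_smul]

lemma combMat_rot (a b c : CP1) (x : ℝ × ℝ × ℝ) : combMat b c a (rot x) = combMat a b c x := by
  simp only [combMat, rot]
  abel

lemma e2_rot (x : ℝ × ℝ × ℝ) : e2 (rot x) = e2 x := by simp only [e2, rot]; ring

lemma det_ray_comb (a b c : CP1) (r s t : ℝ) :
    ((r : ℂ) • ray a + (s : ℂ) • ray b + (t : ℂ) • ray c).det =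
      ((r * s * ‖det2 a.rep b.rep‖ ^ 2 + s * t * ‖det2 b.rep c.rep‖ ^ 2 +
        t * r * ‖det2 c.rep a.rep‖ ^ 2 : ℝ) : ℂ) := by
  have h : ∀ z : ℂ, (‖z‖ : ℂ) ^ 2 = z * star z := fun z => by
    rw [Complex.star_def, Complex.mul_conj, Complex.normSq_eq_norm_sq, Complex.ofReal_pow]
  push_cast
  simp only [h]
  simp only [Matrix.det_fin_two, Matrix.add_apply, Matrix.smul_apply, ray, Matrix.vecMulVec_apply,
    det2, Pi.star_apply, smul_eq_mul, star_sub, star_mul']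
  ring

lemma det_combMat {a b c : CP1} (hab : a ≠ b) (hbc : b ≠ c) (hca : c ≠ a) (x : ℝ × ℝ × ℝ) :
    (combMat a b c x).det = (e2 x : ℂ) := by
  have h1 := (norm_pos_iff.2 (det2_rep_ne_zero.2 hab)).ne'
  have h2 := (norm_pos_iff.2 (det2_rep_ne_zero.2 hbc)).ne'
  have h3 := (norm_pos_iff.2 (det2_rep_ne_zero.2 hca)).ne'
  have := det_ray_comb a b c (x.1 * wt a b c) (x.2.1 * wt b c a) (x.2.2 * wt c a b)
  simp only [combMat, vertexMat, smul_smul, ← Complex.ofReal_mul]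
  rw [this]
  congr 1
  rw [wt, wt, wt, norm_det2_swap a.rep c.rep, norm_det2_swap b.rep a.rep, norm_det2_swap c.rep b.rep,
    e2]
  field_simp

lemma posDef_combMat {a b c : CP1} (hab : a ≠ b) (hbc : b ≠ c) (hca : c ≠ a) {x : ℝ × ℝ × ℝ}
    (hx : Cone x) : (combMat a b c x).PosDef := by
  have hs : ∀ a b c : CP1, (vertexMat a b c).PosSemidef := fun a b c =>
    (Matrix.posSemidef_vecMulVec_self_star _).smul (by
      rw [Complex.zero_le_real]; unfold wt; positivity)
  have h : (combMat a b c x).PosSemidef :=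
    (((hs a b c).smul (Complex.zero_le_real.2 hx.1)).add
      ((hs b c a).smul (Complex.zero_le_real.2 hx.2.1))).add
      ((hs c a b).smul (Complex.zero_le_real.2 hx.2.2.1))
  rw [h.posDef_iff_det_ne_zero, det_combMat hab hbc hca]
  exact_mod_cast hx.2.2.2.ne'

/-- The combination of the vertices with coefficients `x`, scaled to determinant one. -/
def normMat (a b c : CP1) (x : ℝ × ℝ × ℝ) : Matrix (Fin 2) (Fin 2) ℂ :=
  (((√(e2 x))⁻¹ : ℝ) : ℂ) • combMat a b c x

lemma normMat_mem {a b c : CP1} (hab : a ≠ b) (hbc : b ≠ c) (hca : c ≠ a) {x : ℝ × ℝ × ℝ}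
    (hx : Cone x) : (normMat a b c x).PosDef ∧ (normMat a b c x).det = 1 := by
  have h0 : 0 < e2 x := hx.2.2.2
  have hs := Real.sqrt_pos.2 h0
  refine ⟨(posDef_combMat hab hbc hca hx).smul (by
    rw [Complex.zero_lt_real]; positivity), ?_⟩
  rw [normMat, Matrix.det_smul, det_combMat hab hbc hca, Fintype.card_fin, ← Complex.ofReal_pow,
    ← Complex.ofReal_mul, inv_pow, Real.sq_sqrt h0.le, inv_mul_cancel₀ h0.ne']
  simp

lemma normMat_smul (g : SL(2, ℂ)) (a b c : CP1) (x : ℝ × ℝ × ℝ) :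
    (g : Matrix (Fin 2) (Fin 2) ℂ) * normMat a b c x *
      (g : Matrix (Fin 2) (Fin 2) ℂ).conjTranspose = normMat (g • a) (g • b) (g • c) x := by
  rw [normMat, Matrix.mul_smul, Matrix.smul_mul, combMat_smul, normMat]

lemma normMat_rot (a b c : CP1) (x : ℝ × ℝ × ℝ) : normMat b c a (rot x) = normMat a b c x := by
  rw [normMat, normMat, combMat_rot, e2_rot]

/-- The value at `X` of the (exponentiated) horofunction centred at `a`. -/
def horo (a : CP1) (X : Matrix (Fin 2) (Fin 2) ℂ) : ℝ :=
  (star (a.rep 1) * X 0 0 * a.rep 1 - star (a.rep 1) * X 1 0 * a.rep 0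
    - star (a.rep 0) * X 0 1 * a.rep 1 + star (a.rep 0) * X 1 1 * a.rep 0).re

lemma horo_ray_comb (a a₁ a₂ a₃ : CP1) (r s t : ℝ) :
    horo a ((r : ℂ) • ray a₁ + (s : ℂ) • ray a₂ + (t : ℂ) • ray a₃) =
      r * ‖det2 a.rep a₁.rep‖ ^ 2 + s * ‖det2 a.rep a₂.rep‖ ^ 2 + t * ‖det2 a.rep a₃.rep‖ ^ 2 := by
  have h : ∀ z : ℂ, (‖z‖ : ℂ) ^ 2 = z * star z := fun z => by
    rw [Complex.star_def, Complex.mul_conj, Complex.normSq_eq_norm_sq, Complex.ofReal_pow]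
  rw [horo, ← Complex.ofReal_re (r * _ + s * _ + t * _)]
  congr 1
  push_cast
  simp only [h]
  simp only [Matrix.add_apply, Matrix.smul_apply, ray, Matrix.vecMulVec_apply,
    det2, Pi.star_apply, smul_eq_mul, star_sub, star_mul']
  ring

/-- The coordinates of a point with respect to the vertices `a, b, c`. -/
def coords (a b c : CP1) (X : Matrix (Fin 2) (Fin 2) ℂ) : ℝ × ℝ × ℝ :=
  let u := wt a b c * horo a X
  let v := wt b c a * horo b X
  let w := wt c a b * horo c X
  ((v + w - u) / 2, (u + w - v) / 2, (u + v - w) / 2)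

lemma coords_combMat {a b c : CP1} (hab : a ≠ b) (hbc : b ≠ c) (hca : c ≠ a) (x : ℝ × ℝ × ℝ) :
    coords a b c (combMat a b c x) = x := by
  have h1 := (norm_pos_iff.2 (det2_rep_ne_zero.2 hab)).ne'
  have h2 := (norm_pos_iff.2 (det2_rep_ne_zero.2 hbc)).ne'
  have h3 := (norm_pos_iff.2 (det2_rep_ne_zero.2 hca)).ne'
  have h0 : ∀ v : Fin 2 → ℂ, det2 v v = 0 := fun v => by rw [det2]; ring
  have key := fun a' : CP1 =>
    horo_ray_comb a' a b c (x.1 * wt a b c) (x.2.1 * wt b c a) (x.2.2 * wt c a b)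
  simp only [combMat, vertexMat, smul_smul, ← Complex.ofReal_mul, coords, key, h0, norm_zero]
  simp only [wt, norm_det2_swap a.rep c.rep, norm_det2_swap b.rep a.rep, norm_det2_swap c.rep b.rep]
  refine Prod.ext ?_ (Prod.ext ?_ ?_) <;> dsimp only <;> field_simp <;> ring

lemma continuous_coords (a b c : CP1) : Continuous fun X : H3 => coords a b c X.1 := by
  have h : ∀ i j, Continuous fun X : H3 => X.1 i j := fun i j =>
    (continuous_id.matrix_elem i j).comp continuous_subtype_val
  have hh : ∀ a : CP1, Continuous fun X : H3 => horo a X.1 := by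
    intro a
    have h00 := h 0 0
    have h01 := h 0 1
    have h10 := h 1 0
    have h11 := h 1 1
    exact Complex.continuous_re.comp (((((continuous_const.mul h00).mul continuous_const).sub
      ((continuous_const.mul h10).mul continuous_const)).sub
      ((continuous_const.mul h01).mul continuous_const)).add
      ((continuous_const.mul h11).mul continuous_const))
  have ha := (continuous_const (y := wt a b c)).mul (hh a)
  have hb := (continuous_const (y := wt b c a)).mul (hh b)
  have hc := (continuous_const (y := wt c a b)).mul (hh c)
  exact (((hb.add hc).sub ha).div_const 2).prodMk
    ((((ha.add hc).sub hb).div_const 2).prodMk (((ha.add hb).sub hc).div_const 2))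

lemma coords_smul_normMat {a b c : CP1} (hab : a ≠ b) (hbc : b ≠ c) (hca : c ≠ a) (x : ℝ × ℝ × ℝ) :
    coords a b c (normMat a b c x) = (√(e2 x))⁻¹ • x := by
  have : normMat a b c x = combMat a b c ((√(e2 x))⁻¹ • x) := by
    simp only [normMat, combMat, smul_add, smul_smul, Prod.smul_fst, Prod.smul_snd, smul_eq_mul,
      Complex.ofReal_mul]
  rw [this, coords_combMat hab hbc hca]

lemma e2_smul (k : ℝ) (x : ℝ × ℝ × ℝ) : e2 (k • x) = k ^ 2 * e2 x := by
  simp only [e2, Prod.smul_fst, Prod.smul_snd, smul_eq_mul]; ring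

lemma Cone.smul {k : ℝ} (hk : 0 < k) {x : ℝ × ℝ × ℝ} (hx : Cone x) : Cone (k • x) := by
  refine ⟨mul_nonneg hk.le hx.1, mul_nonneg hk.le hx.2.1, mul_nonneg hk.le hx.2.2.1, ?_⟩
  have := e2_smul k x
  rw [e2] at this
  rw [this]
  have : 0 < e2 x := hx.2.2.2
  positivity

lemma normMat_smul_right {k : ℝ} (hk : 0 < k) (a b c : CP1) (x : ℝ × ℝ × ℝ) :
    normMat a b c (k • x) = normMat a b c x := by
  have : combMat a b c (k • x) = (k : ℂ) • combMat a b c x := by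
    simp only [combMat, smul_add, smul_smul, Prod.smul_fst, Prod.smul_snd, smul_eq_mul,
      Complex.ofReal_mul]
  rw [normMat, this, e2_smul, Real.sqrt_mul (by positivity), Real.sqrt_sq hk.le, smul_smul, normMat,
    ← Complex.ofReal_mul, mul_inv, mul_comm k⁻¹, inv_mul_cancel_right₀ hk.ne']

lemma exists_normMat_eq {a b c : CP1} (hab : a ≠ b) (hbc : b ≠ c) (hca : c ≠ a) {X : H3}
    (hX : X ∈ idealTriangle3 a b c) : ∃ x, Cone x ∧ e2 x = 1 ∧ X.1 = normMat a b c x := by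
  obtain ⟨r, s, t, hr, hs, ht, e⟩ := hX
  have w1 := wt_pos hab hbc hca
  have w2 := wt_pos hbc hca hab
  have w3 := wt_pos hca hab hbc
  have hc : X.1 = combMat a b c (r / wt a b c, s / wt b c a, t / wt c a b) := by
    rw [e]
    simp only [combMat, vertexMat, smul_smul, ← Complex.ofReal_mul, div_mul_cancel₀ _ w1.ne',
      div_mul_cancel₀ _ w2.ne', div_mul_cancel₀ _ w3.ne']
  have h1 : e2 (r / wt a b c, s / wt b c a, t / wt c a b) = 1 := by
    have := X.2.2
    rw [hc, det_combMat hab hbc hca] at this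
    exact_mod_cast this
  refine ⟨_, ⟨?_, ?_, ?_, ?_⟩, h1, ?_⟩
  · dsimp only; positivity
  · dsimp only; positivity
  · dsimp only; positivity
  · change 0 < e2 _; rw [h1]; norm_num
  · rw [hc, normMat, h1]; simp

lemma normMat_mem_idealTriangle3 {a b c : CP1} {x : ℝ × ℝ × ℝ} (hx : Cone x) {X : H3}
    (hX : X.1 = normMat a b c x) : X ∈ idealTriangle3 a b c := by
  have hw : ∀ a b c, 0 ≤ wt a b c := fun a b c => by unfold wt; positivity
  refine ⟨(√(e2 x))⁻¹ * (x.1 * wt a b c), (√(e2 x))⁻¹ * (x.2.1 * wt b c a),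
    (√(e2 x))⁻¹ * (x.2.2 * wt c a b), ?_, ?_, ?_, ?_⟩
  · exact mul_nonneg (by positivity) (mul_nonneg hx.1 (hw _ _ _))
  · exact mul_nonneg (by positivity) (mul_nonneg hx.2.1 (hw _ _ _))
  · exact mul_nonneg (by positivity) (mul_nonneg hx.2.2.1 (hw _ _ _))
  · rw [hX]
    simp only [normMat, combMat, vertexMat, smul_add, smul_smul, Complex.ofReal_mul]

lemma mem_geodesic3_iff {a b c : CP1} (hab : a ≠ b) (hbc : b ≠ c) (hca : c ≠ a) {x : ℝ × ℝ × ℝ}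
    (hx : Cone x) {X : H3} (hX : X.1 = normMat a b c x) : X ∈ geodesic3 a b ↔ x.2.2 = 0 := by
  have h0 : 0 < √(e2 x) := Real.sqrt_pos.2 hx.2.2.2
  have hw : ∀ a b c, 0 ≤ wt a b c := fun a b c => by unfold wt; positivity
  constructor
  · rintro ⟨r, s, hr, hs, e⟩
    have hc : X.1 = combMat a b c (r / wt a b c, s / wt b c a, 0) := by
      rw [e]
      simp only [combMat, vertexMat, smul_smul, ← Complex.ofReal_mul,
        div_mul_cancel₀ _ (wt_pos hab hbc hca).ne', div_mul_cancel₀ _ (wt_pos hbc hca hab).ne']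
      simp
    have h1 := coords_combMat hab hbc hca (r / wt a b c, s / wt b c a, 0)
    rw [← hc, hX, coords_smul_normMat hab hbc hca] at h1
    have h2 : (√(e2 x))⁻¹ * x.2.2 = 0 := congrArg (fun y : ℝ × ℝ × ℝ => y.2.2) h1
    exact (mul_eq_zero.1 h2).resolve_left (inv_pos.2 h0).ne'
  · intro h
    refine ⟨(√(e2 x))⁻¹ * (x.1 * wt a b c), (√(e2 x))⁻¹ * (x.2.1 * wt b c a), ?_, ?_, ?_⟩
    · exact mul_nonneg (by positivity) (mul_nonneg hx.1 (hw _ _ _))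
    · exact mul_nonneg (by positivity) (mul_nonneg hx.2.1 (hw _ _ _))
    · rw [hX]
      simp only [normMat, combMat, vertexMat, smul_add, smul_smul, Complex.ofReal_mul, h]
      simp

/-! ### Maps between ideal triangles that slide the sides -/

/-- The coordinates of a point of the hyperbolic plane with respect to an ideal triangle. -/
def triCoords (p q r : RP1) (z : ℍ) : ℝ × ℝ × ℝ := (lam q r z, lam r p z, lam p q z)

lemma triCoords_rot (p q r : RP1) (z : ℍ) : triCoords q r p z = rot (triCoords p q r z) := rfl

lemma continuous_triCoords (p q r : RP1) : Continuous (triCoords p q r) :=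
  (continuous_lam q r).prodMk ((continuous_lam r p).prodMk (continuous_lam p q))

lemma e2_triCoords {p q r : RP1} (h : CCW p q r) (z : ℍ) : e2 (triCoords p q r z) = 1 :=
  lam_quadric h z

lemma cone_triCoords {p q r : RP1} (h : CCW p q r) {z : ℍ} :
    Cone (triCoords p q r z) ↔ z ∈ idealTriangle p q r := by
  rw [mem_idealTriangle_iff h]
  constructor
  · rintro ⟨h1, h2, h3, -⟩
    exact ⟨h3, h1, h2⟩
  · rintro ⟨h1, h2, h3⟩
    refine ⟨h2, h3, h1, ?_⟩
    have := e2_triCoords h z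
    rw [e2] at this
    rw [this]; norm_num

lemma exists_chart {p q r : RP1} (h : CCW p q r) : ∃ g : SL(2, ℝ), ∀ z : ℍ,
    ((g⁻¹ • z : ℍ) : ℂ) = ((triCoords p q r z).2.1 + Complex.I) /
      ((triCoords p q r z).1 + (triCoords p q r z).2.1) := by
  obtain ⟨g, rfl, rfl, rfl⟩ := h
  refine ⟨g, fun z => ?_⟩
  have h1 : lam (g • inftyPt ℝ) (g • zeroPt ℝ) z = (g⁻¹ • z).re / (g⁻¹ • z).im := by
    have := lam_smul g (inftyPt ℝ) (realPt 0) (g⁻¹ • z)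
    rwa [smul_inv_smul, lam_infty_realPt, sub_zero, ← zeroPt_eq] at this
  have h2 : lam (g • onePt ℝ) (g • inftyPt ℝ) z = (1 - (g⁻¹ • z).re) / (g⁻¹ • z).im := by
    have := lam_smul g (inftyPt ℝ) (realPt 1) (g⁻¹ • z)
    rw [smul_inv_smul, lam_infty_realPt, ← onePt_eq] at this
    rw [lam_swap, this, ← neg_div, neg_sub]
  simp only [triCoords, h1, h2]
  have hy : ((g⁻¹ • z).im : ℂ) ≠ 0 := by exact_mod_cast (g⁻¹ • z).im_pos.ne'
  rw [← Complex.re_add_im ((g⁻¹ • z : ℍ) : ℂ)]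
  simp only [UpperHalfPlane.coe_re, UpperHalfPlane.coe_im]
  push_cast
  field_simp
  ring

lemma exists_triCoords_eq {p q r : RP1} (h : CCW p q r) {x : ℝ × ℝ × ℝ} (hx : Cone x)
    (h1 : e2 x = 1) : ∃ z, triCoords p q r z = x := by
  obtain ⟨z, e1, e2, e3⟩ := exists_lam_eq h hx.1 hx.2.1 h1
  exact ⟨z, Prod.ext e1 (Prod.ext e2 e3)⟩

lemma isEmbedding_of_continuousOn {X Y Z : Type*} [TopologicalSpace X] [TopologicalSpace Y]
    [TopologicalSpace Z] {f : X → Y} {g : Y → Z} (hf : Continuous f) (hg : ContinuousOn g (range f))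
    (h : IsEmbedding (g ∘ f)) : IsEmbedding f := by
  have h' : IsEmbedding (rangeFactorization f) :=
    IsEmbedding.of_comp (g := (range f).domRestrict g) (hf.subtype_mk _) hg.domRestrict h
  exact IsEmbedding.subtypeVal.comp h'

section Piece

variable {p q r : RP1} {a b c : CP1} {μ : ℝ × ℝ × ℝ} {f : ℍ → H3}

lemma cone_triSlide (h : CCW p q r) (hμ : Pos3 μ) {z : ℍ} (hz : z ∈ idealTriangle p q r) :
    Cone (slideMap μ (triCoords p q r z)) :=
  Cone.slideMap hμ ((cone_triCoords h).2 hz)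

lemma continuous_domRestrict_slide (h : CCW p q r) (hμ : Pos3 μ)
    (hf : ∀ z ∈ idealTriangle p q r, (f z).1 = normMat a b c (slideMap μ (triCoords p q r z))) :
    Continuous ((idealTriangle p q r).domRestrict f) := by
  suffices hh : Continuous fun z : idealTriangle p q r =>
      normMat a b c (slideMap μ (triCoords p q r z.1)) from
    continuous_induced_rng.2 (hh.congr fun z => (hf z.1 z.2).symm)
  have hx : Continuous fun z : idealTriangle p q r => slideMap μ (triCoords p q r z.1) :=
    (continuous_slideMap hμ).comp ((continuous_triCoords p q r).comp continuous_subtype_val)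
  have he : Continuous fun z : idealTriangle p q r => e2 (slideMap μ (triCoords p q r z.1)) := by
    unfold e2
    fun_prop
  have hs : Continuous fun z : idealTriangle p q r =>
      (((√(e2 (slideMap μ (triCoords p q r z.1))))⁻¹ : ℝ) : ℂ) :=
    Complex.continuous_ofReal.comp ((Real.continuous_sqrt.comp he).inv₀
      fun z => (Real.sqrt_pos.2 (cone_triSlide h hμ z.2).2.2.2).ne')
  unfold normMat combMat
  refine hs.smul ((Continuous.add ?_ ?_).add ?_)
  · exact (Complex.continuous_ofReal.comp (continuous_fst.comp hx)).smul continuous_const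
  · exact (Complex.continuous_ofReal.comp (continuous_fst.comp (continuous_snd.comp hx))).smul
      continuous_const
  · exact (Complex.continuous_ofReal.comp (continuous_snd.comp (continuous_snd.comp hx))).smul
      continuous_const

lemma isEmbedding_slide (h : CCW p q r) (hab : a ≠ b) (hbc : b ≠ c) (hca : c ≠ a) (hμ : Pos3 μ)
    (hf : ∀ z ∈ idealTriangle p q r, (f z).1 = normMat a b c (slideMap μ (triCoords p q r z))) :
    IsEmbedding ((idealTriangle p q r).domRestrict f) := by
  obtain ⟨g, hg⟩ := exists_chart h
  -- a left inverse in the upper half-plane chart in which `p, q, r` are `0, 1, ∞`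
  let F : ℝ × ℝ × ℝ → ℂ := fun x => ((x.2.1 : ℂ) + (√(e2 x) : ℝ) * Complex.I) / ((x.1 + x.2.1 : ℝ) : ℂ)
  let G : H3 → ℂ := fun X => F (slideMap (inv3 μ) (coords a b c X.1))
  have hFk : ∀ (k : ℝ) (x : ℝ × ℝ × ℝ), 0 < k → F (k • x) = F x := by
    intro k x hk
    have hk' : (k : ℂ) ≠ 0 := by exact_mod_cast hk.ne'
    simp only [F, e2_smul, Real.sqrt_mul (sq_nonneg k), Real.sqrt_sq hk.le, Prod.smul_fst,
      Prod.smul_snd, smul_eq_mul, ← mul_add]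
    push_cast
    rw [mul_assoc, ← mul_add, mul_div_mul_left _ _ hk']
  have hsum : ∀ {x}, Cone x → 0 < x.1 + x.2.1 := by
    rintro x ⟨h1, h2, h3, h4⟩
    by_contra h0
    have e1 : x.1 = 0 := by linarith
    have e2 : x.2.1 = 0 := by linarith
    simp [e1, e2] at h4
  have key : ∀ z ∈ idealTriangle p q r, slideMap (inv3 μ) (coords a b c (f z).1) =
      (√(e2 (slideMap μ (triCoords p q r z))))⁻¹ • triCoords p q r z := by
    intro z hz
    rw [hf z hz, coords_smul_normMat hab hbc hca, slideMap_mul (by positivity), slideMap_slideMap hμ]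
  refine isEmbedding_of_continuousOn (g := G) (continuous_domRestrict_slide h hμ hf) ?_ ?_
  · have hc : Continuous fun X : H3 => slideMap (inv3 μ) (coords a b c X.1) :=
      (continuous_slideMap hμ.inv3).comp (continuous_coords a b c)
    have c1 : Continuous fun X : H3 => (slideMap (inv3 μ) (coords a b c X.1)).1 :=
      continuous_fst.comp hc
    have c2 : Continuous fun X : H3 => (slideMap (inv3 μ) (coords a b c X.1)).2.1 :=
      continuous_fst.comp (continuous_snd.comp hc)
    have c3 : Continuous fun X : H3 => e2 (slideMap (inv3 μ) (coords a b c X.1)) := by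
      have : Continuous e2 := by unfold e2; fun_prop
      exact this.comp hc
    refine ContinuousOn.div (Continuous.continuousOn ?_) (Continuous.continuousOn ?_) ?_
    · exact (Complex.continuous_ofReal.comp c2).add
        ((Complex.continuous_ofReal.comp (Real.continuous_sqrt.comp c3)).mul continuous_const)
    · exact Complex.continuous_ofReal.comp (c1.add c2)
    · rintro _ ⟨z, rfl⟩
      have h0 : 0 < (√(e2 (slideMap μ (triCoords p q r z.1))))⁻¹ :=
        inv_pos.2 (Real.sqrt_pos.2 (cone_triSlide h hμ z.2).2.2.2)
      have := hsum (Cone.smul h0 ((cone_triCoords h).2 z.2))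
      rw [← key z.1 z.2] at this
      exact_mod_cast this.ne'
  · have e : G ∘ (idealTriangle p q r).domRestrict f =
        fun z : idealTriangle p q r => ((g⁻¹ • z.1 : ℍ) : ℂ) := by
      funext z
      have h0 : 0 < (√(e2 (slideMap μ (triCoords p q r z.1))))⁻¹ :=
        inv_pos.2 (Real.sqrt_pos.2 (cone_triSlide h hμ z.2).2.2.2)
      change F (slideMap (inv3 μ) (coords a b c (f z.1).1)) = _
      rw [key z.1 z.2, hFk _ _ h0, hg]
      simp only [F, e2_triCoords h]
      simp
    rw [e]
    exact UpperHalfPlane.isEmbedding_coe.comp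
      ((Homeomorph.smul g⁻¹).isEmbedding.comp IsEmbedding.subtypeVal)

lemma image_idealTriangle_slide (h : CCW p q r) (hab : a ≠ b) (hbc : b ≠ c) (hca : c ≠ a)
    (hμ : Pos3 μ)
    (hf : ∀ z ∈ idealTriangle p q r, (f z).1 = normMat a b c (slideMap μ (triCoords p q r z))) :
    f '' idealTriangle p q r = idealTriangle3 a b c ∧ f '' geodesic p q = geodesic3 a b := by
  have surj : ∀ X ∈ idealTriangle3 a b c, ∃ z ∈ idealTriangle p q r, f z = X := by
    intro X hX
    obtain ⟨x, hx, -, e⟩ := exists_normMat_eq hab hbc hca hX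
    have hy := Cone.slideMap hμ.inv3 hx
    have hp : 0 < e2 (slideMap (inv3 μ) x) := hy.2.2.2
    have h0 : 0 < √(e2 (slideMap (inv3 μ) x)) := Real.sqrt_pos.2 hp
    obtain ⟨z, hz⟩ := exists_triCoords_eq h (Cone.smul (inv_pos.2 h0) hy) (by
      rw [e2_smul, inv_pow, Real.sq_sqrt hp.le, inv_mul_cancel₀ hp.ne'])
    have hzm : z ∈ idealTriangle p q r :=
      (cone_triCoords h).1 (hz ▸ Cone.smul (inv_pos.2 h0) hy)
    refine ⟨z, hzm, Subtype.ext ?_⟩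
    rw [hf z hzm, hz, slideMap_mul (inv_pos.2 h0).le, slideMap_slideMap' hμ,
      normMat_smul_right (inv_pos.2 h0), e]
  have hsub : geodesic p q ⊆ idealTriangle p q r := by
    rintro z ⟨r', s', hr, hs, e⟩
    exact ⟨r', s', 0, hr, hs, le_rfl, by rw [e]; simp⟩
  have hsub3 : geodesic3 a b ⊆ idealTriangle3 a b c := by
    rintro z ⟨r', s', hr, hs, e⟩
    exact ⟨r', s', 0, hr, hs, le_rfl, by rw [e]; simp⟩
  have hside : ∀ z ∈ idealTriangle p q r, f z ∈ geodesic3 a b ↔ z ∈ geodesic p q := by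
    intro z hz
    rw [mem_geodesic3_iff hab hbc hca (cone_triSlide h hμ hz) (hf z hz), mem_geodesic_iff h.ne12]
    have hz0 := (cone_triCoords h).2 hz
    have h0 : ∀ {ν x : ℝ × ℝ × ℝ}, Pos3 ν → Cone x → x.2.2 = 0 → (slideMap ν x).2.2 = 0 := by
      rintro ν ⟨R, S, T⟩ hν hx rfl
      rw [slideMap_side hν hx.1 hx.2.1]
    constructor
    · intro h1
      have := h0 hμ.inv3 (Cone.slideMap hμ hz0) h1
      rwa [slideMap_slideMap hμ] at this
    · exact h0 hμ hz0
  refine ⟨Subset.antisymm ?_ fun X hX => surj X hX, Subset.antisymm ?_ fun X hX => ?_⟩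
  · rintro _ ⟨z, hz, rfl⟩
    exact normMat_mem_idealTriangle3 (cone_triSlide h hμ hz) (hf z hz)
  · rintro _ ⟨z, hz, rfl⟩
    exact (hside z (hsub hz)).2 hz
  · obtain ⟨z, hz, rfl⟩ := surj X (hsub3 hX)
    exact ⟨z, (hside z hz).1 hX, rfl⟩

end Piece

/-! ### Matching along a common side -/

lemma lam_eq_crossRatio_mul {p q r s : RP1} (hpq : p ≠ q) (hqr : q ≠ r) (hsq : s ≠ q)
    {z : ℍ} (hz : lam p q z = 0) (hpr : p ≠ r) :
    lam s q z = crossRatio p s q r * lam q r z := by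
  have h1 := det2_rep_ne_zero.2 hpq
  have h2 := det2_rep_ne_zero.2 hqr
  have h3 := det2_rep_ne_zero.2 hsq
  have h4 := det2_rep_ne_zero.2 hpr
  simp only [lam, crossRatio] at *
  have hz' : pairing p.rep q.rep z = 0 := by
    rw [neg_eq_zero, div_eq_zero_iff] at hz
    exact hz.resolve_right h1
  -- expand `s` and `r` in the basis `p, q`
  have hs : det2 p.rep q.rep * pairing s.rep q.rep z =
      det2 p.rep s.rep * pairing q.rep q.rep z := by
    have : det2 p.rep q.rep * pairing s.rep q.rep z = det2 s.rep q.rep * pairing p.rep q.rep z +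
        det2 p.rep s.rep * pairing q.rep q.rep z := by
      simp only [det2, pairing]; ring
    rw [this, hz', mul_zero, zero_add]
  have hr : det2 p.rep q.rep * pairing q.rep r.rep z =
      det2 p.rep r.rep * pairing q.rep q.rep z := by
    have : det2 p.rep q.rep * pairing q.rep r.rep z = det2 r.rep q.rep * pairing p.rep q.rep z +
        det2 p.rep r.rep * pairing q.rep q.rep z := by
      simp only [det2, pairing]; ring
    rw [this, hz', mul_zero, zero_add]
  have hs' : pairing s.rep q.rep z = det2 p.rep s.rep * pairing q.rep q.rep z / det2 p.rep q.rep := by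
    rw [eq_div_iff h1, ← hs]; ring
  have hr' : pairing q.rep r.rep z = det2 p.rep r.rep * pairing q.rep q.rep z / det2 p.rep q.rep := by
    rw [eq_div_iff h1, ← hr]; ring
  rw [hs', hr']
  field_simp

lemma lam_pos_of_side {p q r : RP1} (h : CCW p q r) {z : ℍ} (hz : lam p q z = 0) :
    0 < lam q r z ∧ 0 < lam r p z := by
  have hq := lam_quadric h z
  rw [hz] at hq
  simp only [mul_zero, zero_mul, add_zero] at hq
  -- the three coordinates have positive sum
  obtain ⟨g, hg⟩ := exists_chart h
  have him := (g⁻¹ • z).im_pos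
  have : ((g⁻¹ • z : ℍ) : ℂ).im = 1 / (lam q r z + lam r p z) := by
    rw [hg]
    simp only [triCoords]
    rw [← Complex.ofReal_add, Complex.div_ofReal_im]
    simp
  rw [UpperHalfPlane.coe_im] at this
  rw [this, one_div, inv_pos] at him
  constructor <;> by_contra h0 <;> nlinarith

lemma normMat_side {a b c : CP1} {μ : ℝ × ℝ × ℝ} (hμ : Pos3 μ) {R S : ℝ} (hR : 0 < R) (hS : 0 < S)
    (hRS : R * S = 1) : normMat a b c (slideMap μ (R, S, 0)) =
      ((√μ.2.2 * R * wt a b c : ℝ) : ℂ) • ray a + ((S / √μ.2.2 * wt b a c : ℝ) : ℂ) • ray b := by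
  have hm := hμ.2.2
  have hs : 0 < √μ.2.2 := Real.sqrt_pos.2 hm
  have hk : 0 < (R + S) / (μ.2.2 * R + S) := by positivity
  have e : slideMap μ (R, S, 0) = (√μ.2.2 * ((R + S) / (μ.2.2 * R + S))) •
      (√μ.2.2 * R, S / √μ.2.2, (0 : ℝ)) := by
    rw [slideMap_side hμ hR.le hS.le]
    have h2 : √μ.2.2 * √μ.2.2 = μ.2.2 := Real.mul_self_sqrt hm.le
    refine Prod.ext ?_ (Prod.ext ?_ ?_)
    · simp only [Prod.smul_mk, smul_eq_mul]
      rw [show √μ.2.2 * ((R + S) / (μ.2.2 * R + S)) * (√μ.2.2 * R) =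
        (√μ.2.2 * √μ.2.2) * ((R + S) / (μ.2.2 * R + S)) * R by ring, h2]
      ring
    · simp only [Prod.smul_mk, smul_eq_mul]
      rw [mul_comm √μ.2.2, mul_assoc, mul_div_cancel₀ _ hs.ne']
      ring
    · simp
  have e1 : e2 (√μ.2.2 * R, S / √μ.2.2, (0 : ℝ)) = 1 := by
    simp only [e2, mul_zero, zero_mul, add_zero]
    field_simp
    linarith
  rw [e, normMat_smul_right (mul_pos hs hk), normMat, e1, combMat]
  simp only [vertexMat, smul_smul, Real.sqrt_one, inv_one, Complex.ofReal_one, one_smul,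
    Complex.ofReal_zero, zero_mul, zero_smul, add_zero, ← Complex.ofReal_mul, wt_swap b c a]

/-- Two slid triangles agree on the common side if the parameter of this side is the quotient of
the cross-ratios. -/
lemma normMat_side_eq {p q r s : RP1} (h1 : CCW p q r) (h2 : CCW p s q) {a b c d : CP1}
    (hab : a ≠ b) (hbc : b ≠ c) (hca : c ≠ a) (had : a ≠ d) (hbd : b ≠ d) {μ ν : ℝ × ℝ × ℝ}
    (hμ : Pos3 μ) (hν : Pos3 ν)
    (e1 : μ.2.2 = crossRatio p s q r / ‖crossRatio a d b c‖) (e2 : ν.2.2 = μ.2.2) {z : ℍ}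
    (hz : z ∈ geodesic p q) :
    normMat a b c (slideMap μ (triCoords p q r z)) =
      normMat b a d (slideMap ν (triCoords q p s z)) := by
  rw [mem_geodesic_iff h1.ne12] at hz
  have hz' : lam q p z = 0 := by rw [lam_swap, hz, neg_zero]
  have key : ∀ {p q r s : RP1}, CCW p q r → CCW p s q → lam p q z = 0 → ∀ {a b c d : CP1},
      a ≠ b → b ≠ c → c ≠ a → a ≠ d → b ≠ d → ∀ {m : ℝ}, 0 < m →
      m = crossRatio p s q r / ‖crossRatio a d b c‖ →
      √m * lam q r z * wt a b c = lam s q z / √m * wt a b d := by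
    intro p q r s h1 h2 hz a b c d hab hbc hca had hbd m hm e
    rw [lam_eq_crossRatio_mul h1.ne12 h1.ne23 h2.ne23 hz h1.ne31.symm]
    have i1 := (norm_pos_iff.2 (det2_rep_ne_zero.2 hab))
    have i2 := (norm_pos_iff.2 (det2_rep_ne_zero.2 hbc))
    have i3 := (norm_pos_iff.2 (det2_rep_ne_zero.2 hca.symm))
    have i4 := (norm_pos_iff.2 (det2_rep_ne_zero.2 had))
    have i5 := (norm_pos_iff.2 (det2_rep_ne_zero.2 hbd))
    have hX : ‖crossRatio a d b c‖ = ‖det2 a.rep d.rep‖ * ‖det2 b.rep c.rep‖ /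
        (‖det2 b.rep d.rep‖ * ‖det2 a.rep c.rep‖) := by
      rw [crossRatio, norm_div, norm_mul, norm_mul, norm_det2_swap d.rep]
    have hs : 0 < √m := Real.sqrt_pos.2 hm
    have h2 : √m * √m = m := Real.mul_self_sqrt hm.le
    have e' : crossRatio p s q r = √m * √m * ‖crossRatio a d b c‖ := by
      rw [h2, e, div_mul_cancel₀]
      rw [hX]; positivity
    rw [e', hX, wt, wt]
    field_simp
  have q1 := lam_quadric h1 z
  have h2' : CCW q p s := ccw_rotate.1 (ccw_rotate.1 h2)
  have q2 := lam_quadric h2' z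
  rw [hz] at q1
  rw [hz'] at q2
  simp only [mul_zero, zero_mul, add_zero] at q1 q2
  obtain ⟨p1, p2⟩ := lam_pos_of_side h1 hz
  obtain ⟨p3, p4⟩ := lam_pos_of_side h2' hz'
  rw [triCoords, triCoords, hz, hz', normMat_side hμ p1 p2 q1, normMat_side hν p3 p4 q2, e2]
  rw [key h1 h2 hz hab hbc hca had hbd hμ.2.2 e1, add_comm]
  congr 3
  have := key h2' (ccw_rotate.1 h1) hz' hab.symm had (Ne.symm hbd) hbc hca.symm hμ.2.2
    (by rw [e1, crossRatio_rotate p s q r, crossRatio_rotate a d b c])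
  exact this.symm

lemma crossRatio_pos {p q r s : RP1} (h1 : CCW p s q) (h2 : CCW p q r) : 0 < crossRatio p s q r := by
  rw [ccw_iff] at h1 h2
  have h3 : 0 < (det2 p.rep s.rep * det2 q.rep r.rep) * (det2 s.rep q.rep * det2 p.rep r.rep) := by
    rw [det2_swap p.rep r.rep] at h2
    rw [det2_swap p.rep q.rep] at h1
    by_contra h
    have : (det2 p.rep s.rep * det2 s.rep q.rep * -det2 p.rep q.rep) *
        (det2 p.rep q.rep * det2 q.rep r.rep * -det2 p.rep r.rep) =
        (det2 p.rep s.rep * det2 q.rep r.rep) * (det2 s.rep q.rep * det2 p.rep r.rep) *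
          det2 p.rep q.rep ^ 2 := by ring
    have := this ▸ mul_pos h1 h2
    nlinarith [sq_nonneg (det2 p.rep q.rep)]
  rw [crossRatio, div_eq_mul_inv]
  rcases pos_and_pos_or_neg_and_neg_of_mul_pos h3 with ⟨i, j⟩ | ⟨i, j⟩
  · exact mul_pos i (inv_pos.2 j)
  · exact mul_pos_of_neg_of_neg i (inv_lt_zero.2 j)

lemma isClosed_idealTriangle {p q r : RP1} (h : CCW p q r) : IsClosed (idealTriangle p q r) := by
  have : idealTriangle p q r = {z | 0 ≤ lam p q z} ∩ ({z | 0 ≤ lam q r z} ∩ {z | 0 ≤ lam r p z}) := by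
    ext z; exact mem_idealTriangle_iff h z
  rw [this]
  exact (isClosed_le continuous_const (continuous_lam _ _)).inter
    ((isClosed_le continuous_const (continuous_lam _ _)).inter
      (isClosed_le continuous_const (continuous_lam _ _)))

lemma union_mem_nhds {a s b r : RP1} (hl : CCW b a s) (hr : CCW a b r) {z : ℍ}
    (hz : lam a b z = 0) : idealTriangle b a s ∪ idealTriangle a b r ∈ 𝓝 z := by
  have hz' : lam b a z = 0 := by rw [lam_swap, hz, neg_zero]
  obtain ⟨p1, p2⟩ := lam_pos_of_side hr hz
  obtain ⟨p3, p4⟩ := lam_pos_of_side hl hz'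
  have ev : ∀ {x y : RP1}, 0 < lam x y z → ∀ᶠ w in 𝓝 z, 0 < lam x y w := fun hp =>
    (continuous_lam _ _).continuousAt.eventually (lt_mem_nhds hp)
  filter_upwards [ev p1, ev p2, ev p3, ev p4] with w w1 w2 w3 w4
  rcases le_total 0 (lam a b w) with hw | hw
  · exact Or.inr ((mem_idealTriangle_iff hr w).2 ⟨hw, w1.le, w2.le⟩)
  · refine Or.inl ((mem_idealTriangle_iff hl w).2 ⟨?_, w3.le, w4.le⟩)
    rw [lam_swap]; linarith

lemma mem_nhds_of_interior {p q r : RP1} (h : CCW p q r) {z : ℍ} (h1 : 0 < lam p q z)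
    (h2 : 0 < lam q r z) (h3 : 0 < lam r p z) : idealTriangle p q r ∈ 𝓝 z := by
  have ev : ∀ {x y : RP1}, 0 < lam x y z → ∀ᶠ w in 𝓝 z, 0 < lam x y w := fun hp =>
    (continuous_lam _ _).continuousAt.eventually (lt_mem_nhds hp)
  filter_upwards [ev h1, ev h2, ev h3] with w w1 w2 w3
  exact (mem_idealTriangle_iff h w).2 ⟨w1.le, w2.le, w3.le⟩

/-- `(a, b, c)` is a cyclic permutation of `(p, q, r)`. -/
def IsRot {α : Type*} (p q r a b c : α) : Prop :=
  (a = p ∧ b = q ∧ c = r) ∨ (a = q ∧ b = r ∧ c = p) ∨ (a = r ∧ b = p ∧ c = q)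

namespace IdealTriangulation

variable {Γ : Subgroup PSL(2, ℝ)} {T : IdealTriangulation Γ} {β : Farey Γ → CP1}

/-- A triangle of the triangulation with its vertices in counter-clockwise order. -/
def IsCCWTriangle (T : IdealTriangulation Γ) (p q r : Farey Γ) : Prop :=
  T.IsTriangle p q r ∧ CCW p.pt q.pt r.pt

lemma IsCCWTriangle.rotate {p q r : Farey Γ} (h : T.IsCCWTriangle p q r) : T.IsCCWTriangle q r p :=
  ⟨h.1.rotate, ccw_rotate.1 h.2⟩

lemma IsCCWTriangle.smul (γ : Γ) {p q r : Farey Γ} (h : T.IsCCWTriangle p q r) :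
    T.IsCCWTriangle (γ • p) (γ • q) (γ • r) :=
  ⟨h.1.smul γ, (ccw_pt_smul_iff γ).2 h.2⟩

lemma IsQuad.left {a s b r : Farey Γ} (h : T.IsQuad a s b r) : T.IsCCWTriangle b a s :=
  ⟨h.1.rotate.rotate, ccw_rotate.1 (ccw_rotate.1 h.2.2.1)⟩

lemma IsQuad.right {a s b r : Farey Γ} (h : T.IsQuad a s b r) : T.IsCCWTriangle a b r :=
  ⟨h.2.1, h.2.2.2⟩

/-- Two triangles with a common point are equal or lie on both sides of a common edge. -/
lemma triangles_meet {p q r p' q' r' : Farey Γ} (h : T.IsCCWTriangle p q r)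
    (h' : T.IsCCWTriangle p' q' r') {z : ℍ} (hz : z ∈ idealTriangle p.pt q.pt r.pt)
    (hz' : z ∈ idealTriangle p'.pt q'.pt r'.pt) :
    IsRot p q r p' q' r' ∨ ∃ a b c c', IsRot p q r a b c ∧ IsRot p' q' r' b a c' ∧
      T.IsQuad a c' b c ∧ z ∈ geodesic a.pt b.pt := by
  have edge : ∀ {a b c : Farey Γ}, T.IsCCWTriangle a b c → lam a.pt b.pt z = 0 →
      IsRot p' q' r' a b c ∨ ∃ c', IsRot p' q' r' b a c' ∧ T.IsQuad a c' b c := by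
    intro a b c hh h0
    have h0' : lam b.pt a.pt z = 0 := by rw [lam_swap, h0, neg_zero]
    have same : ∀ {x y w : Farey Γ}, T.IsCCWTriangle x y w → a = x → b = y → c = w := by
      rintro x y w hx rfl rfl
      exact IsTriangle.apex_unique hh.1.rotate hx.1.rotate
        (ccw_rotate.1 hh.2) (ccw_rotate.1 hx.2)
    have opp : ∀ {x y w : Farey Γ}, T.IsCCWTriangle x y w → b = x → a = y → T.IsQuad a w b c := by
      rintro x y w hx rfl rfl
      exact ⟨hx.1.rotate, hh.1, ccw_rotate.1 hx.2, hh.2⟩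
    rcases T.triangle_side hh.1.1 h'.1 with ⟨s1, s2, s3⟩ | ⟨s1, s2, s3⟩
    · rw [← ccw_swap_iff] at s1 s2 s3
      rcases mem_vertices_of_lam_eq_zero h'.2 hh.2.ne12 hz' s1 s2 s3 h0 with ⟨e, e'⟩ | ⟨e, e'⟩ | ⟨e, e'⟩
      · have e1 := Farey.pt_injective e
        have e2 := Farey.pt_injective e'
        exact Or.inl (Or.inl ⟨e1, e2, same h' e1 e2⟩)
      · have e1 := Farey.pt_injective e
        have e2 := Farey.pt_injective e'
        exact Or.inl (Or.inr (Or.inl ⟨e1, e2, same h'.rotate e1 e2⟩))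
      · have e1 := Farey.pt_injective e
        have e2 := Farey.pt_injective e'
        exact Or.inl (Or.inr (Or.inr ⟨e1, e2, same h'.rotate.rotate e1 e2⟩))
    · rw [← ccw_swap_iff] at s1 s2 s3
      rcases mem_vertices_of_lam_eq_zero h'.2 hh.2.ne12.symm hz' s1 s2 s3 h0' with
        ⟨e, e'⟩ | ⟨e, e'⟩ | ⟨e, e'⟩
      · have e1 := Farey.pt_injective e
        have e2 := Farey.pt_injective e'
        exact Or.inr ⟨r', Or.inl ⟨e1, e2, rfl⟩, opp h' e1 e2⟩
      · have e1 := Farey.pt_injective e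
        have e2 := Farey.pt_injective e'
        exact Or.inr ⟨p', Or.inr (Or.inl ⟨e1, e2, rfl⟩), opp h'.rotate e1 e2⟩
      · have e1 := Farey.pt_injective e
        have e2 := Farey.pt_injective e'
        exact Or.inr ⟨q', Or.inr (Or.inr ⟨e1, e2, rfl⟩), opp h'.rotate.rotate e1 e2⟩
  have hz0 := (mem_idealTriangle_iff h.2 z).1 hz
  by_cases h1 : lam p.pt q.pt z = 0
  · rcases edge h h1 with h2 | ⟨c', h2, h3⟩
    · left; simp only [IsRot] at *; grind
    · exact Or.inr ⟨p, q, r, c', Or.inl ⟨rfl, rfl, rfl⟩, h2, h3, (mem_geodesic_iff h.2.ne12 z).2 h1⟩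
  by_cases h1' : lam q.pt r.pt z = 0
  · rcases edge h.rotate h1' with h2 | ⟨c', h2, h3⟩
    · left; simp only [IsRot] at *; grind
    · exact Or.inr ⟨q, r, p, c', Or.inr (Or.inl ⟨rfl, rfl, rfl⟩), h2, h3,
        (mem_geodesic_iff h.2.ne23 z).2 h1'⟩
  by_cases h1'' : lam r.pt p.pt z = 0
  · rcases edge h.rotate.rotate h1'' with h2 | ⟨c', h2, h3⟩
    · left; simp only [IsRot] at *; grind
    · exact Or.inr ⟨r, p, q, c', Or.inr (Or.inr ⟨rfl, rfl, rfl⟩), h2, h3,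
        (mem_geodesic_iff h.2.ne31 z).2 h1''⟩
  left
  obtain ⟨a1, a2, a3⟩ := T.not_ccw_of_lam_pos h.1.1.symm h'.1 h'.2 hz' (lt_of_le_of_ne hz0.1 (Ne.symm h1))
  obtain ⟨b1, b2, b3⟩ :=
    T.not_ccw_of_lam_pos h.1.2.1.symm h'.1 h'.2 hz' (lt_of_le_of_ne hz0.2.1 (Ne.symm h1'))
  obtain ⟨c1, c2, c3⟩ :=
    T.not_ccw_of_lam_pos h.1.2.2.symm h'.1 h'.2 hz' (lt_of_le_of_ne hz0.2.2 (Ne.symm h1''))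
  have key : ∀ x : Farey Γ, ¬ CCW p.pt x.pt q.pt → ¬ CCW q.pt x.pt r.pt → ¬ CCW r.pt x.pt p.pt →
      x = p ∨ x = q ∨ x = r := by
    intro x i j k
    rcases ccw_cases h.2 x.pt with e | e | e | e | e | e
    · exact Or.inl (Farey.pt_injective e)
    · exact Or.inr (Or.inl (Farey.pt_injective e))
    · exact Or.inr (Or.inr (Farey.pt_injective e))
    · exact absurd e i
    · exact absurd e j
    · exact absurd e k
  have n := h.2
  have n' := h'.2
  simp only [ccw_iff_theta] at n n'
  rcases key p' a1 b1 c1 with e | e | e <;> rcases key q' a2 b2 c2 with e' | e' | e' <;>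
    rcases key r' a3 b3 c3 with e'' | e'' | e'' <;> rw [e, e', e''] at n' <;>
    first
    | exact Or.inl ⟨e, e', e''⟩
    | exact Or.inr (Or.inl ⟨e, e', e''⟩)
    | exact Or.inr (Or.inr ⟨e, e', e''⟩)
    | (exfalso; grind)

/-- A point lies in the interior of a triangle or on an edge. -/
lemma interior_or_edge (T : IdealTriangulation Γ) (z : ℍ) :
    (∃ p q r, T.IsCCWTriangle p q r ∧ 0 < lam p.pt q.pt z ∧ 0 < lam q.pt r.pt z ∧
      0 < lam r.pt p.pt z) ∨ ∃ a s b r, T.IsQuad a s b r ∧ lam a.pt b.pt z = 0 := by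
  obtain ⟨p, q, r, h, hc, hz⟩ := T.exists_triangle z
  obtain ⟨h1, h2, h3⟩ := (mem_idealTriangle_iff hc z).1 hz
  rcases h1.eq_or_lt with h1 | h1
  · obtain ⟨s, o, hq⟩ := exists_quad h.1
    exact Or.inr ⟨_, _, _, _, hq, h1.symm⟩
  rcases h2.eq_or_lt with h2 | h2
  · obtain ⟨s, o, hq⟩ := exists_quad h.2.1
    exact Or.inr ⟨_, _, _, _, hq, h2.symm⟩
  rcases h3.eq_or_lt with h3 | h3
  · obtain ⟨s, o, hq⟩ := exists_quad h.2.2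
    exact Or.inr ⟨_, _, _, _, hq, h3.symm⟩
  exact Or.inl ⟨p, q, r, ⟨h, hc⟩, h1, h2, h3⟩

lemma continuous_of_triangles {Y : Type*} [TopologicalSpace Y] {f : ℍ → Y}
    (h : ∀ p q r, T.IsCCWTriangle p q r → ContinuousOn f (idealTriangle p.pt q.pt r.pt)) :
    Continuous f := by
  rw [continuous_iff_continuousAt]
  intro z
  rcases T.interior_or_edge z with ⟨p, q, r, ht, h1, h2, h3⟩ | ⟨a, s, b, r, hq, h0⟩
  · exact (h p q r ht).continuousAt (mem_nhds_of_interior ht.2 h1 h2 h3)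
  · exact ((h _ _ _ hq.left).union_of_isClosed (h _ _ _ hq.right) (isClosed_idealTriangle hq.left.2)
      (isClosed_idealTriangle hq.right.2)).continuousAt (union_mem_nhds hq.left.2 hq.right.2 h0)

lemma HasNonzeroCoordinates.ne (hFG : T.HasNonzeroCoordinates β) {a b : Farey Γ}
    (h : T.graph.Adj a b) : β a ≠ β b := by
  obtain ⟨c, hc, hcc⟩ := T.exists_apex h
  obtain ⟨s, o, hq⟩ := exists_quad hc.1.symm
  have hs : s = b := IsTriangle.apex_unique hq.1 hc.rotate hq.2.2.1 (ccw_rotate.1 hcc)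
  have := (hFG _ _ _ _ hq).1
  rw [hs] at this
  exact (det2_rep_ne_zero.1 (left_ne_zero_of_mul this)).symm

open Classical in
/-- The parameter by which the triangles adjacent to an edge have to be slid: the quotient of the
cross-ratio of the edge in the hyperbolic plane by the modulus of its cross-ratio for `β`. -/
def edgeParam (T : IdealTriangulation Γ) (β : Farey Γ → CP1) (a b : Farey Γ) : ℝ :=
  if h : ∃ s r, T.IsQuad a s b r then
    crossRatio a.pt h.choose.pt b.pt h.choose_spec.choose.pt /
      ‖crossRatio (β a) (β h.choose) (β b) (β h.choose_spec.choose)‖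
  else 1

lemma edgeParam_eq {a s b r : Farey Γ} (h : T.IsQuad a s b r) : T.edgeParam β a b =
    crossRatio a.pt s.pt b.pt r.pt / ‖crossRatio (β a) (β s) (β b) (β r)‖ := by
  have h' : ∃ s r, T.IsQuad a s b r := ⟨s, r, h⟩
  obtain ⟨e1, e2⟩ := h.unique h'.choose_spec.choose_spec
  rw [edgeParam, dif_pos h']
  conv_rhs => rw [e1, e2]

lemma edgeParam_swap {a b : Farey Γ} (h : T.graph.Adj a b) :
    T.edgeParam β b a = T.edgeParam β a b := by
  obtain ⟨s, r, hq⟩ := exists_quad h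
  rw [edgeParam_eq hq, edgeParam_eq hq.rotate, crossRatio_rotate a.pt s.pt b.pt r.pt,
    crossRatio_rotate (β a) (β s) (β b) (β r)]

lemma edgeParam_pos (hFG : T.HasNonzeroCoordinates β) {a b : Farey Γ} (h : T.graph.Adj a b) :
    0 < T.edgeParam β a b := by
  obtain ⟨s, r, hq⟩ := exists_quad h
  rw [edgeParam_eq hq]
  exact div_pos (crossRatio_pos hq.2.2.1 hq.2.2.2) (norm_pos_iff.2 (hFG _ _ _ _ hq).2)

lemma edgeParam_smul {γ : Γ} {g : SL(2, ℂ)} (hg : ∀ p, β (γ • p) = g • β p) {a b : Farey Γ}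
    (h : T.graph.Adj a b) : T.edgeParam β (γ • a) (γ • b) = T.edgeParam β a b := by
  obtain ⟨s, r, hq⟩ := exists_quad h
  rw [edgeParam_eq hq, edgeParam_eq (hq.smul γ), hg, hg, hg, hg, crossRatio_smul]
  simp only [Farey.pt_smul, crossRatio_psl_smul]

/-- The parameters of the three sides of a triangle. -/
def triParam (T : IdealTriangulation Γ) (β : Farey Γ → CP1) (p q r : Farey Γ) : ℝ × ℝ × ℝ :=
  (T.edgeParam β q r, T.edgeParam β r p, T.edgeParam β p q)

/-- The value at `z` of the pleated plane on the triangle `p, q, r`. -/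
def pleatMat (T : IdealTriangulation Γ) (β : Farey Γ → CP1) (p q r : Farey Γ) (z : ℍ) :
    Matrix (Fin 2) (Fin 2) ℂ :=
  normMat (β p) (β q) (β r) (slideMap (T.triParam β p q r) (triCoords p.pt q.pt r.pt z))

lemma pleatMat_rot (p q r : Farey Γ) (z : ℍ) : T.pleatMat β q r p z = T.pleatMat β p q r z := by
  rw [pleatMat, show T.triParam β q r p = rot (T.triParam β p q r) from rfl, triCoords_rot,
    slideMap_rot, normMat_rot, pleatMat]

lemma pleatMat_isRot {p q r a b c : Farey Γ} (h : IsRot p q r a b c) (z : ℍ) :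
    T.pleatMat β a b c z = T.pleatMat β p q r z := by
  rcases h with ⟨rfl, rfl, rfl⟩ | ⟨rfl, rfl, rfl⟩ | ⟨rfl, rfl, rfl⟩
  · rfl
  · rw [pleatMat_rot]
  · rw [pleatMat_rot, pleatMat_rot]

lemma pos3_triParam (hFG : T.HasNonzeroCoordinates β) {p q r : Farey Γ} (h : T.IsTriangle p q r) :
    Pos3 (T.triParam β p q r) :=
  ⟨edgeParam_pos hFG h.2.1, edgeParam_pos hFG h.2.2, edgeParam_pos hFG h.1⟩

lemma pleatMat_eq (hFG : T.HasNonzeroCoordinates β) {p q r p' q' r' : Farey Γ}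
    (h : T.IsCCWTriangle p q r) (h' : T.IsCCWTriangle p' q' r') {z : ℍ}
    (hz : z ∈ idealTriangle p.pt q.pt r.pt) (hz' : z ∈ idealTriangle p'.pt q'.pt r'.pt) :
    T.pleatMat β p' q' r' z = T.pleatMat β p q r z := by
  rcases triangles_meet h h' hz hz' with hr | ⟨a, b, c, c', hr, hr', hq, hm⟩
  · exact pleatMat_isRot hr z
  · rw [← pleatMat_isRot hr, ← pleatMat_isRot hr']
    have ne := fun {a b} => hFG.ne (a := a) (b := b)
    refine (normMat_side_eq hq.2.2.2 hq.2.2.1 (ne hq.2.1.1) (ne hq.2.1.2.1) (ne hq.2.1.2.2)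
      (ne hq.1.1) (ne hq.1.2.1.symm) (pos3_triParam hFG hq.2.1) (pos3_triParam hFG hq.left.1)
      ?_ ?_ hm).symm
    · exact edgeParam_eq hq
    · exact edgeParam_swap hq.adj

/-- There is a pleated plane with framing `β`, equivariant under all symmetries of `β`. -/
theorem exists_pleatedPlane (T : IdealTriangulation Γ) (hFG : T.HasNonzeroCoordinates β) :
    ∃ Ψ : ℍ → H3, T.IsPleatedPlane β Ψ ∧
      ∀ (γ : Γ) (g : SL(2, ℂ)), (∀ p, β (γ • p) = g • β p) → ∀ z, Ψ (γ • z) = g • Ψ z := by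
  have ne := fun {a b} => hFG.ne (a := a) (b := b)
  have ex : ∀ z : ℍ, ∃ X : H3, ∀ p q r, T.IsCCWTriangle p q r → z ∈ idealTriangle p.pt q.pt r.pt →
      X.1 = T.pleatMat β p q r z := by
    intro z
    obtain ⟨p, q, r, h, hc, hz⟩ := T.exists_triangle z
    refine ⟨⟨_, normMat_mem (ne h.1) (ne h.2.1) (ne h.2.2)
      (cone_triSlide hc (pos3_triParam hFG h) hz)⟩, fun p' q' r' h' hz' => ?_⟩
    exact (pleatMat_eq hFG ⟨h, hc⟩ h' hz hz').symm
  choose Ψ hΨ using ex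
  have emb : ∀ p q r, T.IsCCWTriangle p q r →
      IsEmbedding ((idealTriangle p.pt q.pt r.pt).domRestrict Ψ) := fun p q r h =>
    isEmbedding_slide h.2 (ne h.1.1) (ne h.1.2.1) (ne h.1.2.2) (pos3_triParam hFG h.1)
      fun z hz => hΨ z p q r h hz
  have img : ∀ p q r, T.IsCCWTriangle p q r → _ := fun p q r h =>
    image_idealTriangle_slide h.2 (ne h.1.1) (ne h.1.2.1) (ne h.1.2.2) (pos3_triParam hFG h.1)
      fun z hz => hΨ z p q r h hz
  refine ⟨Ψ, ⟨?_, ?_, ?_, ?_⟩, ?_⟩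
  · refine continuous_of_triangles (T := T) fun p q r h => ?_
    exact continuousOn_iff_continuous_domRestrict.2 (emb p q r h).continuous
  · intro p q r h
    rcases h.ccw_or with hc | hc
    · exact emb _ _ _ ⟨h, hc⟩
    · have := emb _ _ _ ⟨h.swap, hc⟩
      rwa [idealTriangle_swap] at this
  · intro p q r h
    rcases h.ccw_or with hc | hc
    · exact (img _ _ _ ⟨h, hc⟩).1
    · rw [idealTriangle_swap, idealTriangle3_swap]
      exact (img _ _ _ ⟨h.swap, hc⟩).1
  · intro p q h
    obtain ⟨s, r, hq⟩ := exists_quad h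
    exact (img _ _ _ hq.right).2
  · intro γ g hg z
    obtain ⟨p, q, r, h, hc, hz⟩ := T.exists_triangle z
    have h' : T.IsCCWTriangle p q r := ⟨h, hc⟩
    have hco : triCoords (γ • p).pt (γ • q).pt (γ • r).pt (γ • z) = triCoords p.pt q.pt r.pt z := by
      simp only [triCoords, Farey.pt_smul]
      exact Prod.ext (lam_psl_smul _ _ _ z) (Prod.ext (lam_psl_smul _ _ _ z) (lam_psl_smul _ _ _ z))
    have hz' : γ • z ∈ idealTriangle (γ • p).pt (γ • q).pt (γ • r).pt := by
      rw [← cone_triCoords (h'.smul γ).2, hco, cone_triCoords hc]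
      exact hz
    apply Subtype.ext
    rw [hΨ _ _ _ _ (h'.smul γ) hz', pleatMat, hco, hg, hg, hg, ← normMat_smul, triParam,
      edgeParam_smul hg h.1, edgeParam_smul hg h.2.1, edgeParam_smul hg h.2.2]
    have := hΨ z p q r h' hz
    rw [pleatMat, triParam] at this
    rw [← this]
    rfl

end IdealTriangulation

/-! ### The equatorial plane -/

lemma H3.eq_toH3 {X : H3} {z : ℍ} (h1 : X.1 0 1 = ((z.re / z.im : ℝ) : ℂ))
    (h2 : X.1 1 1 = ((1 / z.im : ℝ) : ℂ)) : X = toH3 z := by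
  have hy : (z.im : ℂ) ≠ 0 := by exact_mod_cast z.im_pos.ne'
  have h3 : X.1 1 0 = ((z.re / z.im : ℝ) : ℂ) := by
    rw [← X.2.1.isHermitian.apply 1 0, h1, Complex.star_def, Complex.conj_ofReal]
  have hd := X.2.2
  rw [Matrix.det_fin_two, h1, h2, h3] at hd
  have h4 : X.1 0 0 = ((z.im + z.re ^ 2 / z.im : ℝ) : ℂ) := by
    push_cast at hd ⊢
    have h5 : X.1 0 0 * (1 / z.im) = 1 + z.re / z.im * (z.re / z.im) := by
      linear_combination hd
    calc X.1 0 0 = X.1 0 0 * (1 / z.im) * z.im := by field_simp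
      _ = _ := by rw [h5]; field_simp
  apply Subtype.ext
  ext i j
  fin_cases i <;> fin_cases j
  · exact h4
  · exact h1
  · exact h3
  · exact h2

lemma toH3_injective : Function.Injective toH3 := by
  intro z w h
  have h1 := congrArg (fun X : H3 => X.1 1 1) h
  have h2 := congrArg (fun X : H3 => X.1 0 1) h
  simp only [toH3, planeMatrix, Matrix.of_apply, Matrix.cons_val', Matrix.cons_val_zero,
    Matrix.cons_val_one, Matrix.cons_val_fin_one, Complex.ofReal_inj] at h1 h2
  have hi : z.im = w.im := by simpa using h1
  rw [hi, div_left_inj' w.im_pos.ne'] at h2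
  exact UpperHalfPlane.ext (Complex.ext h2 hi)

/-- The inclusion of `SL(2, ℝ)` in `SL(2, ℂ)`. -/
abbrev toSLC (g : SL(2, ℝ)) : SL(2, ℂ) := Matrix.SpecialLinearGroup.map Complex.ofRealHom g

lemma toCP1_smul (g : SL(2, ℝ)) (p : RP1) : toCP1 (g • p) = toSLC g • toCP1 p := by
  obtain ⟨v, hv, rfl⟩ := exists_mk p
  obtain ⟨_, e⟩ := smul_mk_eq g v hv
  obtain ⟨_, e'⟩ := smul_mk_eq (toSLC g) _ (ofReal_comp_ne_zero hv)
  rw [e, toCP1_mk, toCP1_mk, e']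
  congr 1
  funext i
  simp [Matrix.mulVec, dotProduct, Fin.sum_univ_two]

lemma toH3_smul (g : SL(2, ℝ)) (z : ℍ) : toH3 (g • z) = toSLC g • toH3 z := by
  obtain ⟨h0, h1, h2⟩ := smul_re_im g z
  have hy := z.im_pos
  have e : (toSLC g • toH3 z).1 = (toSLC g : Matrix (Fin 2) (Fin 2) ℂ) * planeMatrix z *
    (toSLC g : Matrix (Fin 2) (Fin 2) ℂ).conjTranspose := rfl
  refine (H3.eq_toH3 ?_ ?_).symm
  · rw [e, h1, h2]
    simp only [Matrix.mul_apply, Fin.sum_univ_two, Matrix.conjTranspose_apply, planeMatrix,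
      Matrix.SpecialLinearGroup.map_apply_coe, RingHom.mapMatrix_apply, Matrix.map_apply,
      Complex.ofRealHom_eq_coe, Complex.star_def, Complex.conj_ofReal, Matrix.of_apply,
      Matrix.cons_val', Matrix.cons_val_zero, Matrix.cons_val_one, Matrix.cons_val_fin_one,
      ← Complex.ofReal_mul, ← Complex.ofReal_add]
    congr 1
    rw [div_div_div_cancel_right₀ h0.ne']
    field_simp
    ring
  · rw [e, h2]
    simp only [Matrix.mul_apply, Fin.sum_univ_two, Matrix.conjTranspose_apply, planeMatrix,
      Matrix.SpecialLinearGroup.map_apply_coe, RingHom.mapMatrix_apply, Matrix.map_apply,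
      Complex.ofRealHom_eq_coe, Complex.star_def, Complex.conj_ofReal, Matrix.of_apply,
      Matrix.cons_val', Matrix.cons_val_zero, Matrix.cons_val_one, Matrix.cons_val_fin_one,
      ← Complex.ofReal_mul, ← Complex.ofReal_add]
    congr 1
    field_simp
    ring

lemma crossRatio_toCP1 (a b c d : RP1) :
    crossRatio (toCP1 a) (toCP1 b) (toCP1 c) (toCP1 d) = ((crossRatio a b c d : ℝ) : ℂ) := by
  obtain ⟨v, hv, rfl⟩ := exists_mk a
  obtain ⟨w, hw, rfl⟩ := exists_mk b
  obtain ⟨x, hx, rfl⟩ := exists_mk c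
  obtain ⟨y, hy, rfl⟩ := exists_mk d
  simp only [toCP1_mk, crossRatio_mk, det2]
  push_cast
  rfl

lemma toCP1_injective : Function.Injective toCP1 := by
  intro a b h
  obtain ⟨v, hv, rfl⟩ := exists_mk a
  obtain ⟨w, hw, rfl⟩ := exists_mk b
  rw [toCP1_mk, toCP1_mk, ← det2_eq_zero_iff] at h
  rw [← det2_eq_zero_iff]
  simp only [det2] at h ⊢
  exact_mod_cast h

lemma idealTriangle3_toCP1_subset (a b c : RP1) :
    idealTriangle3 (toCP1 a) (toCP1 b) (toCP1 c) ⊆ range toH3 := by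
  obtain ⟨u, hu, rfl⟩ := exists_mk a
  obtain ⟨v, hv, rfl⟩ := exists_mk b
  obtain ⟨w, hw, rfl⟩ := exists_mk c
  obtain ⟨k, -, ek⟩ := ray_toCP1 u hu
  obtain ⟨l, -, el⟩ := ray_toCP1 v hv
  obtain ⟨m, -, em⟩ := ray_toCP1 w hw
  rintro X ⟨r, s, t, -, -, -, e⟩
  have hX : ∀ i j, ∃ x : ℝ, X.1 i j = x := fun i j =>
    ⟨r * (k * (u i * u j)) + s * (l * (v i * v j)) + t * (m * (w i * w j)), by
      rw [e]
      simp only [Matrix.add_apply, Matrix.smul_apply, ek, el, em, smul_eq_mul]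
      push_cast
      ring⟩
  obtain ⟨x, hx⟩ := hX 0 1
  obtain ⟨y, hy⟩ := hX 1 1
  have hpos : 0 < y := by
    have := X.2.1.diag_pos (i := 1)
    rw [hy] at this
    exact_mod_cast this
  refine ⟨⟨⟨x / y, 1 / y⟩, by simpa using hpos⟩, (H3.eq_toH3 ?_ ?_).symm⟩
  · rw [hx]
    congr 1
    change x = (x / y) / (1 / y)
    field_simp
  · rw [hy]
    congr 1
    change y = 1 / (1 / y)
    field_simp

namespace IdealTriangulation

variable {Γ : Subgroup PSL(2, ℝ)} {T : IdealTriangulation Γ} {β : Farey Γ → CP1} {β' : Farey Γ → RP1}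

theorem IsStraightening.exists_straightenedPlane (hs : T.IsStraightening β β')
    (hFG : T.HasNonzeroCoordinates β) {ρ' : Γ →* PSL(2, ℝ)} (hρ : IsEquivariant ρ' β') :
    ∃ Ψ' : ℍ → ℍ, T.IsStraightenedPlane β' Ψ' ∧ IsEquivariant ρ' Ψ' := by
  have hFG' : T.HasNonzeroCoordinates fun p => toCP1 (β' p) := by
    intro p₁ p₂ p₃ p₄ h
    have hne : ∀ {a b : Farey Γ}, a ≠ b → toCP1 (β' a) ≠ toCP1 (β' b) := fun hab e =>
      hab (hs.injective (toCP1_injective e))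
    refine ⟨mul_ne_zero (det2_rep_ne_zero.2 (hne h.1.2.1.ne))
      (det2_rep_ne_zero.2 (hne h.2.1.2.2.ne.symm)), ?_⟩
    rw [crossRatio_toCP1, hs.crossRatio_eq _ _ _ _ h]
    simpa using (hFG _ _ _ _ h).2
  obtain ⟨Ψ, hΨ, heq⟩ := T.exists_pleatedPlane hFG'
  have hr : ∀ z, ∃ w, toH3 w = Ψ z := by
    intro z
    obtain ⟨p, q, r, h, -, hz⟩ := T.exists_triangle z
    have := hΨ.image_triangle p q r h ▸ mem_image_of_mem Ψ hz
    exact idealTriangle3_toCP1_subset _ _ _ this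
  choose Ψ' hΨ' using hr
  refine ⟨Ψ', ?_, ?_⟩
  · rw [IsStraightenedPlane]
    simp only [hΨ']
    exact hΨ
  · intro γ z
    obtain ⟨g, hg⟩ := QuotientGroup.mk_surjective (ρ' γ)
    apply toH3_injective
    have h1 : ∀ p, toCP1 (β' (γ • p)) = toSLC g • toCP1 (β' p) := by
      intro p
      rw [hρ, ← toCP1_smul, ← hg]
      rfl
    rw [hΨ', heq γ (toSLC g) h1, ← hΨ', ← toH3_smul, ← hg]
    rfl

end IdealTriangulation

/-! ### Bending angles -/

/-- The argument of a complex number in `[0, 2π)`. -/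
def argPos (c : ℂ) : ℝ := if c.arg < 0 then c.arg + 2 * Real.pi else c.arg

lemma argPos_mem (c : ℂ) : argPos c ∈ Ico 0 (2 * Real.pi) := by
  have h1 := Complex.neg_pi_lt_arg c
  have h2 := Complex.arg_le_pi c
  have := Real.pi_pos
  rw [argPos]
  split_ifs with h
  · constructor <;> linarith
  · constructor <;> linarith

lemma norm_mul_exp_argPos (c : ℂ) : (‖c‖ : ℂ) * Complex.exp (argPos c * Complex.I) = c := by
  have : Complex.exp (argPos c * Complex.I) = Complex.exp (c.arg * Complex.I) := by
    rw [argPos]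
    split_ifs
    · push_cast
      rw [add_mul, Complex.exp_add, Complex.exp_two_pi_mul_I, mul_one]
    · rfl
  rw [this, Complex.norm_mul_exp_arg_mul_I]

lemma foot_of_mem {a b : CP1} {v : Fin 2 → ℂ} (hv : v ≠ 0) {X : H3} {g : SL(2, ℂ)}
    (ha : g • zeroPt ℂ = a) (hb : g • inftyPt ℂ = b) (hv0 : v 0 ≠ 0) (hv1 : v 1 ≠ 0)
    (hX : X ∈ idealTriangle3 a b (g • Projectivization.mk ℂ v hv)) (hX' : X ∉ geodesic3 a b) :
    ∃ k : ℝ, 0 < k ∧ (g⁻¹ • X).foot = k * (v 0 / v 1) := by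
  subst ha hb
  have hz : (![0, 1] : Fin 2 → ℂ) ≠ 0 := by simp
  have hi : (![1, 0] : Fin 2 → ℂ) ≠ 0 := by simp
  have n1 : zeroPt ℂ ≠ inftyPt ℂ := by
    intro h
    have := (det2_eq_zero_iff hz hi).2 h
    simp [det2] at this
  have n2 : inftyPt ℂ ≠ Projectivization.mk ℂ v hv := by
    intro h
    have := (det2_eq_zero_iff hi hv).2 h
    simp [det2, hv1] at this
  have n3 : Projectivization.mk ℂ v hv ≠ zeroPt ℂ := by
    intro h
    have := (det2_eq_zero_iff hv hz).2 h
    simp [det2, hv0] at this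
  have inj : ∀ {x y : CP1}, x ≠ y → g • x ≠ g • y := fun h e => h (MulAction.injective g e)
  obtain ⟨x, hx, hx1, e⟩ := exists_normMat_eq (inj n1) (inj n2) (inj n3) hX
  rw [mem_geodesic3_iff (inj n1) (inj n2) (inj n3) hx e] at hX'
  have hx3 : 0 < x.2.2 := lt_of_le_of_ne hx.2.2.1 (Ne.symm hX')
  have hY : (g⁻¹ • X).1 = combMat (zeroPt ℂ) (inftyPt ℂ) (Projectivization.mk ℂ v hv) x := by
    have h := normMat_smul g⁻¹ (g • zeroPt ℂ) (g • inftyPt ℂ) (g • Projectivization.mk ℂ v hv) x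
    rw [inv_smul_smul, inv_smul_smul, inv_smul_smul, ← e, normMat, hx1, Real.sqrt_one, inv_one,
      Complex.ofReal_one, one_smul] at h
    exact h
  have w1 := wt_pos n1 n2 n3
  have w3 := wt_pos n3 n1 n2
  obtain ⟨c, hc, ec⟩ := ray_mk _ hz
  obtain ⟨d, hd, ed⟩ := ray_mk _ hi
  obtain ⟨m, hm, em⟩ := ray_mk v hv
  have hn : v 1 * (starRingEnd ℂ) (v 1) = ((‖v 1‖ ^ 2 : ℝ) : ℂ) := by
    rw [Complex.mul_conj, Complex.normSq_eq_norm_sq]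
  set A := x.1 * wt (zeroPt ℂ) (inftyPt ℂ) (Projectivization.mk ℂ v hv) * c
  set B := x.2.2 * wt (Projectivization.mk ℂ v hv) (zeroPt ℂ) (inftyPt ℂ) * m
  have hA : 0 ≤ A := mul_nonneg (mul_nonneg hx.1 w1.le) hc.le
  have hB : 0 < B := mul_pos (mul_pos hx3 w3) hm
  have hv1' : 0 < ‖v 1‖ := norm_pos_iff.2 hv1
  have r0 : ray (zeroPt ℂ) 0 1 = 0 := by
    rw [zeroPt, ec, Matrix.smul_apply, Matrix.vecMulVec_apply]; simp
  have r1 : ray (inftyPt ℂ) 0 1 = 0 := by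
    rw [inftyPt, ed, Matrix.smul_apply, Matrix.vecMulVec_apply]; simp
  have r2 : ray (zeroPt ℂ) 1 1 = c := by
    rw [zeroPt, ec, Matrix.smul_apply, Matrix.vecMulVec_apply]; simp
  have r3 : ray (inftyPt ℂ) 1 1 = 0 := by
    rw [inftyPt, ed, Matrix.smul_apply, Matrix.vecMulVec_apply]; simp
  have r4 : ray (Projectivization.mk ℂ v hv) 0 1 = m * (v 0 * (starRingEnd ℂ) (v 1)) := by
    rw [em, Matrix.smul_apply, Matrix.vecMulVec_apply]; simp
  have r5 : ray (Projectivization.mk ℂ v hv) 1 1 = m * (v 1 * (starRingEnd ℂ) (v 1)) := by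
    rw [em, Matrix.smul_apply, Matrix.vecMulVec_apply]; simp
  have h01 : (g⁻¹ • X).1 0 1 = B * (v 0 * (starRingEnd ℂ) (v 1)) := by
    rw [hY]
    simp only [combMat, vertexMat, Matrix.add_apply, Matrix.smul_apply, r0, r1, r4, smul_eq_mul, B]
    push_cast
    ring
  have h11 : (g⁻¹ • X).1 1 1 = ((A + B * ‖v 1‖ ^ 2 : ℝ) : ℂ) := by
    have : (g⁻¹ • X).1 1 1 = A + B * (v 1 * (starRingEnd ℂ) (v 1)) := by
      rw [hY]
      simp only [combMat, vertexMat, Matrix.add_apply, Matrix.smul_apply, r2, r3, r5, smul_eq_mul,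
        A, B]
      push_cast
      ring
    rw [this, hn]
    push_cast
    rfl
  have hD : 0 < A + B * ‖v 1‖ ^ 2 := by positivity
  refine ⟨B * ‖v 1‖ ^ 2 / (A + B * ‖v 1‖ ^ 2), by positivity, ?_⟩
  have hD' : ((A + B * ‖v 1‖ ^ 2 : ℝ) : ℂ) ≠ 0 := by exact_mod_cast hD.ne'
  rw [H3.foot, h01, h11, Complex.ofReal_div, div_mul_div_comm, div_eq_div_iff hD' (mul_ne_zero hD' hv1),
    Complex.ofReal_mul B, ← hn]
  ring

namespace IdealTriangulation

variable {Γ : Subgroup PSL(2, ℝ)} {T : IdealTriangulation Γ} {β : Farey Γ → CP1}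

open Classical in
/-- The bending angle at the edge `a, b`: the argument of its cross-ratio. -/
def bendAngle (T : IdealTriangulation Γ) (β : Farey Γ → CP1) (a b : Farey Γ) : ℝ :=
  if h : ∃ s r, T.IsQuad a s b r then
    argPos (crossRatio (β a) (β h.choose) (β b) (β h.choose_spec.choose))
  else 0

lemma bendAngle_eq {a s b r : Farey Γ} (h : T.IsQuad a s b r) :
    T.bendAngle β a b = argPos (crossRatio (β a) (β s) (β b) (β r)) := by
  have h' : ∃ s r, T.IsQuad a s b r := ⟨s, r, h⟩
  obtain ⟨e1, e2⟩ := h.unique h'.choose_spec.choose_spec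
  rw [bendAngle, dif_pos h']
  conv_rhs => rw [e1, e2]

lemma bendAngle_swap {a b : Farey Γ} (h : T.graph.Adj a b) :
    T.bendAngle β b a = T.bendAngle β a b := by
  obtain ⟨s, r, hq⟩ := exists_quad h
  rw [bendAngle_eq hq, bendAngle_eq hq.rotate, crossRatio_rotate]

lemma bendAngle_smul {ρ : Γ →* PSL(2, ℂ)} (hβ : IsEquivariant ρ β) (γ : Γ) {a b : Farey Γ}
    (h : T.graph.Adj a b) : T.bendAngle β (γ • a) (γ • b) = T.bendAngle β a b := by
  obtain ⟨s, r, hq⟩ := exists_quad h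
  rw [bendAngle_eq hq, bendAngle_eq (hq.smul γ), hβ, hβ, hβ, hβ, crossRatio_psl_smul]

theorem isBendingAngle_bendAngle (hFG : T.HasNonzeroCoordinates β) {Ψ : ℍ → H3}
    (hΨ : T.IsPleatedPlane β Ψ) {p₁ p₂ p₃ p₄ : Farey Γ} (h : T.IsQuad p₁ p₂ p₃ p₄) :
    IsBendingAngle (β p₁) (β p₃) (Ψ '' idealTriangle p₁.pt p₂.pt p₃.pt)
      (Ψ '' idealTriangle p₁.pt p₃.pt p₄.pt) (T.bendAngle β p₁ p₃) := by
  rw [bendAngle_eq h, hΨ.image_triangle _ _ _ h.1, hΨ.image_triangle _ _ _ h.2.1]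
  refine ⟨argPos_mem _, fun g ha hb x hx y hy => ?_⟩
  have ne := fun {a b} => hFG.ne (a := a) (b := b)
  have n12 := ne h.1.1
  have n23 := ne h.1.2.1
  have n34 := ne h.2.1.2.1
  have n41 := ne h.2.1.2.2
  have hc0 := (hFG _ _ _ _ h).2
  obtain ⟨v, hv, ev⟩ := exists_mk (g⁻¹ • β p₂)
  obtain ⟨w, hw, ew⟩ := exists_mk (g⁻¹ • β p₄)
  rw [inv_smul_eq_iff] at ev ew
  have hz : (![0, 1] : Fin 2 → ℂ) ≠ 0 := by simp
  have hi : (![1, 0] : Fin 2 → ℂ) ≠ 0 := by simp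
  have key : ∀ {p : CP1} (u : Fin 2 → ℂ) (hu : u ≠ 0), p = g • Projectivization.mk ℂ u hu →
      β p₁ ≠ p → β p₃ ≠ p → u 0 ≠ 0 ∧ u 1 ≠ 0 := by
    rintro p u hu rfl h1 h3
    constructor
    · intro h0
      refine h1 ?_
      rw [← ha, zeroPt, (det2_eq_zero_iff hz hu).1 (by simp [det2, h0])]
    · intro h0
      refine h3 ?_
      rw [← hb, inftyPt, (det2_eq_zero_iff hi hu).1 (by simp [det2, h0])]
  obtain ⟨v0, v1⟩ := key v hv ev n12 n23.symm
  obtain ⟨w0, w1⟩ := key w hw ew n41.symm n34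
  have hx1 : x ∈ idealTriangle3 (β p₁) (β p₃) (β p₂) := by
    rw [← idealTriangle3_rotate, ← idealTriangle3_swap]
    exact hx.1
  obtain ⟨k, hk, ek⟩ := foot_of_mem hv ha hb v0 v1 (ev ▸ hx1) hx.2
  obtain ⟨l, hl, el⟩ := foot_of_mem hw ha hb w0 w1 (ew ▸ hy.1) hy.2
  have hcr : crossRatio (β p₁) (β p₂) (β p₃) (β p₄) = -(v 0 * w 1) / (v 1 * w 0) := by
    rw [ev, ew, ← ha, ← hb, crossRatio_smul, zeroPt, inftyPt, crossRatio_mk]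
    simp [det2]
  set c := crossRatio (β p₁) (β p₂) (β p₃) (β p₄) with hc
  have hn : 0 < ‖c‖ := norm_pos_iff.2 hc0
  refine ⟨k / l * ‖c‖, by positivity, ?_⟩
  have hlC : (l : ℂ) ≠ 0 := by exact_mod_cast hl.ne'
  have : Complex.exp (argPos c * Complex.I) * -(((k / l * ‖c‖ : ℝ) : ℂ) * (l * (w 0 / w 1))) =
      (‖c‖ * Complex.exp (argPos c * Complex.I)) * -(k * (w 0 / w 1)) := by
    push_cast
    field_simp
  rw [ek, el, this, norm_mul_exp_argPos, hcr]
  field_simp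

end IdealTriangulation

/-! ### The straightened plane is an open embedding -/

lemma isEmbedding_toH3 : IsEmbedding toH3 := by
  have h : ∀ i j, Continuous fun X : H3 => X.1 i j := fun i j =>
    (continuous_id.matrix_elem i j).comp continuous_subtype_val
  have hre : Continuous fun z : ℍ => z.re := UpperHalfPlane.continuous_re
  have him : Continuous fun z : ℍ => z.im := UpperHalfPlane.continuous_im
  have hne : ∀ z : ℍ, z.im ≠ 0 := fun z => z.im_pos.ne'
  have hc : Continuous toH3 := by
    refine continuous_induced_rng.2 ?_
    refine continuous_matrix fun i j => ?_
    fin_cases i <;> fin_cases j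
    · exact Complex.continuous_ofReal.comp (him.add ((hre.pow 2).div him hne))
    · exact Complex.continuous_ofReal.comp (hre.div him hne)
    · exact Complex.continuous_ofReal.comp (hre.div him hne)
    · exact Complex.continuous_ofReal.comp (continuous_const.div him hne)
  refine isEmbedding_of_continuousOn (g := fun X : H3 => X.1 0 1 / X.1 1 1 + Complex.I / X.1 1 1)
    hc ?_ ?_
  · have : ∀ X ∈ range toH3, X.1 1 1 ≠ 0 := by
      rintro _ ⟨z, rfl⟩
      simp only [toH3, planeMatrix, Matrix.of_apply, Matrix.cons_val', Matrix.cons_val_one,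
        Matrix.cons_val_fin_one, ne_eq, Complex.ofReal_eq_zero]
      exact one_div_ne_zero (hne z)
    exact ((h 0 1).continuousOn.div (h 1 1).continuousOn this).add
      (continuousOn_const.div (h 1 1).continuousOn this)
  · convert UpperHalfPlane.isEmbedding_coe using 1
    funext z
    have hz : (z.im : ℂ) ≠ 0 := by exact_mod_cast hne z
    rw [← Complex.re_add_im (z : ℂ)]
    simp only [Function.comp_apply, toH3, planeMatrix, Matrix.of_apply, Matrix.cons_val',
      Matrix.cons_val_zero, Matrix.cons_val_one, Matrix.cons_val_fin_one,
      UpperHalfPlane.coe_re, UpperHalfPlane.coe_im]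
    push_cast
    field_simp

lemma dist_psl_smul (g : PSL(2, ℝ)) (z w : ℍ) : dist (g • z) (g • w) = dist z w := by
  induction g using QuotientGroup.induction_on with
  | H g => exact dist_smul g z w

namespace IdealTriangulation

variable {Γ : Subgroup PSL(2, ℝ)} {T : IdealTriangulation Γ} {β : Farey Γ → CP1}
  {β' : Farey Γ → RP1} {Ψ' : ℍ → ℍ} {ρ' : Γ →* PSL(2, ℝ)}

lemma IsStraightenedPlane.continuous (hΨ : T.IsStraightenedPlane β' Ψ') : Continuous Ψ' :=
  isEmbedding_toH3.continuous_iff.2 (IsPleatedPlane.continuous hΨ)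

lemma IsStraightenedPlane.image_triangle (hΨ : T.IsStraightenedPlane β' Ψ') {p q r : Farey Γ}
    (h : T.IsTriangle p q r) :
    Ψ' '' idealTriangle p.pt q.pt r.pt = idealTriangle (β' p) (β' q) (β' r) := by
  have := IsPleatedPlane.image_triangle hΨ p q r h
  rw [idealTriangle.eq_def (β' p), ← this, ← Function.comp_def, image_comp, preimage_image_eq _ toH3_injective]

lemma IsStraightenedPlane.image_edge (hΨ : T.IsStraightenedPlane β' Ψ') {p q : Farey Γ}
    (h : T.graph.Adj p q) : Ψ' '' geodesic p.pt q.pt = geodesic (β' p) (β' q) := by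
  have := IsPleatedPlane.image_edge hΨ p q h
  rw [geodesic.eq_def (β' p), ← this, ← Function.comp_def, image_comp, preimage_image_eq _ toH3_injective]

lemma IsStraightenedPlane.isEmbedding (hΨ : T.IsStraightenedPlane β' Ψ') {p q r : Farey Γ}
    (h : T.IsTriangle p q r) : IsEmbedding ((idealTriangle p.pt q.pt r.pt).domRestrict Ψ') := by
  have hc : Continuous ((idealTriangle p.pt q.pt r.pt).domRestrict Ψ') :=
    hΨ.continuous.comp continuous_subtype_val
  exact IsEmbedding.of_comp hc isEmbedding_toH3.continuous (IsPleatedPlane.isEmbedding hΨ p q r h)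

lemma IsStraightenedPlane.injOn (hΨ : T.IsStraightenedPlane β' Ψ') {p q r : Farey Γ}
    (h : T.IsTriangle p q r) : InjOn Ψ' (idealTriangle p.pt q.pt r.pt) :=
  injOn_iff_injective.2 (hΨ.isEmbedding h).injective

/-- The straightened plane respects the sides of the edges. -/
lemma IsStraightening.lam_pos (hs : T.IsStraightening β β') (hΨ : T.IsStraightenedPlane β' Ψ')
    {a b : Farey Γ} (h : T.graph.Adj a b) {z : ℍ} (hz : 0 < lam a.pt b.pt z) :
    0 < lam (β' a) (β' b) (Ψ' z) := by
  obtain ⟨p, q, r, ht, hc, hm⟩ := T.exists_triangle z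
  obtain ⟨s1, s2, s3⟩ := T.not_ccw_of_lam_pos h.symm ht hc hm hz
  rw [← hs.ccw_iff_of_adj h, ← ccw_swap_iff] at s1 s2 s3
  have hne : β' a ≠ β' b := fun e => h.ne (hs.injective e)
  have hm' : Ψ' z ∈ idealTriangle (β' p) (β' q) (β' r) :=
    hΨ.image_triangle ht ▸ mem_image_of_mem Ψ' hm
  have hc' := hs.ccw _ _ _ ht hc
  refine lt_of_le_of_ne (lam_nonneg_of_mem_idealTriangle hc' hne hm' s1 s2 s3) fun h0 => ?_
  have hsub : geodesic a.pt b.pt ⊆ idealTriangle p.pt q.pt r.pt := by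
    have key : ∀ {p q r : RP1}, geodesic p q ⊆ idealTriangle p q r := by
      rintro p q r z ⟨r', s', hr, hs, e⟩
      exact ⟨r', s', 0, hr, hs, le_rfl, by rw [e]; simp⟩
    rcases mem_vertices_of_lam_eq_zero hc' hne hm' s1 s2 s3 h0.symm with ⟨e, e'⟩ | ⟨e, e'⟩ | ⟨e, e'⟩
    · rw [hs.injective e, hs.injective e']
      exact key
    · rw [hs.injective e, hs.injective e', idealTriangle_rotate]
      exact key
    · rw [hs.injective e, hs.injective e', ← idealTriangle_rotate]
      exact key
  have hg := (mem_geodesic_iff hne _).2 h0.symm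
  rw [← hΨ.image_edge h] at hg
  obtain ⟨w, hw, e⟩ := hg
  have := hΨ.injOn ht (hsub hw) hm e
  rw [this, mem_geodesic_iff (T.pt_ne h)] at hw
  exact hz.ne' hw

lemma IsStraightening.lam_neg (hs : T.IsStraightening β β') (hΨ : T.IsStraightenedPlane β' Ψ')
    {a b : Farey Γ} (h : T.graph.Adj a b) {z : ℍ} (hz : lam a.pt b.pt z < 0) :
    lam (β' a) (β' b) (Ψ' z) < 0 := by
  have := hs.lam_pos hΨ h.symm (z := z) (by rw [lam_swap]; linarith)
  rw [lam_swap] at this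
  linarith

lemma IsStraightening.lam_zero (hs : T.IsStraightening β β') (hΨ : T.IsStraightenedPlane β' Ψ')
    {a b : Farey Γ} (h : T.graph.Adj a b) {z : ℍ} (hz : lam a.pt b.pt z = 0) :
    lam (β' a) (β' b) (Ψ' z) = 0 := by
  have hne : β' a ≠ β' b := fun e => h.ne (hs.injective e)
  rw [← mem_geodesic_iff hne, ← hΨ.image_edge h]
  exact mem_image_of_mem Ψ' ((mem_geodesic_iff (T.pt_ne h) z).2 hz)

lemma IsStraightening.lam_pos_iff (hs : T.IsStraightening β β') (hΨ : T.IsStraightenedPlane β' Ψ')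
    {a b : Farey Γ} (h : T.graph.Adj a b) {z : ℍ} :
    0 < lam (β' a) (β' b) (Ψ' z) ↔ 0 < lam a.pt b.pt z := by
  refine ⟨fun hp => ?_, hs.lam_pos hΨ h⟩
  by_contra hn
  rcases (not_lt.1 hn).lt_or_eq with h' | h'
  · exact absurd (hs.lam_neg hΨ h h') (not_lt.2 hp.le)
  · exact hp.ne' (hs.lam_zero hΨ h h')

lemma IsStraightening.lam_nonneg_iff (hs : T.IsStraightening β β')
    (hΨ : T.IsStraightenedPlane β' Ψ') {a b : Farey Γ} (h : T.graph.Adj a b) {z : ℍ} :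
    0 ≤ lam (β' a) (β' b) (Ψ' z) ↔ 0 ≤ lam a.pt b.pt z := by
  have := hs.lam_pos_iff hΨ h.symm (z := z)
  rw [lam_swap, lam_swap a.pt] at this
  constructor <;> intro h' <;> by_contra hn
  · linarith [this.2 (by linarith)]
  · linarith [this.1 (by linarith)]

lemma IsStraightening.mem_triangle_iff (hs : T.IsStraightening β β')
    (hΨ : T.IsStraightenedPlane β' Ψ') {p q r : Farey Γ} (h : T.IsCCWTriangle p q r) {z : ℍ} :
    Ψ' z ∈ idealTriangle (β' p) (β' q) (β' r) ↔ z ∈ idealTriangle p.pt q.pt r.pt := by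
  rw [mem_idealTriangle_iff h.2, mem_idealTriangle_iff (hs.ccw _ _ _ h.1 h.2),
    hs.lam_nonneg_iff hΨ h.1.1, hs.lam_nonneg_iff hΨ h.1.2.1, hs.lam_nonneg_iff hΨ h.1.2.2]

lemma IsStraightening.plane_injective (hs : T.IsStraightening β β')
    (hΨ : T.IsStraightenedPlane β' Ψ') : Function.Injective Ψ' := by
  intro z w e
  obtain ⟨p, q, r, ht, hc, hm⟩ := T.exists_triangle z
  have hw : w ∈ idealTriangle p.pt q.pt r.pt := by
    rw [← hs.mem_triangle_iff hΨ ⟨ht, hc⟩, ← e, hs.mem_triangle_iff hΨ ⟨ht, hc⟩]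
    exact hm
  exact hΨ.injOn ht hm hw e

/-- The inverse of the straightened plane is continuous on the image of each triangle. -/
lemma IsStraightening.continuousOn_invFun (hs : T.IsStraightening β β')
    (hΨ : T.IsStraightenedPlane β' Ψ') {p q r : Farey Γ} (h : T.IsTriangle p q r) :
    ContinuousOn (Function.invFun Ψ') (idealTriangle (β' p) (β' q) (β' r)) := by
  have hinv := Function.leftInverse_invFun (hs.plane_injective hΨ)
  rw [← hΨ.image_triangle h]
  set Δ := idealTriangle p.pt q.pt r.pt
  have e := hΨ.isEmbedding h
  rw [continuousOn_iff_continuous_domRestrict]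
  have hr : ∀ y : Ψ' '' Δ, y.1 ∈ range (Δ.domRestrict Ψ') := by
    rintro ⟨y, z, hz, rfl⟩
    exact ⟨⟨z, hz⟩, rfl⟩
  have h1 : Continuous fun y : Ψ' '' Δ => e.toHomeomorph.symm ⟨y.1, hr y⟩ :=
    e.toHomeomorph.symm.continuous.comp (continuous_subtype_val.subtype_mk _)
  refine (continuous_subtype_val.comp h1).congr fun y => ?_
  obtain ⟨y, z, hz, rfl⟩ := y
  have : e.toHomeomorph ⟨z, hz⟩ = ⟨Ψ' z, hr ⟨Ψ' z, z, hz, rfl⟩⟩ := rfl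
  change (e.toHomeomorph.symm ⟨Ψ' z, hr ⟨Ψ' z, z, hz, rfl⟩⟩).1 = Function.invFun Ψ' (Ψ' z)
  rw [← this, Homeomorph.symm_apply_apply, hinv]

lemma IsStraightening.isOpenEmbedding (hs : T.IsStraightening β β')
    (hΨ : T.IsStraightenedPlane β' Ψ') : IsOpenEmbedding Ψ' := by
  have hinv := Function.leftInverse_invFun (hs.plane_injective hΨ)
  refine IsOpenEmbedding.of_continuous_injective_isOpenMap hΨ.continuous (hs.plane_injective hΨ) ?_
  rw [isOpenMap_iff_nhds_le]
  have key : ∀ (z : ℍ) (N : Set ℍ), N ∈ 𝓝 (Ψ' z) → N ⊆ range Ψ' →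
      ContinuousOn (Function.invFun Ψ') N → 𝓝 (Ψ' z) ≤ Filter.map Ψ' (𝓝 z) := by
    intro z N hN hNr hc U hU
    have h1 : ContinuousAt (Function.invFun Ψ') (Ψ' z) := hc.continuousAt hN
    have h2 : Function.invFun Ψ' ⁻¹' (Ψ' ⁻¹' U) ∈ 𝓝 (Ψ' z) := by
      refine h1 ?_
      rw [hinv z]
      exact hU
    filter_upwards [h2, hN] with y hy hy'
    obtain ⟨w, rfl⟩ := hNr hy'
    rw [mem_preimage, mem_preimage, hinv w] at hy
    exact hy
  have hsub : ∀ {p q r : Farey Γ}, T.IsTriangle p q r →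
      idealTriangle (β' p) (β' q) (β' r) ⊆ range Ψ' := fun h => by
    rw [← hΨ.image_triangle h]
    exact image_subset_range _ _
  intro z
  rcases T.interior_or_edge z with ⟨p, q, r, ht, h1, h2, h3⟩ | ⟨a, s, b, r, hq, h0⟩
  · exact key z _ (mem_nhds_of_interior (hs.ccw _ _ _ ht.1 ht.2) (hs.lam_pos hΨ ht.1.1 h1)
      (hs.lam_pos hΨ ht.1.2.1 h2) (hs.lam_pos hΨ ht.1.2.2 h3)) (hsub ht.1)
      (hs.continuousOn_invFun hΨ ht.1)
  · have hl := hs.ccw _ _ _ hq.left.1 hq.left.2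
    have hr := hs.ccw _ _ _ hq.right.1 hq.right.2
    exact key z _ (union_mem_nhds hl hr (hs.lam_zero hΨ hq.adj h0))
      (union_subset (hsub hq.left.1) (hsub hq.right.1))
      ((hs.continuousOn_invFun hΨ hq.left.1).union_of_isClosed (hs.continuousOn_invFun hΨ hq.right.1)
        (isClosed_idealTriangle hl) (isClosed_idealTriangle hr))

lemma IsStraightening.holonomy_injective (hfree : ActsFreely Γ) (hs : T.IsStraightening β β')
    (hΨ : T.IsStraightenedPlane β' Ψ') (hρ : IsEquivariant ρ' Ψ') : Function.Injective ρ' := by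
  rw [injective_iff_map_eq_one]
  intro γ hγ
  have : γ • UpperHalfPlane.I = UpperHalfPlane.I := by
    apply hs.plane_injective hΨ
    rw [hρ, hγ, one_smul]
  exact Subtype.ext (hfree γ γ.2 _ this)

/-- The induced map of the quotient surfaces is a homeomorphism. -/
lemma IsStraightening.exists_homeo (hs : T.IsStraightening β β')
    (hΨ : T.IsStraightenedPlane β' Ψ') (hρ : IsEquivariant ρ' Ψ') :
    ∃ h : Quotient (MulAction.orbitRel Γ ℍ) ≃ₜ
      Quotient ((MulAction.orbitRel ρ'.range ℍ).comap (Subtype.val : range Ψ' → ℍ)),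
    ∀ z : ℍ, h (Quotient.mk _ z) = Quotient.mk _ ⟨Ψ' z, mem_range_self z⟩ := by
  let e : ℍ ≃ₜ range Ψ' := (hs.isOpenEmbedding hΨ).isEmbedding.toHomeomorph
  have he : ∀ z, e z = ⟨Ψ' z, mem_range_self z⟩ := fun z => rfl
  have rel : ∀ z w : ℍ, MulAction.orbitRel Γ ℍ z w ↔
      (MulAction.orbitRel ρ'.range ℍ).comap (Subtype.val : range Ψ' → ℍ) (e z) (e w) := by
    intro z w
    change z ∈ MulAction.orbit Γ w ↔ Ψ' z ∈ MulAction.orbit ρ'.range (Ψ' w)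
    constructor
    · rintro ⟨γ, rfl⟩
      exact ⟨⟨ρ' γ, γ, rfl⟩, (hρ γ w).symm⟩
    · rintro ⟨⟨_, γ, rfl⟩, h⟩
      exact ⟨γ, hs.plane_injective hΨ ((hρ γ w).trans h)⟩
  refine ⟨⟨Quotient.congr e.toEquiv rel, ?_, ?_⟩, fun z => rfl⟩
  · exact e.continuous.quotient_map' fun a b h => (rel a b).1 h
  · exact e.symm.continuous.quotient_map' fun a b h => (rel _ _).2 (by simpa using h)

/-- The holonomy group is Fuchsian: since the straightened plane is open and injective, the orbit of a
point of its image is uniformly discrete. -/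
lemma IsStraightening.isFuchsian_range (hΓ : IsFuchsian Γ) (hfree : ActsFreely Γ)
    (hs : T.IsStraightening β β') (hΨ : T.IsStraightenedPlane β' Ψ') (hρ : IsEquivariant ρ' Ψ') :
    IsFuchsian ρ'.range := by
  set z₀ : ℍ := UpperHalfPlane.I
  -- the orbit of `z₀` stays away from `z₀`, hence so does the orbit of its image
  obtain ⟨δ, hδ, hδ'⟩ : ∃ δ > 0, ∀ γ : Γ, γ ≠ 1 → δ ≤ dist (γ • z₀) z₀ := by
    have hfin := hΓ _ (isCompact_closedBall z₀ 1)
    have hfin' : {γ : Γ | dist (γ • z₀) z₀ ≤ 1}.Finite := by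
      refine Finite.of_finite_image (f := Subtype.val) (hfin.subset ?_) Subtype.val_injective.injOn
      rintro _ ⟨γ, hγ, rfl⟩
      exact ⟨γ.2, γ • z₀, ⟨z₀, Metric.mem_closedBall_self zero_le_one, rfl⟩, hγ⟩
    have hev : ∀ γ : Γ, γ ≠ 1 → 0 < dist (γ • z₀) z₀ := fun γ hγ =>
      dist_pos.2 fun h => hγ (Subtype.ext (hfree γ γ.2 z₀ h))
    have hfin'' := hfin'.subset (fun γ (h : γ ∈ {γ : Γ | dist (γ • z₀) z₀ ≤ 1} ∩ {γ | γ ≠ 1}) => h.1)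
    rcases ({γ : Γ | dist (γ • z₀) z₀ ≤ 1} ∩ {γ | γ ≠ 1}).eq_empty_or_nonempty with he | hne
    · refine ⟨1, one_pos, fun γ hγ => ?_⟩
      by_contra h
      have : γ ∈ ({γ : Γ | dist (γ • z₀) z₀ ≤ 1} ∩ {γ | γ ≠ 1}) := ⟨(not_le.1 h).le, hγ⟩
      rw [he] at this
      exact this
    · obtain ⟨γ₀, h₀, hmin⟩ := exists_min_image _ (fun γ : Γ => dist (γ • z₀) z₀) hfin'' hne
      refine ⟨dist (γ₀ • z₀) z₀, hev _ h₀.2, fun γ hγ => ?_⟩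
      by_cases h : dist (γ • z₀) z₀ ≤ 1
      · exact hmin γ ⟨h, hγ⟩
      · exact h₀.1.trans (not_le.1 h).le
  obtain ⟨ε, hε, hball⟩ := Metric.mem_nhds_iff.1 ((hs.isOpenEmbedding hΨ).isOpenMap.image_mem_nhds
    (Metric.ball_mem_nhds z₀ hδ))
  have hsep : ∀ γ γ' : Γ, γ ≠ γ' → ε ≤ dist (ρ' γ • Ψ' z₀) (ρ' γ' • Ψ' z₀) := by
    intro γ γ' hne
    by_contra h
    have h1 : ρ' (γ'⁻¹ * γ) • Ψ' z₀ ∈ Metric.ball (Ψ' z₀) ε := by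
      rw [Metric.mem_ball, ← dist_psl_smul (ρ' γ'), ← mul_smul, ← map_mul, mul_inv_cancel_left]
      exact not_le.1 h
    obtain ⟨w, hw, e⟩ := hball h1
    rw [← hρ] at e
    rw [hs.plane_injective hΨ e, Metric.mem_ball] at hw
    exact absurd (hδ' (γ'⁻¹ * γ) fun h => hne (inv_mul_eq_one.1 h).symm) (not_le.2 hw)
  intro K hK
  obtain ⟨D, hD⟩ := hK.isBounded.subset_closedBall (Ψ' z₀)
  obtain ⟨t, -, ht, hcov⟩ := Metric.totallyBounded_iff.1
    (isCompact_closedBall (Ψ' z₀) (D + D)).totallyBounded (ε / 2) (half_pos hε) |>.imp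
      fun t h => (⟨trivial, h⟩ : True ∧ _ ∧ _)
  have hin : ∀ g ∈ {g : PSL(2, ℝ) | g ∈ ρ'.range ∧ (((g • ·) '' K) ∩ K).Nonempty},
      ∃ c ∈ t, dist (g • Ψ' z₀) c < ε / 2 := by
    rintro g ⟨-, _, ⟨k, hk, rfl⟩, hk'⟩
    have h1 : g • Ψ' z₀ ∈ Metric.closedBall (Ψ' z₀) (D + D) := by
      have a := hD hk
      have b := hD hk'
      rw [Metric.mem_closedBall] at a b ⊢
      have c := dist_psl_smul g (Ψ' z₀) k
      rw [dist_comm (Ψ' z₀) k] at c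
      linarith [dist_triangle (g • Ψ' z₀) (g • k) (Ψ' z₀)]
    simpa using hcov h1
  choose! c hct hc using hin
  refine Finite.of_injOn (f := c) (fun g hg => hct g hg) ?_ ht
  rintro _ hg _ hg' e
  obtain ⟨γ, rfl⟩ := hg.1
  obtain ⟨γ', rfl⟩ := hg'.1
  by_contra hne
  have h1 := hsep γ γ' fun h => hne (by rw [h])
  have h2 := hc _ hg
  have h3 := hc _ hg'
  rw [← e] at h3
  linarith [dist_triangle_right (ρ' γ • Ψ' z₀) (ρ' γ' • Ψ' z₀) (c (ρ' γ))]

end IdealTriangulation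

/-! ### The complement of the developed image -/

/-- A point lies beyond at most one side of an ideal triangle, in the strong sense that any two of its
coordinates have positive sum. -/
lemma lam_add_pos {p q r : RP1} (h : CCW p q r) (z : ℍ) : 0 < lam q r z + lam r p z := by
  obtain ⟨g, hg⟩ := exists_chart h
  have him := (g⁻¹ • z).im_pos
  have : ((g⁻¹ • z : ℍ) : ℂ).im = 1 / (lam q r z + lam r p z) := by
    rw [hg]
    simp only [triCoords]
    rw [← Complex.ofReal_add, Complex.div_ofReal_im]
    simp
  rw [UpperHalfPlane.coe_im] at this
  rwa [this, one_div, inv_pos] at him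

lemma lam_neg_of_ccw {a b q : RP1} (h : CCW a b q) {y : ℍ} (hy : lam a b y < 0) : lam a q y < 0 := by
  have := lam_add_pos (ccw_rotate.1 h) y
  rw [lam_swap a q] at this
  linarith

lemma lam_neg_of_ccw' {a b q : RP1} (h : CCW q a b) {y : ℍ} (hy : lam a b y < 0) : lam q b y < 0 := by
  have := lam_add_pos h y
  rw [lam_swap q b] at this
  linarith

lemma lam_chart (A : SL(2, ℝ)) (p q : RP1) (y : ℍ) : lam (A • p) (A • q) y = lam p q (A⁻¹ • y) := by
  have := lam_smul A p q (A⁻¹ • y)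
  rwa [smul_inv_smul] at this

lemma chart_between {A : SL(2, ℝ)} {x z : ℝ} {p : RP1} (h : CCW (A • realPt x) p (A • realPt z))
    (hxz : x < z) : ∃ t, p = A • realPt t ∧ x < t ∧ t < z := by
  have hp : p ≠ A • inftyPt ℝ := by
    rintro rfl
    rw [ccw_smul_iff, ccw_rotate, ccw_rotate, ccw_infty] at h
    exact lt_asymm h hxz
  obtain ⟨t, rfl⟩ := chart_cases A hp
  rw [ccw_smul_iff, ccw_realPt, cyclic_iff_mul_pos] at h
  exact ⟨t, rfl, by grind⟩

/-- If the cross-ratio of `x < u < v < w` is at least `m`, then the middle interval is shorter than the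
whole one by a factor that depends on `m`. -/
lemma sub_le_of_crossRatio {x u v w m : ℝ} (h1 : x < u) (h2 : u < v) (h3 : v < w) (hm : 0 < m)
    (h : m ≤ crossRatio (realPt x) (realPt u) (realPt v) (realPt w)) :
    v - u ≤ (1 + 4 * m)⁻¹ * (w - x) := by
  have e : crossRatio (realPt x) (realPt u) (realPt v) (realPt w) =
      ((u - x) * (w - v)) / ((v - u) * (w - x)) := by
    simp only [realPt, crossRatio_mk]
    simp only [det2, Matrix.cons_val_zero, Matrix.cons_val_one, Matrix.cons_val_fin_one]
    congr 1 <;> ring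
  have hd : 0 < (v - u) * (w - x) := mul_pos (by linarith) (by linarith)
  rw [e, le_div_iff₀ hd] at h
  have hL : 0 < w - x := by linarith
  rw [inv_mul_eq_div, le_div_iff₀ (by positivity)]
  have h4 : 4 * (m * ((v - u) * (w - x))) ≤ (w - x) * ((w - x) - (v - u)) := by
    nlinarith [sq_nonneg ((u - x) - (w - v)), mul_pos (sub_pos.2 h2) (sub_pos.2 h1),
      mul_pos (sub_pos.2 h2) (sub_pos.2 h3)]
  have h5 : (w - x) * (4 * m * (v - u)) ≤ (w - x) * ((w - x) - (v - u)) := by linarith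
  have := le_of_mul_le_mul_left h5 hL
  linarith

/-- A point below the half-circle over `x, t` has height less than `t - x`. -/
lemma im_lt_of_lam_neg {x t : ℝ} (h : x < t) {y : ℍ} (hy : lam (realPt x) (realPt t) y < 0) :
    y.im < t - x := by
  have him := y.im_pos
  have hd : 0 < y.im * (t - x) := mul_pos him (by linarith)
  rw [lam_realPt, div_lt_iff₀ hd, zero_mul] at hy
  nlinarith [sq_nonneg ((y.re - x) + (y.re - t))]

namespace IdealTriangulation

variable {Γ : Subgroup PSL(2, ℝ)} {T : IdealTriangulation Γ} {β : Farey Γ → CP1}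
  {β' : Farey Γ → RP1} {Ψ' : ℍ → ℍ} {ρ' : Γ →* PSL(2, ℝ)}

/-- The points that lie beyond all pleating lines ending at `β' p`, on the left or on the right of
all of them. -/
def Beyond (T : IdealTriangulation Γ) (β' : Farey Γ → RP1) (p : Farey Γ) : Set ℍ :=
  {y | ∀ q, T.graph.Adj p q → lam (β' p) (β' q) y < 0} ∪
    {y | ∀ q, T.graph.Adj p q → 0 < lam (β' p) (β' q) y}

/-- A point outside of the developed image that lies beyond a side of a triangle lies beyond one of
the two other sides. -/
lemma IsStraightening.lam_neg_or (hs : T.IsStraightening β β') (hΨ : T.IsStraightenedPlane β' Ψ')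
    {y : ℍ} (hy : y ∉ range Ψ') {a b c : Farey Γ} (h : T.IsTriangle a c b) (hc : CCW a.pt c.pt b.pt)
    (hab : lam (β' a) (β' b) y < 0) : lam (β' a) (β' c) y < 0 ∨ lam (β' c) (β' b) y < 0 := by
  by_contra hn
  push Not at hn
  refine hy ?_
  have : y ∈ idealTriangle (β' a) (β' c) (β' b) := by
    rw [mem_idealTriangle_iff (hs.ccw _ _ _ h hc)]
    refine ⟨hn.1, hn.2, ?_⟩
    rw [lam_swap]
    linarith
  rw [← hΨ.image_triangle h] at this
  exact image_subset_range _ _ this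

/-- On its way towards a point outside of the developed image, the sequence of triangles that turns
around the vertex `a` eventually leaves this vertex, unless the point lies beyond all edges at `a`. -/
lemma IsStraightening.exists_turn_left (hs : T.IsStraightening β β')
    (hΨ : T.IsStraightenedPlane β' Ψ') {y : ℍ} (hy : y ∉ range Ψ') {a b d : Farey Γ}
    (hH : y ∉ T.Beyond β' a) (h : T.IsTriangle a b d) (hc : CCW a.pt b.pt d.pt)
    (hab : lam (β' a) (β' b) y < 0) :
    ∃ b' c d', T.IsQuad a c b' d' ∧ lam (β' a) (β' b') y < 0 ∧ lam (β' c) (β' b') y < 0 ∧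
      (d' = d ∨ CCW a.pt d'.pt d.pt) := by
  by_contra! H
  have key : ∀ {x b q : Farey Γ}, T.Desc x b q → x = a → T.graph.Adj a q →
      ∀ d', T.IsTriangle a b d' → CCW a.pt b.pt d'.pt → (d' = d ∨ CCW a.pt d'.pt d.pt) →
      lam (β' a) (β' b) y < 0 → lam (β' a) (β' q) y < 0 := by
    intro x b q hD
    induction hD with
    | @apex x b q h1 h2 =>
      rintro rfl hq d' t1 t2 t3 hl
      rcases hs.lam_neg_or hΨ hy h1 h2 hl with h' | h'
      · exact h'
      · have := H b q d' ⟨h1, t1, h2, t2⟩ hl h'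
        tauto
    | @left x b c q h1 h2 _ ih =>
      rintro rfl hq d' t1 t2 t3 hl
      rcases hs.lam_neg_or hΨ hy h1 h2 hl with h' | h'
      · refine ih rfl hq b h1 h2 (Or.inr ?_) h'
        rcases t3 with rfl | t3
        · exact t2
        · simp only [ccw_iff_theta] at *; grind
      · have := H b c d' ⟨h1, t1, h2, t2⟩ hl h'
        tauto
    | @right x b c q h1 h2 hD _ =>
      rintro rfl hq
      exact (T.not_cross h1.2.1 hq.symm hD.ccw (ccw_rotate.1 (ccw_rotate.1 h2))).elim
  refine hH (Or.inl fun q hq => ?_)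
  by_cases hqb : q = b
  · rw [hqb]; exact hab
  have hn : q.pt ≠ b.pt := fun e => hqb (Farey.pt_injective e)
  rcases ccw_or_ccw (T.pt_ne hq) hn (T.pt_ne h.1).symm with h' | h'
  · exact key (T.desc_of_ccw h.1 h') rfl hq d h hc (Or.inl rfl) hab
  · exact lam_neg_of_ccw ((hs.ccw_iff_of_adj hq).2 h') hab

/-- The mirror image of `exists_turn_left`. -/
lemma IsStraightening.exists_turn_right (hs : T.IsStraightening β β')
    (hΨ : T.IsStraightenedPlane β' Ψ') {y : ℍ} (hy : y ∉ range Ψ') {a b : Farey Γ}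
    (hH : y ∉ T.Beyond β' b) (h : T.graph.Adj a b) (hab : lam (β' a) (β' b) y < 0) :
    ∃ a' e, T.IsTriangle a' e b ∧ CCW a'.pt e.pt b.pt ∧ lam (β' a') (β' e) y < 0 ∧
      (a' = a ∨ CCW a.pt a'.pt b.pt) := by
  by_contra! H
  have key : ∀ {a' x q : Farey Γ}, T.Desc a' x q → x = b → T.graph.Adj q b →
      (a' = a ∨ CCW a.pt a'.pt b.pt) →
      lam (β' a') (β' b) y < 0 → lam (β' q) (β' b) y < 0 := by
    intro a' x q hD
    induction hD with
    | @apex a' x q h1 h2 =>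
      rintro rfl hq t hl
      rcases hs.lam_neg_or hΨ hy h1 h2 hl with h' | h'
      · have := H a' q h1 h2 h'
        tauto
      · exact h'
    | @left a' x c q h1 h2 hD _ =>
      rintro rfl hq
      exact (T.not_cross h1.1 hq hD.ccw (ccw_rotate.1 h2)).elim
    | @right a' x c q h1 h2 _ ih =>
      rintro rfl hq t hl
      rcases hs.lam_neg_or hΨ hy h1 h2 hl with h' | h'
      · have := H a' c h1 h2 h'
        tauto
      · refine ih rfl hq (Or.inr ?_) h'
        rcases t with rfl | t
        · exact h2
        · simp only [ccw_iff_theta] at *; grind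
  refine hH (Or.inr fun q hq => ?_)
  rw [lam_swap, neg_pos]
  by_cases hqa : q = a
  · rw [hqa]; exact hab
  have hn : q.pt ≠ a.pt := fun e => hqa (Farey.pt_injective e)
  rcases ccw_or_ccw hn (T.pt_ne h) (T.pt_ne hq) with h' | h'
  · refine lam_neg_of_ccw' ?_ hab
    have h3 : CCW (β' q) (β' a) (β' b) := (hs.ccw_iff_of_adj hq.symm).2 h'
    exact h3
  · exact key (T.desc_of_ccw h (ccw_rotate.1 (ccw_rotate.1 (ccw_swap_iff.2 (ccw_rotate.1 h'))))) rfl hq.symm (Or.inl rfl) hab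

/-- The moduli of the cross-ratios are bounded below since there are finitely many edges modulo the
group. -/
lemma exists_le_norm_crossRatio {ρ : Γ →* PSL(2, ℂ)} (hβ : IsEquivariant ρ β)
    (hFG : T.HasNonzeroCoordinates β) : ∃ m > 0, ∀ p₁ p₂ p₃ p₄, T.IsQuad p₁ p₂ p₃ p₄ →
      m ≤ ‖crossRatio (β p₁) (β p₂) (β p₃) (β p₄)‖ := by
  obtain ⟨F, hF, hF'⟩ := T.finite_orbits
  have hm : ∀ e : Farey Γ × Farey Γ, ∃ m : ℝ, 0 < m ∧ ∀ s r, T.IsQuad e.1 s e.2 r →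
      m ≤ ‖crossRatio (β e.1) (β s) (β e.2) (β r)‖ := by
    intro e
    by_cases h : ∃ s r, T.IsQuad e.1 s e.2 r
    · obtain ⟨s, r, h⟩ := h
      refine ⟨_, norm_pos_iff.2 (hFG _ _ _ _ h).2, fun s' r' h' => ?_⟩
      obtain ⟨rfl, rfl⟩ := h.unique h'
      exact le_rfl
    · exact ⟨1, one_pos, fun s r h' => absurd ⟨s, r, h'⟩ h⟩
  choose m hm0 hm1 using hm
  have hne : F.Nonempty := by
    obtain ⟨p, q, r, h, -, -⟩ := T.exists_triangle UpperHalfPlane.I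
    obtain ⟨γ, hγ⟩ := hF' p q h.1
    exact ⟨_, hγ⟩
  obtain ⟨e, he, hmin⟩ := exists_min_image F m hF hne
  refine ⟨m e, hm0 e, fun p₁ p₂ p₃ p₄ h => ?_⟩
  obtain ⟨γ, hγ⟩ := hF' _ _ h.adj
  have := hm1 (γ • p₁, γ • p₃) _ _ (h.smul γ)
  dsimp only at this
  rw [hβ, hβ, hβ, hβ, crossRatio_psl_smul] at this
  exact (hmin _ hγ).trans this

/-- A point outside of the developed image lies beyond all pleating lines at some ideal point. If not,
the sequence of edges that separate it from a base triangle would change its pivot infinitely often;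
as the cross-ratios are bounded, the half-planes bounded by these edges would shrink to a point of the
ideal boundary. -/
theorem IsStraightening.exists_mem_beyond {ρ : Γ →* PSL(2, ℂ)} (hβ : IsEquivariant ρ β)
    (hFG : T.HasNonzeroCoordinates β) (hs : T.IsStraightening β β')
    (hΨ : T.IsStraightenedPlane β' Ψ') {y : ℍ} (hy : y ∉ range Ψ') : ∃ p, y ∈ T.Beyond β' p := by
  by_contra! hH
  obtain ⟨m, hm, hcr⟩ := exists_le_norm_crossRatio hβ hFG
  obtain ⟨a, b, hab, hlab⟩ : ∃ a b, T.graph.Adj a b ∧ lam (β' a) (β' b) y < 0 := by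
    obtain ⟨p, q, r, h, hc, -⟩ := T.exists_triangle UpperHalfPlane.I
    by_contra! hn
    refine hy (image_subset_range _ _ ((hΨ.image_triangle h).symm ▸
      (mem_idealTriangle_iff (hs.ccw _ _ _ h hc) y).2 ⟨hn _ _ h.1, hn _ _ h.2.1, hn _ _ h.2.2⟩))
  -- a chart in which the whole segment of the ideal boundary beyond the edge `a, b` is visible
  obtain ⟨o, ho, hoc⟩ := T.exists_apex hab.symm
  obtain ⟨A, hA⟩ := exists_smul_infty (β' o)
  have hoc' := hs.ccw _ _ _ ho hoc
  rw [← hA] at hoc'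
  obtain ⟨x₀, hx₀⟩ := chart_cases A hoc'.ne23.symm
  obtain ⟨z₀, hz₀⟩ := chart_cases A hoc'.ne12
  rw [hx₀, hz₀, ccw_smul_iff, ccw_rotate, ccw_rotate, ccw_infty] at hoc'
  -- `L ℓ`: the point lies beyond the side `a, e` of a triangle `a, e, d` whose outer vertices `a, d`
  -- are at distance at most `ℓ` in the chart
  let L : ℝ → Prop := fun ℓ => ∃ a e d x z, T.IsTriangle a e d ∧ CCW a.pt e.pt d.pt ∧
    lam (β' a) (β' e) y < 0 ∧ β' a = A • realPt x ∧ β' d = A • realPt z ∧ x < z ∧ z - x ≤ ℓ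
  have right : ∀ {a b : Farey Γ} {x z : ℝ}, T.graph.Adj a b → lam (β' a) (β' b) y < 0 →
      β' a = A • realPt x → β' b = A • realPt z → x < z → L (z - x) := by
    intro a b x z h hl hx hz hxz
    obtain ⟨a', e, ht, hc, hl', ha'⟩ := hs.exists_turn_right hΨ hy (hH b) h hl
    rcases ha' with rfl | ha'
    · exact ⟨_, e, b, x, z, ht, hc, hl', hx, hz, hxz, le_rfl⟩
    · have := (hs.ccw_iff_of_adj h).2 ha'
      rw [hx, hz] at this
      obtain ⟨t, ht', h1, h2⟩ := chart_between this hxz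
      exact ⟨a', e, b, t, z, ht, hc, hl', ht', hz, h2, by linarith⟩
  have base : L (z₀ - x₀) := right hab hlab hx₀ hz₀ hoc'
  -- turning around `a` until this vertex is left, and then around the new vertex, contracts `ℓ`
  have step : ∀ ℓ, L ℓ → L ((1 + 4 * m)⁻¹ * ℓ) := by
    rintro ℓ ⟨a, e, d, x, z, ht, hc, hl, hx, hz, hxz, hℓ⟩
    obtain ⟨b', c, d', hq, hl1, hl2, hd'⟩ := hs.exists_turn_left hΨ hy (hH a) ht hc hl
    obtain ⟨w, hw, hxw, hwz⟩ : ∃ w, β' d' = A • realPt w ∧ x < w ∧ w ≤ z := by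
      rcases hd' with rfl | hd'
      · exact ⟨z, hz, hxz, le_rfl⟩
      · have := (hs.ccw_iff_of_adj ht.2.2.symm).2 hd'
        rw [hx, hz] at this
        obtain ⟨t, ht', h1, h2⟩ := chart_between this hxz
        exact ⟨t, ht', h1, h2.le⟩
    have h1 := hs.ccw _ _ _ hq.2.1 hq.2.2.2
    rw [hx, hw] at h1
    obtain ⟨v, hv, hxv, hvw⟩ := chart_between h1 hxw
    have h2 := hs.ccw _ _ _ hq.1 hq.2.2.1
    rw [hx, hv] at h2
    obtain ⟨u, hu, hxu, huv⟩ := chart_between h2 hxv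
    have h3 := hcr _ _ _ _ hq
    rw [← hs.crossRatio_eq _ _ _ _ hq, hx, hu, hv, hw, crossRatio_smul] at h3
    have h4 := sub_le_of_crossRatio hxu huv hvw hm h3
    obtain ⟨a, e, d, x', z', i1, i2, i3, i4, i5, i6, i7⟩ := right hq.1.2.1 hl2 hu hv huv
    refine ⟨a, e, d, x', z', i1, i2, i3, i4, i5, i6, (i7.trans h4).trans ?_⟩
    gcongr
    linarith
  have all : ∀ n : ℕ, L ((1 + 4 * m)⁻¹ ^ n * (z₀ - x₀)) := by
    intro n
    induction n with
    | zero => simpa using base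
    | succ n ih =>
      have := step _ ih
      rwa [← mul_assoc, ← pow_succ'] at this
  have hpos : 0 < (A⁻¹ • y).im / (z₀ - x₀) := div_pos (A⁻¹ • y).im_pos (by linarith)
  obtain ⟨n, hn⟩ := exists_pow_lt_of_lt_one hpos (inv_lt_one_of_one_lt₀ (by linarith : 1 < 1 + 4 * m))
  rw [lt_div_iff₀ (by linarith)] at hn
  obtain ⟨a, e, d, x, z, ht, hc, hl, hx, hz, hxz, hℓ⟩ := all n
  have h1 := hs.ccw _ _ _ ht hc
  rw [hx, hz] at h1
  obtain ⟨t, ht, h2, h3⟩ := chart_between h1 hxz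
  rw [hx, ht, lam_chart] at hl
  linarith [im_lt_of_lam_neg h2 hl]

/-- The points beyond all edges at `p` lie on the same side of every edge as `p`. -/
lemma IsStraightening.lam_neg_of_mem_beyond (hs : T.IsStraightening β β') {a b p : Farey Γ}
    (h : T.graph.Adj a b) (hc : CCW a.pt p.pt b.pt) {y : ℍ} (hy : y ∈ T.Beyond β' p) :
    lam (β' a) (β' b) y < 0 := by
  have := T.desc_of_ccw h hc
  clear h hc
  induction this with
  | @apex a b p h1 h2 =>
    have hc := hs.ccw _ _ _ h1 h2
    have h5 := lam_swap (β' a) (β' b) y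
    rcases hy with hy | hy
    · linarith [hy b h1.2.1, lam_add_pos hc y]
    · linarith [hy a h1.1.symm, lam_add_pos (ccw_rotate.1 hc) y, lam_swap (β' a) (β' p) y]
  | @left a b c p h1 h2 _ ih =>
    have hc := hs.ccw _ _ _ h1 h2
    linarith [ih hy, lam_add_pos (ccw_rotate.1 hc) y, lam_swap (β' a) (β' b) y]
  | @right a b c p h1 h2 _ ih =>
    have hc := hs.ccw _ _ _ h1 h2
    linarith [ih hy, lam_add_pos hc y, lam_swap (β' a) (β' b) y]

end IdealTriangulation

/-! ### Coordinates on the ideal boundary and affine recursions -/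

lemma eq_add_of_shift {f : ℤ → ℝ} {t : ℝ} (h : ∀ n, f (n + 1) = f n + t) (n : ℤ) :
    f n = f 0 + n * t := by
  induction n using Int.induction_on with
  | zero => simp
  | succ i ih => rw [h, ih]; push_cast; ring
  | pred i ih =>
    have := h (-i - 1)
    rw [sub_add_cancel, ih] at this
    push_cast at *
    linarith

lemma eq_mul_of_shift {f : ℤ → ℝ} {l : ℝ} (hl : 0 < l) (h : ∀ n, f (n + 1) = l * f n) (n : ℤ) :
    f n = l ^ n * f 0 := by
  induction n using Int.induction_on with
  | zero => simp
  | succ i ih => rw [h, ih, zpow_add_one₀ hl.ne']; ring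
  | pred i ih =>
    have := h (-i - 1)
    rw [sub_add_cancel, ih] at this
    rw [zpow_sub_one₀ hl.ne', mul_right_comm, this]
    field_simp

/-- The coordinate of an ideal point in the chart in which `A • ∞` lies at infinity (arbitrary for the
point `A • ∞` itself). -/
def coord (A : SL(2, ℝ)) (q : RP1) : ℝ := Classical.epsilon fun x => q = A • realPt x

lemma coord_spec {A : SL(2, ℝ)} {q : RP1} (h : q ≠ A • inftyPt ℝ) : q = A • realPt (coord A q) :=
  Classical.epsilon_spec (chart_cases A h)

lemma coord_eq {A : SL(2, ℝ)} {x : ℝ} : coord A (A • realPt x) = x := by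
  have : A • realPt x ≠ A • inftyPt ℝ := fun h => realPt_ne_infty x (MulAction.injective A h)
  exact (realPt_injective (MulAction.injective A (coord_spec this))).symm

lemma lam_coord {A : SL(2, ℝ)} {p q : RP1} (hA : A • inftyPt ℝ = p) (h : q ≠ p) (z : ℍ) :
    lam p q z = ((A⁻¹ • z).re - coord A q) / (A⁻¹ • z).im := by
  conv_lhs => rw [← hA, coord_spec (hA ▸ h : q ≠ A • inftyPt ℝ), lam_chart, lam_infty_realPt]

lemma ccw_coord {A : SL(2, ℝ)} {p q r : RP1} (hA : A • inftyPt ℝ = p) (hq : q ≠ p) (hr : r ≠ p) :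
    CCW p q r ↔ coord A q < coord A r := by
  conv_lhs => rw [← hA, coord_spec (hA ▸ hq : q ≠ A • inftyPt ℝ),
    coord_spec (hA ▸ hr : r ≠ A • inftyPt ℝ), ccw_smul_iff, ccw_rotate, ccw_infty]

lemma exists_zpow_lt {l : ℝ} (hl : 0 < l) (h1 : l ≠ 1) {ε : ℝ} (hε : 0 < ε) :
    (∃ n : ℤ, l ^ n < ε) ∧ ∃ n : ℤ, ε < l ^ n := by
  have main : ∀ {l ε : ℝ}, 0 < ε → 1 < l → ∃ n : ℤ, ε < l ^ n := fun {l ε} hε hl => by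
    obtain ⟨n, hn⟩ := pow_unbounded_of_one_lt ε hl
    exact ⟨n, by simpa using hn⟩
  have both : ∀ {ε}, 0 < ε → ∃ n : ℤ, ε < l ^ n := fun {ε} hε => by
    rcases h1.lt_or_gt with h | h
    · obtain ⟨n, hn⟩ := main hε (one_lt_inv₀ hl |>.2 h)
      exact ⟨-n, by simpa using hn⟩
    · exact main hε h
  refine ⟨?_, both hε⟩
  obtain ⟨n, hn⟩ := both (inv_pos.2 hε)
  refine ⟨-n, ?_⟩
  rw [zpow_neg]
  exact inv_lt_of_inv_lt₀ hε hn

/-! ### The holonomy acts freely -/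

namespace IdealTriangulation

variable {Γ : Subgroup PSL(2, ℝ)} {T : IdealTriangulation Γ} {β : Farey Γ → CP1}
  {β' : Farey Γ → RP1} {Ψ' : ℍ → ℍ} {ρ' : Γ →* PSL(2, ℝ)}

lemma Desc.adj_or_separated {a b p q : Farey Γ} (h : T.Desc a b q) (hp : a = p ∨ b = p) :
    T.graph.Adj p q ∨ ∃ c d, T.graph.Adj c d ∧ CCW c.pt q.pt d.pt ∧ CCW d.pt p.pt c.pt := by
  induction h with
  | @apex a b q h1 h2 =>
    rcases hp with rfl | rfl
    · exact Or.inl h1.1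
    · exact Or.inl h1.2.1.symm
  | @left a b c q h1 h2 h3 ih =>
    rcases hp with rfl | rfl
    · exact ih (Or.inl rfl)
    · exact Or.inr ⟨a, c, h1.1, h3.ccw, ccw_rotate.1 h2⟩
  | @right a b c q h1 h2 h3 ih =>
    rcases hp with rfl | rfl
    · exact Or.inr ⟨c, b, h1.2.1, h3.ccw, ccw_rotate.1 (ccw_rotate.1 h2)⟩
    · exact ih (Or.inr rfl)

/-- Two vertices are neighbours, or an edge separates them. -/
lemma adj_or_separated {p q : Farey Γ} (h : p ≠ q) :
    T.graph.Adj p q ∨ ∃ c d, T.graph.Adj c d ∧ CCW c.pt q.pt d.pt ∧ CCW d.pt p.pt c.pt := by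
  obtain ⟨a, b, ht, hc⟩ := T.exists_triangle_of_vertex p
  rcases desc_cases ht hc q with rfl | rfl | rfl | hD | hD | hD
  · exact absurd rfl h
  · exact Or.inl ht.1
  · exact Or.inl ht.2.2.symm
  · exact hD.adj_or_separated (Or.inl rfl)
  · exact Or.inr ⟨a, b, ht.2.1, hD.ccw, ccw_rotate.1 (ccw_rotate.1 hc)⟩
  · exact hD.adj_or_separated (Or.inr rfl)

lemma IsStraightening.not_mem_beyond_of_adj (hs : T.IsStraightening β β') {p q : Farey Γ}
    (h : T.graph.Adj p q) {y : ℍ} (hp : y ∈ T.Beyond β' p) (hq : y ∈ T.Beyond β' q)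
    (hl : lam (β' p) (β' q) y < 0) : False := by
  obtain ⟨c, ht, hc⟩ := T.exists_apex h
  have h1 : lam (β' p) (β' c) y < 0 := by
    rcases hp with hp | hp
    · exact hp c ht.1
    · exact absurd (hp q h) hl.not_gt
  have h2 : 0 < lam (β' q) (β' c) y := by
    have := lam_swap (β' p) (β' q) y
    rcases hq with hq | hq
    · linarith [hq p h.symm]
    · exact hq c ht.2.1.symm
  linarith [lam_add_pos (ccw_rotate.1 (ccw_rotate.1 (hs.ccw _ _ _ ht hc))) y,
    lam_swap (β' q) (β' c) y]

/-- The regions beyond the edges at different vertices are disjoint. -/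
lemma IsStraightening.eq_of_mem_beyond (hs : T.IsStraightening β β') {p q : Farey Γ} {y : ℍ}
    (hp : y ∈ T.Beyond β' p) (hq : y ∈ T.Beyond β' q) : p = q := by
  by_contra hne
  rcases T.adj_or_separated hne with h | ⟨c, d, h, h1, h2⟩
  · rcases hp with hp' | hp'
    · exact hs.not_mem_beyond_of_adj h (Or.inl hp') hq (hp' q h)
    · refine hs.not_mem_beyond_of_adj h.symm hq (Or.inr hp') ?_
      rw [lam_swap, neg_lt_zero]
      exact hp' q h
  · linarith [hs.lam_neg_of_mem_beyond h h1 hq, hs.lam_neg_of_mem_beyond h.symm h2 hp,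
      lam_swap (β' c) (β' d) y]

lemma smul_mem_beyond (hρ : IsEquivariant ρ' β') (γ : Γ) {p : Farey Γ} {y : ℍ}
    (h : y ∈ T.Beyond β' p) : ρ' γ • y ∈ T.Beyond β' (γ • p) := by
  have key : ∀ q, lam (β' (γ • p)) (β' q) (ρ' γ • y) = lam (β' p) (β' (γ⁻¹ • q)) y := by
    intro q
    rw [hρ, ← lam_psl_smul (ρ' γ) (β' p), ← hρ γ (γ⁻¹ • q), smul_inv_smul]
  have hadj : ∀ q, T.graph.Adj (γ • p) q → T.graph.Adj p (γ⁻¹ • q) := fun q hq => by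
    rw [← T.smul_adj_iff γ, smul_inv_smul]
    exact hq
  rcases h with h | h
  · exact Or.inl fun q hq => key q ▸ h _ (hadj q hq)
  · exact Or.inr fun q hq => key q ▸ h _ (hadj q hq)

/-- A fixed point in the developed image is one of the source; a fixed point beyond the edges at `p`
forces an affine map that preserves a height. -/
lemma IsStraightening.actsFreely_range {ρ : Γ →* PSL(2, ℂ)} (hβ : IsEquivariant ρ β)
    (hFG : T.HasNonzeroCoordinates β) (hfree : ActsFreely Γ) (hs : T.IsStraightening β β')
    (hΨ : T.IsStraightenedPlane β' Ψ') (hρ : IsEquivariant ρ' β') (hρΨ : IsEquivariant ρ' Ψ') :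
    ActsFreely ρ'.range := by
  rintro _ ⟨γ, rfl⟩ y hy
  by_cases h : y ∈ range Ψ'
  · obtain ⟨z, rfl⟩ := h
    rw [← hρΨ] at hy
    have := hfree γ γ.2 z (hs.plane_injective hΨ hy)
    rw [show γ = 1 from Subtype.ext this, map_one]
  · obtain ⟨p, hp⟩ := hs.exists_mem_beyond hβ hFG hΨ h
    have h1 := smul_mem_beyond hρ γ hp
    rw [hy] at h1
    have hfix : ρ' γ • β' p = β' p := by rw [← hρ, ← hs.eq_of_mem_beyond hp h1]
    obtain ⟨A, hA⟩ := exists_smul_infty (β' p)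
    rw [← hA] at hfix
    obtain ⟨l, t, hl, hx, hz⟩ := exists_affine_chart A (ρ' γ) hfix
    obtain ⟨e1, e2⟩ := hz y
    rw [hy] at e1 e2
    have him := (A⁻¹ • y).im_pos
    have hl1 : l = 1 := by nlinarith
    have ht : t = 0 := by rw [hl1] at e1; linarith
    have hc : CCW (A • realPt 0) (A • realPt 1) (A • inftyPt ℝ) := by
      rw [ccw_smul_iff, ccw_infty]; exact one_pos
    refine psl_eq_of_ccw hc ?_ ?_ ?_
    · rw [hx, hl1, ht, one_smul]; norm_num
    · rw [hx, hl1, ht, one_smul]; norm_num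
    · rw [hfix, one_smul]

/-! ### Charts at a puncture -/

/-- Charts of the source and of the target of the straightened plane with the puncture `p` and its
image at infinity. A parabolic element `γ` of `Γ` at `p` is a translation by `τ > 0` in the source;
its holonomy is an affine map `x ↦ l x + t` in the target. -/
structure EndChart (ρ' : Γ →* PSL(2, ℝ)) (β' : Farey Γ → RP1) (p : Farey Γ) (A A' : SL(2, ℝ))
    (γ : Γ) (τ l t : ℝ) : Prop where
  source : A • inftyPt ℝ = p.pt
  target : A' • inftyPt ℝ = β' p
  smul_eq : γ • p = p
  shift_pos : 0 < τ
  factor_pos : 0 < l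
  coord_source : ∀ q : RP1, q ≠ p.pt → coord A ((γ : PSL(2, ℝ)) • q) = coord A q + τ
  re_source : ∀ z : ℍ, (A⁻¹ • ((γ : PSL(2, ℝ)) • z)).re = (A⁻¹ • z).re + τ
  im_source : ∀ z : ℍ, (A⁻¹ • ((γ : PSL(2, ℝ)) • z)).im = (A⁻¹ • z).im
  target_realPt : ∀ x, ρ' γ • (A' • realPt x) = A' • realPt (l * x + t)
  re_target : ∀ z : ℍ, (A'⁻¹ • (ρ' γ • z)).re = l * (A'⁻¹ • z).re + t
  im_target : ∀ z : ℍ, (A'⁻¹ • (ρ' γ • z)).im = l * (A'⁻¹ • z).im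

lemma exists_endChart (hρ : IsEquivariant ρ' β') (p : Farey Γ) :
    ∃ A A' γ τ l t, EndChart ρ' β' p A A' γ τ l t := by
  obtain ⟨A, hA⟩ := exists_smul_infty p.pt
  obtain ⟨A', hA'⟩ := exists_smul_infty (β' p)
  have par : ∃ γ : Γ, ∃ τ : ℝ, 0 < τ ∧ (γ : PSL(2, ℝ)) • p.pt = p.pt ∧
      (∀ x, (γ : PSL(2, ℝ)) • (A • realPt x) = A • realPt (x + τ)) ∧
      ∀ z : ℍ, (A⁻¹ • ((γ : PSL(2, ℝ)) • z)).re = (A⁻¹ • z).re + τ ∧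
        (A⁻¹ • ((γ : PSL(2, ℝ)) • z)).im = (A⁻¹ • z).im := by
    have main : ∀ g : PSL(2, ℝ), IsParabolicAt g p.pt → ∃ τ, τ ≠ 0 ∧ g • p.pt = p.pt ∧
        (∀ x, g • (A • realPt x) = A • realPt (x + τ)) ∧
        ∀ z : ℍ, (A⁻¹ • (g • z)).re = (A⁻¹ • z).re + τ ∧ (A⁻¹ • (g • z)).im = (A⁻¹ • z).im := by
      intro g hg
      have hfix : g • p.pt = p.pt := (hg.2 _).2 rfl
      have hfix' := hfix
      rw [← hA] at hfix'
      obtain ⟨l, t, hl, hx, hz⟩ := exists_affine_chart A g hfix'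
      rw [← hA] at hg
      obtain ⟨rfl, ht⟩ := (isParabolicAt_affine hx hfix').1 hg
      simp only [one_mul] at hx hz
      exact ⟨t, ht, hfix, hx, hz⟩
    obtain ⟨g, hgΓ, hg⟩ := p.2
    obtain ⟨τ, hτ, h1, h2, h3⟩ := main g hg
    rcases hτ.lt_or_gt with h | h
    · refine ⟨⟨g⁻¹, Γ.inv_mem hgΓ⟩, -τ, by linarith, ?_, fun x => ?_, fun z => ?_⟩
      · change g⁻¹ • p.pt = p.pt
        rw [inv_smul_eq_iff, h1]
      · change g⁻¹ • _ = _
        rw [inv_smul_eq_iff, h2, neg_add_cancel_right]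
      · change (A⁻¹ • (g⁻¹ • z)).re = _ ∧ (A⁻¹ • (g⁻¹ • z)).im = _
        have := h3 (g⁻¹ • z)
        rw [smul_inv_smul] at this
        exact ⟨by linarith [this.1], this.2.symm⟩
    · exact ⟨⟨g, hgΓ⟩, τ, h, h1, h2, h3⟩
  obtain ⟨γ, τ, hτ, h1, h2, h3⟩ := par
  have hγ : γ • p = p := Farey.pt_injective (by rw [Farey.pt_smul, h1])
  have hfix : ρ' γ • (A' • inftyPt ℝ) = A' • inftyPt ℝ := by rw [hA', ← hρ, hγ]
  obtain ⟨l, t, hl, hx, hz⟩ := exists_affine_chart A' (ρ' γ) hfix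
  refine ⟨A, A', γ, τ, l, t, hA, hA', hγ, hτ, hl, fun q hq => ?_, fun z => (h3 z).1,
    fun z => (h3 z).2, hx, fun z => (hz z).1, fun z => (hz z).2⟩
  conv_lhs => rw [coord_spec (hA ▸ hq : q ≠ A • inftyPt ℝ), h2, coord_eq]

namespace EndChart

variable {p : Farey Γ} {A A' : SL(2, ℝ)} {γ : Γ} {τ l t : ℝ}

lemma ne_source {q : Farey Γ} (hq : T.graph.Adj p q) : q.pt ≠ p.pt := (T.pt_ne hq).symm

lemma ne_target (hs : T.IsStraightening β β') {q : Farey Γ} (hq : T.graph.Adj p q) : β' q ≠ β' p :=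
  fun e => hq.ne (hs.injective e).symm

lemma zpow_smul_eq (h : EndChart ρ' β' p A A' γ τ l t) (n : ℤ) : γ ^ n • p = p :=
  (MulAction.stabilizer Γ p).zpow_mem (MulAction.mem_stabilizer_iff.2 h.smul_eq) n

lemma adj_zpow (h : EndChart ρ' β' p A A' γ τ l t) {q : Farey Γ} (hq : T.graph.Adj p q) (n : ℤ) :
    T.graph.Adj p (γ ^ n • q) := by
  rw [← h.zpow_smul_eq n, T.smul_adj_iff]
  exact hq

lemma coord_lt_iff (h : EndChart ρ' β' p A A' γ τ l t) (hs : T.IsStraightening β β')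
    {q r : Farey Γ} (hq : T.graph.Adj p q) (hr : T.graph.Adj p r) :
    coord A' (β' q) < coord A' (β' r) ↔ coord A q.pt < coord A r.pt := by
  rw [← ccw_coord h.source (ne_source hq) (ne_source hr), ← ccw_coord h.target
    (ne_target hs hq) (ne_target hs hr), hs.ccw_iff_of_adj hr]

lemma coord_zpow_source (h : EndChart ρ' β' p A A' γ τ l t) {q : Farey Γ} (hq : T.graph.Adj p q)
    (n : ℤ) : coord A (γ ^ n • q).pt = coord A q.pt + n * τ := by
  have := eq_add_of_shift (f := fun n : ℤ => coord A (γ ^ n • q).pt) (t := τ) (fun n => ?_) n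
  · simpa using this
  · rw [add_comm n, zpow_add, zpow_one, mul_smul, Farey.pt_smul,
      h.coord_source _ (ne_source (h.adj_zpow hq n))]

lemma coord_smul_target (h : EndChart ρ' β' p A A' γ τ l t) (hρ : IsEquivariant ρ' β')
    (hs : T.IsStraightening β β') {q : Farey Γ} (hq : T.graph.Adj p q) :
    coord A' (β' (γ • q)) = l * coord A' (β' q) + t := by
  have := coord_spec (h.target ▸ ne_target hs hq : β' q ≠ A' • inftyPt ℝ)
  rw [hρ]
  conv_lhs => rw [this, h.target_realPt, coord_eq]

lemma coord_succ_target (h : EndChart ρ' β' p A A' γ τ l t) (hρ : IsEquivariant ρ' β')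
    (hs : T.IsStraightening β β') {q : Farey Γ} (hq : T.graph.Adj p q) (n : ℤ) :
    coord A' (β' (γ ^ (n + 1) • q)) = l * coord A' (β' (γ ^ n • q)) + t := by
  rw [← h.coord_smul_target hρ hs (h.adj_zpow hq n), ← mul_smul, add_comm, zpow_add, zpow_one]

/-- The holonomy moves the edges at the puncture in the same direction as the parabolic shift. -/
lemma lt_affine (h : EndChart ρ' β' p A A' γ τ l t) (hρ : IsEquivariant ρ' β')
    (hs : T.IsStraightening β β') {q : Farey Γ} (hq : T.graph.Adj p q) :
    coord A' (β' q) < l * coord A' (β' q) + t := by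
  have h1 : T.graph.Adj p (γ • q) := by simpa using h.adj_zpow hq 1
  rw [← h.coord_smul_target hρ hs hq, h.coord_lt_iff hs hq h1, Farey.pt_smul,
    h.coord_source _ (ne_source hq)]
  linarith [h.shift_pos]

lemma exists_lt_source (h : EndChart ρ' β' p A A' γ τ l t) (T : IdealTriangulation Γ) (x : ℝ) :
    (∃ q, T.graph.Adj p q ∧ coord A q.pt < x) ∧ ∃ q, T.graph.Adj p q ∧ x < coord A q.pt := by
  obtain ⟨q, hq⟩ := T.exists_adj p
  constructor
  · obtain ⟨n, hn⟩ := exists_nat_gt ((coord A q.pt - x) / τ)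
    rw [div_lt_iff₀ h.shift_pos] at hn
    refine ⟨_, h.adj_zpow hq (-n), ?_⟩
    rw [h.coord_zpow_source hq]
    push_cast
    linarith
  · obtain ⟨n, hn⟩ := exists_nat_gt ((x - coord A q.pt) / τ)
    rw [div_lt_iff₀ h.shift_pos] at hn
    refine ⟨_, h.adj_zpow hq n, ?_⟩
    rw [h.coord_zpow_source hq]
    push_cast
    linarith

lemma lam_neg_iff (h : EndChart ρ' β' p A A' γ τ l t) (hs : T.IsStraightening β β') {q : Farey Γ}
    (hq : T.graph.Adj p q) {y : ℍ} :
    lam (β' p) (β' q) y < 0 ↔ (A'⁻¹ • y).re < coord A' (β' q) := by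
  rw [lam_coord h.target (ne_target hs hq), div_lt_iff₀ (A'⁻¹ • y).im_pos, zero_mul, sub_neg]

lemma lam_pos_iff (h : EndChart ρ' β' p A A' γ τ l t) (hs : T.IsStraightening β β') {q : Farey Γ}
    (hq : T.graph.Adj p q) {y : ℍ} :
    0 < lam (β' p) (β' q) y ↔ coord A' (β' q) < (A'⁻¹ • y).re := by
  rw [lam_coord h.target (ne_target hs hq), lt_div_iff₀ (A'⁻¹ • y).im_pos, zero_mul, sub_pos]

lemma mem_beyond_iff (h : EndChart ρ' β' p A A' γ τ l t) (hs : T.IsStraightening β β') {y : ℍ} :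
    y ∈ T.Beyond β' p ↔ (∀ q, T.graph.Adj p q → (A'⁻¹ • y).re < coord A' (β' q)) ∨
      ∀ q, T.graph.Adj p q → coord A' (β' q) < (A'⁻¹ • y).re :=
  or_congr (forall₂_congr fun _ hq => h.lam_neg_iff hs hq)
    (forall₂_congr fun _ hq => h.lam_pos_iff hs hq)

/-- The parabolic shift of the source shows that the developed image has no point beyond all edges
at a puncture. -/
lemma notMem_beyond (h : EndChart ρ' β' p A A' γ τ l t) (hs : T.IsStraightening β β')
    (hΨ : T.IsStraightenedPlane β' Ψ') (z : ℍ) : Ψ' z ∉ T.Beyond β' p := by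
  obtain ⟨⟨q, hq, h1⟩, r, hr, h2⟩ := h.exists_lt_source T (A⁻¹ • z).re
  have him := (A⁻¹ • z).im_pos
  rintro (hy | hy)
  · refine (hy q hq).not_gt (hs.lam_pos hΨ hq ?_)
    rw [lam_coord h.source (ne_source hq)]
    exact div_pos (by linarith) him
  · refine (hy r hr).not_gt (hs.lam_neg hΨ hr ?_)
    rw [lam_coord h.source (ne_source hr)]
    exact div_neg_of_neg_of_pos (by linarith) him

lemma exists_lt_target (h : EndChart ρ' β' p A A' γ τ 1 t) (hρ : IsEquivariant ρ' β')
    (hs : T.IsStraightening β β') (x : ℝ) :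
    (∃ q, T.graph.Adj p q ∧ coord A' (β' q) < x) ∧ ∃ q, T.graph.Adj p q ∧ x < coord A' (β' q) := by
  obtain ⟨q, hq⟩ := T.exists_adj p
  have ht : 0 < t := by linarith [h.lt_affine hρ hs hq]
  have key := eq_add_of_shift (f := fun n : ℤ => coord A' (β' (γ ^ n • q))) (t := t)
    (fun n => by rw [h.coord_succ_target hρ hs hq, one_mul])
  simp only [zpow_zero, one_smul] at key
  constructor
  · obtain ⟨n, hn⟩ := exists_nat_gt ((coord A' (β' q) - x) / t)
    rw [div_lt_iff₀ ht] at hn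
    refine ⟨_, h.adj_zpow hq (-n), ?_⟩
    rw [key]
    push_cast
    linarith
  · obtain ⟨n, hn⟩ := exists_nat_gt ((x - coord A' (β' q)) / t)
    rw [div_lt_iff₀ ht] at hn
    refine ⟨_, h.adj_zpow hq n, ?_⟩
    rw [key]
    push_cast
    linarith

lemma beyond_eq_empty (h : EndChart ρ' β' p A A' γ τ 1 t) (hρ : IsEquivariant ρ' β')
    (hs : T.IsStraightening β β') : T.Beyond β' p = ∅ := by
  refine eq_empty_of_forall_notMem fun y hy => ?_
  obtain ⟨⟨q, hq, h1⟩, r, hr, h2⟩ := h.exists_lt_target hρ hs (A'⁻¹ • y).re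
  rcases (h.mem_beyond_iff hs).1 hy with hy | hy
  · exact lt_asymm h1 (hy q hq)
  · exact lt_asymm h2 (hy r hr)

/-- The chart at a puncture with hyperbolic holonomy: all edges at the puncture lie on the same
side of `b`, the second fixed point of the holonomy. The sign `s` tells on which side. -/
structure IsBoundary (_h : EndChart ρ' β' p A A' γ τ l t) (T : IdealTriangulation Γ) (b s : ℝ) :
    Prop where
  sign : s = 1 ∨ s = -1
  fixed : l * b + t = b
  side : ∀ q, T.graph.Adj p q → 0 < s * (coord A' (β' q) - b)
  near : ∀ ε > 0, ∃ q, T.graph.Adj p q ∧ s * (coord A' (β' q) - b) < ε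
  far : ∀ M : ℝ, ∃ q, T.graph.Adj p q ∧ M < s * (coord A' (β' q) - b)

lemma exists_isBoundary (h : EndChart ρ' β' p A A' γ τ l t) (hρ : IsEquivariant ρ' β')
    (hs : T.IsStraightening β β') (hl : l ≠ 1) : ∃ b s, h.IsBoundary T b s := by
  have hl' : 1 - l ≠ 0 := sub_ne_zero.2 hl.symm
  obtain ⟨b, hb⟩ : ∃ b, l * b + t = b := ⟨t / (1 - l), by field_simp; ring⟩
  obtain ⟨s, hs1, hsl⟩ : ∃ s : ℝ, (s = 1 ∨ s = -1) ∧ 0 < s * (l - 1) := by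
    rcases hl.lt_or_gt with h1 | h1
    · exact ⟨-1, Or.inr rfl, by linarith⟩
    · exact ⟨1, Or.inl rfl, by linarith⟩
  have hss : s * s = 1 := by rcases hs1 with rfl | rfl <;> norm_num
  have side : ∀ q, T.graph.Adj p q → 0 < s * (coord A' (β' q) - b) := fun q hq => by
    have h1 := h.lt_affine hρ hs hq
    have h2 : 0 < (l - 1) * (coord A' (β' q) - b) := by linear_combination h1 + hb
    have h3 : 0 < (s * (l - 1)) * (s * (coord A' (β' q) - b)) := by
      calc 0 < (l - 1) * (coord A' (β' q) - b) := h2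
        _ = (s * s) * ((l - 1) * (coord A' (β' q) - b)) := by rw [hss, one_mul]
        _ = _ := by ring
    exact (pos_iff_pos_of_mul_pos h3).1 hsl
  obtain ⟨q, hq⟩ := T.exists_adj p
  have h0 := side q hq
  have key := eq_mul_of_shift (f := fun n : ℤ => s * (coord A' (β' (γ ^ n • q)) - b)) h.factor_pos
    (fun n => by rw [h.coord_succ_target hρ hs hq]; linear_combination s * hb)
  simp only [zpow_zero, one_smul] at key
  refine ⟨b, s, hs1, hb, side, fun ε hε => ?_, fun M => ?_⟩
  · obtain ⟨⟨n, hn⟩, -⟩ := exists_zpow_lt h.factor_pos hl (div_pos hε h0)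
    refine ⟨_, h.adj_zpow hq n, ?_⟩
    rwa [key, ← lt_div_iff₀ h0]
  · obtain ⟨-, n, hn⟩ := exists_zpow_lt h.factor_pos hl (div_pos (by positivity : 0 < |M| + 1) h0)
    refine ⟨_, h.adj_zpow hq n, ?_⟩
    rw [div_lt_iff₀ h0] at hn
    rw [key]
    linarith [le_abs_self M]

lemma IsBoundary.mem_beyond_iff {h : EndChart ρ' β' p A A' γ τ l t} {b s : ℝ}
    (hb : h.IsBoundary T b s) (hs : T.IsStraightening β β') {y : ℍ} :
    y ∈ T.Beyond β' p ↔ s * ((A'⁻¹ • y).re - b) ≤ 0 := by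
  rw [h.mem_beyond_iff hs]
  constructor
  · intro hy
    by_contra! hn
    obtain ⟨q, hq, h1⟩ := hb.near _ hn
    obtain ⟨r, hr, h2⟩ := hb.far (s * ((A'⁻¹ • y).re - b))
    rcases hb.sign with rfl | rfl
    · rcases hy with hy | hy
      · linarith [hy q hq]
      · linarith [hy r hr]
    · rcases hy with hy | hy
      · linarith [hy r hr]
      · linarith [hy q hq]
  · intro hy
    rcases hb.sign with rfl | rfl
    · exact Or.inl fun q hq => by linarith [hb.side q hq]
    · exact Or.inr fun q hq => by linarith [hb.side q hq]

end EndChart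

end IdealTriangulation

lemma exists_chart_point (A : SL(2, ℝ)) (x : ℝ) {y : ℝ} (hy : 0 < y) :
    ∃ z : ℍ, (A⁻¹ • z).re = x ∧ (A⁻¹ • z).im = y :=
  ⟨A • ⟨⟨x, y⟩, hy⟩, by rw [inv_smul_smul]; rfl, by rw [inv_smul_smul]; rfl⟩

lemma eq_of_chart_eq {A : SL(2, ℝ)} {z w : ℍ} (h1 : (A⁻¹ • z).re = (A⁻¹ • w).re)
    (h2 : (A⁻¹ • z).im = (A⁻¹ • w).im) : z = w :=
  MulAction.injective A⁻¹ (UpperHalfPlane.ext (Complex.ext h1 h2))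

lemma continuous_chart_re (A : SL(2, ℝ)) : Continuous fun z : ℍ => (A⁻¹ • z).re :=
  UpperHalfPlane.continuous_re.comp (continuous_const_smul A⁻¹)

lemma smul_infty_ne_smul_realPt (A : SL(2, ℝ)) (x : ℝ) : A • inftyPt ℝ ≠ A • realPt x :=
  fun h => realPt_ne_infty x (MulAction.injective A h).symm

lemma mem_vertical_iff {A : SL(2, ℝ)} {x : ℝ} {z : ℍ} :
    z ∈ geodesic (A • inftyPt ℝ) (A • realPt x) ↔ (A⁻¹ • z).re = x := by
  rw [mem_geodesic_iff (smul_infty_ne_smul_realPt A x), lam_chart, lam_infty_realPt,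
    div_eq_zero_iff, sub_eq_zero, or_iff_left (A⁻¹ • z).im_ne_zero]

/-- The horizontal lines of a chart are curves in the hyperbolic plane. -/
lemma exists_horizontal (A : SL(2, ℝ)) {y : ℝ} (hy : 0 < y) :
    ∃ f : ℝ → ℍ, Continuous f ∧ ∀ x, (A⁻¹ • f x).re = x ∧ (A⁻¹ • f x).im = y := by
  refine ⟨fun x => A • (⟨⟨x, y⟩, hy⟩ : ℍ), ?_, fun x => ⟨by rw [inv_smul_smul]; rfl,
    by rw [inv_smul_smul]; rfl⟩⟩
  refine (continuous_const_smul A).comp ?_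
  refine UpperHalfPlane.isEmbedding_coe.continuous_iff.2 ?_
  have : Continuous fun x : ℝ => (x : ℂ) + (y : ℂ) * Complex.I := by fun_prop
  refine this.congr fun x => ?_
  apply Complex.ext <;> simp

namespace IdealTriangulation

variable {Γ : Subgroup PSL(2, ℝ)} {T : IdealTriangulation Γ} {β : Farey Γ → CP1}
  {β' : Farey Γ → RP1} {Ψ' : ℍ → ℍ} {ρ' : Γ →* PSL(2, ℝ)}

namespace EndChart

variable {p : Farey Γ} {A A' : SL(2, ℝ)} {γ : Γ} {τ l t : ℝ}

lemma exists_affine_of_smul_eq (h : EndChart ρ' β' p A A' γ τ l t) (hρ : IsEquivariant ρ' β')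
    {δ : Γ} (hδ : δ • p = p) : ∃ l' t' : ℝ, 0 < l' ∧
      ρ' δ • (A' • inftyPt ℝ) = A' • inftyPt ℝ ∧
      (∀ x, ρ' δ • (A' • realPt x) = A' • realPt (l' * x + t')) ∧
      ∀ z : ℍ, (A'⁻¹ • (ρ' δ • z)).re = l' * (A'⁻¹ • z).re + t' ∧
        (A'⁻¹ • (ρ' δ • z)).im = l' * (A'⁻¹ • z).im := by
  have hfix : ρ' δ • (A' • inftyPt ℝ) = A' • inftyPt ℝ := by rw [h.target, ← hρ, hδ]
  obtain ⟨l', t', h1, h2, h3⟩ := exists_affine_chart A' (ρ' δ) hfix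
  exact ⟨l', t', h1, hfix, h2, h3⟩

/-- In a Fuchsian group, an element that fixes the centre of a parabolic element cannot contract:
the conjugates of the parabolic element by its powers would accumulate at the identity. -/
lemma not_factor_lt_one (h : EndChart ρ' β' p A A' γ τ 1 t) (hG : IsFuchsian ρ'.range)
    (ht : 0 < t) {δ : Γ} {l' t' : ℝ} (hl' : 0 < l')
    (hδ : ∀ z : ℍ, (A'⁻¹ • (ρ' δ • z)).re = l' * (A'⁻¹ • z).re + t' ∧
        (A'⁻¹ • (ρ' δ • z)).im = l' * (A'⁻¹ • z).im) : ¬ l' < 1 := by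
  intro hlt
  have conj : ∀ n : ℕ, ∀ z : ℍ, (A'⁻¹ • (ρ' (δ ^ n * γ * (δ ^ n)⁻¹) • z)).re =
      (A'⁻¹ • z).re + l' ^ n * t ∧
      (A'⁻¹ • (ρ' (δ ^ n * γ * (δ ^ n)⁻¹) • z)).im = (A'⁻¹ • z).im := by
    intro n
    induction n with
    | zero =>
      intro z
      have h1 := h.re_target z
      have h2 := h.im_target z
      simp only [one_mul] at h1 h2
      simpa using ⟨h1, h2⟩
    | succ n ih =>
      intro z
      have e : δ ^ (n + 1) * γ * (δ ^ (n + 1))⁻¹ = δ * (δ ^ n * γ * (δ ^ n)⁻¹) * δ⁻¹ := by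
        rw [pow_succ']; group
      obtain ⟨z, rfl⟩ : ∃ w, z = ρ' δ • w := ⟨(ρ' δ)⁻¹ • z, (smul_inv_smul _ _).symm⟩
      rw [e, map_mul, map_mul ρ' δ, map_inv, mul_smul, mul_smul, inv_smul_smul, (hδ _).1, (hδ _).2,
        (hδ _).1, (hδ _).2, (ih z).1, (ih z).2]
      exact ⟨by ring, rfl⟩
  obtain ⟨f, hf, hf'⟩ := exists_horizontal A' one_pos
  have hfin := hG (f '' Icc 0 t) (isCompact_Icc.image hf)
  refine infinite_of_injective_forall_mem
    (f := fun n : ℕ => ρ' (δ ^ n * γ * (δ ^ n)⁻¹)) (fun m n e => ?_) (fun n => ?_) hfin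
  · have h1 := (conj m (f 0)).1
    have h2 := (conj n (f 0)).1
    dsimp only at e
    rw [e, h2] at h1
    have h3 : l' ^ n = l' ^ m := mul_right_cancel₀ ht.ne' (add_left_cancel h1)
    exact ((pow_right_strictAnti₀ hl' hlt).injective h3).symm
  · refine ⟨⟨_, rfl⟩, f (l' ^ n * t), ⟨f 0, mem_image_of_mem f ⟨le_rfl, ht.le⟩, ?_⟩,
      mem_image_of_mem f ⟨by positivity, ?_⟩⟩
    · refine eq_of_chart_eq (A := A') ?_ ?_
      · rw [(conj n _).1, (hf' _).1, (hf' _).1, zero_add]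
      · rw [(conj n _).2, (hf' _).2, (hf' _).2]
    · exact mul_le_of_le_one_left ht.le (pow_le_one₀ hl'.le hlt.le)

/-- The holonomy of the stabilizer of a puncture is parabolic as soon as that of one parabolic element
is. -/
lemma parabolic (h : EndChart ρ' β' p A A' γ τ 1 t) (hρ : IsEquivariant ρ' β')
    (hG : IsFuchsian ρ'.range) (hinj : Function.Injective ρ') (hs : T.IsStraightening β β')
    {δ : Γ} (hδ : δ • p = p) (h1 : δ ≠ 1) : IsParabolicAt (ρ' δ) (β' p) := by
  have ht : 0 < t := by
    obtain ⟨q, hq⟩ := T.exists_adj p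
    linarith [h.lt_affine hρ hs hq]
  obtain ⟨l₁, t₁, hl₁, hfix, hx₁, hz₁⟩ := h.exists_affine_of_smul_eq hρ hδ
  obtain ⟨l₂, t₂, hl₂, -, -, hz₂⟩ := h.exists_affine_of_smul_eq hρ (inv_smul_eq_iff.2 hδ.symm)
  have hl : l₁ = 1 := by
    have e := (hz₁ (ρ' δ⁻¹ • UpperHalfPlane.I)).2
    rw [(hz₂ _).2, map_inv, smul_inv_smul] at e
    have e' : l₁ * l₂ = 1 := by
      have := (A'⁻¹ • UpperHalfPlane.I).im_pos
      have e2 : (l₁ * l₂ - 1) * (A'⁻¹ • UpperHalfPlane.I).im = 0 := by linarith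
      rcases mul_eq_zero.1 e2 with h | h <;> linarith
    have a := h.not_factor_lt_one hG ht hl₁ hz₁
    have b := h.not_factor_lt_one hG ht hl₂ hz₂
    nlinarith
  subst hl
  rw [← h.target, isParabolicAt_affine hx₁ hfix]
  refine ⟨rfl, fun ht0 => h1 (hinj ?_)⟩
  subst ht0
  have hc : CCW (A' • realPt 0) (A' • realPt 1) (A' • inftyPt ℝ) := by
    rw [ccw_smul_iff, ccw_infty]; exact one_pos
  rw [map_one]
  refine psl_eq_of_ccw hc ?_ ?_ ?_
  · rw [hx₁, one_smul]; norm_num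
  · rw [hx₁, one_smul]; norm_num
  · rw [hfix, one_smul]

namespace IsBoundary

variable {h : EndChart ρ' β' p A A' γ τ l t} {b s : ℝ}

/-- The stabilizer of the puncture preserves the half-plane beyond its edges, hence fixes `b`. -/
lemma smul_fixed (hb : h.IsBoundary T b s) (hρ : IsEquivariant ρ' β')
    (hs : T.IsStraightening β β') {δ : Γ} (hδ : δ • p = p) :
    ρ' δ • (A' • realPt b) = A' • realPt b := by
  obtain ⟨l', t', hl', hfix, hx, hz⟩ := h.exists_affine_of_smul_eq hρ hδ
  rw [hx]
  congr 2
  have sgn : ∀ x : ℝ, s * x ≤ 0 → s * (-x) ≤ 0 → x = 0 := by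
    intro x h1 h2
    rcases hb.sign with rfl | rfl <;> linarith
  have e1 : s * (l' * b + t' - b) ≤ 0 := by
    obtain ⟨z, hz1, -⟩ := exists_chart_point A' b one_pos
    have h1 : z ∈ T.Beyond β' p := (hb.mem_beyond_iff hs).2 (by rw [hz1]; simp)
    have h2 := smul_mem_beyond hρ δ h1
    rwa [hδ, hb.mem_beyond_iff hs, (hz z).1, hz1] at h2
  have e2 : s * ((b - t') / l' - b) ≤ 0 := by
    obtain ⟨z, hz1, -⟩ := exists_chart_point A' ((b - t') / l') one_pos
    have h1 : ρ' δ • z ∈ T.Beyond β' p := (hb.mem_beyond_iff hs).2 (by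
      rw [(hz z).1, hz1]; field_simp; simp)
    have h2 := smul_mem_beyond hρ δ⁻¹ h1
    rwa [map_inv, inv_smul_smul, inv_smul_eq_iff.2 hδ.symm, hb.mem_beyond_iff hs, hz1] at h2
  have e3 : s * (-(l' * b + t' - b)) ≤ 0 := by
    have := mul_nonpos_of_nonpos_of_nonneg e2 hl'.le
    have e : s * ((b - t') / l' - b) * l' = s * (-(l' * b + t' - b)) := by field_simp; ring
    rwa [e] at this
  linarith [sgn _ e1 e3]

lemma mem_line_of_mem_closure (hb : h.IsBoundary T b s) (hs : T.IsStraightening β β')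
    (hΨ : T.IsStraightenedPlane β' Ψ') {y : ℍ} (hy : y ∈ T.Beyond β' p)
    (hc : y ∈ closure (range Ψ')) : (A'⁻¹ • y).re = b := by
  have h1 := (hb.mem_beyond_iff hs).1 hy
  have h2 : ¬ s * ((A'⁻¹ • y).re - b) < 0 := by
    intro hlt
    have ho : IsOpen {z : ℍ | s * ((A'⁻¹ • z).re - b) < 0} :=
      isOpen_lt (by have := continuous_chart_re A'; fun_prop) continuous_const
    obtain ⟨_, hz, ⟨z, rfl⟩⟩ := mem_closure_iff.1 hc _ ho hlt
    exact h.notMem_beyond hs hΨ z ((hb.mem_beyond_iff hs).2 (le_of_lt hz))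
  rcases hb.sign with rfl | rfl <;> linarith

lemma line_subset_frontier (hb : h.IsBoundary T b s) (hs : T.IsStraightening β β')
    (hΨ : T.IsStraightenedPlane β' Ψ') {y : ℍ} (hy : (A'⁻¹ • y).re = b) :
    y ∈ frontier (range Ψ') := by
  rw [(hs.isOpenEmbedding hΨ).isOpen_range.frontier_eq]
  constructor
  · obtain ⟨f, hf, hf'⟩ := exists_horizontal A' (A'⁻¹ • y).im_pos
    have hfb : f b = y := eq_of_chart_eq (A := A') (by rw [(hf' b).1, hy]) (hf' b).2
    have hcl : b ∈ closure {x | ∃ q, T.graph.Adj p q ∧ x = coord A' (β' q)} := by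
      rw [Metric.mem_closure_iff]
      intro ε hε
      obtain ⟨q, hq, h1⟩ := hb.near ε hε
      refine ⟨_, ⟨q, hq, rfl⟩, ?_⟩
      have h2 := hb.side q hq
      rw [Real.dist_eq, abs_lt]
      rcases hb.sign with rfl | rfl <;> constructor <;> linarith
    rw [← hfb]
    refine closure_mono ?_ (image_closure_subset_closure_image hf (mem_image_of_mem f hcl))
    rintro _ ⟨_, ⟨q, hq, rfl⟩, rfl⟩
    have : f (coord A' (β' q)) ∈ geodesic (β' p) (β' q) := by
      have e := coord_spec (h.target ▸ ne_target hs hq : β' q ≠ A' • inftyPt ℝ)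
      rw [← h.target, e, mem_vertical_iff, coord_eq, (hf' _).1]
    rw [← hΨ.image_edge hq] at this
    exact image_subset_range _ _ this
  · rintro ⟨z, rfl⟩
    exact h.notMem_beyond hs hΨ z ((hb.mem_beyond_iff hs).2 (by rw [hy]; simp))

end IsBoundary

/-- A boundary end at `p` forces the holonomy to be hyperbolic; its geodesic is the vertical line at the
fixed point `b`. -/
lemma exists_isBoundary_of_boundaryEnd (h : EndChart ρ' β' p A A' γ τ l t)
    (hρ : IsEquivariant ρ' β') (hs : T.IsStraightening β β') {ℓ : Set ℍ}
    (hℓ : IsBoundaryEnd ρ' β' Ψ' p ℓ) :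
    ∃ b s, h.IsBoundary T b s ∧ ℓ = geodesic (β' p) (A' • realPt b) := by
  obtain ⟨q, hq, hℓq, hfix⟩ := hℓ.axis
  have e := coord_spec (h.target ▸ hq : q ≠ A' • inftyPt ℝ)
  have h1 := (hfix γ h.smul_eq).2
  rw [e, h.target_realPt] at h1
  have h2 : l * coord A' q + t = coord A' q := realPt_injective (MulAction.injective A' h1)
  have hl : l ≠ 1 := by
    rintro rfl
    obtain ⟨r, hr⟩ := T.exists_adj p
    linarith [h.lt_affine hρ hs hr]
  obtain ⟨b, s, hb⟩ := h.exists_isBoundary hρ hs hl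
  refine ⟨b, s, hb, ?_⟩
  have h3 : (l - 1) * (coord A' q - b) = 0 := by linear_combination h2 - hb.fixed
  rw [hℓq]
  conv_lhs => rw [e]
  rcases mul_eq_zero.1 h3 with h4 | h4
  · exact absurd (by linarith) hl
  · rw [sub_eq_zero.1 h4]

end EndChart

end IdealTriangulation

/-! ### Ends of an ideal triangle -/

lemma isPreconnected_strip (M : ℝ) (hM : 0 ≤ M) :
    IsPreconnected {z : ℍ | 0 ≤ z.re ∧ z.re ≤ 1 ∧ M < z.im} := by
  rw [← UpperHalfPlane.isEmbedding_coe.isInducing.isPreconnected_image]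
  have : ((↑) : ℍ → ℂ) '' {z : ℍ | 0 ≤ z.re ∧ z.re ≤ 1 ∧ M < z.im} = Icc 0 1 ×ℂ Ioi M := by
    ext w
    constructor
    · rintro ⟨z, ⟨h1, h2, h3⟩, rfl⟩
      exact ⟨⟨h1, h2⟩, h3⟩
    · rintro ⟨⟨h1, h2⟩, h3⟩
      exact ⟨⟨w, lt_of_le_of_lt hM h3⟩, ⟨h1, h2, h3⟩, rfl⟩
  rw [this]
  exact (((convex_Icc (0 : ℝ) 1).is_linear_preimage ⟨Complex.add_re, fun c z => by simp⟩).inter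
    ((convex_Ioi M).is_linear_preimage ⟨Complex.add_im, fun c z => by simp⟩)).isPreconnected

lemma isCompact_box {a : ℝ} (ha : 0 < a) (b : ℝ) :
    IsCompact {z : ℍ | 0 ≤ z.re ∧ z.re ≤ 1 ∧ a ≤ z.im ∧ z.im ≤ b} := by
  rw [UpperHalfPlane.isEmbedding_coe.isCompact_iff]
  have : ((↑) : ℍ → ℂ) '' {z : ℍ | 0 ≤ z.re ∧ z.re ≤ 1 ∧ a ≤ z.im ∧ z.im ≤ b} =
      Icc 0 1 ×ℂ Icc a b := by
    ext w
    constructor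
    · rintro ⟨z, ⟨h1, h2, h3, h4⟩, rfl⟩
      exact ⟨⟨h1, h2⟩, h3, h4⟩
    · rintro ⟨⟨h1, h2⟩, h3, h4⟩
      exact ⟨⟨w, lt_of_lt_of_le ha h3⟩, ⟨h1, h2, h3, h4⟩, rfl⟩
  rw [this]
  exact isCompact_Icc.reProdIm isCompact_Icc

lemma exists_strip_chart {p q r : RP1} (h : CCW p q r) : ∃ g : SL(2, ℝ), ∀ z : ℍ,
    lam q r z = (1 - (g⁻¹ • z).re) / (g⁻¹ • z).im ∧ lam r p z = (g⁻¹ • z).re / (g⁻¹ • z).im := by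
  obtain ⟨g, rfl, rfl, rfl⟩ := h
  refine ⟨g, fun z => ⟨?_, ?_⟩⟩
  · rw [lam_swap, lam_chart, onePt_eq, lam_infty_realPt, ← neg_div, neg_sub]
  · rw [lam_chart, zeroPt_eq, lam_infty_realPt, sub_zero]

/-- The part of an ideal triangle near its third vertex. -/
lemma isPreconnected_vertex {p q r : RP1} (h : CCW p q r) {δ : ℝ} (hδ : 0 < δ) (hδ1 : δ ≤ 1) :
    IsPreconnected {z | z ∈ idealTriangle p q r ∧ lam q r z + lam r p z < δ} := by
  obtain ⟨g, hg⟩ := exists_strip_chart h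
  have : {z | z ∈ idealTriangle p q r ∧ lam q r z + lam r p z < δ} =
      (g • ·) '' {z : ℍ | 0 ≤ z.re ∧ z.re ≤ 1 ∧ δ⁻¹ < z.im} := by
    ext z
    have him := (g⁻¹ • z).im_pos
    have hsum : lam q r z + lam r p z = ((g⁻¹ • z).im)⁻¹ := by
      rw [(hg z).1, (hg z).2]; field_simp; ring
    constructor
    · rintro ⟨h1, h2⟩
      rw [mem_idealTriangle_iff h, (hg z).1, (hg z).2] at h1
      rw [hsum] at h2
      refine ⟨g⁻¹ • z, ⟨?_, ?_, ?_⟩, smul_inv_smul g z⟩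
      · have := h1.2.2
        rwa [le_div_iff₀ him, zero_mul] at this
      · have := h1.2.1
        rw [le_div_iff₀ him, zero_mul] at this
        linarith
      · exact inv_lt_of_inv_lt₀ him h2
    · rintro ⟨w, ⟨h1, h2, h3⟩, rfl⟩
      simp only [inv_smul_smul] at him hsum ⊢
      have hg' := hg (g • w)
      rw [inv_smul_smul] at hg'
      have hR : 0 ≤ lam q r (g • w) := by rw [hg'.1]; exact div_nonneg (by linarith) him.le
      have hS : 0 ≤ lam r p (g • w) := by rw [hg'.2]; exact div_nonneg h1 him.le
      have hlt : lam q r (g • w) + lam r p (g • w) < δ := by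
        rw [hsum]; exact inv_lt_of_inv_lt₀ hδ h3
      refine ⟨(mem_idealTriangle_iff h _).2 ⟨?_, hR, hS⟩, hlt⟩
      have hq := lam_quadric h (g • w)
      have hpos := lam_add_pos h (g • w)
      by_contra! hn
      nlinarith [mul_pos hpos (neg_pos.2 hn), mul_nonneg hR hS]
  rw [this]
  exact (isPreconnected_strip _ (inv_pos.2 hδ).le).image _ (continuous_const_smul g).continuousOn

/-- The part of an ideal triangle away from its vertices. -/
lemma isCompact_core {p q r : RP1} (h : CCW p q r) {ε : ℝ} (hε : 0 < ε) :
    IsCompact {z | z ∈ idealTriangle p q r ∧ ε ≤ lam q r z + lam r p z ∧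
      ε ≤ lam r p z + lam p q z ∧ ε ≤ lam p q z + lam q r z} := by
  obtain ⟨g, hg⟩ := exists_strip_chart h
  refine ((isCompact_box (half_pos hε) ε⁻¹).image (continuous_const_smul g)).of_isClosed_subset
    ?_ ?_
  · have h1 := continuous_lam p q
    have h2 := continuous_lam q r
    have h3 := continuous_lam r p
    exact (isClosed_idealTriangle h).inter ((isClosed_le continuous_const (h2.add h3)).inter
      ((isClosed_le continuous_const (h3.add h1)).inter
        (isClosed_le continuous_const (h1.add h2))))
  · rintro z ⟨h0, h1, h2, h3⟩
    have him := (g⁻¹ • z).im_pos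
    have hsum : lam q r z + lam r p z = ((g⁻¹ • z).im)⁻¹ := by
      rw [(hg z).1, (hg z).2]; field_simp; ring
    rw [mem_idealTriangle_iff h] at h0
    have hq := lam_quadric h z
    have hR : lam q r z ≤ ε⁻¹ := by
      rw [← one_div, le_div_iff₀ hε]
      nlinarith [mul_nonneg h0.2.2 h0.1, mul_le_mul_of_nonneg_left h2 h0.2.1]
    have hS : lam r p z ≤ ε⁻¹ := by
      rw [← one_div, le_div_iff₀ hε]
      nlinarith [mul_nonneg h0.2.1 h0.1, mul_le_mul_of_nonneg_left h3 h0.2.2]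
    refine ⟨g⁻¹ • z, ⟨?_, ?_, ?_, ?_⟩, smul_inv_smul g z⟩
    · have := h0.2.2
      rwa [(hg z).2, le_div_iff₀ him, zero_mul] at this
    · have := h0.2.1
      rw [(hg z).1, le_div_iff₀ him, zero_mul] at this
      linarith
    · rw [hsum] at h1
      have : ((g⁻¹ • z).im)⁻¹ ≤ (ε / 2)⁻¹ := by
        rw [← hsum, inv_div, div_eq_mul_inv]; linarith
      exact (inv_le_inv₀ him (half_pos hε)).1 this
    · rw [hsum] at h1
      exact (le_inv_comm₀ hε him).1 h1

/-- A homeomorphism between ideal triangles that preserves two sides maps small neighbourhoods of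
their common vertex to small neighbourhoods of the corresponding vertex. -/
lemma exists_vertex_nhds {p q r p' q' r' : RP1} (h : CCW p q r) (h' : CCW p' q' r') {f g : ℍ → ℍ}
    (hf : ContinuousOn f (idealTriangle p q r))
    (hmaps : MapsTo f (idealTriangle p q r) (idealTriangle p' q' r'))
    (hg : ContinuousOn g (idealTriangle p' q' r'))
    (hgf : ∀ z ∈ idealTriangle p q r, g (f z) = z)
    (e1 : ∀ z ∈ idealTriangle p q r, lam r p z = 0 → lam r' p' (f z) = 0)
    (e2 : ∀ z ∈ idealTriangle p q r, lam q r z = 0 → lam q' r' (f z) = 0) {ε : ℝ} (hε : 0 < ε) :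
    ∃ δ > 0, ∀ z ∈ idealTriangle p q r, lam q r z + lam r p z < δ →
      lam q' r' (f z) + lam r' p' (f z) < ε := by
  wlog hε1 : ε ≤ 1 generalizing ε
  · obtain ⟨δ, hδ, H⟩ := this one_pos le_rfl
    exact ⟨δ, hδ, fun z hz hz' => (H z hz hz').trans (not_le.1 hε1)⟩
  have c1 := continuous_lam p' q'
  have c2 := continuous_lam q' r'
  have c3 := continuous_lam r' p'
  -- the core of the target triangle stays away from the vertex
  obtain ⟨δ₀, hδ₀, hK⟩ : ∃ δ₀ > 0, ∀ z ∈ idealTriangle p q r, lam q r z + lam r p z < δ₀ →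
      ¬ (ε ≤ lam q' r' (f z) + lam r' p' (f z) ∧ ε ≤ lam r' p' (f z) + lam p' q' (f z) ∧
        ε ≤ lam p' q' (f z) + lam q' r' (f z)) := by
    have hc := isCompact_core h' hε
    have hc' := hc.image_of_continuousOn (hg.mono fun z hz => hz.1)
    rcases Set.eq_empty_or_nonempty (g '' {z | z ∈ idealTriangle p' q' r' ∧
      ε ≤ lam q' r' z + lam r' p' z ∧ ε ≤ lam r' p' z + lam p' q' z ∧
      ε ≤ lam p' q' z + lam q' r' z}) with hem | hne
    · refine ⟨1, one_pos, fun z hz _ hz' => ?_⟩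
      have : g (f z) ∈ (∅ : Set ℍ) := hem ▸ mem_image_of_mem g ⟨hmaps hz, hz'⟩
      exact this
    · obtain ⟨w, -, hw⟩ := hc'.exists_isMinOn hne
        ((continuous_lam q r).add (continuous_lam r p)).continuousOn
      refine ⟨lam q r w + lam r p w, lam_add_pos h w, fun z hz hlt hz' => hlt.not_ge ?_⟩
      have := hw (mem_image_of_mem g ⟨hmaps hz, hz'⟩)
      rwa [mem_ofPred_eq, hgf z hz] at this
  have hδ : 0 < min δ₀ 1 := lt_min hδ₀ one_pos
  refine ⟨min δ₀ 1, hδ, ?_⟩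
  set C := {z | z ∈ idealTriangle p q r ∧ lam q r z + lam r p z < min δ₀ 1} with hC
  have hpre : IsPreconnected (f '' C) :=
    (isPreconnected_vertex h hδ (min_le_right _ _)).image f (hf.mono fun z hz => hz.1)
  have hsub : f '' C ⊆ {z | lam q' r' z + lam r' p' z < ε} ∪
      ({z | lam r' p' z + lam p' q' z < ε} ∪ {z | lam p' q' z + lam q' r' z < ε}) := by
    rintro _ ⟨z, hz, rfl⟩
    by_contra hn
    simp only [mem_union, mem_ofPred_eq, not_or, not_lt] at hn
    exact hK z hz.1 (hz.2.trans_le (min_le_left _ _)) ⟨hn.1, hn.2.1, hn.2.2⟩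
  have hCT : ∀ w ∈ f '' C, 0 ≤ lam p' q' w ∧ 0 ≤ lam q' r' w ∧ 0 ≤ lam r' p' w := by
    rintro _ ⟨z, hz, rfl⟩
    exact (mem_idealTriangle_iff h' _).1 (hmaps hz.1)
  -- near the vertex there are points on the two sides
  obtain ⟨z₁, hz₁, hz₁'⟩ : ∃ z ∈ C, lam r p z = 0 := by
    obtain ⟨z, a1, a2, a3⟩ := exists_lam_eq h (half_pos hδ).le le_rfl
      (T := (min δ₀ 1 / 2)⁻¹) (by field_simp; ring)
    refine ⟨z, ⟨(mem_idealTriangle_iff h z).2 ⟨?_, ?_, ?_⟩, ?_⟩, a2⟩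
    · rw [a3]; positivity
    · rw [a1]; positivity
    · rw [a2]
    · rw [a1, a2]; linarith
  obtain ⟨z₂, hz₂, hz₂'⟩ : ∃ z ∈ C, lam q r z = 0 := by
    obtain ⟨z, a1, a2, a3⟩ := exists_lam_eq h le_rfl (half_pos hδ).le
      (T := (min δ₀ 1 / 2)⁻¹) (by field_simp; ring)
    refine ⟨z, ⟨(mem_idealTriangle_iff h z).2 ⟨?_, ?_, ?_⟩, ?_⟩, a1⟩
    · rw [a3]; positivity
    · rw [a1]
    · rw [a2]; positivity
    · rw [a1, a2]; linarith
  have o1 : IsOpen {z | lam q' r' z + lam r' p' z < ε} := isOpen_lt (by fun_prop) continuous_const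
  have o2 : IsOpen {z | lam r' p' z + lam p' q' z < ε} := isOpen_lt (by fun_prop) continuous_const
  have o3 : IsOpen {z | lam p' q' z + lam q' r' z < ε} := isOpen_lt (by fun_prop) continuous_const
  -- two coordinates of small sum leave no room for another such pair
  have key : ∀ {R S U : ℝ}, 0 ≤ R → 0 ≤ S → 0 ≤ U → R * S + S * U + U * R = 1 → R + S < ε →
      S + U < ε → False := by
    intro R S U hR hS hU hq h1 h2
    nlinarith [mul_nonneg hR hS, mul_nonneg hR (by linarith : 0 ≤ 1 - (S + U)),
      mul_nonneg hS (by linarith : 0 ≤ 1 - U)]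
  have d1 : f '' C ⊆ {z | lam q' r' z + lam r' p' z < ε} := by
    intro w hw
    by_contra hn
    have hw' := (hsub hw).resolve_left hn
    by_cases hne : (f '' C ∩ {z | lam q' r' z + lam r' p' z < ε}).Nonempty
    · obtain ⟨v, hv, hv1, hv2⟩ := hpre _ _ o1 (o2.union o3) hsub hne ⟨w, hw, hw'⟩
      obtain ⟨a1, a2, a3⟩ := hCT v hv
      have hq := lam_quadric h' v
      rcases hv2 with hv2 | hv2
      · exact key a2 a3 a1 hq hv1 hv2
      · exact key a1 a2 a3 (by linarith) hv2 hv1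
    · have hsub' : f '' C ⊆ {z | lam r' p' z + lam p' q' z < ε} ∪
          {z | lam p' q' z + lam q' r' z < ε} := fun v hv =>
        (hsub hv).resolve_left fun hv' => hne ⟨v, hv, hv'⟩
      have m₁ := mem_image_of_mem f hz₁
      have m₂ := mem_image_of_mem f hz₂
      have s₁ := e1 z₁ hz₁.1 hz₁'
      have s₂ := e2 z₂ hz₂.1 hz₂'
      have q₁ := lam_quadric h' (f z₁)
      have q₂ := lam_quadric h' (f z₂)
      obtain ⟨b1, b2, b3⟩ := hCT _ m₁
      obtain ⟨d1, d2, d3⟩ := hCT _ m₂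
      have u₁ : f z₁ ∈ {z | lam r' p' z + lam p' q' z < ε} := (hsub' m₁).resolve_right fun hu => by
        rw [mem_ofPred_eq] at hu
        rw [s₁] at q₁
        nlinarith
      have u₂ : f z₂ ∈ {z | lam p' q' z + lam q' r' z < ε} := (hsub' m₂).resolve_left fun hu => by
        rw [mem_ofPred_eq] at hu
        rw [s₂] at q₂
        nlinarith
      obtain ⟨v, hv, hv1, hv2⟩ := hpre _ _ o2 o3 hsub' ⟨_, m₁, u₁⟩ ⟨_, m₂, u₂⟩
      obtain ⟨a1, a2, a3⟩ := hCT v hv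
      exact key a3 a1 a2 (by linarith [lam_quadric h' v]) hv1 hv2
  exact fun z hz hz' => d1 (mem_image_of_mem f ⟨hz, hz'⟩)

lemma chart_sum {A : SL(2, ℝ)} {p q r : RP1} (hA : A • inftyPt ℝ = p) (h : CCW p q r) (z : ℍ) :
    lam r p z + lam p q z = (coord A r - coord A q) / (A⁻¹ • z).im := by
  rw [lam_swap p r, lam_coord hA h.ne12.symm, lam_coord hA h.ne31]
  ring

/-- The points between two vertical sides, above the half-circle over the third side. -/
lemma mem_idealTriangle_of_chart {A : SL(2, ℝ)} {p q r : RP1} (hA : A • inftyPt ℝ = p)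
    (h : CCW p q r) {z : ℍ} (h1 : coord A q ≤ (A⁻¹ • z).re) (h2 : (A⁻¹ • z).re ≤ coord A r)
    (h3 : coord A r - coord A q ≤ (A⁻¹ • z).im) : z ∈ idealTriangle p q r := by
  have him := (A⁻¹ • z).im_pos
  have hsum := chart_sum hA h z
  have hq := lam_quadric h z
  have hU : 0 ≤ lam p q z := by
    rw [lam_coord hA h.ne12.symm]; exact div_nonneg (by linarith) him.le
  have hS : 0 ≤ lam r p z := by
    rw [lam_swap p r, lam_coord hA h.ne31, ← neg_div]; exact div_nonneg (by linarith) him.le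
  have hle : lam r p z + lam p q z ≤ 1 := by
    rw [hsum, div_le_one him]; exact h3
  refine (mem_idealTriangle_iff h z).2 ⟨hU, ?_, hS⟩
  by_contra! hn
  nlinarith [mul_nonneg hS hU, mul_nonneg (neg_pos.2 hn).le (add_nonneg hS hU),
    mul_nonneg hS (by linarith : 0 ≤ 1 - lam p q z)]

/-- `exists_vertex_nhds` in terms of the heights in charts with the vertices `p` and `p'` at infinity. -/
lemma exists_height {p q r p' q' r' : RP1} {A A' : SL(2, ℝ)} (hA : A • inftyPt ℝ = p)
    (hA' : A' • inftyPt ℝ = p') (h : CCW p q r) (h' : CCW p' q' r') {f g : ℍ → ℍ}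
    (hf : ContinuousOn f (idealTriangle p q r))
    (hmaps : MapsTo f (idealTriangle p q r) (idealTriangle p' q' r'))
    (hg : ContinuousOn g (idealTriangle p' q' r'))
    (hgf : ∀ z ∈ idealTriangle p q r, g (f z) = z)
    (e1 : ∀ z ∈ idealTriangle p q r, lam p q z = 0 → lam p' q' (f z) = 0)
    (e2 : ∀ z ∈ idealTriangle p q r, lam r p z = 0 → lam r' p' (f z) = 0) (M : ℝ) :
    ∃ N, ∀ z : ℍ, coord A q ≤ (A⁻¹ • z).re → (A⁻¹ • z).re ≤ coord A r → N < (A⁻¹ • z).im →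
      z ∈ idealTriangle p q r ∧ M < (A'⁻¹ • f z).im := by
  have hX : 0 < coord A r - coord A q :=
    sub_pos.2 ((ccw_coord hA h.ne12.symm h.ne31).1 h)
  have hX' : 0 < coord A' r' - coord A' q' :=
    sub_pos.2 ((ccw_coord hA' h'.ne12.symm h'.ne31).1 h')
  have hM : 0 < max M 1 := lt_max_of_lt_right one_pos
  have E := idealTriangle_rotate p q r
  have E' := idealTriangle_rotate p' q' r'
  rw [E] at hf hmaps hgf e1 e2
  rw [E'] at hmaps hg
  obtain ⟨δ, hδ, H⟩ := exists_vertex_nhds (ccw_rotate.1 h) (ccw_rotate.1 h') hf hmaps hg hgf e1 e2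
    (div_pos hX' hM)
  refine ⟨max (coord A r - coord A q) ((coord A r - coord A q) / δ), fun z h1 h2 h3 => ?_⟩
  have hz := mem_idealTriangle_of_chart hA h h1 h2 ((le_max_left _ _).trans h3.le)
  refine ⟨hz, (le_max_left M 1).trans_lt ?_⟩
  have := H z (E ▸ hz) (by
    rw [chart_sum hA h, div_lt_iff₀ (A⁻¹ • z).im_pos, ← div_lt_iff₀' hδ]
    exact (le_max_right _ _).trans_lt h3)
  rw [chart_sum hA' h', div_lt_div_iff_of_pos_left hX' (A'⁻¹ • f z).im_pos hM] at this
  exact this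

namespace IdealTriangulation

variable {Γ : Subgroup PSL(2, ℝ)} {T : IdealTriangulation Γ} {β : Farey Γ → CP1}
  {β' : Farey Γ → RP1} {Ψ' : ℍ → ℍ} {ρ' : Γ →* PSL(2, ℝ)}

lemma IsStraightening.lam_eq_zero_iff (hs : T.IsStraightening β β')
    (hΨ : T.IsStraightenedPlane β' Ψ') {a b : Farey Γ} (h : T.graph.Adj a b) {z : ℍ} :
    lam (β' a) (β' b) (Ψ' z) = 0 ↔ lam a.pt b.pt z = 0 := by
  refine ⟨fun h0 => ?_, hs.lam_zero hΨ h⟩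
  rcases lt_trichotomy (lam a.pt b.pt z) 0 with h1 | h1 | h1
  · exact absurd h0 (hs.lam_neg hΨ h h1).ne
  · exact h1
  · exact absurd h0 (hs.lam_pos hΨ h h1).ne'

namespace EndChart

variable {p : Farey Γ} {A A' : SL(2, ℝ)} {γ : Γ} {τ l t : ℝ}

lemma finite_neighbours (h : EndChart ρ' β' p A A' γ τ l t) (T : IdealTriangulation Γ)
    (x₁ x₂ : ℝ) :
    {q | T.graph.Adj p q ∧ x₁ ≤ coord A q.pt ∧ coord A q.pt ≤ x₂}.Finite := by
  obtain ⟨f, hf, hf'⟩ := exists_horizontal A one_pos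
  have hfin := T.locally_finite _ (isCompact_Icc.image hf : IsCompact (f '' Icc x₁ x₂))
  refine Set.Finite.of_injOn (f := fun q : Farey Γ => (p, q)) ?_
    (fun q _ r _ e => (Prod.ext_iff.1 e).2) hfin
  rintro q ⟨hq, h1, h2⟩
  have e := coord_spec (h.source ▸ ne_source hq : q.pt ≠ A • inftyPt ℝ)
  have hmem : f (coord A q.pt) ∈ geodesic p.pt q.pt := by
    rw [← h.source]
    generalize coord A q.pt = x at e ⊢
    rw [e, mem_vertical_iff, (hf' _).1]
  exact And.intro hq (Set.nonempty_of_mem (And.intro hmem (mem_image_of_mem f ⟨h1, h2⟩)))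

/-- A cut of the sequence of edges at a puncture lies between two sides of a triangle. -/
lemma exists_consecutive (h : EndChart ρ' β' p A A' γ τ l t) {P : Farey Γ → Prop}
    (hP : ∀ q r, T.graph.Adj p q → T.graph.Adj p r → coord A q.pt < coord A r.pt → P r → P q)
    {q₁ q₂ : Farey Γ} (h1 : T.graph.Adj p q₁) (h2 : T.graph.Adj p q₂) (hq1 : P q₁)
    (hq2 : ¬ P q₂) : ∃ q r, T.IsCCWTriangle p q r ∧ P q ∧ ¬ P r := by
  have below : ∀ q, T.graph.Adj p q → P q → coord A q.pt ≤ coord A q₂.pt := fun q hq hPq => by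
    by_contra! hn
    exact hq2 (hP _ _ h2 hq hn hPq)
  have hfin : {q | T.graph.Adj p q ∧ coord A q₁.pt ≤ coord A q.pt ∧ P q}.Finite :=
    (h.finite_neighbours T (coord A q₁.pt) (coord A q₂.pt)).subset
      fun q hq => ⟨hq.1, hq.2.1, below q hq.1 hq.2.2⟩
  obtain ⟨q, ⟨hq, hq', hPq⟩, hmax⟩ := exists_max_image _ (fun q : Farey Γ => coord A q.pt) hfin
    ⟨q₁, h1, le_rfl, hq1⟩
  obtain ⟨r, ht, hc⟩ := T.exists_apex hq.symm
  have hlt := (ccw_coord h.source (ne_source hq) (ne_source ht.2.1.symm)).1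
    (ccw_rotate.1 (ccw_rotate.1 hc))
  exact ⟨q, r, ⟨ht.rotate.rotate, ccw_rotate.1 (ccw_rotate.1 hc)⟩, hPq, fun hPr =>
    (hmax r ⟨ht.2.1.symm, hq'.trans hlt.le, hPr⟩).not_gt hlt⟩

/-- Modulo the parabolic element there are finitely many triangles at a puncture. -/
lemma exists_finite_triangles (h : EndChart ρ' β' p A A' γ τ l t) (T : IdealTriangulation Γ) :
    ∃ F : Set (Farey Γ × Farey Γ), F.Finite ∧ (∀ e ∈ F, T.IsCCWTriangle p e.1 e.2) ∧
      ∀ q r, T.IsCCWTriangle p q r → ∃ n : ℤ, (γ ^ n • q, γ ^ n • r) ∈ F := by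
  obtain ⟨q₀, hq₀⟩ := T.exists_adj p
  refine ⟨{e | T.IsCCWTriangle p e.1 e.2 ∧ coord A q₀.pt ≤ coord A e.1.pt ∧
    coord A e.1.pt ≤ coord A q₀.pt + τ}, ?_, fun e he => he.1, fun q r hqr => ?_⟩
  · refine Set.Finite.of_injOn (f := Prod.fst)
      (fun e he => (⟨he.1.1.1, he.2⟩ : _ ∧ _)) ?_ (h.finite_neighbours T _ _)
    rintro ⟨q, r⟩ h1 ⟨q', r'⟩ h2 (rfl : q = q')
    congr 1
    exact (h1.1.1.rotate.apex_unique h2.1.1.rotate (ccw_rotate.1 h1.1.2) (ccw_rotate.1 h2.1.2))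
  · obtain ⟨n, hn, -⟩ := existsUnique_add_zsmul_mem_Ico h.shift_pos (coord A q.pt) (coord A q₀.pt)
    rw [zsmul_eq_mul, ← h.coord_zpow_source hqr.1.1] at hn
    have := hqr.smul (γ ^ n)
    rw [h.zpow_smul_eq] at this
    exact ⟨n, this, hn.1, hn.2.le⟩

lemma re_zpow_source (h : EndChart ρ' β' p A A' γ τ l t) (z : ℍ) (n : ℤ) :
    (A⁻¹ • (γ ^ n • z)).re = (A⁻¹ • z).re + n * τ := by
  have := eq_add_of_shift (f := fun n : ℤ => (A⁻¹ • (γ ^ n • z)).re) (t := τ) (fun n => ?_) n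
  · simpa using this
  · rw [add_comm n, zpow_add, zpow_one, mul_smul]
    exact h.re_source _

lemma im_zpow_source (h : EndChart ρ' β' p A A' γ τ l t) (z : ℍ) (n : ℤ) :
    (A⁻¹ • (γ ^ n • z)).im = (A⁻¹ • z).im := by
  have := eq_add_of_shift (f := fun n : ℤ => (A⁻¹ • (γ ^ n • z)).im) (t := 0) (fun n => ?_) n
  · simpa using this
  · rw [add_comm n, zpow_add, zpow_one, mul_smul, add_zero]
    exact h.im_source _

lemma im_zpow_target (h : EndChart ρ' β' p A A' γ τ l t) (y : ℍ) (n : ℤ) :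
    (A'⁻¹ • (ρ' (γ ^ n) • y)).im = l ^ n * (A'⁻¹ • y).im := by
  have := eq_mul_of_shift (f := fun n : ℤ => (A'⁻¹ • (ρ' (γ ^ n) • y)).im) h.factor_pos
    (fun n => ?_) n
  · simpa using this
  · rw [add_comm n, zpow_add, zpow_one, map_mul, mul_smul]
    exact h.im_target _

lemma weight_zpow_target (h : EndChart ρ' β' p A A' γ τ l t) {c d : ℝ}
    (hw : ∀ x, c * (l * x + t) + d = l * (c * x + d)) (y : ℍ) (n : ℤ) :
    c * (A'⁻¹ • (ρ' (γ ^ n) • y)).re + d = l ^ n * (c * (A'⁻¹ • y).re + d) := by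
  have := eq_mul_of_shift (f := fun n : ℤ => c * (A'⁻¹ • (ρ' (γ ^ n) • y)).re + d) h.factor_pos
    (fun n => ?_) n
  · simpa using this
  · rw [add_comm n, zpow_add, zpow_one, map_mul, mul_smul, h.re_target, hw]

lemma coord_le_iff (h : EndChart ρ' β' p A A' γ τ l t) {q : Farey Γ} (hq : T.graph.Adj p q)
    {z : ℍ} : coord A q.pt ≤ (A⁻¹ • z).re ↔ 0 ≤ lam p.pt q.pt z := by
  rw [lam_coord h.source (ne_source hq), le_div_iff₀ (A⁻¹ • z).im_pos, zero_mul, sub_nonneg]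

lemma le_coord_iff (h : EndChart ρ' β' p A A' γ τ l t) {q : Farey Γ} (hq : T.graph.Adj p q)
    {z : ℍ} : (A⁻¹ • z).re ≤ coord A q.pt ↔ 0 ≤ lam q.pt p.pt z := by
  rw [lam_swap p.pt, lam_coord h.source (ne_source hq), ← neg_div, neg_sub,
    le_div_iff₀ (A⁻¹ • z).im_pos, zero_mul, sub_nonneg]

lemma coord_le_iff' (h : EndChart ρ' β' p A A' γ τ l t) (hs : T.IsStraightening β β')
    {q : Farey Γ} (hq : T.graph.Adj p q)
    {y : ℍ} : coord A' (β' q) ≤ (A'⁻¹ • y).re ↔ 0 ≤ lam (β' p) (β' q) y := by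
  rw [lam_coord h.target (ne_target hs hq), le_div_iff₀ (A'⁻¹ • y).im_pos, zero_mul, sub_nonneg]

lemma le_coord_iff' (h : EndChart ρ' β' p A A' γ τ l t) (hs : T.IsStraightening β β')
    {q : Farey Γ} (hq : T.graph.Adj p q)
    {y : ℍ} : (A'⁻¹ • y).re ≤ coord A' (β' q) ↔ 0 ≤ lam (β' q) (β' p) y := by
  rw [lam_swap (β' p), lam_coord h.target (ne_target hs hq), ← neg_div, neg_sub,
    le_div_iff₀ (A'⁻¹ • y).im_pos, zero_mul, sub_nonneg]

lemma exists_height_target (h : EndChart ρ' β' p A A' γ τ l t) (hs : T.IsStraightening β β')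
    (hΨ : T.IsStraightenedPlane β' Ψ') {q r : Farey Γ} (hqr : T.IsCCWTriangle p q r) (M : ℝ) :
    ∃ N, ∀ z : ℍ, coord A q.pt ≤ (A⁻¹ • z).re → (A⁻¹ • z).re ≤ coord A r.pt →
      N < (A⁻¹ • z).im → M < (A'⁻¹ • Ψ' z).im := by
  obtain ⟨N, hN⟩ := exists_height h.source h.target hqr.2 (hs.ccw _ _ _ hqr.1 hqr.2)
    (f := Ψ') (g := Function.invFun Ψ') hΨ.continuous.continuousOn
    (fun z hz => hΨ.image_triangle hqr.1 ▸ mem_image_of_mem _ hz) (hs.continuousOn_invFun hΨ hqr.1)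
    (fun z _ => Function.leftInverse_invFun (hs.plane_injective hΨ) z)
    (fun z _ hz => hs.lam_zero hΨ hqr.1.1 hz) (fun z _ hz => hs.lam_zero hΨ hqr.1.2.2 hz) M
  exact ⟨N, fun z h1 h2 h3 => (hN z h1 h2 h3).2⟩

lemma exists_height_source (h : EndChart ρ' β' p A A' γ τ l t) (hs : T.IsStraightening β β')
    (hΨ : T.IsStraightenedPlane β' Ψ') {q r : Farey Γ} (hqr : T.IsCCWTriangle p q r) (M : ℝ) :
    ∃ N, ∀ y : ℍ, coord A' (β' q) ≤ (A'⁻¹ • y).re → (A'⁻¹ • y).re ≤ coord A' (β' r) →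
      N < (A'⁻¹ • y).im → ∃ z, Ψ' z = y ∧ M < (A⁻¹ • z).im := by
  have inv : ∀ z, Function.invFun Ψ' (Ψ' z) = z :=
    Function.leftInverse_invFun (hs.plane_injective hΨ)
  have him := hΨ.image_triangle hqr.1
  obtain ⟨N, hN⟩ := exists_height h.target h.source (hs.ccw _ _ _ hqr.1 hqr.2) hqr.2
    (f := Function.invFun Ψ') (g := Ψ') (hs.continuousOn_invFun hΨ hqr.1)
    (by rw [← him]; rintro _ ⟨z, hz, rfl⟩; rwa [inv]) hΨ.continuous.continuousOn
    (by rw [← him]; rintro _ ⟨z, hz, rfl⟩; rw [inv])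
    (by rw [← him]; rintro _ ⟨z, hz, rfl⟩; rw [inv]; exact (hs.lam_eq_zero_iff hΨ hqr.1.1).1)
    (by rw [← him]; rintro _ ⟨z, hz, rfl⟩; rw [inv]; exact (hs.lam_eq_zero_iff hΨ hqr.1.2.2).1) M
  refine ⟨N, fun y h1 h2 h3 => ?_⟩
  obtain ⟨hy, hM⟩ := hN y h1 h2 h3
  rw [← him] at hy
  obtain ⟨z, hz, rfl⟩ := hy
  rw [inv] at hM
  exact ⟨z, rfl, hM⟩

/-- High horoballs at a puncture are mapped to places of the target where the height is large
compared with an equivariant affine weight `x ↦ c x + d`. -/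
lemma exists_source_height (h : EndChart ρ' β' p A A' γ τ l t) (hs : T.IsStraightening β β')
    (hΨ : T.IsStraightenedPlane β' Ψ') (hρ : IsEquivariant ρ' Ψ') {c d : ℝ}
    (hw : ∀ x, c * (l * x + t) + d = l * (c * x + d))
    (hpos : ∀ q, T.graph.Adj p q → 0 < c * coord A' (β' q) + d) {N : ℝ} (hN : 0 ≤ N) :
    ∃ M, ∀ z : ℍ, M < (A⁻¹ • z).im → N * (c * (A'⁻¹ • Ψ' z).re + d) < (A'⁻¹ • Ψ' z).im := by
  obtain ⟨F, hF, hFt, hFn⟩ := h.exists_finite_triangles T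
  have : ∀ e : Farey Γ × Farey Γ, ∃ M, e ∈ F → ∀ z : ℍ, coord A e.1.pt ≤ (A⁻¹ • z).re →
      (A⁻¹ • z).re ≤ coord A e.2.pt → M < (A⁻¹ • z).im →
      N * ((c * coord A' (β' e.1) + d) + (c * coord A' (β' e.2) + d)) < (A'⁻¹ • Ψ' z).im := by
    intro e
    by_cases he : e ∈ F
    · obtain ⟨M, hM⟩ := h.exists_height_target hs hΨ (hFt e he)
        (N * ((c * coord A' (β' e.1) + d) + (c * coord A' (β' e.2) + d)))
      exact ⟨M, fun _ => hM⟩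
    · exact ⟨0, fun h => absurd h he⟩
  choose m hm using this
  obtain ⟨M, hM⟩ := (hF.image m).bddAbove
  refine ⟨M, fun z hz => ?_⟩
  obtain ⟨⟨q₁, hq₁, l₁⟩, q₂, hq₂, l₂⟩ := h.exists_lt_source T (A⁻¹ • z).re
  obtain ⟨q, r, hqr, h1, h2⟩ := h.exists_consecutive (P := fun q => coord A q.pt ≤ (A⁻¹ • z).re)
    (fun q r _ _ hlt hr => hlt.le.trans hr) hq₁ hq₂ l₁.le l₂.not_ge
  obtain ⟨n, hn⟩ := hFn q r hqr
  have ht := hFt _ hn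
  have a1 : coord A (γ ^ n • q).pt ≤ (A⁻¹ • (γ ^ n • z)).re := by
    rw [h.coord_zpow_source hqr.1.1, h.re_zpow_source]; linarith
  have a2 : (A⁻¹ • (γ ^ n • z)).re ≤ coord A (γ ^ n • r).pt := by
    rw [h.coord_zpow_source hqr.1.2.2.symm, h.re_zpow_source]; linarith
  have a3 := hm _ hn (γ ^ n • z) a1 a2
    (by rw [h.im_zpow_source]; exact (hM (mem_image_of_mem m hn)).trans_lt hz)
  have b1 := hpos _ ht.1.1
  have b2 := hpos _ ht.1.2.2.symm
  have c1 := (h.coord_le_iff' hs ht.1.1 (y := Ψ' (γ ^ n • z))).2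
    ((hs.lam_nonneg_iff hΨ ht.1.1).2 ((h.coord_le_iff ht.1.1).1 a1))
  have c2 := (h.le_coord_iff' hs ht.1.2.2.symm (y := Ψ' (γ ^ n • z))).2
    ((hs.lam_nonneg_iff hΨ ht.1.2.2).2 ((h.le_coord_iff ht.1.2.2.symm).1 a2))
  dsimp only at a3 b1 b2 c1 c2
  have key : c * (A'⁻¹ • Ψ' (γ ^ n • z)).re + d ≤
      (c * coord A' (β' (γ ^ n • q)) + d) + (c * coord A' (β' (γ ^ n • r)) + d) := by
    rcases le_total 0 c with hc | hc
    · linarith [mul_le_mul_of_nonneg_left c2 hc]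
    · linarith [mul_le_mul_of_nonpos_left c1 hc]
  have fin := (mul_le_mul_of_nonneg_left key hN).trans_lt a3
  rw [hρ, h.weight_zpow_target hw, h.im_zpow_target, mul_left_comm] at fin
  exact lt_of_mul_lt_mul_left fin (zpow_pos h.factor_pos n).le

/-- Conversely, such places of the target are images of points in high horoballs. -/
lemma exists_target_height (h : EndChart ρ' β' p A A' γ τ l t) (hs : T.IsStraightening β β')
    (hΨ : T.IsStraightenedPlane β' Ψ') (hρβ : IsEquivariant ρ' β') (hρ : IsEquivariant ρ' Ψ')
    {c d : ℝ} (hw : ∀ x, c * (l * x + t) + d = l * (c * x + d))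
    (hpos : ∀ q, T.graph.Adj p q → 0 < c * coord A' (β' q) + d)
    (hull : ∀ x, 0 < c * x + d → (∃ q, T.graph.Adj p q ∧ coord A' (β' q) ≤ x) ∧
      ∃ q, T.graph.Adj p q ∧ x < coord A' (β' q)) (M : ℝ) :
    ∃ N > 0, ∀ y : ℍ, 0 < c * (A'⁻¹ • y).re + d →
      N * (c * (A'⁻¹ • y).re + d) < (A'⁻¹ • y).im → ∃ z, Ψ' z = y ∧ M < (A⁻¹ • z).im := by
  obtain ⟨F, hF, hFt, hFn⟩ := h.exists_finite_triangles T
  have : ∀ e : Farey Γ × Farey Γ, ∃ N, e ∈ F → ∀ y : ℍ, coord A' (β' e.1) ≤ (A'⁻¹ • y).re →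
      (A'⁻¹ • y).re ≤ coord A' (β' e.2) → N < (A'⁻¹ • y).im → ∃ z, Ψ' z = y ∧ M < (A⁻¹ • z).im := by
    intro e
    by_cases he : e ∈ F
    · obtain ⟨N, hN⟩ := h.exists_height_source hs hΨ (hFt e he) M
      exact ⟨N, fun _ => hN⟩
    · exact ⟨0, fun h => absurd h he⟩
  choose m hm using this
  obtain ⟨N, hN⟩ := (hF.image fun e => |m e| /
    min (c * coord A' (β' e.1) + d) (c * coord A' (β' e.2) + d)).bddAbove
  refine ⟨max N 1, lt_max_of_lt_right one_pos, fun y hy hlt => ?_⟩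
  obtain ⟨⟨q₁, hq₁, l₁⟩, q₂, hq₂, l₂⟩ := hull _ hy
  obtain ⟨q, r, hqr, h1, h2⟩ := h.exists_consecutive
    (P := fun q => coord A' (β' q) ≤ (A'⁻¹ • y).re)
    (fun q r hq hr hlt hr' => ((h.coord_lt_iff hs hq hr).2 hlt).le.trans hr') hq₁ hq₂ l₁ l₂.not_ge
  obtain ⟨n, hn⟩ := hFn q r hqr
  have ht := hFt _ hn
  have b1 := hpos _ ht.1.1
  have b2 := hpos _ ht.1.2.2.symm
  have a1 : coord A' (β' (γ ^ n • q)) ≤ (A'⁻¹ • (ρ' (γ ^ n) • y)).re := by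
    rw [h.coord_le_iff' hs ht.1.1, hρβ]
    conv_rhs => rw [← h.zpow_smul_eq n, hρβ]
    rw [lam_psl_smul]
    exact (h.coord_le_iff' hs hqr.1.1).1 h1
  have a2 : (A'⁻¹ • (ρ' (γ ^ n) • y)).re ≤ coord A' (β' (γ ^ n • r)) := by
    rw [h.le_coord_iff' hs ht.1.2.2.symm, hρβ]
    conv_rhs => rw [← h.zpow_smul_eq n, hρβ]
    rw [lam_psl_smul]
    exact (h.le_coord_iff' hs hqr.1.2.2.symm).1 (not_le.1 h2).le
  have hn' := hN (mem_image_of_mem _ hn)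
  dsimp only at hn' b1 b2
  set k := min (c * coord A' (β' (γ ^ n • q)) + d) (c * coord A' (β' (γ ^ n • r)) + d) with hk
  have hk0 : 0 < k := lt_min b1 b2
  have key : k ≤ c * (A'⁻¹ • (ρ' (γ ^ n) • y)).re + d := by
    rcases le_total 0 c with hc | hc
    · exact (min_le_left _ _).trans (by linarith [mul_le_mul_of_nonneg_left a1 hc])
    · exact (min_le_right _ _).trans (by linarith [mul_le_mul_of_nonpos_left a2 hc])
  have big : m (γ ^ n • q, γ ^ n • r) < (A'⁻¹ • (ρ' (γ ^ n) • y)).im := by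
    have e1 := mul_lt_mul_of_pos_left hlt (zpow_pos h.factor_pos n)
    rw [← h.im_zpow_target, mul_left_comm, ← h.weight_zpow_target hw] at e1
    refine (le_abs_self _).trans_lt (lt_of_le_of_lt ?_ e1)
    rw [div_le_iff₀ hk0] at hn'
    calc _ ≤ N * k := hn'
      _ ≤ max N 1 * k := mul_le_mul_of_nonneg_right (le_max_left _ _) hk0.le
      _ ≤ _ := mul_le_mul_of_nonneg_left key (le_max_of_le_right zero_le_one)
  obtain ⟨z, hz, hzM⟩ := hm _ hn _ a1 a2 big
  refine ⟨γ ^ (-n) • z, ?_, by rwa [h.im_zpow_source]⟩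
  rw [hρ, hz, ← mul_smul, ← map_mul, ← zpow_add]
  simp

end EndChart

end IdealTriangulation

/-! ### Cusps and geodesic boundary components -/

lemma isHoroball_iff {A : SL(2, ℝ)} {c : RP1} (hA : A • inftyPt ℝ = c) {B : Set ℍ} :
    IsHoroball c B ↔ ∃ H : ℝ, 0 < H ∧ B = {z | H < (A⁻¹ • z).im} := by
  constructor
  · rintro ⟨g, hg, rfl⟩
    obtain ⟨l, t, hl, -, hz⟩ := exists_affine (A⁻¹ * g) (by rw [mul_smul, hg, inv_smul_eq_iff, hA])
    refine ⟨l, hl, ext fun z => ?_⟩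
    have := (hz (g⁻¹ • z)).2
    rw [mul_smul, smul_inv_smul] at this
    simp only [mem_ofPred_eq]
    rw [this, lt_mul_iff_one_lt_right hl]
  · rintro ⟨H, hH, rfl⟩
    obtain ⟨g, h0, h1, h2⟩ := ccw_infty.2 hH
    obtain ⟨l, t, hl, hx, hz⟩ := exists_affine g h2
    rw [zeroPt_eq, hx] at h0
    rw [onePt_eq, hx] at h1
    have e0 := realPt_injective h0
    have e1 := realPt_injective h1
    have hlH : l = H := by linarith
    subst hlH
    refine ⟨A * g, by rw [mul_smul, h2, hA], ext fun z => ?_⟩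
    have := (hz ((A * g)⁻¹ • z)).2
    rw [mul_inv_rev, mul_smul, smul_inv_smul] at this
    simp only [mem_ofPred_eq]
    rw [this, mul_inv_rev, mul_smul, lt_mul_iff_one_lt_right hl]

/-- The distance of a point to a vertical line is at least the one given by the ratio of its Euclidean
distance and its height. -/
lemma abs_re_sub_le {A : SL(2, ℝ)} {b : ℝ} {y w : ℍ} (hw : (A⁻¹ • w).re = b) :
    |(A⁻¹ • y).re - b| ≤ Real.sinh (dist y w) * (A⁻¹ • y).im := by
  have hu := (A⁻¹ • y).im_pos
  have hv := (A⁻¹ • w).im_pos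
  have hc := UpperHalfPlane.cosh_dist' (A⁻¹ • y) (A⁻¹ • w)
  rw [dist_smul, hw, eq_div_iff (by positivity)] at hc
  have hs : 0 ≤ Real.sinh (dist y w) := Real.sinh_nonneg_iff.2 dist_nonneg
  refine abs_le_of_sq_le_sq ?_ (by positivity)
  have hcs := Real.cosh_sq (dist y w)
  rw [mul_pow, ← sub_nonneg]
  have : Real.sinh (dist y w) ^ 2 = Real.cosh (dist y w) ^ 2 - 1 := by linarith
  rw [this]
  nlinarith [sq_nonneg (Real.cosh (dist y w) * (A⁻¹ • y).im - (A⁻¹ • w).im)]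

lemma exists_dist_lt (A : SL(2, ℝ)) (b : ℝ) {ε : ℝ} (hε : 0 < ε) : ∃ N > 0, ∀ y : ℍ,
    N * |(A⁻¹ • y).re - b| < (A⁻¹ • y).im → ∃ w, (A⁻¹ • w).re = b ∧ dist y w < ε := by
  have hκ : 0 < Real.cosh ε - 1 := sub_pos.2 (Real.one_lt_cosh.2 hε.ne')
  -- the distance `d` to the point of the line at the same height satisfies
  -- `cosh d = 1 + (re - b) ^ 2 / (2 * im ^ 2)`
  refine ⟨1 + 1 / (Real.cosh ε - 1), by positivity, fun y hy => ?_⟩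
  have hu := (A⁻¹ • y).im_pos
  obtain ⟨w, hw1, hw2⟩ := exists_chart_point A b hu
  refine ⟨w, hw1, ?_⟩
  have hc := UpperHalfPlane.cosh_dist' (A⁻¹ • y) (A⁻¹ • w)
  rw [dist_smul, hw1, hw2] at hc
  rw [← abs_of_nonneg (dist_nonneg (x := y) (y := w)), ← abs_of_pos hε, ← Real.cosh_lt_cosh, hc,
    div_lt_iff₀ (by positivity)]
  have h1 : (1 + 1 / (Real.cosh ε - 1)) ^ 2 * ((A⁻¹ • y).re - b) ^ 2 < (A⁻¹ • y).im ^ 2 := by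
    rw [← sq_abs ((A⁻¹ • y).re - b), ← mul_pow]
    exact pow_lt_pow_left₀ hy (by positivity) two_ne_zero
  have h2 : 1 ≤ (Real.cosh ε - 1) * (1 + 1 / (Real.cosh ε - 1)) ^ 2 := by
    have : (Real.cosh ε - 1) * (1 + 1 / (Real.cosh ε - 1)) ^ 2 =
      (Real.cosh ε - 1) + 2 + 1 / (Real.cosh ε - 1) := by field_simp; ring
    rw [this]
    have : 0 < 1 / (Real.cosh ε - 1) := by positivity
    linarith
  nlinarith [mul_le_mul_of_nonneg_right h2 (sq_nonneg ((A⁻¹ • y).re - b)),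
    mul_lt_mul_of_pos_left h1 hκ]

namespace IdealTriangulation

variable {Γ : Subgroup PSL(2, ℝ)} {T : IdealTriangulation Γ} {β : Farey Γ → CP1}
  {β' : Farey Γ → RP1} {Ψ' : ℍ → ℍ} {ρ' : Γ →* PSL(2, ℝ)}

namespace EndChart

variable {p : Farey Γ} {A A' : SL(2, ℝ)} {γ : Γ} {τ l t : ℝ}

lemma isCuspEnd (h : EndChart ρ' β' p A A' γ τ 1 t) (hs : T.IsStraightening β β')
    (hΨ : T.IsStraightenedPlane β' Ψ') (hρβ : IsEquivariant ρ' β') (hρ : IsEquivariant ρ' Ψ')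
    (hG : IsFuchsian ρ'.range) (hinj : Function.Injective ρ') : IsCuspEnd ρ' β' Ψ' p where
  parabolic δ hδ h1 := h.parabolic hρβ hG hinj hs hδ h1
  horoball_subset_image B hB := by
    obtain ⟨M, -, rfl⟩ := (isHoroball_iff h.source).1 hB
    obtain ⟨N, hN, H⟩ := h.exists_target_height hs hΨ hρβ hρ (c := 0) (d := 1) (by simp) (by simp)
      (fun x _ => by
        obtain ⟨⟨q, hq, h1⟩, h2⟩ := h.exists_lt_target hρβ hs x
        exact ⟨⟨q, hq, h1.le⟩, h2⟩) M
    refine ⟨_, (isHoroball_iff h.target).2 ⟨N, hN, rfl⟩, fun y hy => ?_⟩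
    obtain ⟨z, hz, hzM⟩ := H y (by simp) (by simpa using hy)
    exact ⟨z, hzM, hz⟩
  image_subset_horoball B' hB' := by
    obtain ⟨N, hN, rfl⟩ := (isHoroball_iff h.target).1 hB'
    obtain ⟨M, H⟩ := h.exists_source_height hs hΨ hρ (c := 0) (d := 1) (by simp) (by simp) hN.le
    refine ⟨_, (isHoroball_iff h.source).2 ⟨max M 1, by positivity, rfl⟩, ?_⟩
    rintro _ ⟨z, hz, rfl⟩
    simpa using H z ((le_max_left _ _).trans_lt hz)

lemma IsBoundary.side_of_mem_range {h : EndChart ρ' β' p A A' γ τ l t} {b s : ℝ}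
    (hb : h.IsBoundary T b s) (hs : T.IsStraightening β β')
    (hΨ : T.IsStraightenedPlane β' Ψ') {y : ℍ} (hy : y ∈ range Ψ') :
    0 < s * ((A'⁻¹ • y).re - b) := by
  obtain ⟨z, rfl⟩ := hy
  by_contra! hn
  exact h.notMem_beyond hs hΨ z ((hb.mem_beyond_iff hs).2 hn)

lemma IsBoundary.isBoundaryEnd {h : EndChart ρ' β' p A A' γ τ l t} {b s : ℝ}
    (hb : h.IsBoundary T b s) (hs : T.IsStraightening β β')
    (hΨ : T.IsStraightenedPlane β' Ψ') (hρβ : IsEquivariant ρ' β') (hρ : IsEquivariant ρ' Ψ') :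
    IsBoundaryEnd ρ' β' Ψ' p (geodesic (β' p) (A' • realPt b)) := by
  have mem : ∀ {y}, y ∈ geodesic (β' p) (A' • realPt b) ↔ (A'⁻¹ • y).re = b := by
    intro y
    rw [← h.target, mem_vertical_iff]
  have beyond : ∀ {y}, y ∈ geodesic (β' p) (A' • realPt b) → y ∈ T.Beyond β' p := fun {y} hy =>
    (hb.mem_beyond_iff hs).2 (by rw [mem.1 hy]; simp)
  have hne : (geodesic (β' p) (A' • realPt b)).Nonempty := by
    obtain ⟨z, hz, -⟩ := exists_chart_point A' b one_pos
    exact ⟨z, mem.2 hz⟩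
  have hw : ∀ x, s * (l * x + t) + -(s * b) = l * (s * x + -(s * b)) := fun x => by
    linear_combination s * hb.fixed
  have hpos : ∀ q, T.graph.Adj p q → 0 < s * coord A' (β' q) + -(s * b) := fun q hq => by
    linarith [hb.side q hq]
  have habs : ∀ {x : ℝ}, 0 < s * (x - b) → |x - b| = s * x + -(s * b) := by
    intro x hx
    rcases hb.sign with rfl | rfl
    · rw [abs_of_pos (by linarith)]; ring
    · rw [abs_of_neg (by linarith)]; ring
  refine ⟨⟨_, ?_, rfl, fun δ hδ => ⟨by rw [← hρβ, hδ], hb.smul_fixed hρβ hs hδ⟩⟩,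
    fun y hy => hb.line_subset_frontier hs hΨ (mem.1 hy), fun δ hδ => ?_, fun B hB => ?_,
    fun ε hε => ?_⟩
  · rw [← h.target]
    exact (smul_infty_ne_smul_realPt A' b).symm
  · rw [disjoint_left]
    rintro _ ⟨y, hy, rfl⟩ hy'
    exact hδ (hs.eq_of_mem_beyond (smul_mem_beyond hρβ δ (beyond hy)) (beyond hy'))
  · obtain ⟨M, -, rfl⟩ := (isHoroball_iff h.source).1 hB
    obtain ⟨N, hN, H⟩ := h.exists_target_height hs hΨ hρβ hρ hw hpos (fun x hx => by
      obtain ⟨q, hq, h1⟩ := hb.near _ hx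
      obtain ⟨r, hr, h2⟩ := hb.far (s * x + -(s * b))
      rcases hb.sign with rfl | rfl
      · exact ⟨⟨q, hq, by linarith⟩, r, hr, by linarith⟩
      · exact ⟨⟨r, hr, by linarith⟩, q, hq, by linarith⟩) M
    refine ⟨Real.arsinh N⁻¹, Real.arsinh_pos_iff.2 (inv_pos.2 hN), ?_⟩
    rintro y ⟨hy, hyε⟩
    obtain ⟨w, hw, hd⟩ := (Metric.infDist_lt_iff hne).1 hyε
    have h0 := hb.side_of_mem_range hs hΨ hy
    have h1 := abs_re_sub_le (y := y) (mem.1 hw)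
    have h2 : Real.sinh (dist y w) < N⁻¹ := by
      rw [← Real.sinh_arsinh N⁻¹]; exact Real.sinh_lt_sinh.2 hd
    have h3 := h1.trans_lt (mul_lt_mul_of_pos_right h2 (A'⁻¹ • y).im_pos)
    rw [habs h0, inv_mul_eq_div, lt_div_iff₀' hN] at h3
    obtain ⟨z, hz, hzM⟩ := H y (by linarith) h3
    exact ⟨z, hzM, hz⟩
  · obtain ⟨N, hN, H⟩ := exists_dist_lt A' b hε
    obtain ⟨M, HM⟩ := h.exists_source_height hs hΨ hρ hw hpos hN.le
    refine ⟨_, (isHoroball_iff h.source).2 ⟨max M 1, by positivity, rfl⟩, ?_⟩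
    rintro _ ⟨z, hz, rfl⟩
    refine ⟨mem_range_self z, ?_⟩
    have h1 := HM z ((le_max_left _ _).trans_lt hz)
    rw [← habs (hb.side_of_mem_range hs hΨ (mem_range_self z))] at h1
    obtain ⟨w, hw, hd⟩ := H _ h1
    exact (Metric.infDist_lt_iff hne).2 ⟨w, mem.2 hw, hd⟩

end EndChart

lemma IsStraightening.cusp_or_boundary (hs : T.IsStraightening β β')
    (hΨ : T.IsStraightenedPlane β' Ψ') (hρβ : IsEquivariant ρ' β') (hρ : IsEquivariant ρ' Ψ')
    (hG : IsFuchsian ρ'.range) (hinj : Function.Injective ρ') (p : Farey Γ) :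
    IsCuspEnd ρ' β' Ψ' p ∨ ∃ ℓ, IsBoundaryEnd ρ' β' Ψ' p ℓ := by
  obtain ⟨A, A', γ, τ, l, t, h⟩ := exists_endChart hρβ p
  by_cases hl : l = 1
  · subst hl
    exact Or.inl (h.isCuspEnd hs hΨ hρβ hρ hG hinj)
  · obtain ⟨b, s, hb⟩ := h.exists_isBoundary hρβ hs hl
    exact Or.inr ⟨_, hb.isBoundaryEnd hs hΨ hρβ hρ⟩

/-- A point of the frontier of the developed image lies on a boundary geodesic. -/
lemma IsStraightening.exists_boundaryEnd {ρ : Γ →* PSL(2, ℂ)} (hβ : IsEquivariant ρ β)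
    (hFG : T.HasNonzeroCoordinates β) (hs : T.IsStraightening β β')
    (hΨ : T.IsStraightenedPlane β' Ψ') (hρβ : IsEquivariant ρ' β') (hρ : IsEquivariant ρ' Ψ')
    {y : ℍ} (hy : y ∈ frontier (range Ψ')) : ∃ p ℓ, IsBoundaryEnd ρ' β' Ψ' p ℓ ∧ y ∈ ℓ := by
  rw [(hs.isOpenEmbedding hΨ).isOpen_range.frontier_eq] at hy
  obtain ⟨p, hp⟩ := hs.exists_mem_beyond hβ hFG hΨ hy.2
  obtain ⟨A, A', γ, τ, l, t, h⟩ := exists_endChart hρβ p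
  by_cases hl : l = 1
  · subst hl
    rw [h.beyond_eq_empty hρβ hs] at hp
    exact absurd hp (notMem_empty y)
  · obtain ⟨b, s, hb⟩ := h.exists_isBoundary hρβ hs hl
    refine ⟨p, _, hb.isBoundaryEnd hs hΨ hρβ hρ, ?_⟩
    rw [← h.target, mem_vertical_iff]
    exact hb.mem_line_of_mem_closure hs hΨ hp hy.1

/-- The frontier of the developed image consists of the boundary geodesics. -/
theorem IsStraightening.frontier_eq {ρ : Γ →* PSL(2, ℂ)} (hβ : IsEquivariant ρ β)
    (hFG : T.HasNonzeroCoordinates β) (hs : T.IsStraightening β β')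
    (hΨ : T.IsStraightenedPlane β' Ψ') (hρβ : IsEquivariant ρ' β') (hρ : IsEquivariant ρ' Ψ') :
    frontier (range Ψ') = ⋃₀ {ℓ : Set ℍ | ∃ p, IsBoundaryEnd ρ' β' Ψ' p ℓ} := by
  refine Subset.antisymm (fun y hy => ?_) (sUnion_subset ?_)
  · obtain ⟨p, ℓ, hℓ, hyℓ⟩ := hs.exists_boundaryEnd hβ hFG hΨ hρβ hρ hy
    exact ⟨ℓ, ⟨p, hℓ⟩, hyℓ⟩
  · rintro ℓ ⟨p, hℓ⟩
    exact hℓ.subset_frontier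

/-- Pleating lines spiral onto the boundary geodesic at their endpoint. -/
lemma IsStraightening.isAsymptoticAt (hs : T.IsStraightening β β')
    (hΨ : T.IsStraightenedPlane β' Ψ') (hρβ : IsEquivariant ρ' β') {p q : Farey Γ} {ℓ : Set ℍ}
    (hℓ : IsBoundaryEnd ρ' β' Ψ' p ℓ) (hq : T.graph.Adj p q) :
    IsAsymptoticAt (β' p) (Ψ' '' geodesic p.pt q.pt) ℓ := by
  obtain ⟨A, A', γ, τ, l, t, h⟩ := exists_endChart hρβ p
  obtain ⟨b, s, hb, rfl⟩ := h.exists_isBoundary_of_boundaryEnd hρβ hs hℓ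
  refine ⟨β' q, A' • realPt b, (EndChart.ne_target hs hq).symm, ?_, ?_, hΨ.image_edge hq, rfl⟩
  · rw [← h.target]
    exact smul_infty_ne_smul_realPt A' b
  · intro e
    have := hb.side q hq
    rw [e, coord_eq] at this
    simp at this

end IdealTriangulation

/-! ### Geodesic segments -/

lemma isClosed_geodesicSegment (x y : ℍ) : IsClosed (geodesicSegment x y) :=
  isClosed_eq (by fun_prop) continuous_const

lemma isCompact_geodesicSegment (x y : ℍ) : IsCompact (geodesicSegment x y) := by
  refine (isCompact_closedBall x (dist x y)).of_isClosed_subset (isClosed_geodesicSegment x y) ?_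
  intro z (hz : dist x z + dist z y = dist x y)
  rw [Metric.mem_closedBall, dist_comm]
  linarith [dist_nonneg (x := z) (y := y)]

/-- Two points lie on a common vertical line in a suitable chart. -/
lemma exists_vertical_chart (x y : ℍ) : ∃ A : SL(2, ℝ), (A⁻¹ • x).re = (A⁻¹ • y).re := by
  by_cases h : x.re = y.re
  · exact ⟨1, by simpa using h⟩
  have h' : x.re - y.re ≠ 0 := sub_ne_zero.2 h
  obtain ⟨c, hc⟩ : ∃ c : ℝ, (x.re - c) ^ 2 + x.im ^ 2 = (y.re - c) ^ 2 + y.im ^ 2 :=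
    ⟨(x.re ^ 2 + x.im ^ 2 - y.re ^ 2 - y.im ^ 2) / (2 * (x.re - y.re)), by field_simp; ring⟩
  have hpos : 0 < (x.re - c) ^ 2 + x.im ^ 2 := by have := x.im_pos; positivity
  set R := Real.sqrt ((x.re - c) ^ 2 + x.im ^ 2) with hR
  have hR0 : 0 < R := Real.sqrt_pos.2 hpos
  have hRR : R ^ 2 = (x.re - c) ^ 2 + x.im ^ 2 := Real.sq_sqrt hpos.le
  obtain ⟨A, hA⟩ := exists_smul_infty (realPt (c - R))
  have hne : realPt (c + R) ≠ A • inftyPt ℝ := by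
    rw [hA]
    intro e
    linarith [realPt_injective e]
  obtain ⟨b, hb⟩ := chart_cases A hne
  have key : ∀ z : ℍ, (z.re - c) ^ 2 + z.im ^ 2 = R ^ 2 → (A⁻¹ • z).re = b := by
    intro z hz
    have hAb : A • inftyPt ℝ ≠ A • realPt b := smul_infty_ne_smul_realPt A b
    rw [← mem_vertical_iff, mem_geodesic_iff hAb, hA, ← hb, lam_realPt]
    rw [show (z.re - (c - R)) * (z.re - (c + R)) + z.im ^ 2 = 0 by linear_combination hz, zero_div]
  exact ⟨A, by rw [key x hRR.symm, key y (by rw [hRR, hc])]⟩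

lemma re_eq_of_mem_geodesicSegment {x y z : ℍ} (h : x.re = y.re) (hz : z ∈ geodesicSegment x y) :
    z.re = x.re := by
  have h1 : dist x z + dist z y = dist x y := hz
  rw [UpperHalfPlane.dist_of_re_eq h] at h1
  have h2 := UpperHalfPlane.dist_log_im_le x z
  have h3 := UpperHalfPlane.dist_log_im_le z y
  have h4 := dist_triangle (Real.log x.im) (Real.log z.im) (Real.log y.im)
  have h5 : dist x z = dist (Real.log x.im) (Real.log z.im) := by linarith
  obtain ⟨w, hw1, hw2⟩ : ∃ w : ℍ, w.re = x.re ∧ w.im = z.im := ⟨⟨⟨x.re, z.im⟩, z.im_pos⟩, rfl, rfl⟩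
  rw [← hw2, ← UpperHalfPlane.dist_of_re_eq hw1.symm] at h5
  have h6 := congrArg Real.cosh h5
  rw [UpperHalfPlane.cosh_dist', UpperHalfPlane.cosh_dist', hw1, hw2] at h6
  have hx := x.im_pos
  have hzp := z.im_pos
  rw [div_left_inj' (by positivity)] at h6
  have h7 : (x.re - z.re) ^ 2 = 0 := by linarith
  linarith [pow_eq_zero_iff two_ne_zero |>.1 h7]

/-- A geodesic that does not contain a segment meets it at most once. -/
lemma subsingleton_geodesicSegment_inter {x y : ℍ} {a b : RP1} (hab : a ≠ b)
    (h : ¬ (x ∈ geodesic a b ∧ y ∈ geodesic a b)) :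
    (geodesicSegment x y ∩ geodesic a b).Subsingleton := by
  obtain ⟨A, hA⟩ := exists_vertical_chart x y
  have line : ∀ z ∈ geodesicSegment x y, (A⁻¹ • z).re = (A⁻¹ • x).re := by
    intro z (hz : dist x z + dist z y = dist x y)
    refine re_eq_of_mem_geodesicSegment hA ?_
    change dist _ _ + dist _ _ = dist _ _
    rwa [dist_smul, dist_smul, dist_smul]
  have vert : ∀ {c : ℝ} {z : ℍ}, z ∈ geodesicSegment x y →
      z ∈ geodesic (A • inftyPt ℝ) (A • realPt c) →
      x ∈ geodesic (A • inftyPt ℝ) (A • realPt c) ∧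
        y ∈ geodesic (A • inftyPt ℝ) (A • realPt c) := by
    intro c z hz hz'
    rw [mem_vertical_iff] at hz' ⊢
    rw [mem_vertical_iff]
    rw [line z hz] at hz'
    exact ⟨hz', by rw [← hA]; exact hz'⟩
  rintro z ⟨hz, hz'⟩ w ⟨hw, hw'⟩
  by_cases ha : a = A • inftyPt ℝ
  · obtain ⟨c, rfl⟩ := chart_cases A (ha ▸ hab.symm : b ≠ A • inftyPt ℝ)
    rw [ha] at h hz'
    exact absurd (vert hz hz') h
  by_cases hb : b = A • inftyPt ℝ
  · obtain ⟨c, rfl⟩ := chart_cases A ha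
    rw [hb, geodesic_comm] at h hz'
    exact absurd (vert hz hz') h
  obtain ⟨s, rfl⟩ := chart_cases A ha
  obtain ⟨t, rfl⟩ := chart_cases A hb
  have hst : t - s ≠ 0 := fun e => hab (by rw [sub_eq_zero.1 e])
  rw [mem_geodesic_iff hab, lam_chart, lam_realPt, line _ hz,
    div_eq_zero_iff, or_iff_left (mul_ne_zero (A⁻¹ • z).im_ne_zero hst)] at hz'
  rw [mem_geodesic_iff hab, lam_chart, lam_realPt, line _ hw,
    div_eq_zero_iff, or_iff_left (mul_ne_zero (A⁻¹ • w).im_ne_zero hst)] at hw'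
  refine eq_of_chart_eq (A := A) (by rw [line z hz, line w hw]) ?_
  have : (A⁻¹ • z).im ^ 2 = (A⁻¹ • w).im ^ 2 := by linarith
  exact (pow_left_inj₀ (A⁻¹ • z).im_pos.le (A⁻¹ • w).im_pos.le two_ne_zero).1 this

/-! ### Laminations with atomic transverse measure -/

/-- The sum of point masses with weight function `W`. -/
def atomMeasure (W : ℍ → ℝ≥0∞) : Measure ℍ := Measure.sum fun z => W z • Measure.dirac z

lemma atomMeasure_apply (W : ℍ → ℝ≥0∞) {A : Set ℍ} (hA : MeasurableSet A) :
    atomMeasure W A = ∑' z : A, W z := by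
  rw [atomMeasure, Measure.sum_apply _ hA, tsum_subtype A W]
  refine tsum_congr fun z => ?_
  rw [Measure.smul_apply, Measure.dirac_apply' _ hA]
  by_cases hz : z ∈ A <;> simp [hz]

lemma atomMeasure_bijOn {W : ℍ → ℝ≥0∞} {A B : Set ℍ} (hA : MeasurableSet A)
    (hB : MeasurableSet B) {f : ℍ → ℍ} (hf : BijOn f A B) (hW : ∀ z ∈ A, W (f z) = W z) :
    atomMeasure W B = atomMeasure W A := by
  rw [atomMeasure_apply W hA, atomMeasure_apply W hB, ← (hf.equiv f).tsum_eq]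
  exact tsum_congr fun z => hW z z.2

lemma atomMeasure_restrict_singleton (W : ℍ → ℝ≥0∞) {x y z : ℍ} (hz : z ∈ geodesicSegment x y) :
    (atomMeasure W).restrict (geodesicSegment x y) {z} = W z := by
  rw [Measure.restrict_apply (measurableSet_singleton z),
    inter_eq_left.2 (singleton_subset_iff.2 hz), atomMeasure_apply W (measurableSet_singleton z),
    tsum_singleton z W]

lemma measurableSet_inter_preimage {S A : Set ℍ} (hS : MeasurableSet S) (hA : MeasurableSet A)
    {f : ℍ → ℍ} (hf : ContinuousOn f S) : MeasurableSet (S ∩ f ⁻¹' A) := by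
  rw [← Subtype.image_preimage_coe]
  exact (MeasurableEmbedding.subtype_coe hS).measurableSet_image.2
    ((continuousOn_iff_continuous_domRestrict.1 hf).measurable hA)

/-- A locally finite family of disjoint geodesics with weights is a measured lamination. The weights
are given by a function `W` on the hyperbolic plane that is constant on the leaves. -/
def weightedLamination (G : Subgroup PSL(2, ℝ)) (X : Set ℍ) (leaves : Set (Set ℍ))
    (W : ℍ → ℝ≥0∞)
    (isGeodesic : ∀ ℓ ∈ leaves, ∃ a b : RP1, a ≠ b ∧ ℓ = geodesic a b)
    (subset : ∀ ℓ ∈ leaves, ℓ ⊆ X)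
    (disjoint : leaves.PairwiseDisjoint id)
    (isClosed : IsClosed (⋃₀ leaves))
    (smul_leaves : ∀ g ∈ G, ∀ ℓ ∈ leaves, (g • ·) '' ℓ ∈ leaves)
    (W_zero : ∀ z, W z = 0 ↔ z ∉ ⋃₀ leaves)
    (W_eq : ∀ ℓ ∈ leaves, ∀ z ∈ ℓ, ∀ w ∈ ℓ, W z = W w)
    (W_smul : ∀ g ∈ G, ∀ z, W (g • z) = W z)
    (W_finite : ∀ z ∈ interior X, W z ≠ ⊤)
    (finite : ∀ K ⊆ interior X, IsCompact K → {ℓ ∈ leaves | (ℓ ∩ K).Nonempty}.Finite) :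
    MeasuredLamination G X where
  leaves := leaves
  measure x y := (atomMeasure W).restrict (geodesicSegment x y)
  isGeodesic := isGeodesic
  subset := subset
  disjoint := disjoint
  isClosed := isClosed
  smul_leaves := smul_leaves
  concentrated x y _ := by
    have hm : MeasurableSet (geodesicSegment x y ∩ ⋃₀ leaves)ᶜ :=
      ((isClosed_geodesicSegment x y).inter isClosed).measurableSet.compl
    rw [Measure.restrict_apply hm,
      atomMeasure_apply W (hm.inter (isClosed_geodesicSegment x y).measurableSet),
      ENNReal.tsum_eq_zero]
    rintro ⟨z, hz, hz'⟩
    exact (W_zero z).2 fun h => hz ⟨hz', h⟩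
  full_support x y _ z hz _ := by
    rw [Measure.mem_support_iff_forall]
    intro U hU
    refine lt_of_lt_of_le ?_ (measure_mono (singleton_subset_iff.2 (mem_of_mem_nhds hU)))
    rw [atomMeasure_restrict_singleton W hz.1, pos_iff_ne_zero]
    exact fun h => (W_zero z).1 h hz.2
  restrict x y x' y' _ _ h := by
    rw [Measure.restrict_restrict (isClosed_geodesicSegment x' y').measurableSet,
      inter_eq_left.2 h]
  holonomy x y x' y' _ _ f hf hbij hleaf A hA := by
    have hS := (isClosed_geodesicSegment x y).measurableSet
    have hm := measurableSet_inter_preimage hS hA hf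
    rw [Measure.restrict_apply hA, Measure.restrict_apply hm, inter_right_comm, inter_self]
    refine atomMeasure_bijOn hm (hA.inter (isClosed_geodesicSegment x' y').measurableSet)
      ⟨fun z hz => ⟨hz.2, hbij.mapsTo hz.1⟩, hbij.injOn.mono inter_subset_left, ?_⟩ ?_
    · rintro w ⟨hwA, hw⟩
      obtain ⟨z, hz, rfl⟩ := hbij.surjOn hw
      exact ⟨z, ⟨hz, hwA⟩, rfl⟩
    · rintro z ⟨hz, -⟩
      by_cases h : z ∈ ⋃₀ leaves
      · obtain ⟨ℓ, hℓ, hzℓ⟩ := h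
        exact W_eq ℓ hℓ _ ((hleaf ℓ hℓ z hz).1 hzℓ) _ hzℓ
      · rw [(W_zero z).2 h, W_zero]
        rintro ⟨ℓ, hℓ, hzℓ⟩
        exact h ⟨ℓ, hℓ, (hleaf ℓ hℓ z hz).2 hzℓ⟩
  smul_measure g hg x y _ := by
    have hc : Continuous fun z : ℍ => g • z :=
      (Isometry.of_dist_eq fun z w => dist_psl_smul g z w).continuous
    refine Measure.ext fun A hA => ?_
    have hS := (isClosed_geodesicSegment x y).measurableSet
    have hA' := hc.measurable hA
    rw [Measure.map_apply hc.measurable hA, Measure.restrict_apply hA,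
      Measure.restrict_apply hA']
    refine atomMeasure_bijOn (hA'.inter hS)
      (hA.inter (isClosed_geodesicSegment _ _).measurableSet) (f := (g • ·))
      ⟨?_, (MulAction.injective g).injOn, ?_⟩ fun z _ => W_smul g hg z
    · rintro z ⟨h1, h2⟩
      refine ⟨h1, ?_⟩
      change dist _ _ + dist _ _ = dist _ _
      rw [dist_psl_smul, dist_psl_smul, dist_psl_smul]
      exact h2
    · rintro w ⟨h1, h2 : dist _ _ + dist _ _ = dist _ _⟩
      refine ⟨g⁻¹ • w, ⟨by simpa using h1, ?_⟩, smul_inv_smul g w⟩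
      change dist _ _ + dist _ _ = dist _ _
      rw [← dist_psl_smul g x (g⁻¹ • w), ← dist_psl_smul g (g⁻¹ • w) y, ← dist_psl_smul g x y,
        smul_inv_smul]
      exact h2
  finite x y hxy hint := by
    have hS := isClosed_geodesicSegment x y
    have hfin : {z | z ∈ geodesicSegment x y ∧ W z ≠ 0}.Finite := by
      refine ((finite _ hint (isCompact_geodesicSegment x y)).biUnion (t := fun ℓ =>
        geodesicSegment x y ∩ ℓ) fun ℓ hℓ => ?_).subset ?_
      · obtain ⟨a, b, hab, rfl⟩ := isGeodesic ℓ hℓ.1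
        exact (subsingleton_geodesicSegment_inter hab (hxy.2.2 _ hℓ.1)).finite
      · rintro z ⟨hz, hWz⟩
        obtain ⟨ℓ, hℓ, hzℓ⟩ := not_not.1 (mt (W_zero z).2 hWz)
        exact mem_biUnion (show ℓ ∈ {ℓ ∈ leaves | (ℓ ∩ geodesicSegment x y).Nonempty} from
          ⟨hℓ, z, hzℓ, hz⟩) ⟨hz, hzℓ⟩
    rw [Measure.restrict_apply_univ, atomMeasure_apply W hS.measurableSet, tsum_subtype,
      tsum_eq_sum (s := hfin.toFinset) fun z hz => ?_]
    · refine ENNReal.sum_lt_top.2 fun z hz => ?_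
      rw [Finite.mem_toFinset] at hz
      rw [indicator_of_mem hz.1]
      exact (W_finite z (hint hz.1)).lt_top
    · rw [Finite.mem_toFinset] at hz
      by_contra hn
      exact hz ⟨mem_of_indicator_ne_zero hn, fun h0 => hn (by
        rw [indicator_of_mem (mem_of_indicator_ne_zero hn), h0])⟩

/-! ### The bending lamination -/

lemma smul_geodesic (g : PSL(2, ℝ)) {a b : RP1} (hab : a ≠ b) :
    (g • ·) '' geodesic a b = geodesic (g • a) (g • b) := by
  have hab' : g • a ≠ g • b := fun e => hab (MulAction.injective g e)
  ext z
  rw [mem_geodesic_iff hab']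
  constructor
  · rintro ⟨w, hw, rfl⟩
    rwa [lam_psl_smul, ← mem_geodesic_iff hab]
  · intro hz
    refine ⟨g⁻¹ • z, ?_, smul_inv_smul g z⟩
    rwa [mem_geodesic_iff hab, ← lam_psl_smul g, smul_inv_smul]

lemma geodesic_endpoint_unique {a b c : RP1} (hb : b ≠ a) (hc : c ≠ a) {z : ℍ}
    (h1 : z ∈ geodesic a b) (h2 : z ∈ geodesic a c) : b = c := by
  obtain ⟨A, rfl⟩ := exists_smul_infty a
  obtain ⟨x, rfl⟩ := chart_cases A hb
  obtain ⟨y, rfl⟩ := chart_cases A hc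
  rw [mem_vertical_iff] at h1 h2
  rw [← h1, ← h2]

lemma geodesic_nonempty {a b : RP1} (hb : b ≠ a) : (geodesic a b).Nonempty := by
  obtain ⟨A, rfl⟩ := exists_smul_infty a
  obtain ⟨x, rfl⟩ := chart_cases A hb
  obtain ⟨z, hz, -⟩ := exists_chart_point A x one_pos
  exact ⟨z, mem_vertical_iff.2 hz⟩

namespace IdealTriangulation

variable {Γ : Subgroup PSL(2, ℝ)} {T : IdealTriangulation Γ} {β : Farey Γ → CP1}
  {β' : Farey Γ → RP1} {Ψ' : ℍ → ℍ} {ρ' : Γ →* PSL(2, ℝ)} {ρ : Γ →* PSL(2, ℂ)}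

lemma IsStraightening.mem_beyond_of_boundaryEnd (hs : T.IsStraightening β β')
    (hρβ : IsEquivariant ρ' β') {p : Farey Γ} {ℓ : Set ℍ} (hℓ : IsBoundaryEnd ρ' β' Ψ' p ℓ)
    {y : ℍ} (hy : y ∈ ℓ) : y ∈ T.Beyond β' p := by
  obtain ⟨A, A', γ, τ, l, t, h⟩ := exists_endChart hρβ p
  obtain ⟨b, s, hb, rfl⟩ := h.exists_isBoundary_of_boundaryEnd hρβ hs hℓ
  rw [← h.target, mem_vertical_iff] at hy
  rw [hb.mem_beyond_iff hs, hy]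
  simp

lemma IsStraightening.boundaryEnd_eq_of_mem (hs : T.IsStraightening β β')
    (hρβ : IsEquivariant ρ' β') {p p' : Farey Γ} {ℓ ℓ' : Set ℍ}
    (hℓ : IsBoundaryEnd ρ' β' Ψ' p ℓ) (hℓ' : IsBoundaryEnd ρ' β' Ψ' p' ℓ') {y : ℍ} (hy : y ∈ ℓ)
    (hy' : y ∈ ℓ') : ℓ = ℓ' := by
  obtain rfl := hs.eq_of_mem_beyond (hs.mem_beyond_of_boundaryEnd hρβ hℓ hy)
    (hs.mem_beyond_of_boundaryEnd hρβ hℓ' hy')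
  obtain ⟨q, hq, rfl, -⟩ := hℓ.axis
  obtain ⟨q', hq', rfl, -⟩ := hℓ'.axis
  rw [geodesic_endpoint_unique hq hq' hy hy']

lemma smul_mem_frontier (hρ : IsEquivariant ρ' Ψ')
    (ho : IsOpen (range Ψ')) (γ : Γ) {y : ℍ} (hy : y ∈ frontier (range Ψ')) :
    ρ' γ • y ∈ frontier (range Ψ') := by
  rw [ho.frontier_eq] at hy ⊢
  have hc : Continuous fun z : ℍ => ρ' γ • z :=
    (Isometry.of_dist_eq fun z w => dist_psl_smul (ρ' γ) z w).continuous
  constructor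
  · refine closure_mono ?_ (image_closure_subset_closure_image hc (mem_image_of_mem _ hy.1))
    rintro _ ⟨_, ⟨z, rfl⟩, rfl⟩
    exact ⟨γ • z, hρ γ z⟩
  · rintro ⟨z, hz⟩
    refine hy.2 ⟨γ⁻¹ • z, ?_⟩
    rw [hρ, hz, map_inv, inv_smul_smul]

/-- The holonomy permutes the boundary geodesics. -/
lemma IsStraightening.smul_boundaryEnd (hβ : IsEquivariant ρ β)
    (hFG : T.HasNonzeroCoordinates β) (hs : T.IsStraightening β β')
    (hΨ : T.IsStraightenedPlane β' Ψ') (hρβ : IsEquivariant ρ' β') (hρ : IsEquivariant ρ' Ψ')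
    (γ : Γ) {p : Farey Γ} {ℓ : Set ℍ} (hℓ : IsBoundaryEnd ρ' β' Ψ' p ℓ) :
    IsBoundaryEnd ρ' β' Ψ' (γ • p) ((ρ' γ • ·) '' ℓ) := by
  obtain ⟨q, hq, rfl, -⟩ := hℓ.axis
  obtain ⟨y, hy⟩ := geodesic_nonempty hq
  obtain ⟨p', ℓ', hℓ', hy'⟩ := hs.exists_boundaryEnd hβ hFG hΨ hρβ hρ
    (smul_mem_frontier hρ (hs.isOpenEmbedding hΨ).isOpen_range γ
      (hℓ.subset_frontier hy))
  obtain rfl := hs.eq_of_mem_beyond (hs.mem_beyond_of_boundaryEnd hρβ hℓ' hy')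
    (smul_mem_beyond hρβ γ (hs.mem_beyond_of_boundaryEnd hρβ hℓ hy))
  have hmem := mem_image_of_mem (ρ' γ • ·) hy
  obtain ⟨q', hq', rfl, -⟩ := hℓ'.axis
  rw [smul_geodesic _ hq.symm, ← hρβ] at hmem ⊢
  rwa [geodesic_endpoint_unique (fun e => hq (smul_left_cancel (ρ' γ) (e.trans (hρβ γ p)))) hq'
    hmem hy']

/-- The developed image is the interior of its closure: it lies on one side of each boundary geodesic. -/
lemma IsStraightening.interior_closure_range (hβ : IsEquivariant ρ β)
    (hFG : T.HasNonzeroCoordinates β) (hs : T.IsStraightening β β')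
    (hΨ : T.IsStraightenedPlane β' Ψ') (hρβ : IsEquivariant ρ' β') (hρ : IsEquivariant ρ' Ψ') :
    interior (closure (range Ψ')) ⊆ range Ψ' := by
  intro y hy
  by_contra hn
  have hfr : y ∈ frontier (range Ψ') := by
    rw [(hs.isOpenEmbedding hΨ).isOpen_range.frontier_eq]
    exact ⟨interior_subset hy, hn⟩
  obtain ⟨p, ℓ, hℓ, hyℓ⟩ := hs.exists_boundaryEnd hβ hFG hΨ hρβ hρ hfr
  obtain ⟨A, A', γ, τ, l, t, h⟩ := exists_endChart hρβ p
  obtain ⟨b, s, hb, rfl⟩ := h.exists_isBoundary_of_boundaryEnd hρβ hs hℓ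
  rw [← h.target, mem_vertical_iff] at hyℓ
  -- points slightly beyond the boundary geodesic
  obtain ⟨f, hf, hf'⟩ := exists_horizontal A' (A'⁻¹ • y).im_pos
  have hfb : f b = y := eq_of_chart_eq (A := A') (by rw [(hf' b).1, hyℓ]) (hf' b).2
  obtain ⟨ε, hε, hball⟩ := Metric.isOpen_iff.1 (isOpen_interior.preimage hf) b
    (by rw [mem_preimage, hfb]; exact hy)
  have hx : b - s * (ε / 2) ∈ Metric.ball b ε := by
    rw [Metric.mem_ball, Real.dist_eq, abs_lt]
    rcases hb.sign with rfl | rfl <;> constructor <;> linarith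
  have hmem : f (b - s * (ε / 2)) ∈ closure (range Ψ') := interior_subset (hball hx)
  have hbey : f (b - s * (ε / 2)) ∈ T.Beyond β' p := by
    rw [hb.mem_beyond_iff hs, (hf' _).1]
    rcases hb.sign with rfl | rfl <;> linarith
  have e := hb.mem_line_of_mem_closure hs hΨ hbey hmem
  rw [(hf' _).1] at e
  rcases hb.sign with rfl | rfl <;> linarith

lemma IsStraightening.edge_unique (hs : T.IsStraightening β β')
    (hΨ : T.IsStraightenedPlane β' Ψ') {p q p' q' : Farey Γ} (h : T.graph.Adj p q)
    (h' : T.graph.Adj p' q') {y : ℍ} (hy : y ∈ Ψ' '' geodesic p.pt q.pt)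
    (hy' : y ∈ Ψ' '' geodesic p'.pt q'.pt) : s(p, q) = s(p', q') := by
  obtain ⟨z, hz, rfl⟩ := hy
  obtain ⟨w, hw, e⟩ := hy'
  obtain rfl := hs.plane_injective hΨ e
  by_contra hne
  exact disjoint_left.1 (T.disjoint _ _ _ _ h h' hne) hz hw

/-- The weight of the bending lamination at a point: infinite on the boundary geodesics, the bending
angle on the pleating lines. -/
def bendWeight (T : IdealTriangulation Γ) (β : Farey Γ → CP1) (Ψ' : ℍ → ℍ) (y : ℍ) : ℝ≥0∞ :=
  open Classical in
  if y ∈ frontier (range Ψ') then ⊤ else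
    ⨆ (p : Farey Γ) (q : Farey Γ) (_ : T.graph.Adj p q ∧ y ∈ Ψ' '' geodesic p.pt q.pt),
      ENNReal.ofReal (T.bendAngle β p q)

lemma bendWeight_frontier {y : ℍ} (hy : y ∈ frontier (range Ψ')) : T.bendWeight β Ψ' y = ⊤ :=
  if_pos hy

lemma notMem_frontier_of_mem_range (hs : T.IsStraightening β β')
    (hΨ : T.IsStraightenedPlane β' Ψ') {y : ℍ} (hy : y ∈ range Ψ') : y ∉ frontier (range Ψ') := by
  rw [(hs.isOpenEmbedding hΨ).isOpen_range.frontier_eq]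
  exact fun h => h.2 hy

lemma IsStraightening.bendWeight_edge (hs : T.IsStraightening β β')
    (hΨ : T.IsStraightenedPlane β' Ψ') {p q : Farey Γ} (h : T.graph.Adj p q) {y : ℍ}
    (hy : y ∈ Ψ' '' geodesic p.pt q.pt) :
    T.bendWeight β Ψ' y = ENNReal.ofReal (T.bendAngle β p q) := by
  rw [bendWeight, if_neg (notMem_frontier_of_mem_range hs hΨ (image_subset_range _ _ hy))]
  refine le_antisymm (iSup₂_le fun p' q' => iSup_le fun ⟨h', hy'⟩ => ?_)
    (le_iSup₂_of_le p q (le_iSup_of_le ⟨h, hy⟩ le_rfl))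
  rcases Sym2.eq_iff.1 (hs.edge_unique hΨ h h' hy hy') with ⟨rfl, rfl⟩ | ⟨rfl, rfl⟩
  · exact le_rfl
  · rw [bendAngle_swap h]

lemma bendWeight_of_not_edge {y : ℍ} (h1 : y ∉ frontier (range Ψ'))
    (h2 : ∀ p q, T.graph.Adj p q → y ∉ Ψ' '' geodesic p.pt q.pt) : T.bendWeight β Ψ' y = 0 := by
  rw [bendWeight, if_neg h1]
  simp only [ENNReal.iSup_eq_zero]
  exact fun p q h => absurd h.2 (h2 p q h.1)

/-- The edges with positive bending angle. -/
def bentEdges (T : IdealTriangulation Γ) (β : Farey Γ → CP1) (Ψ' : ℍ → ℍ) : Set (Set ℍ) :=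
  {m | ∃ p q : Farey Γ, T.graph.Adj p q ∧ 0 < T.bendAngle β p q ∧
    m = Ψ' '' geodesic p.pt q.pt}

lemma isClosed_iUnion_edges (T : IdealTriangulation Γ) (P : Farey Γ → Farey Γ → Prop) :
    IsClosed (⋃ e : {e : Farey Γ × Farey Γ // T.graph.Adj e.1 e.2 ∧ P e.1 e.2},
      geodesic e.1.1.pt e.1.2.pt) := by
  refine LocallyFinite.isClosed_iUnion (fun z => ?_)
    fun e => isClosed_geodesic (T.pt_ne e.2.1)
  refine ⟨Metric.closedBall z 1, Metric.closedBall_mem_nhds z one_pos, ?_⟩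
  refine Set.Finite.of_injOn (f := Subtype.val) (fun e he => ?_) Subtype.val_injective.injOn
    (T.locally_finite _ (isCompact_closedBall z 1))
  exact And.intro e.2.1 he

lemma IsStraightening.isClosed_leaves (hβ : IsEquivariant ρ β)
    (hFG : T.HasNonzeroCoordinates β) (hs : T.IsStraightening β β')
    (hΨ : T.IsStraightenedPlane β' Ψ') (hρβ : IsEquivariant ρ' β') (hρ : IsEquivariant ρ' Ψ') :
    IsClosed (⋃₀ (T.bentEdges β Ψ' ∪ {ℓ : Set ℍ | ∃ p, IsBoundaryEnd ρ' β' Ψ' p ℓ})) := by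
  have ho := hs.isOpenEmbedding hΨ
  have hE := T.isClosed_iUnion_edges (fun p q => 0 < T.bendAngle β p q)
  set E := ⋃ e : {e : Farey Γ × Farey Γ // T.graph.Adj e.1 e.2 ∧ 0 < T.bendAngle β e.1 e.2},
      geodesic e.1.1.pt e.1.2.pt with hEdef
  have hU : ⋃₀ T.bentEdges β Ψ' = Ψ' '' E := by
    ext y
    constructor
    · rintro ⟨_, ⟨p, q, h, hα, rfl⟩, z, hz, rfl⟩
      exact mem_image_of_mem _ (mem_iUnion.2 ⟨⟨(p, q), h, hα⟩, hz⟩)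
    · rintro ⟨z, hz, rfl⟩
      obtain ⟨⟨⟨p, q⟩, h, hα⟩, hz⟩ := mem_iUnion.1 hz
      exact ⟨_, ⟨p, q, h, hα, rfl⟩, mem_image_of_mem _ hz⟩
  rw [sUnion_union, ← hs.frontier_eq hβ hFG hΨ hρβ hρ, hU]
  refine isClosed_of_closure_subset fun y hy => ?_
  rw [closure_union, isClosed_frontier.closure_eq] at hy
  rcases hy with hy | hy
  · by_cases hr : y ∈ range Ψ'
    · obtain ⟨z, rfl⟩ := hr
      refine Or.inl (mem_image_of_mem _ ?_)
      rwa [← hE.closure_eq, ho.isInducing.closure_eq_preimage_closure_image]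
    · refine Or.inr ?_
      rw [ho.isOpen_range.frontier_eq]
      exact ⟨closure_mono (image_subset_range _ _) hy, hr⟩
  · exact Or.inr hy

lemma IsStraightening.finite_leaves (hs : T.IsStraightening β β')
    (hΨ : T.IsStraightenedPlane β' Ψ') {K : Set ℍ} (hK : K ⊆ range Ψ') (hc : IsCompact K) :
    {ℓ ∈ T.bentEdges β Ψ' ∪ {ℓ : Set ℍ | ∃ p, IsBoundaryEnd ρ' β' Ψ' p ℓ} |
      (ℓ ∩ K).Nonempty}.Finite := by
  have ho := hs.isOpenEmbedding hΨ
  refine ((T.locally_finite _ (ho.isInducing.isCompact_preimage' hc hK)).image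
    fun e => Ψ' '' geodesic e.1.pt e.2.pt).subset ?_
  rintro _ ⟨⟨p, q, h, -, rfl⟩ | ⟨p, hℓ⟩, y, hy, hyK⟩
  · obtain ⟨z, hz, rfl⟩ := hy
    exact ⟨(p, q), ⟨h, z, hz, hyK⟩, rfl⟩
  · exact absurd (hℓ.subset_frontier hy) (notMem_frontier_of_mem_range hs hΨ (hK hyK))

lemma IsStraightening.pairwiseDisjoint_leaves (hs : T.IsStraightening β β')
    (hΨ : T.IsStraightenedPlane β' Ψ') (hρβ : IsEquivariant ρ' β') :
    (T.bentEdges β Ψ' ∪ {ℓ : Set ℍ | ∃ p, IsBoundaryEnd ρ' β' Ψ' p ℓ}).PairwiseDisjoint id := by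
  have key : ∀ {p q p' ℓ y}, y ∈ Ψ' '' geodesic p q → IsBoundaryEnd ρ' β' Ψ' p' ℓ → y ∉ ℓ :=
    fun hy hℓ hy' => notMem_frontier_of_mem_range hs hΨ (image_subset_range _ _ hy)
      (hℓ.subset_frontier hy')
  intro m hm m' hm' hne
  refine disjoint_left.2 fun y hy hy' => hne ?_
  rcases hm with ⟨p, q, h, -, rfl⟩ | ⟨p, hℓ⟩ <;> rcases hm' with ⟨p', q', h', -, rfl⟩ | ⟨p', hℓ'⟩
  · rcases Sym2.eq_iff.1 (hs.edge_unique hΨ h h' hy hy') with ⟨rfl, rfl⟩ | ⟨rfl, rfl⟩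
    · rfl
    · rw [geodesic_comm]
  · exact absurd hy' (key hy hℓ')
  · exact absurd hy (key hy' hℓ)
  · exact hs.boundaryEnd_eq_of_mem hρβ hℓ hℓ' hy hy'

lemma IsStraightenedPlane.smul_image_edge (hΨ : T.IsStraightenedPlane β' Ψ')
    (hs : T.IsStraightening β β') (hρβ : IsEquivariant ρ' β') (γ : Γ) {p q : Farey Γ}
    (h : T.graph.Adj p q) : (ρ' γ • ·) '' (Ψ' '' geodesic p.pt q.pt) =
      Ψ' '' geodesic (γ • p).pt (γ • q).pt := by
  rw [hΨ.image_edge h, hΨ.image_edge (T.smul_adj γ _ _ h),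
    smul_geodesic _ (fun e => h.ne (hs.injective e)), hρβ, hρβ]

lemma IsStraightening.bendWeight_smul (hβ : IsEquivariant ρ β) (hs : T.IsStraightening β β')
    (hΨ : T.IsStraightenedPlane β' Ψ') (hρβ : IsEquivariant ρ' β') (hρ : IsEquivariant ρ' Ψ')
    (γ : Γ) (y : ℍ) : T.bendWeight β Ψ' (ρ' γ • y) = T.bendWeight β Ψ' y := by
  have ho := (hs.isOpenEmbedding hΨ).isOpen_range
  by_cases h1 : y ∈ frontier (range Ψ')
  · rw [bendWeight_frontier h1, bendWeight_frontier (smul_mem_frontier hρ ho γ h1)]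
  by_cases h2 : ∃ p q, T.graph.Adj p q ∧ y ∈ Ψ' '' geodesic p.pt q.pt
  · obtain ⟨p, q, h, hy⟩ := h2
    have := mem_image_of_mem (ρ' γ • ·) hy
    rw [hΨ.smul_image_edge hs hρβ γ h] at this
    rw [hs.bendWeight_edge hΨ h hy, hs.bendWeight_edge hΨ (T.smul_adj γ _ _ h) this,
      bendAngle_smul hβ γ h]
  · push Not at h2
    rw [bendWeight_of_not_edge h1 h2, bendWeight_of_not_edge]
    · intro h
      refine h1 ?_
      have := smul_mem_frontier hρ ho γ⁻¹ h
      rwa [map_inv, inv_smul_smul] at this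
    · intro p q h hy
      have := mem_image_of_mem (ρ' γ⁻¹ • ·) hy
      rw [hΨ.smul_image_edge hs hρβ γ⁻¹ h] at this
      refine h2 _ _ (T.smul_adj γ⁻¹ _ _ h) ?_
      simpa only [map_inv, inv_smul_smul] using this

lemma IsStraightening.bendWeight_eq_zero_iff (hβ : IsEquivariant ρ β)
    (hFG : T.HasNonzeroCoordinates β) (hs : T.IsStraightening β β')
    (hΨ : T.IsStraightenedPlane β' Ψ') (hρβ : IsEquivariant ρ' β') (hρ : IsEquivariant ρ' Ψ')
    (y : ℍ) : T.bendWeight β Ψ' y = 0 ↔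
      y ∉ ⋃₀ (T.bentEdges β Ψ' ∪ {ℓ : Set ℍ | ∃ p, IsBoundaryEnd ρ' β' Ψ' p ℓ}) := by
  rw [sUnion_union, ← hs.frontier_eq hβ hFG hΨ hρβ hρ]
  by_cases h1 : y ∈ frontier (range Ψ')
  · rw [bendWeight_frontier h1]
    simp [h1]
  have hiff : y ∉ ⋃₀ T.bentEdges β Ψ' ∪ frontier (range Ψ') ↔ y ∉ ⋃₀ T.bentEdges β Ψ' := by
    simp [h1]
  rw [hiff]
  by_cases h2 : ∃ p q, T.graph.Adj p q ∧ y ∈ Ψ' '' geodesic p.pt q.pt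
  · obtain ⟨p, q, h, hy⟩ := h2
    rw [hs.bendWeight_edge hΨ h hy, ENNReal.ofReal_eq_zero]
    constructor
    · rintro hle ⟨_, ⟨p', q', h', hα, rfl⟩, hy'⟩
      rcases Sym2.eq_iff.1 (hs.edge_unique hΨ h h' hy hy') with ⟨rfl, rfl⟩ | ⟨rfl, rfl⟩
      · exact hle.not_gt hα
      · rw [bendAngle_swap h] at hα
        exact hle.not_gt hα
    · intro hn
      by_contra! hα
      exact hn ⟨_, ⟨p, q, h, hα, rfl⟩, hy⟩
  · push Not at h2
    rw [bendWeight_of_not_edge h1 h2]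
    simp only [true_iff]
    rintro ⟨_, ⟨p', q', h', -, rfl⟩, hy'⟩
    exact h2 _ _ h' hy'

lemma IsStraightening.bendWeight_ne_top (hs : T.IsStraightening β β')
    (hΨ : T.IsStraightenedPlane β' Ψ') {y : ℍ} (hy : y ∈ range Ψ') : T.bendWeight β Ψ' y ≠ ⊤ := by
  have h1 := notMem_frontier_of_mem_range hs hΨ hy
  by_cases h2 : ∃ p q, T.graph.Adj p q ∧ y ∈ Ψ' '' geodesic p.pt q.pt
  · obtain ⟨p, q, h, hy⟩ := h2
    rw [hs.bendWeight_edge hΨ h hy]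
    exact ENNReal.ofReal_ne_top
  · push Not at h2
    rw [bendWeight_of_not_edge h1 h2]
    exact ENNReal.zero_ne_top

/-- The bending lamination of a pleated plane, on the surface developed by its straightening. -/
theorem IsStraightening.exists_lamination (hβ : IsEquivariant ρ β)
    (hFG : T.HasNonzeroCoordinates β) (hs : T.IsStraightening β β')
    (hΨ : T.IsStraightenedPlane β' Ψ') (hρβ : IsEquivariant ρ' β') (hρ : IsEquivariant ρ' Ψ') :
    ∃ L : MeasuredLamination ρ'.range (closure (range Ψ')),
      L.leaves = T.bentEdges β Ψ' ∪ {ℓ : Set ℍ | ∃ p, IsBoundaryEnd ρ' β' Ψ' p ℓ} ∧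
      (∀ p q : Farey Γ, T.graph.Adj p q →
        L.HasWeight (Ψ' '' geodesic p.pt q.pt) (ENNReal.ofReal (T.bendAngle β p q))) ∧
      ∀ (p : Farey Γ) (ℓ : Set ℍ), IsBoundaryEnd ρ' β' Ψ' p ℓ → L.HasWeight ℓ ⊤ := by
  have hint := hs.interior_closure_range hβ hFG hΨ hρβ hρ
  refine ⟨weightedLamination ρ'.range (closure (range Ψ'))
    (T.bentEdges β Ψ' ∪ {ℓ : Set ℍ | ∃ p, IsBoundaryEnd ρ' β' Ψ' p ℓ}) (T.bendWeight β Ψ')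
    ?_ ?_ (hs.pairwiseDisjoint_leaves hΨ hρβ) (hs.isClosed_leaves hβ hFG hΨ hρβ hρ) ?_
    (hs.bendWeight_eq_zero_iff hβ hFG hΨ hρβ hρ) ?_ ?_
    (fun z hz => hs.bendWeight_ne_top hΨ (hint hz))
    (fun K hK hc => hs.finite_leaves hΨ (hK.trans hint) hc), rfl, ?_, ?_⟩
  · rintro _ (⟨p, q, h, -, rfl⟩ | ⟨p, hℓ⟩)
    · exact ⟨_, _, fun e => h.ne (hs.injective e), hΨ.image_edge h⟩
    · obtain ⟨q, hq, e, -⟩ := hℓ.axis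
      exact ⟨_, _, hq.symm, e⟩
  · rintro _ (⟨p, q, h, -, rfl⟩ | ⟨p, hℓ⟩)
    · exact (image_subset_range _ _).trans subset_closure
    · exact hℓ.subset_frontier.trans frontier_subset_closure
  · rintro _ ⟨γ, rfl⟩ _ (⟨p, q, h, hα, rfl⟩ | ⟨p, hℓ⟩)
    · exact Or.inl ⟨γ • p, γ • q, T.smul_adj γ _ _ h, by rwa [bendAngle_smul hβ γ h],
        hΨ.smul_image_edge hs hρβ γ h⟩
    · exact Or.inr ⟨γ • p, hs.smul_boundaryEnd hβ hFG hΨ hρβ hρ γ hℓ⟩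
  · rintro _ (⟨p, q, h, -, rfl⟩ | ⟨p, hℓ⟩) z hz w hw
    · rw [hs.bendWeight_edge hΨ h hz, hs.bendWeight_edge hΨ h hw]
    · rw [bendWeight_frontier (hℓ.subset_frontier hz), bendWeight_frontier (hℓ.subset_frontier hw)]
  · rintro _ ⟨γ, rfl⟩ z
    exact hs.bendWeight_smul hβ hΨ hρβ hρ γ z
  · intro p q h x y _ z hz
    exact (atomMeasure_restrict_singleton _ hz.1).trans (hs.bendWeight_edge hΨ h hz.2)
  · intro p ℓ hℓ x y _ z hz
    exact (atomMeasure_restrict_singleton _ hz.1).trans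
      (bendWeight_frontier (hℓ.subset_frontier hz.2))

end IdealTriangulation

end Straightening

end

theorem proposition2
    (Γ : Subgroup PSL(2, ℝ)) (hΓ : Straightening.IsFuchsian Γ)
    (hfree : Straightening.ActsFreely Γ)
    (T : Straightening.IdealTriangulation Γ)
    (ρ : Γ →* PSL(2, ℂ)) (β : Straightening.Farey Γ → Straightening.CP1)
    (hβ : Straightening.IsEquivariant ρ β)
    (hFG : T.HasNonzeroCoordinates β) :
    -- the pleated plane and the straightened framing exist
    (∃ Ψ : ℍ → Straightening.H3, T.IsPleatedPlane β Ψ ∧ Straightening.IsEquivariant ρ Ψ) ∧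
    (∃ β' : Straightening.Farey Γ → Straightening.RP1, T.IsStraightening β β') ∧
    ∀ Ψ : ℍ → Straightening.H3, T.IsPleatedPlane β Ψ → Straightening.IsEquivariant ρ Ψ →
    -- the bending angles of `Ψ`
    ∃ α : Straightening.Farey Γ → Straightening.Farey Γ → ℝ,
      (∀ p₁ p₂ p₃ p₄ : Straightening.Farey Γ, T.IsQuad p₁ p₂ p₃ p₄ →
        Straightening.IsBendingAngle (β p₁) (β p₃)
          (Ψ '' Straightening.idealTriangle p₁.pt p₂.pt p₃.pt)
          (Ψ '' Straightening.idealTriangle p₁.pt p₃.pt p₄.pt) (α p₁ p₃)) ∧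
    ∀ β' : Straightening.Farey Γ → Straightening.RP1, T.IsStraightening β β' →
    -- the holonomy of the straightened plane
    ∃ ρ' : Γ →* PSL(2, ℝ),
      Straightening.IsEquivariant ρ' β' ∧
      (∃ Ψ' : ℍ → ℍ, T.IsStraightenedPlane β' Ψ' ∧ Straightening.IsEquivariant ρ' Ψ') ∧
      ∀ Ψ' : ℍ → ℍ, T.IsStraightenedPlane β' Ψ' → Straightening.IsEquivariant ρ' Ψ' →
        -- it develops a hyperbolic surface homeomorphic to `ℍ / Γ`
        Straightening.IsDevelopingMap ρ' Ψ' ∧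
        -- each puncture becomes a cusp or a geodesic boundary component, and there is no other
        -- boundary
        (∀ p : Straightening.Farey Γ, Straightening.IsCuspEnd ρ' β' Ψ' p ∨
          ∃ ℓ : Set ℍ, Straightening.IsBoundaryEnd ρ' β' Ψ' p ℓ) ∧
        frontier (Set.range Ψ') =
          ⋃₀ {ℓ : Set ℍ | ∃ p, Straightening.IsBoundaryEnd ρ' β' Ψ' p ℓ} ∧
        -- the pleating lines and the boundary components form a measured lamination
        (∃ lam : Straightening.MeasuredLamination ρ'.range (closure (Set.range Ψ')),
          lam.leaves =
            {m : Set ℍ | ∃ p q : Straightening.Farey Γ, T.graph.Adj p q ∧ 0 < α p q ∧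
              m = Ψ' '' Straightening.geodesic p.pt q.pt} ∪
            {ℓ : Set ℍ | ∃ p, Straightening.IsBoundaryEnd ρ' β' Ψ' p ℓ} ∧
          (∀ p q : Straightening.Farey Γ, T.graph.Adj p q → 0 < α p q →
            lam.HasWeight (Ψ' '' Straightening.geodesic p.pt q.pt) (ENNReal.ofReal (α p q))) ∧
          (∀ (p : Straightening.Farey Γ) (ℓ : Set ℍ),
            Straightening.IsBoundaryEnd ρ' β' Ψ' p ℓ → lam.HasWeight ℓ ⊤)) ∧
        -- there are pleating lines that spiral onto each boundary component
        (∀ (p : Straightening.Farey Γ) (ℓ : Set ℍ), Straightening.IsBoundaryEnd ρ' β' Ψ' p ℓ →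
          (∃ q : Straightening.Farey Γ, T.graph.Adj p q) ∧
          ∀ q : Straightening.Farey Γ, T.graph.Adj p q →
            Straightening.IsAsymptoticAt (β' p)
              (Ψ' '' Straightening.geodesic p.pt q.pt) ℓ) := by
  obtain ⟨Ψ₀, hΨ₀, hequiv⟩ := Straightening.IdealTriangulation.exists_pleatedPlane T hFG
  refine ⟨⟨Ψ₀, hΨ₀, fun γ z => ?_⟩,
    Straightening.IdealTriangulation.exists_straightening T hFG, fun Ψ hΨ _ => ?_⟩
  · obtain ⟨g, hg⟩ := QuotientGroup.mk_surjective (ρ γ)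
    have hgβ : ∀ p, β (γ • p) = g • β p := fun p => by rw [hβ γ p, ← hg]; rfl
    rw [hequiv γ g hgβ, ← hg]
    rfl
  refine ⟨T.bendAngle β, fun p₁ p₂ p₃ p₄ h =>
    Straightening.IdealTriangulation.isBendingAngle_bendAngle hFG hΨ h, fun β' hs => ?_⟩
  obtain ⟨ρ', hρβ⟩ := hs.exists_holonomy hβ hFG
  refine ⟨ρ', hρβ, hs.exists_straightenedPlane hFG hρβ, fun Ψ' hΨ' hρ => ?_⟩
  have hG := hs.isFuchsian_range hΓ hfree hΨ' hρ
  have hinj := hs.holonomy_injective hfree hΨ' hρ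
  obtain ⟨L, hL, hbent, hbdry⟩ := hs.exists_lamination hβ hFG hΨ' hρβ hρ
  exact ⟨⟨hinj, hG, hs.actsFreely_range hβ hFG hfree hΨ' hρβ hρ, hρ, hs.isOpenEmbedding hΨ',
      hs.exists_homeo hΨ' hρ⟩, hs.cusp_or_boundary hΨ' hρβ hρ hG hinj,
    hs.frontier_eq hβ hFG hΨ' hρβ hρ, ⟨L, hL, fun p q h _ => hbent p q h, hbdry⟩,
    fun p ℓ hℓ => ⟨T.exists_adj p, fun q hq => hs.isAsymptoticAt hΨ' hρβ hℓ hq⟩⟩
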